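/- **Setting.** Let $M$ be a smooth ($C^\infty$, Hausdorff, second countable) manifold of dimension $d$. A *Weyl class* $[g,a]$ on $M$ is an equivalence class of pairs of a smooth metric $g$ of signature $(p,q)$ and a smooth 1-form $a$ under $(g,a)\sim(\mathcal B^{-2}g,\;a-\mathrm d\ln\mathcal B)$, with $\mathcal B>0$ smooth; $(M,[g,a])$ is a Weyl manifold. Fix a representative $(g,a)$. It identifies the Weyl structure $\mathcal P_W$ (the principal $\mathbb R_+$-bundle of metrics in the conformal class) with $\mathbb R_+\times M$, $(t,x)\leftrightarrow t^2g_x$, on which the tautological tensor is $\mathbf g_0=t^2\pi^*g$ and the dilatations are $\delta_s(t,x)=(st,x)$; they act on $\mathcal P_W\times\mathbb R\ni(t,x,\rho)$ by $\delta_s(t,x,\rho)=(st,x,\rho)$. A *Weyl pre-ambient space* for $(M,[g,a])$ is $(\tilde M,\tilde g)$, where $\tilde M$ is a dilatation-invariant open neighbourhood of $\mathcal P_W\times\{0\}$ in $\mathcal P_W\times\mathbb R$ and $\tilde g$ is a smooth metric on $\tilde M$ of signature $(p+1,q+1)$ with $\delta_s^*\tilde g=s^2\tilde g$ for all $s>0$,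 whose pullback to $\mathcal P_W\times\{0\}$ is $\mathbf g_0$. It is a *Weyl-ambient space* if moreover $\mathrm{Ric}(\tilde g)$ vanishes to infinite order at every point of $\mathcal P_W\times\{0\}$. An *acceleration* is a covector $\mathcal A=t^2\varphi_i(x,\rho)\,\mathrm dx^i$, where $\varphi_i(x,\rho)\,\mathrm dx^i$ is a family of 1-forms on $M$ that is smooth in $(x,\rho)$ on an open neighbourhood of $M\times\{0\}$ in $M\times\mathbb R$. A pre-ambient space is in *Weyl-normal form with acceleration $\mathcal A$* if: for each $p\in\mathcal P_W$ the set $\{\rho:(p,\rho)\in\tilde M\}$ is an open interval containing $0$; $\mathcal A$ is defined on $\tilde M$, and the curves $\rho\mapsto(p,\rho)$, with tangent $\mathcal U=\partial_\rho$, satisfy $\tilde g(\tilde\nabla_{\mathcal U}\,\mathcal U,\cdot)=\mathcal A$ (in particular the acceleration vector is orthogonal to $t\partial_t$ and to $\mathcal U$); and $$\tilde g|_{\rho=0}=\mathbf g_0+2t^2\left(t^{-1}\mathrm dt+a\right)\mathrm d\rho .$$ **Formal dimension.** Let $\mathbb K=\mathbb R$ or $\mathbb C$ and $D\in\mathbb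 K$. A *Weyl-ambient space with dimension parameter $D$* is a triple $(\tilde M,\tilde g,f)$ such that $(\tilde M,\tilde g)$ is a pre-ambient space as above, where for $\mathbb K=\mathbb C$ the components of $\tilde g$ may be complex ($\tilde g$ being nondegenerate, and the signature being that of $\operatorname{Re}\tilde g$); $f:\tilde M\to\mathbb K\setminus\{0\}$ is smooth with $f\circ\delta_s=sf$ and $f=t$ at $\rho=0$; and, with $N=D-d$, both $$\mathrm{Ric}(\tilde g)-\frac Nf\tilde\nabla^2f\qquad\text{and}\qquad f\tilde\Delta f+(N-1)|\tilde\nabla f|^2$$ vanish to infinite order at every point of $\mathcal P_W\times\{0\}$. (For $N\in\mathbb N$ this says that $\tilde g+f^2(\mathrm dw_1^2+\dots+\mathrm dw_N^2)$ is Ricci-flat to infinite order there, that is, that it is Weyl-ambient for the product of $M$ with a flat $\mathbb R^N$, of dimension $D=d+N$. The equations are polynomial in $N$, so they replace the dimension $\delta^i{}_i=d$ of $M$ by the parameter $D$.) Call $D$ *regular* if $D\notin\{1\}\cup\{0,2,4,6,\dots\}$. **Theorem.** Let $(M,[g,a])$ be a Weyl manifold of dimension $d$, let $(g,a)$ be a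 representative of the Weyl class, and let $\mathcal A$ be an acceleration. 1. *Odd $d\ge 3$.* (A) There is a Weyl-ambient space for $(M,[g,a])$ in Weyl-normal form with acceleration $\mathcal A$. (B) If $(\tilde M_1,\tilde g_1)$ and $(\tilde M_2,\tilde g_2)$ are two such spaces, then $\tilde g_1-\tilde g_2$ vanishes to infinite order at every point of $\mathcal P_W\times\{0\}$. 2. *Every $d$, with the dimension as a formal parameter.* For every regular $D\in\mathbb K$: (A) there is a Weyl-ambient space $(\tilde M,\tilde g,f)$ with dimension parameter $D$ in Weyl-normal form with acceleration $\mathcal A$; (B) if $(\tilde M_1,\tilde g_1,f_1)$ and $(\tilde M_2,\tilde g_2,f_2)$ are two such spaces, then $\tilde g_1-\tilde g_2$ and $f_1-f_2$ vanish to infinite order at every point of $\mathcal P_W\times\{0\}$. 3. In 2, each coefficient $\partial_\rho^m\tilde g_{IJ}|_{\rho=0}$ (in coordinates $(t,x^i,\rho)$, at a given point) is the value at $D$ of a rational function with real coefficients that has no poles at regular values. -/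

import Mathlib

open scoped Manifold ContDiff Topology

noncomputable section

namespace WeylAmbient

section LocalCalculus

/- Tensor calculus in one coordinate chart. `V` is the coordinate space, `e : ι → V` the coordinate
basis, and `G y` the matrix of components of a metric at the point `y`. The components take values in
`𝕜` (the real or the complex numbers), the coordinates are real. -/

variable {𝕜 : Type*} [RCLike 𝕜] {ι : Type*} [Fintype ι] [DecidableEq ι]
  {V : Type*} [NormedAddCommGroup V] [NormedSpace ℝ V]

/-- The partial derivative `∂_i F`. -/
def pd (e : ι → V) (i : ι) (F : V → 𝕜) (y : V) : 𝕜 := fderiv ℝ F y (e i)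

/-- The Christoffel symbol `Γ^k_{ij} = ½ g^{kl} (∂_i g_{jl} + ∂_j g_{il} - ∂_l g_{ij})` of the
Levi-Civita connection. -/
def christoffel (e : ι → V) (G : V → Matrix ι ι 𝕜) (k i j : ι) (y : V) : 𝕜 :=
  (1 / 2) * ∑ l, (G y)⁻¹ k l *
    (pd e i (fun z => G z j l) y + pd e j (fun z => G z i l) y - pd e l (fun z => G z i j) y)

/-- The Ricci tensor
`R_{ij} = ∂_k Γ^k_{ij} - ∂_i Γ^k_{kj} + Γ^k_{kl} Γ^l_{ij} - Γ^k_{il} Γ^l_{kj}`. -/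
def ricci (e : ι → V) (G : V → Matrix ι ι 𝕜) (i j : ι) (y : V) : 𝕜 :=
  ∑ k, pd e k (christoffel e G k i j) y - ∑ k, pd e i (christoffel e G k k j) y
    + ∑ k, ∑ l, christoffel e G k k l y * christoffel e G l i j y
    - ∑ k, ∑ l, christoffel e G k i l y * christoffel e G l k j y

/-- The Hessian `∇_i ∇_j f = ∂_i ∂_j f - Γ^k_{ij} ∂_k f`. -/
def hessian (e : ι → V) (G : V → Matrix ι ι 𝕜) (f : V → 𝕜) (i j : ι) (y : V) : 𝕜 :=
  pd e i (pd e j f) y - ∑ k, christoffel e G k i j y * pd e k f y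

/-- The Laplacian `Δ f = g^{ij} ∇_i ∇_j f`. -/
def laplacian (e : ι → V) (G : V → Matrix ι ι 𝕜) (f : V → 𝕜) (y : V) : 𝕜 :=
  ∑ i, ∑ j, (G y)⁻¹ i j * hessian e G f i j y

/-- The squared gradient `|∇f|² = g^{ij} ∂_i f ∂_j f`. -/
def gradSq (e : ι → V) (G : V → Matrix ι ι 𝕜) (f : V → 𝕜) (y : V) : 𝕜 :=
  ∑ i, ∑ j, (G y)⁻¹ i j * (pd e i f y * pd e j f y)

/-- The component along the base of the Ricci tensor of the warped product `G + f² (dw₁² + ⋯ + dw_N²)`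
with a flat fibre of dimension `N`: `R_{ij} - (N / f) ∇_i ∇_j f`. It is polynomial in `N` and thereby
makes sense for every scalar `N`. -/
def warpedRicciBase (N : 𝕜) (e : ι → V) (G : V → Matrix ι ι 𝕜) (f : V → 𝕜) (i j : ι) (y : V) : 𝕜 :=
  ricci e G i j y - N / f y * hessian e G f i j y

/-- The Ricci tensor of the warped product `G + f² (dw₁² + ⋯ + dw_N²)` along the flat fibre is
`-(f Δf + (N - 1) |∇f|²) δ_{ab}`; this is its coefficient. (The mixed components vanish.) -/
def warpedRicciFibre (N : 𝕜) (e : ι → V) (G : V → Matrix ι ι 𝕜) (f : V → 𝕜) (y : V) : 𝕜 :=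
  -(f y * laplacian e G f y + (N - 1) * gradSq e G f y)

/-- `F` vanishes to infinite order at `y₀`. -/
def VanishesToInfiniteOrder (F : V → 𝕜) (y₀ : V) : Prop :=
  ∀ k : ℕ, F =O[𝓝 y₀] fun y => ‖y - y₀‖ ^ k

end LocalCalculus

/-- The symmetric bilinear form `B` on the real vector space `W` has signature `(p, q)`: it is the
standard form `u₁v₁ + ⋯ + u_pv_p - u_{p+1}v_{p+1} - ⋯ - u_{p+q}v_{p+q}` in a suitable basis. -/
def HasSignature {W : Type*} [AddCommGroup W] [Module ℝ W] (B : W → W → ℝ) (p q : ℕ) : Prop :=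
  ∃ e : W ≃ₗ[ℝ] (Fin p → ℝ) × (Fin q → ℝ), ∀ u v,
    B u v = ∑ i, (e u).1 i * (e v).1 i - ∑ i, (e u).2 i * (e v).2 i

section Charts

variable {E : Type*} [NormedAddCommGroup E] [NormedSpace ℝ E] {H : Type*} [TopologicalSpace H]
  (I : ModelWithCorners ℝ E H) {X : Type*} [TopologicalSpace X] [ChartedSpace H X]

/-- The tangent vector at the point with coordinates `y`, in the chart around `z₀`, whose coordinate
components are `u`. (All manifolds below are without boundary.) -/
def chartVec (z₀ : X) (y u : E) : TangentSpace I ((extChartAt I z₀).symm y) :=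
  mfderiv 𝓘(ℝ, E) I (extChartAt I z₀).symm y u

/-- The part of the coordinate domain of the chart around `z₀` that corresponds to points of `U`. -/
def chartDomain (z₀ : X) (U : Set X) : Set E :=
  (extChartAt I z₀).target ∩ (extChartAt I z₀).symm ⁻¹' U

end Charts

section Base

variable (d : ℕ) (M : Type*) [TopologicalSpace M] [ChartedSpace (EuclideanSpace ℝ (Fin d)) M]

/-- A pair `(g, a)` of a smooth metric of signature `(p, q)` and a smooth 1-form on `M`. -/
structure WeylPair (p q : ℕ) where
  g : ∀ x : M, TangentSpace (𝓡 d) x →ₗ[ℝ] TangentSpace (𝓡 d) x →ₗ[ℝ] ℝ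
  a : ∀ x : M, TangentSpace (𝓡 d) x →ₗ[ℝ] ℝ
  signature : ∀ x, HasSignature (fun u v => g x u v) p q
  smooth_g : ∀ (x₀ : M) (u v : EuclideanSpace ℝ (Fin d)),
    ContDiffOn ℝ ∞ (fun y => g ((extChartAt (𝓡 d) x₀).symm y) (chartVec (𝓡 d) x₀ y u)
      (chartVec (𝓡 d) x₀ y v)) (extChartAt (𝓡 d) x₀).target
  smooth_a : ∀ (x₀ : M) (u : EuclideanSpace ℝ (Fin d)),
    ContDiffOn ℝ ∞ (fun y => a ((extChartAt (𝓡 d) x₀).symm y) (chartVec (𝓡 d) x₀ y u))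
      (extChartAt (𝓡 d) x₀).target

variable {d M}

/-- The 1-form `d ln B`, applied to the tangent vector `u`. -/
def dLog (B : M → ℝ) (x : M) (u : TangentSpace (𝓡 d) x) : ℝ :=
  mfderiv (𝓡 d) 𝓘(ℝ, ℝ) (fun x' => Real.log (B x')) x u

/-- Weyl equivalence: `(g', a') = (B⁻² g, a - d ln B)` for some smooth positive function `B`. -/
def WeylRelated {p q : ℕ} (r r' : WeylPair d M p q) : Prop :=
  ∃ B : M → ℝ, ContMDiff (𝓡 d) 𝓘(ℝ, ℝ) ∞ B ∧ (∀ x, 0 < B x) ∧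
    (∀ x u v, r'.g x u v = (B x)⁻¹ ^ 2 * r.g x u v) ∧
    ∀ (x : M) (u : TangentSpace (𝓡 d) x),
      r'.a x u = r.a x u - dLog B x u

theorem mdifferentiableAt_log {B : M → ℝ} (hB : ContMDiff (𝓡 d) 𝓘(ℝ, ℝ) ∞ B)
    (hpos : ∀ x, 0 < B x) (x : M) :
    MDifferentiableAt (𝓡 d) 𝓘(ℝ, ℝ) (fun x' => Real.log (B x')) x := by
  have h1 : MDifferentiableAt 𝓘(ℝ, ℝ) 𝓘(ℝ, ℝ) Real.log (B x) :=
    (Real.differentiableAt_log (hpos x).ne').mdifferentiableAt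
  exact h1.comp x (hB.mdifferentiableAt (by simp))

theorem WeylRelated.refl {p q : ℕ} (r : WeylPair d M p q) : WeylRelated r r := by
  refine ⟨fun _ => 1, contMDiff_const, fun _ => one_pos, fun x u v => by simp, fun x u => ?_⟩
  have h : dLog (fun _ : M => (1 : ℝ)) x u = 0 := by
    unfold dLog
    rw [mfderiv_const]
    rfl
  rw [h, sub_zero]

theorem WeylRelated.symm {p q : ℕ} {r r' : WeylPair d M p q} (h : WeylRelated r r') :
    WeylRelated r' r := by
  obtain ⟨B, hB, hpos, hg, ha⟩ := h
  refine ⟨fun x => (B x)⁻¹, ?_, fun x => inv_pos.2 (hpos x), fun x u v => ?_, fun x u => ?_⟩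
  · intro x
    have h1 : ContMDiffAt 𝓘(ℝ, ℝ) 𝓘(ℝ, ℝ) ∞ (fun y : ℝ => y⁻¹) (B x) :=
      (contDiffAt_inv ℝ (hpos x).ne').contMDiffAt
    exact h1.comp x (hB x)
  · have := (hpos x).ne'
    rw [hg]
    field_simp
  · have h1 : (fun x' => Real.log (B x')⁻¹) = -(fun x' => Real.log (B x')) := by
      funext x'
      simp [Real.log_inv]
    have h2 : dLog (fun x => (B x)⁻¹) x u = -dLog B x u := by
      unfold dLog
      rw [h1, mfderiv_neg]
      rfl
    rw [ha, h2]
    ring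

theorem WeylRelated.trans {p q : ℕ} {r r' r'' : WeylPair d M p q} (h : WeylRelated r r')
    (h' : WeylRelated r' r'') : WeylRelated r r'' := by
  obtain ⟨B, hB, hpos, hg, ha⟩ := h
  obtain ⟨C, hC, hpos', hg', ha'⟩ := h'
  refine ⟨fun x => B x * C x, hB.mul hC, fun x => mul_pos (hpos x) (hpos' x), fun x u v => ?_,
    fun x u => ?_⟩
  · rw [hg', hg, mul_inv]
    ring
  · have h1 : (fun x' => Real.log (B x' * C x')) =
        (fun x' => Real.log (B x')) + fun x' => Real.log (C x') := by
      funext x'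
      simp [Real.log_mul (hpos x').ne' (hpos' x').ne']
    have h2 : dLog (fun x => B x * C x) x u = dLog B x u + dLog C x u := by
      unfold dLog
      rw [h1, mfderiv_add (mdifferentiableAt_log hB hpos x) (mdifferentiableAt_log hC hpos' x)]
      rfl
    rw [ha', ha, h2]
    ring

variable (d M) in
/-- Weyl equivalence of pairs `(g, a)`, as an equivalence relation. -/
def weylSetoid (p q : ℕ) : Setoid (WeylPair d M p q) where
  r := WeylRelated
  iseqv := ⟨WeylRelated.refl, WeylRelated.symm, WeylRelated.trans⟩

variable (d M) in
/-- A Weyl class `[g, a]` on `M`; the pair of `M` and a Weyl class is a Weyl manifold. -/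
def WeylClass (p q : ℕ) : Type _ := Quotient (weylSetoid d M p q)

/-- The Weyl class `[g, a]` of the pair `(g, a)`. -/
def WeylPair.weylClass {p q : ℕ} (r : WeylPair d M p q) : WeylClass d M p q :=
  Quotient.mk (weylSetoid d M p q) r

variable (d M) in
/-- Prescribed acceleration: a family `φ_ρ = φ_i(x, ρ) dx^i` of 1-forms on `M`, depending smoothly on
`(x, ρ)` in an open neighbourhood `dom` of `M × {0}` in `M × ℝ`. It stands for the acceleration
covector `𝒜 = t² φ_i(x, ρ) dx^i` on `ℝ₊ × M × ℝ`: `𝒜` has neither a `dt` nor a `dρ` component, and the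
factor `t²` expresses that it is homogeneous of degree 2. Values outside `dom` are irrelevant. -/
structure Acceleration where
  dom : Set (M × ℝ)
  isOpen_dom : IsOpen dom
  zero_mem : ∀ x : M, (x, (0 : ℝ)) ∈ dom
  form : ∀ (x : M) (_ρ : ℝ), TangentSpace (𝓡 d) x →ₗ[ℝ] ℝ
  smooth : ∀ (x₀ : M) (u : EuclideanSpace ℝ (Fin d)),
    ContDiffOn ℝ ∞
      (fun w : EuclideanSpace ℝ (Fin d) × ℝ =>
        form ((extChartAt (𝓡 d) x₀).symm w.1) w.2 (chartVec (𝓡 d) x₀ w.1 u))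
      {w | w.1 ∈ (extChartAt (𝓡 d) x₀).target ∧ ((extChartAt (𝓡 d) x₀).symm w.1, w.2) ∈ dom}

end Base

section Ambient

variable (d : ℕ) (M : Type*) [TopologicalSpace M] [ChartedSpace (EuclideanSpace ℝ (Fin d)) M]

/- The Weyl structure `𝒫_W` is trivialised by the chosen representative `(g, a)`: the point `(t, x)`,
`t > 0`, corresponds to the point `(x, t² g_x)` of the metric bundle of `[g]`. Thus `𝒫_W × ℝ` is the
open subset `t > 0` of the manifold `ℝ × M × ℝ` of triples `(t, x, ρ)`. -/

/-- The manifold `ℝ × M × ℝ` of triples `(t, x, ρ)`. -/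
abbrev Total : Type _ := ℝ × M × ℝ

/-- The model space of coordinates `(t, x¹, …, x^d, ρ)`. -/
abbrev Coord : Type := ℝ × EuclideanSpace ℝ (Fin d) × ℝ

/-- The model with corners (without boundary) of `ℝ × M × ℝ`. -/
abbrev totalModel := 𝓘(ℝ, ℝ).prod ((𝓡 d).prod 𝓘(ℝ, ℝ))

/-- The index set `{0, 1, …, d, ∞}` of ambient coordinates. -/
abbrev Idx : Type := Unit ⊕ Fin d ⊕ Unit

/-- The index `∞` of the coordinate `ρ`. -/
abbrev infIdx : Idx d := Sum.inr (Sum.inr ())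

/-- The coordinate basis `∂_t, ∂_1, …, ∂_d, ∂_ρ` of the model space. -/
def coordBasis : Idx d → Coord d
  | Sum.inl _ => (1, 0, 0)
  | Sum.inr (Sum.inl i) => (0, EuclideanSpace.single i 1, 0)
  | Sum.inr (Sum.inr _) => (0, 0, 1)

/-- A `𝕜`-valued covariant 2-tensor field on `ℝ × M × ℝ`. -/
abbrev TwoTensor (𝕜 : Type*) [RCLike 𝕜] : Type _ :=
  ∀ z : Total M, TangentSpace (totalModel d) z →ₗ[ℝ] TangentSpace (totalModel d) z →ₗ[ℝ] 𝕜

variable {d M}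

/-- The tangent vector `τ ∂_t + ξ + σ ∂_ρ` at `z = (t, x, ρ)`, where `ξ` is tangent to `M` at `x`. -/
def vec (z : Total M) (τ : ℝ) (ξ : TangentSpace (𝓡 d) z.2.1) (σ : ℝ) :
    TangentSpace (totalModel d) z := (τ, ξ, σ)

/-- The component of a tangent vector of `ℝ × M × ℝ` along `M`. -/
def basePart (z : Total M) (u : TangentSpace (totalModel d) z) : TangentSpace (𝓡 d) z.2.1 :=
  (show Coord d from u).2.1

/-- The dilatation `δ_s (t, x, ρ) = (s t, x, ρ)`. -/
def dil (s : ℝ) (z : Total M) : Total M := (s * z.1, z.2)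

variable (d M) in
/-- The hypersurface `𝒫_W × {0}`. -/
def initialSurface : Set (Total M) := {z | 0 < z.1 ∧ z.2.2 = 0}

variable {𝕜 : Type*} [RCLike 𝕜]

/-- The matrix of components `T_{IJ}` of a 2-tensor in the ambient coordinates `(t, xⁱ, ρ)` defined by
the chart around `z₀`, as a function of the coordinates. -/
def comps (T : TwoTensor d M 𝕜) (z₀ : Total M) (y : Coord d) : Matrix (Idx d) (Idx d) 𝕜 :=
  Matrix.of fun I J => T ((extChartAt (totalModel d) z₀).symm y)
    (chartVec (totalModel d) z₀ y (coordBasis d I)) (chartVec (totalModel d) z₀ y (coordBasis d J))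

/-- A function on `ℝ × M × ℝ` in the ambient coordinates defined by the chart around `z₀`. -/
def inChart (f : Total M → 𝕜) (z₀ : Total M) (y : Coord d) : 𝕜 :=
  f ((extChartAt (totalModel d) z₀).symm y)

/-- Weyl pre-ambient spaces `(M̃, g̃)` for `(M, [g, a])`, with `M̃` the set `U`, described in the
trivialisation given by the representative `r = (g, a)`.

For `𝕜 = ℝ` these are the pseudo-Riemannian spaces of that name. For `𝕜 = ℂ` the components of `g̃` may
be complex; the signature is then that of the real part of `g̃`. -/
structure IsWeylPreAmbient {p q : ℕ} (r : WeylPair d M p q) (U : Set (Total M))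
    (g : TwoTensor d M 𝕜) : Prop where
  isOpen : IsOpen U
  pos : ∀ z ∈ U, 0 < z.1
  initial_mem : ∀ z ∈ initialSurface M, z ∈ U
  dil_mem : ∀ s : ℝ, 0 < s → ∀ z ∈ U, dil s z ∈ U
  /-- `ι^* g̃` is the tautological tensor `t² π^* g` of `𝒫_W`. -/
  pullback : ∀ z ∈ initialSurface M, ∀ (τ τ' : ℝ) (ξ ξ' : TangentSpace (𝓡 d) z.2.1),
    g z (vec z τ ξ 0) (vec z τ' ξ' 0) = ((z.1 ^ 2 * r.g z.2.1 ξ ξ' : ℝ) : 𝕜)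
  smooth : ∀ (z₀ : Total M) (I J : Idx d),
    ContDiffOn ℝ ∞ (fun y => comps g z₀ y I J) (chartDomain (totalModel d) z₀ U)
  symm : ∀ z ∈ U, ∀ u v, g z u v = g z v u
  nondegenerate : ∀ (z₀ : Total M), ∀ y ∈ chartDomain (totalModel d) z₀ U, (comps g z₀ y).det ≠ 0
  signature : ∀ z ∈ U, HasSignature (fun u v => RCLike.re (g z u v)) (p + 1) (q + 1)
  /-- `δ_s^* g̃ = s² g̃`; the differential of `δ_s` maps `(τ, ξ, σ)` to `(s τ, ξ, σ)`. -/
  homogeneous : ∀ s : ℝ, 0 < s → ∀ z ∈ U, ∀ (τ τ' : ℝ) (ξ ξ' : TangentSpace (𝓡 d) z.2.1) (σ σ' : ℝ),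
    g (dil s z) (vec (dil s z) (s * τ) ξ σ) (vec (dil s z) (s * τ') ξ' σ') =
      ((s ^ 2 : ℝ) : 𝕜) * g z (vec z τ ξ σ) (vec z τ' ξ' σ')

/-- The acceleration vector `∇_𝒰 𝒰` of the `ρ`-lines, `𝒰 = ∂_ρ`, has components `Γ^K_{∞∞}`. This is the
component with index `I` of the corresponding covector: `g̃(∇_𝒰 𝒰, ∂_I) = Γ^K_{∞∞} g̃_{KI}`. -/
def lineAcceleration (g : TwoTensor d M 𝕜) (z₀ : Total M) (I : Idx d) (y : Coord d) : 𝕜 :=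
  ∑ K, christoffel (coordBasis d) (comps g z₀) K (infIdx d) (infIdx d) y * comps g z₀ y K I

/-- The covector `𝒜 = t² φ_i(x, ρ) dx^i` at `z = (t, x, ρ)`, applied to the tangent vector `u`. -/
def Acceleration.covector (A : Acceleration d M) (z : Total M)
    (u : TangentSpace (totalModel d) z) : ℝ :=
  z.1 ^ 2 * A.form z.2.1 z.2.2 (basePart z u)

/-- Weyl-normal form with acceleration `A`, relative to the representative `r = (g, a)`. -/
structure IsWeylNormal {p q : ℕ} (r : WeylPair d M p q) (A : Acceleration d M) (U : Set (Total M))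
    (g : TwoTensor d M 𝕜) : Prop where
  interval : ∀ (t : ℝ) (x : M), 0 < t → {ρ : ℝ | (t, x, ρ) ∈ U}.OrdConnected
  subset_dom : ∀ z ∈ U, z.2 ∈ A.dom
  /-- The `ρ`-lines have acceleration covector `𝒜`; in particular the acceleration vector is
  orthogonal to `𝒯 = t ∂_t` and to `𝒰 = ∂_ρ`. -/
  acceleration : ∀ z₀ : Total M, ∀ y ∈ chartDomain (totalModel d) z₀ U, ∀ I : Idx d,
    lineAcceleration g z₀ I y =
      ((A.covector _ (chartVec (totalModel d) z₀ y (coordBasis d I)) : ℝ) : 𝕜)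
  /-- `g̃ = t² g + 2 t² (t⁻¹ dt + a) dρ` at `ρ = 0`, with `2 α β = α ⊗ β + β ⊗ α`. -/
  initial : ∀ z ∈ initialSurface M, ∀ (τ τ' : ℝ) (ξ ξ' : TangentSpace (𝓡 d) z.2.1) (σ σ' : ℝ),
    g z (vec z τ ξ σ) (vec z τ' ξ' σ') =
      ((z.1 ^ 2 * r.g z.2.1 ξ ξ' + z.1 ^ 2 * ((z.1⁻¹ * τ + r.a z.2.1 ξ) * σ' +
        (z.1⁻¹ * τ' + r.a z.2.1 ξ') * σ) : ℝ) : 𝕜)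

/-- Weyl-ambient spaces for `(M, [g, a])`: `Ric(g̃)` vanishes to infinite order at every point of
`𝒫_W × {0}`. -/
structure IsWeylAmbient {p q : ℕ} (r : WeylPair d M p q) (U : Set (Total M))
    (g : TwoTensor d M 𝕜) : Prop extends IsWeylPreAmbient r U g where
  ricciFlat : ∀ (z₀ : Total M), ∀ y ∈ chartDomain (totalModel d) z₀ (initialSurface M),
    ∀ I J : Idx d, VanishesToInfiniteOrder (ricci (coordBasis d) (comps g z₀) I J) y

/-- Weyl-ambient spaces for `(M, [g, a])` with the dimension of `M` replaced by the formal parameter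
`D`, which need not be an integer.

For a natural number `N = D - d` these are the metrics `g̃ + f² (dw₁² + ⋯ + dw_N²)` over the product of
`M` with a flat `ℝ^N`, carrying the metric `g + dw₁² + ⋯ + dw_N²` and the pullback of `a`, that are
Weyl-ambient, with all data constant along `ℝ^N`: taking `N` flat directions along leaves every tensor
on `M` unchanged and replaces the trace `δ^i_i = d` by `D = d + N`. The equations `Ric = 0` of this
warped product are polynomial in `N`, and here they are imposed for `N = D - d` with `D` arbitrary. For
`D = d` the equation for `g̃` is `Ric(g̃) = 0`. -/
structure IsFormalWeylAmbient {p q : ℕ} (D : 𝕜) (r : WeylPair d M p q) (U : Set (Total M))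
    (g : TwoTensor d M 𝕜) (f : Total M → 𝕜) : Prop extends IsWeylPreAmbient r U g where
  smooth_warp : ∀ z₀ : Total M,
    ContDiffOn ℝ ∞ (inChart f z₀) (chartDomain (totalModel d) z₀ U)
  warp_ne_zero : ∀ z ∈ U, f z ≠ 0
  warp_homogeneous : ∀ s : ℝ, 0 < s → ∀ z ∈ U, f (dil s z) = (s : 𝕜) * f z
  warp_initial : ∀ z ∈ initialSurface M, f z = (z.1 : 𝕜)
  ricciFlat_base : ∀ (z₀ : Total M), ∀ y ∈ chartDomain (totalModel d) z₀ (initialSurface M),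
    ∀ I J : Idx d, VanishesToInfiniteOrder
      (warpedRicciBase (D - (d : 𝕜)) (coordBasis d) (comps g z₀) (inChart f z₀) I J) y
  ricciFlat_fibre : ∀ (z₀ : Total M), ∀ y ∈ chartDomain (totalModel d) z₀ (initialSurface M),
    VanishesToInfiniteOrder
      (warpedRicciFibre (D - (d : 𝕜)) (coordBasis d) (comps g z₀) (inChart f z₀)) y

/-- `g̃₁ - g̃₂` vanishes to infinite order at every point of `𝒫_W × {0}`. -/
def AgreeToInfiniteOrder (g₁ g₂ : TwoTensor d M 𝕜) : Prop :=
  ∀ (z₀ : Total M), ∀ y ∈ chartDomain (totalModel d) z₀ (initialSurface M), ∀ I J : Idx d,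
    VanishesToInfiniteOrder (fun y' => comps g₁ z₀ y' I J - comps g₂ z₀ y' I J) y

/-- The same for functions. -/
def AgreeToInfiniteOrderFun (f₁ f₂ : Total M → 𝕜) : Prop :=
  ∀ (z₀ : Total M), ∀ y ∈ chartDomain (totalModel d) z₀ (initialSurface M),
    VanishesToInfiniteOrder (fun y' : Coord d => inChart f₁ z₀ y' - inChart f₂ z₀ y') y

/-- The coefficient `∂_ρ^m g̃_{IJ} |_{ρ = 0}` of the expansion of `g̃` in powers of `ρ`. -/
def rhoCoeff (m : ℕ) (g : TwoTensor d M 𝕜) (z₀ : Total M) (I J : Idx d) (t : ℝ)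
    (y : EuclideanSpace ℝ (Fin d)) : 𝕜 :=
  iteratedDeriv m (fun ρ : ℝ => comps g z₀ (t, y, ρ) I J) 0

/-- The values of the dimension parameter that are not poles: `D ∉ {1, 0, 2, 4, 6, …}`. -/
def Regular (D : 𝕜) : Prop := D ≠ 1 ∧ ∀ k : ℕ, D ≠ 2 * (k : 𝕜)

end Ambient

end WeylAmbient

end

noncomputable section
namespace WeylAmbient

set_option linter.unusedSectionVars false

open Finset (sum_comm mul_sum sum_mul sum_sub_distrib sum_add_distrib sum_const_zero sum_neg_distrib
  sum_ite_eq sum_congr sum_eq_zero smul_sum sum_nonneg)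
open Matrix (mul_apply one_apply map_apply of_apply transpose_apply
  transpose_mul transpose_one diagonal)
open RCLike (ofReal_mul ofReal_one ofReal_zero ofReal_ne_zero ofReal_sum real_smul_eq_coe_mul)
open PowerSeries (coeff constantCoeff coeff_map coeff_zero_eq_constantCoeff_apply)
open scoped PowerSeries
open EuclideanSpace (single)
open Sum (inl inr)
open TopologicalSpace (Opens)

notation:max "ℰ" d:max => EuclideanSpace ℝ (Fin d)
notation:max "Mat" d:max => Matrix (Fin d) (Fin d)
notation:max "AMat" d:max => Matrix (Idx d) (Idx d)
notation "nI" => infIdx _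

lemma sum_ext {ι P : Type*} [Fintype ι] [AddCommMonoid P] {f g : ι → P} (h : ∀ i, f i = g i) :
    Finset.univ.sum f = Finset.univ.sum g := Fintype.sum_congr f g h

lemma sum_ext₂ {ι κ P : Type*} [Fintype ι] [Fintype κ] [AddCommMonoid P] {f g : ι → κ → P}
    (h : ∀ i j, f i j = g i j) : ∑ i, ∑ j, f i j = ∑ i, ∑ j, g i j :=
  sum_ext fun i => sum_ext (h i)

lemma coeff_zero {R : Type*} [CommRing R] (f : R⟦X⟧) : coeff 0 f = constantCoeff f :=
  coeff_zero_eq_constantCoeff_apply f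

notation "mapX" => PowerSeries.map
notation:max "Der" P:max => Derivation ℝ P P
notation "SmoothOn" => ContDiffOn ℝ ∞

section
variable {P : Type*} [CommRing P] [Algebra ℝ P] {ι : Type*} [Fintype ι] [DecidableEq ι]
  {D : ι → Der P} {q : ι → P} {G K G' K' : Matrix ι ι P} {Γ : ι → ι → ι → P}

variable (P) in
/-- The element `1 / 2` of a real algebra. -/
def half : P := algebraMap ℝ P (1 / 2)

lemma two_mul_half : 2 * half P = 1 := by
  have : (2 : P) = algebraMap ℝ P 2 := (map_ofNat (algebraMap ℝ P) 2).symm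
  rw [half, this, ← map_mul]; norm_num

/-- The derivative of a quantity of weight `w`, twisted by `q`. -/
def tw (D : ι → Der P) (q : ι → P) (w : P) (i : ι) (x : P) : P := D i x + w * q i * x

/-- Christoffel symbols with all indices lowered, of a metric of weight 2. -/
def lowChr (D : ι → Der P) (q : ι → P) (G : Matrix ι ι P) (l i j : ι) : P :=
  half P * (tw D q 2 i (G j l) + tw D q 2 j (G i l) - tw D q 2 l (G i j))

/-- Christoffel symbols of the metric `G` of weight 2 with inverse `K`. -/
def chr (D : ι → Der P) (q : ι → P) (G K : Matrix ι ι P) (k i j : ι) : P :=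
  ∑ l, K k l * lowChr D q G l i j

/-- The Ricci tensor of a connection. -/
def ricA (D : ι → Der P) (Γ : ι → ι → ι → P) (i j : ι) : P :=
  ∑ k, D k (Γ k i j) - ∑ k, D i (Γ k k j) + ∑ k, ∑ l, Γ k k l * Γ l i j
    - ∑ k, ∑ l, Γ k i l * Γ l k j

/-- The Hessian of a function of weight 1. -/
def hessA (D : ι → Der P) (q : ι → P) (Γ : ι → ι → ι → P) (f : P) (i j : ι) : P :=
  tw D q 1 i (tw D q 1 j f) - ∑ k, Γ k i j * tw D q 1 k f

/-- The full contraction of `K` with a 2-tensor. -/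
def trA (K : Matrix ι ι P) (T : ι → ι → P) : P := ∑ i, ∑ j, K i j * T i j

/-- The base component of the warped Ricci tensor; `φ` is the inverse of `f`. -/
def baseA (D : ι → Der P) (q : ι → P) (N : P) (Γ : ι → ι → ι → P) (f φ : P) (i j : ι) : P :=
  ricA D Γ i j - N * φ * hessA D q Γ f i j

/-- Minus the fibre component of the warped Ricci tensor. -/
def fibreA (D : ι → Der P) (q : ι → P) (N : P) (K : Matrix ι ι P) (Γ : ι → ι → ι → P) (f : P) : P :=
  f * trA K (hessA D q Γ f) + (N - 1) * trA K (fun i j => tw D q 1 i f * tw D q 1 j f)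

/-- `Γ` is the Levi-Civita connection of the metric `G` of weight 2, with inverse `K`. -/
structure IsLeviCivita (D : ι → Der P) (q : ι → P) (G K : Matrix ι ι P)
    (Γ : ι → ι → ι → P) : Prop where
  symmG : ∀ i j, G i j = G j i
  inv : G * K = 1
  symm : ∀ k i j, Γ k i j = Γ k j i
  compat : ∀ i j k, tw D q 2 i (G j k) = ∑ l, G j l * Γ l i k + ∑ l, G k l * Γ l i j

lemma lowChr_symm (hG : ∀ i j, G i j = G j i) (l i j : ι) :
    lowChr D q G l i j = lowChr D q G l j i := by simp only [lowChr, tw, hG j i]; ring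

lemma lowChr_add (hG : ∀ i j, G i j = G j i) (i j k : ι) :
    lowChr D q G j i k + lowChr D q G k i j = tw D q 2 i (G j k) := by
  simp only [lowChr, tw, hG k j]
  linear_combination (D i (G j k) + 2 * q i * G j k) * two_mul_half (P := P)

lemma sum_mul_chr (hK : G * K = 1) (l i j : ι) :
    ∑ k, G l k * chr D q G K k i j = lowChr D q G l i j := by
  simp only [chr, mul_sum, ← mul_assoc]
  rw [sum_comm]
  simp only [← sum_mul, ← mul_apply, hK, one_apply, ite_mul, one_mul,
    zero_mul, sum_ite_eq, Finset.mem_univ, if_true]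

lemma isLeviCivita_chr (hG : ∀ i j, G i j = G j i) (hK : G * K = 1) :
    IsLeviCivita D q G K (chr D q G K) where
  symmG := hG
  inv := hK
  symm k i j := by simp only [chr, lowChr_symm hG _ i j]
  compat i j k := by rw [sum_mul_chr hK, sum_mul_chr hK, lowChr_add hG]

namespace IsLeviCivita

variable (h : IsLeviCivita D q G K Γ)

include h

lemma inv' : K * G = 1 := by
  have := h.inv
  rwa [mul_eq_one_comm] at this

lemma transG : G.transpose = G := by ext i j; exact h.symmG j i

lemma transK : K.transpose = K := by
  have h1 : K.transpose * G = 1 := by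
    have := congrArg Matrix.transpose h.inv
    rwa [transpose_mul, h.transG, transpose_one] at this
  calc K.transpose = K.transpose * (G * K) := by rw [h.inv, mul_one]
    _ = K := by rw [← mul_assoc, h1, one_mul]

lemma symmK (i j : ι) : K i j = K j i := by
  conv_lhs => rw [← h.transK]
  rfl

lemma sum_metric (l i j : ι) : ∑ k, G l k * Γ k i j = lowChr D q G l i j := by
  have e1 := h.compat i j l
  have e2 := h.compat j i l
  have e3 := h.compat l i j
  simp only [h.symm _ l i, h.symm _ l j] at e3
  simp only [h.symm _ j i] at e2
  rw [lowChr, e1, e2, e3]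
  linear_combination (-∑ k, G l k * Γ k i j) * two_mul_half (P := P)

lemma eq_chr : Γ = chr D q G K := by
  funext k i j
  simp only [chr, ← h.sum_metric, mul_sum, ← mul_assoc]
  rw [sum_comm]
  simp only [← sum_mul, ← mul_apply, h.inv', one_apply, ite_mul, one_mul,
    zero_mul, sum_ite_eq, Finset.mem_univ, if_true]

end IsLeviCivita

/-- The entrywise derivative of a matrix. -/
def dM (D : Der P) (A : Matrix ι ι P) : Matrix ι ι P := A.map D

lemma dM_add (δ : Der P) (A B : Matrix ι ι P) : dM δ (A + B) = dM δ A + dM δ B := by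
  ext; simp [dM]

lemma dM_sub (δ : Der P) (A B : Matrix ι ι P) : dM δ (A - B) = dM δ A - dM δ B := by
  ext; simp [dM]

lemma dM_mul (δ : Der P) (A B : Matrix ι ι P) : dM δ (A * B) = dM δ A * B + A * dM δ B := by
  ext i j
  simp only [dM, map_apply, mul_apply, map_sum, Derivation.leibniz, smul_eq_mul,
    Matrix.add_apply, ← sum_add_distrib]
  exact sum_ext fun _ => by ring

lemma dM_smul (δ : Der P) (c : P) (A : Matrix ι ι P) :
    dM δ (c • A) = δ c • A + c • dM δ A := by ext i j; simp [dM, mul_comm, add_comm]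

lemma dM_transpose (δ : Der P) (A : Matrix ι ι P) : dM δ A.transpose = (dM δ A).transpose := rfl

lemma dM_one (δ : Der P) : dM δ (1 : Matrix ι ι P) = 0 := by
  ext i j
  by_cases hij : i = j
  · subst hij; simp [dM]
  · simp [dM, hij]

lemma dM_comm {δ δ' : Der P} (hc : ∀ x, δ (δ' x) = δ' (δ x)) (A : Matrix ι ι P) :
    dM δ (dM δ' A) = dM δ' (dM δ A) := by ext i j; exact hc _

/-- The connection matrices `(Γ_i)^k_j`. -/
def cm (Γ : ι → ι → ι → P) (i : ι) : Matrix ι ι P := Matrix.of fun k j => Γ k i j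

/-- The curvature matrices `∂_i Γ_j - ∂_j Γ_i + [Γ_i, Γ_j]`. -/
def curv (D : ι → Der P) (C : ι → Matrix ι ι P) (i j : ι) : Matrix ι ι P :=
  dM (D i) (C j) - dM (D j) (C i) + C i * C j - C j * C i

lemma curv_swap (C : ι → Matrix ι ι P) (i j : ι) : curv D C i j = -curv D C j i := by
  simp only [curv]; abel

lemma ricA_eq_curv (Γ : ι → ι → ι → P) (i j : ι) : ricA D Γ i j = ∑ k, curv D (cm Γ) k i k j := by
  simp only [ricA, curv, Matrix.sub_apply, Matrix.add_apply, sum_sub_distrib,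
    sum_add_distrib, mul_apply]
  rfl

lemma curv_bianchi (hD : ∀ i j x, D i (D j x) = D j (D i x)) (C : ι → Matrix ι ι P) (m i j : ι) :
    (dM (D m) (curv D C i j) + C m * curv D C i j - curv D C i j * C m)
      + (dM (D i) (curv D C j m) + C i * curv D C j m - curv D C j m * C i)
      + (dM (D j) (curv D C m i) + C j * curv D C m i - curv D C m i * C j) = 0 := by
  simp only [curv, dM_add, dM_sub, dM_mul]
  rw [dM_comm (hD m j), dM_comm (hD m i), dM_comm (hD i j)]
  noncomm_ring

namespace IsLeviCivita

variable (h : IsLeviCivita D q G K Γ)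

include h

lemma dM_G (i : ι) : dM (D i) G = G * cm Γ i + (cm Γ i).transpose * G - (2 * q i) • G := by
  ext j k
  have := h.compat i j k
  simp only [tw] at this
  simp only [dM, map_apply, Matrix.sub_apply, Matrix.add_apply, mul_apply, cm,
    of_apply, transpose_apply, Matrix.smul_apply, smul_eq_mul]
  rw [eq_sub_iff_add_eq, this]
  congr 1
  exact sum_ext fun l => by rw [h.symmG k l, mul_comm]

lemma dM_K (i : ι) : dM (D i) K = (2 * q i) • K - cm Γ i * K - K * (cm Γ i).transpose := by
  have h1 : dM (D i) G * K + G * dM (D i) K = 0 := by rw [← dM_mul, h.inv, dM_one]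
  have h2 : dM (D i) K = -(K * dM (D i) G * K) := by
    calc dM (D i) K = K * G * dM (D i) K := by rw [h.inv', one_mul]
      _ = K * (dM (D i) G * K + G * dM (D i) K) - K * dM (D i) G * K := by noncomm_ring
      _ = _ := by rw [h1]; simp
  rw [h2, h.dM_G]
  have h3 : K * (G * cm Γ i + (cm Γ i).transpose * G - (2 * q i) • G) * K
      = (K * G) * cm Γ i * K + K * (cm Γ i).transpose * (G * K) - (2 * q i) • (K * (G * K)) := by
    simp only [mul_sub, sub_mul, mul_smul_comm, smul_mul_assoc]
    noncomm_ring
  rw [h3, h.inv, h.inv']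
  simp only [one_mul, mul_one]
  abel

lemma curv_antisymm (hD : ∀ i j x, D i (D j x) = D j (D i x))
    (hq : ∀ i j, D i (q j) = D j (q i)) (i j : ι) :
    G * curv D (cm Γ) i j + (curv D (cm Γ) i j).transpose * G = 0 := by
  have e : dM (D i) (dM (D j) G) = dM (D j) (dM (D i) G) := dM_comm (hD i j) G
  rw [h.dM_G, h.dM_G] at e
  simp only [dM_add, dM_sub, dM_mul, dM_smul, h.dM_G, dM_transpose] at e
  have hq' : D i (2 * q j) = D j (2 * q i) := by
    have h2 : (2 : P) = algebraMap ℝ P 2 := (map_ofNat (algebraMap ℝ P) 2).symm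
    simp [Derivation.leibniz, hq i j, h2]
  rw [hq'] at e
  simp only [curv, Matrix.transpose_add, Matrix.transpose_sub, transpose_mul]
  simp only [add_mul, sub_mul, mul_add, mul_sub, smul_mul_assoc, mul_smul_comm, smul_add,
    smul_sub, smul_smul, mul_comm (2 * q j) (2 * q i)] at e
  rw [← sub_eq_zero] at e
  rw [← e]
  noncomm_ring

end IsLeviCivita

/-- Raising the second index of a symmetric 2-tensor. -/
def mixA (K : Matrix ι ι P) (T : ι → ι → P) (m i : ι) : P := ∑ n, T m n * K n i

/-- The divergence of a symmetric 2-tensor of weight `w + 2`. -/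
def divA (D : ι → Der P) (q : ι → P) (K : Matrix ι ι P) (Γ : ι → ι → ι → P) (w : P)
    (T : ι → ι → P) (m : ι) : P :=
  ∑ i, tw D q w i (mixA K T m i) + ∑ i, ∑ n, Γ i i n * mixA K T m n
    - ∑ i, ∑ n, Γ i m n * mixA K T i n

namespace IsLeviCivita

variable (h : IsLeviCivita D q G K Γ) (hD : ∀ i j x, D i (D j x) = D j (D i x))
  (hq : ∀ i j, D i (q j) = D j (q i))

include h hD hq

lemma raised_antisymm (i j k l : ι) :
    (curv D (cm Γ) i j * K) k l = -(curv D (cm Γ) i j * K) l k := by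
  have e := congrArg (fun A => K * A * K) (h.curv_antisymm hD hq i j)
  have e2 : curv D (cm Γ) i j * K + K * (curv D (cm Γ) i j).transpose = 0 := by
    calc curv D (cm Γ) i j * K + K * (curv D (cm Γ) i j).transpose
        = (K * G) * curv D (cm Γ) i j * K + K * (curv D (cm Γ) i j).transpose * (G * K) := by
          rw [h.inv, h.inv', one_mul, mul_one]
      _ = K * (G * curv D (cm Γ) i j + (curv D (cm Γ) i j).transpose * G) * K := by noncomm_ring
      _ = 0 := by rw [e]; simp
  have e3 : (curv D (cm Γ) i j * K).transpose = K * (curv D (cm Γ) i j).transpose := by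
    rw [transpose_mul, h.transK]
  rw [← e3] at e2
  have := congrFun (congrFun e2 k) l
  simp only [Matrix.add_apply, transpose_apply, Matrix.zero_apply] at this
  exact eq_neg_of_add_eq_zero_left this

omit h hD hq in
lemma mixA_ricA (j k : ι) : mixA K (ricA D Γ) j k = ∑ i, (curv D (cm Γ) i j * K) i k := by
  simp only [mixA, ricA_eq_curv, mul_apply, sum_mul]
  exact sum_comm

lemma mixA_ricA' (j k : ι) : ∑ i, (curv D (cm Γ) j i * K) k i = mixA K (ricA D Γ) j k := by
  rw [mixA_ricA]
  refine sum_ext fun i => ?_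
  rw [h.raised_antisymm hD hq, curv_swap]; simp

lemma raised_bianchi (m i j : ι) :
    (dM (D m) (curv D (cm Γ) i j * K) + cm Γ m * (curv D (cm Γ) i j * K)
        + (curv D (cm Γ) i j * K) * (cm Γ m).transpose - (2 * q m) • (curv D (cm Γ) i j * K))
      + (dM (D i) (curv D (cm Γ) j m * K) + cm Γ i * (curv D (cm Γ) j m * K)
        + (curv D (cm Γ) j m * K) * (cm Γ i).transpose - (2 * q i) • (curv D (cm Γ) j m * K))
      + (dM (D j) (curv D (cm Γ) m i * K) + cm Γ j * (curv D (cm Γ) m i * K)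
        + (curv D (cm Γ) m i * K) * (cm Γ j).transpose - (2 * q j) • (curv D (cm Γ) m i * K))
      = 0 := by
  have e := congrArg (fun A => A * K) (curv_bianchi hD (cm Γ) m i j)
  simp only [zero_mul] at e
  rw [← e]
  simp only [dM_mul, h.dM_K, mul_sub, mul_smul_comm]
  noncomm_ring

lemma div_ricA (m : ι) : divA D q K Γ (-2) (ricA D Γ) m
      = half P * tw D q (-2) m (∑ i, mixA K (ricA D Γ) i i) := by
  set Φ : ι → ι → Matrix ι ι P := fun i j => curv D (cm Γ) i j * K with hΦ
  set r := mixA K (ricA D Γ) with hr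
  have r1 : ∀ j k, ∑ i, Φ i j i k = r j k := fun j k => (mixA_ricA j k).symm
  have r2 : ∀ j k, ∑ i, Φ j i k i = r j k := fun j k => h.mixA_ricA' hD hq j k
  have sw : ∀ i j k l, Φ i j k l = -Φ j i k l := by
    intro i j k l
    simp only [hΦ]
    rw [curv_swap]; simp
  have an : ∀ i j k l, Φ i j k l = -Φ i j l k := fun i j k l => h.raised_antisymm hD hq i j k l
  have r3 : ∀ j k, ∑ i, Φ j i i k = -r j k := fun j k => by
    rw [← r1, ← sum_neg_distrib]
    exact sum_ext fun i => sw _ _ _ _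
  have r4 : ∀ j k, ∑ i, Φ i j k i = -r j k := fun j k => by
    rw [← r1, ← sum_neg_distrib]
    exact sum_ext fun i => an _ _ _ _
  have key : ∀ i j, (D m (Φ i j i j) + ∑ n, Γ i m n * Φ i j n j + ∑ n, Φ i j i n * Γ j m n
        - 2 * q m * Φ i j i j)
      + (D i (Φ j m i j) + ∑ n, Γ i i n * Φ j m n j + ∑ n, Φ j m i n * Γ j i n
        - 2 * q i * Φ j m i j)
      + (D j (Φ m i i j) + ∑ n, Γ i j n * Φ m i n j + ∑ n, Φ m i i n * Γ j j n
        - 2 * q j * Φ m i i j) = 0 := by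
    intro i j
    have := congrFun (congrFun (h.raised_bianchi hD hq m i j) i) j
    simp only [Matrix.add_apply, Matrix.sub_apply, mul_apply (M := cm Γ _),
      mul_apply (N := (cm Γ _).transpose), Matrix.smul_apply, smul_eq_mul,
      Matrix.zero_apply] at this
    exact this
  have key2 := sum_eq_zero (s := (Finset.univ : Finset ι)) (fun i _ =>
    sum_eq_zero (s := (Finset.univ : Finset ι)) (fun j _ => key i j))
  simp only [sum_add_distrib, sum_sub_distrib] at key2
  have t1 : ∑ i, ∑ j, D m (Φ i j i j) = D m (∑ i, r i i) := by
    simp only [← map_sum]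
    rw [sum_comm]
    simp only [r1]
  have t2 : ∑ i, ∑ j, ∑ n, Γ i m n * Φ i j n j = ∑ i, ∑ n, Γ i m n * r i n := by
    refine sum_ext fun i => ?_
    rw [sum_comm]
    simp only [← mul_sum, r2]
  have t3 : ∑ i, ∑ j, ∑ n, Φ i j i n * Γ j m n = ∑ i, ∑ n, Γ i m n * r i n := by
    rw [sum_comm]
    refine sum_ext fun i => ?_
    rw [sum_comm]
    simp only [← sum_mul, r1]
    exact sum_ext fun _ => mul_comm _ _
  have t4 : ∑ i, ∑ j, 2 * q m * Φ i j i j = 2 * q m * ∑ i, r i i := by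
    rw [sum_comm]
    simp only [← mul_sum, r1]
  have t5 : ∑ i, ∑ j, D i (Φ j m i j) = -∑ i, D i (r m i) := by
    simp only [← map_sum, r4, map_neg, sum_neg_distrib]
  have t6 : ∑ i, ∑ j, ∑ n, Γ i i n * Φ j m n j = -∑ i, ∑ n, Γ i i n * r m n := by
    rw [← sum_neg_distrib]
    refine sum_ext fun i => ?_
    rw [sum_comm]
    simp only [← mul_sum, r4, mul_neg, sum_neg_distrib]
  have t7 : ∑ i, ∑ j, ∑ n, Φ j m i n * Γ j i n = 0 := by
    have e1 : ∑ i, ∑ j, ∑ n, Φ j m i n * Γ j i n = -∑ i, ∑ j, ∑ n, Φ j m i n * Γ j i n := by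
      conv_lhs => rw [sum_comm]
      conv_rhs => rw [sum_comm]
      rw [← sum_neg_distrib]
      refine sum_ext fun j => ?_
      conv_lhs => rw [sum_comm]
      rw [← sum_neg_distrib]
      refine sum_ext fun a => ?_
      rw [← sum_neg_distrib]
      refine sum_ext fun b => ?_
      rw [an j m b a, h.symm j b a]; ring
    linear_combination half P * e1 - (∑ i, ∑ j, ∑ n, Φ j m i n * Γ j i n) * two_mul_half (P := P)
  have t8 : ∑ i, ∑ j, 2 * q i * Φ j m i j = -∑ i, 2 * q i * r m i := by
    simp only [← mul_sum, r4, mul_neg, sum_neg_distrib]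
  have t9 : ∑ i, ∑ j, D j (Φ m i i j) = -∑ i, D i (r m i) := by
    rw [sum_comm]
    simp only [← map_sum, r3, map_neg, sum_neg_distrib]
  have t10 : ∑ i, ∑ j, ∑ n, Γ i j n * Φ m i n j = 0 := by
    have e1 : ∑ i, ∑ j, ∑ n, Γ i j n * Φ m i n j = -∑ i, ∑ j, ∑ n, Γ i j n * Φ m i n j := by
      conv_rhs => rw [← sum_neg_distrib]
      refine sum_ext fun i => ?_
      conv_lhs => rw [sum_comm]
      rw [← sum_neg_distrib]
      refine sum_ext fun a => ?_
      rw [← sum_neg_distrib]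
      refine sum_ext fun b => ?_
      rw [an m i a b, h.symm i b a]; ring
    linear_combination half P * e1 - (∑ i, ∑ j, ∑ n, Γ i j n * Φ m i n j) * two_mul_half (P := P)
  have t11 : ∑ i, ∑ j, ∑ n, Φ m i i n * Γ j j n = -∑ i, ∑ n, Γ i i n * r m n := by
    rw [sum_comm, ← sum_neg_distrib]
    refine sum_ext fun i => ?_
    rw [sum_comm]
    simp only [← sum_mul, r3, neg_mul, sum_neg_distrib]
    exact congrArg _ (sum_ext fun _ => mul_comm _ _)
  have t12 : ∑ i, ∑ j, 2 * q j * Φ m i i j = -∑ i, 2 * q i * r m i := by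
    rw [sum_comm]
    simp only [← mul_sum, r3, mul_neg, sum_neg_distrib]
  rw [t1, t2, t3, t4, t5, t6, t7, t8, t9, t10, t11, t12] at key2
  have t13 : ∑ i, -2 * q i * r m i = -∑ i, 2 * q i * r m i := by
    rw [← sum_neg_distrib]
    exact sum_ext fun i => by ring
  simp only [divA, tw, ← hr, sum_add_distrib, t13]
  linear_combination (-half P) * key2 - (∑ i, D i (r m i) - ∑ i, 2 * q i * r m i
    + ∑ i, ∑ n, Γ i i n * r m n - ∑ i, ∑ n, Γ i m n * r i n) * two_mul_half (P := P)

end IsLeviCivita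

lemma derivation_two (δ : Der P) : δ (2 : P) = 0 := by
  have h2 : (2 : P) = algebraMap ℝ P 2 := (map_ofNat (algebraMap ℝ P) 2).symm
  rw [h2, Derivation.map_algebraMap]

/-- The matrix all of whose rows are `v`. -/
def rowM (v : ι → P) : Matrix ι ι P := Matrix.of fun _ j => v j

lemma rowM_hessA (f : P) (j : ι) : rowM (hessA D q Γ f j) = dM (D j) (rowM fun k => tw D q 1 k f)
      + q j • rowM (fun k => tw D q 1 k f) - rowM (fun k => tw D q 1 k f) * cm Γ j := by
  ext a m
  simp only [rowM, hessA, tw, dM, of_apply, Matrix.sub_apply, Matrix.add_apply,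
    map_apply, Matrix.smul_apply, smul_eq_mul, mul_apply, cm, one_mul]
  congr 1
  exact sum_ext fun _ => mul_comm _ _

lemma rowM_curv (hD : ∀ i j x, D i (D j x) = D j (D i x))
    (hq : ∀ i j, D i (q j) = D j (q i)) (f : P) (i j : ι) :
    dM (D i) (rowM (hessA D q Γ f j)) + q i • rowM (hessA D q Γ f j)
      - rowM (hessA D q Γ f j) * cm Γ i
      - (dM (D j) (rowM (hessA D q Γ f i)) + q j • rowM (hessA D q Γ f i)
      - rowM (hessA D q Γ f i) * cm Γ j) = -(rowM (fun k => tw D q 1 k f) * curv D (cm Γ) i j) := by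
  simp only [rowM_hessA, curv, dM_add, dM_sub, dM_mul, dM_smul, smul_add, smul_sub, smul_smul,
    add_mul, sub_mul, mul_add, mul_sub, smul_mul_assoc]
  rw [dM_comm (hD i j), hq i j, mul_comm (q j) (q i)]
  simp only [mul_assoc]
  abel

namespace IsLeviCivita

variable (h : IsLeviCivita D q G K Γ) (hD : ∀ i j x, D i (D j x) = D j (D i x))
  (hq : ∀ i j, D i (q j) = D j (q i))

include h

lemma tw_K (i j k : ι) : tw D q (-2) i (K j k) = -∑ n, Γ j i n * K n k - ∑ n, K j n * Γ k i n := by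
  have := congrFun (congrFun (h.dM_K i) j) k
  simp only [dM, map_apply, Matrix.sub_apply, Matrix.smul_apply, smul_eq_mul,
    mul_apply, cm, of_apply, transpose_apply] at this
  rw [tw, this]; ring

include hD hq in
lemma hessA_symm (f : P) (i j : ι) : hessA D q Γ f i j = hessA D q Γ f j i := by
  simp only [hessA, tw, map_add, Derivation.leibniz, smul_eq_mul, hD i j, hq i j, h.symm _ i j,
    one_mul]
  ring

lemma divA_eq (w : P) {T : ι → ι → P} (hT : ∀ i j, T i j = T j i) (m : ι) :
    divA D q K Γ w T m = ∑ i, ∑ n, K i n * (tw D q (w + 2) i (T n m)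
      - ∑ k, Γ k i n * T k m - ∑ k, Γ k i m * T n k) := by
  have e1 : ∀ i, tw D q w i (mixA K T m i)
      = ∑ n, K i n * tw D q (w + 2) i (T n m) - ∑ n, ∑ k, T m n * Γ n i k * K k i
        - ∑ n, ∑ k, T m n * K n k * Γ i i k := by
    intro i
    simp only [mixA, tw, map_sum, Derivation.leibniz, smul_eq_mul, mul_sum]
    rw [← sum_add_distrib, ← sum_sub_distrib, ← sum_sub_distrib]
    refine sum_ext fun n => ?_
    have := h.tw_K i n i
    simp only [tw] at this
    simp only [mul_assoc, ← mul_sum]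
    rw [h.symmK i n, hT n m]
    linear_combination (T m n) * this
  simp only [divA, e1, sum_sub_distrib, mul_sub]
  have e2 : ∑ i, ∑ n, ∑ k, T m n * Γ n i k * K k i
      = ∑ i, ∑ n, K i n * ∑ k, Γ k i n * T k m := by
    refine sum_ext fun i => ?_
    rw [sum_comm]
    refine sum_ext fun n => ?_
    rw [mul_sum]
    exact sum_ext fun k => by rw [hT k m, h.symmK n i]; ring
  have e3 : ∑ i, ∑ n, ∑ k, T m n * K n k * Γ i i k = ∑ i, ∑ n, Γ i i n * mixA K T m n := by
    refine sum_ext fun i => ?_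
    rw [sum_comm]
    refine sum_ext fun n => ?_
    rw [mixA, mul_sum]
    exact sum_ext fun k => by ring
  have e4 : ∑ i, ∑ n, Γ i m n * mixA K T i n = ∑ i, ∑ n, K i n * ∑ k, Γ k i m * T n k := by
    simp only [mixA, mul_sum]
    rw [sum_comm]
    refine sum_ext fun n => ?_
    rw [sum_comm]
    refine sum_ext fun k => ?_
    exact sum_ext fun i => by rw [h.symmK n k, h.symm i m n, hT k i]; ring
  rw [e2, e3, e4]
  ring

include hD hq in
lemma div_hessA (f : P) (m : ι) :
    divA D q K Γ (-1) (hessA D q Γ f) m = tw D q (-1) m (trA K (hessA D q Γ f))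
      + ∑ k, mixA K (ricA D Γ) m k * tw D q 1 k f := by
  rw [h.divA_eq (-1) (h.hessA_symm hD hq f)]
  set H := hessA D q Γ f with hH
  have Hs : ∀ i j, H i j = H j i := h.hessA_symm hD hq f
  have c : ∀ i n, tw D q (-1 + 2) i (H n m) - ∑ k, Γ k i n * H k m - ∑ k, Γ k i m * H n k
      = (tw D q 1 m (H i n) - ∑ k, Γ k m n * H i k - ∑ k, Γ k m i * H k n)
        - ∑ k, tw D q 1 k f * curv D (cm Γ) i m k n := by
    intro i n
    have := congrFun (congrFun (rowM_curv (Γ := Γ) hD hq f i m) i) n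
    simp only [← hH, rowM, Matrix.sub_apply, Matrix.add_apply, dM, map_apply,
      of_apply, Matrix.smul_apply, smul_eq_mul, mul_apply, cm, Matrix.neg_apply]
      at this
    have s1 : ∑ k, Γ k i n * H k m = ∑ k, H m k * Γ k i n :=
      sum_ext fun k => by rw [Hs k m]; ring
    have s2 : ∑ k, Γ k i m * H n k = ∑ k, Γ k m i * H k n :=
      sum_ext fun k => by rw [Hs n k, h.symm k i m]
    have s3 : ∑ k, Γ k m n * H i k = ∑ k, H i k * Γ k m n :=
      sum_ext fun k => by ring
    rw [s1, s2, s3, Hs n m]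
    have e : (-1 + 2 : P) = 1 := by norm_num
    rw [e]
    simp only [tw, one_mul]
    simp only [tw, one_mul] at this ⊢
    linear_combination this
  simp only [c]
  have d1 : ∑ i, ∑ n, K i n * ∑ k, tw D q 1 k f * curv D (cm Γ) i m k n
      = -∑ k, mixA K (ricA D Γ) m k * tw D q 1 k f := by
    have : ∀ k, mixA K (ricA D Γ) m k = -∑ i, (curv D (cm Γ) i m * K) k i := by
      intro k
      rw [mixA_ricA, ← sum_neg_distrib]
      exact sum_ext fun i => h.raised_antisymm hD hq i m i k
    simp only [this, neg_mul, sum_neg_distrib, neg_neg, sum_mul, mul_sum, mul_apply]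
    have : ∀ i, ∑ n, ∑ k, K i n * (tw D q 1 k f * curv D (cm Γ) i m k n)
        = ∑ k, ∑ n, curv D (cm Γ) i m k n * K n i * tw D q 1 k f := by
      intro i
      rw [sum_comm]
      refine sum_ext₂ fun k n => ?_
      rw [h.symmK i n]; ring
    simp only [this]
    rw [sum_comm]
  have d2 : ∑ i, ∑ n, K i n * (tw D q 1 m (H i n) - ∑ k, Γ k m n * H i k - ∑ k, Γ k m i * H k n)
      = tw D q (-1) m (trA K H) := by
    simp only [trA, tw, map_sum, Derivation.leibniz, smul_eq_mul, mul_sub, sum_sub_distrib]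
    have k1 : ∀ i n, H i n * D m (K i n) = 2 * q m * K i n * H i n
        - ∑ l, Γ i m l * K l n * H i n - ∑ l, K i l * Γ n m l * H i n := by
      intro i n
      have := h.tw_K m i n
      simp only [tw] at this
      simp only [← sum_mul]
      linear_combination (H i n) * this
    simp only [k1, sum_add_distrib, sum_sub_distrib, mul_add]
    have k2 : ∑ i, ∑ n, ∑ l, Γ i m l * K l n * H i n
        = ∑ i, ∑ n, K i n * ∑ k, Γ k m i * H k n := by
      simp only [mul_sum]
      rw [Finset.sum_comm_cycle]
      refine sum_ext fun l => ?_
      rw [sum_comm]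
      exact sum_ext₂ fun n i => by ring
    have k3 : ∑ i, ∑ n, ∑ l, K i l * Γ n m l * H i n
        = ∑ i, ∑ n, K i n * ∑ k, Γ k m n * H i k := by
      simp only [mul_sum]
      refine sum_ext fun i => ?_
      rw [sum_comm]
      exact sum_ext₂ fun n l => by ring
    rw [k2, k3]
    have k4 : ∑ i, ∑ n, 2 * q m * K i n * H i n = 2 * q m * ∑ i, ∑ n, K i n * H i n := by
      simp only [mul_sum, mul_assoc]
    have k5 : ∑ i, ∑ n, K i n * (1 * q m * H i n) = q m * ∑ i, ∑ n, K i n * H i n := by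
      simp only [mul_sum]
      exact sum_ext₂ fun n l => by ring
    rw [k4, k5]
    ring
  simp only [mul_sub, sum_sub_distrib] at d1 d2 ⊢
  rw [d1, d2]
  ring

lemma tw_gradSq (f : P) (m : ι) : D m (trA K fun i j => tw D q 1 i f * tw D q 1 j f)
      = 2 * ∑ n, hessA D q Γ f m n * ∑ i, K n i * tw D q 1 i f := by
  set p := fun i => tw D q 1 i f with hp
  have e1 : ∀ n, hessA D q Γ f m n = tw D q 1 m (p n) - ∑ k, Γ k m n * p k := fun n => rfl
  have e2 : ∀ i j, D m (K i j * (p i * p j)) = K i j * (tw D q 1 m (p i) * p j)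
      + K i j * (p i * tw D q 1 m (p j)) - ∑ l, Γ i m l * K l j * (p i * p j)
      - ∑ l, K i l * Γ j m l * (p i * p j) := by
    intro i j
    have := h.tw_K m i j
    simp only [tw] at this
    simp only [← sum_mul, Derivation.leibniz, smul_eq_mul, tw]
    linear_combination (p i * p j) * this
  simp only [trA, map_sum]
  change ∑ i, ∑ j, D m (K i j * (p i * p j)) = _
  simp only [e2, sum_sub_distrib, sum_add_distrib, e1, sub_mul]
  have f1 : ∑ i, ∑ j, K i j * (p i * tw D q 1 m (p j))
      = ∑ n, tw D q 1 m (p n) * ∑ i, K n i * tw D q 1 i f := by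
    rw [sum_comm]
    simp only [mul_sum]
    exact sum_ext₂ fun n i => by rw [h.symmK i n]; ring
  have f2 : ∑ i, ∑ j, K i j * (tw D q 1 m (p i) * p j)
      = ∑ n, tw D q 1 m (p n) * ∑ i, K n i * tw D q 1 i f := by
    simp only [mul_sum]
    exact sum_ext₂ fun n i => by ring
  have f3 : ∑ i, ∑ j, ∑ l, K i l * Γ j m l * (p i * p j)
      = ∑ n, (∑ k, Γ k m n * p k) * ∑ i, K n i * tw D q 1 i f := by
    simp only [mul_sum, sum_mul]
    rw [Finset.sum_comm_cycle]
    refine sum_ext fun n => ?_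
    exact sum_ext₂ fun i j => by rw [h.symmK i n]; ring
  have f4 : ∑ i, ∑ j, ∑ l, Γ i m l * K l j * (p i * p j)
      = ∑ n, (∑ k, Γ k m n * p k) * ∑ i, K n i * tw D q 1 i f := by
    rw [← f3, sum_comm]
    refine sum_ext₂ fun i j =>
      sum_ext fun l => ?_
    rw [h.symmK l i]; ring
  rw [f1, f2, f3, f4]
  ring

lemma sum_mixA (T : ι → ι → P) : ∑ i, mixA K T i i = trA K T := by
  simp only [mixA, trA]
  exact sum_ext₂ fun i n => by rw [h.symmK n i, mul_comm]

include hD hq in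
lemma warped_bianchi {N f φ : P} (hN : ∀ i, D i N = 0) (hφ : f * φ = 1) (m : ι) :
    divA D q K Γ (-2) (baseA D q N Γ f φ) m
      + N * φ * ∑ n, baseA D q N Γ f φ m n * ∑ i, K n i * tw D q 1 i f
      = half P * tw D q (-2) m (trA K (baseA D q N Γ f φ) - N * fibreA D q N K Γ f * φ ^ 2)
        - N * fibreA D q N K Γ f * φ ^ 3 * tw D q 1 m f := by
  have hφ' : ∀ i, tw D q (-1) i φ = -(φ ^ 2 * tw D q 1 i f) := by
    intro i
    have e := congrArg (D i) hφ
    simp only [Derivation.leibniz, smul_eq_mul, Derivation.map_one_eq_zero] at e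
    simp only [tw]
    linear_combination φ * e - (D i φ - q i * φ) * hφ
  set H := hessA D q Γ f with hH
  have Hs : ∀ i j, H i j = H j i := h.hessA_symm hD hq f
  have mix1 : ∀ i j, mixA K (baseA D q N Γ f φ) i j
      = mixA K (ricA D Γ) i j - N * φ * mixA K H i j := by
    intro i j
    simp only [mixA, baseA, ← hH, sub_mul, sum_sub_distrib, mul_sum]
    congr 1
    exact sum_ext fun _ => by ring
  have tr2 : trA K (baseA D q N Γ f φ) = trA K (ricA D Γ) - N * φ * trA K H := by
    simp only [trA, baseA, ← hH, mul_sub, sum_sub_distrib, mul_sum]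
    congr 1
    exact sum_ext₂ fun _ _ => by ring
  have con : ∀ T : ι → ι → P, ∑ n, T m n * ∑ i, K n i * tw D q 1 i f
      = ∑ i, mixA K T m i * tw D q 1 i f := by
    intro T
    simp only [mixA, mul_sum, sum_mul]
    rw [sum_comm]
    exact sum_ext₂ fun _ _ => by ring
  set Q := ∑ i, mixA K H m i * tw D q 1 i f with hQ
  set rQ := ∑ i, mixA K (ricA D Γ) m i * tw D q 1 i f with hrQ
  set g2 := trA K fun i j => tw D q 1 i f * tw D q 1 j f with hg2
  set Δ := trA K H with hΔ
  have dg2 : D m g2 = 2 * Q := by rw [h.tw_gradSq f m, con]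
  have hR := h.div_ricA hD hq m
  rw [h.sum_mixA] at hR
  have hH2 : divA D q K Γ (-1) H m = tw D q (-1) m Δ + rQ := h.div_hessA hD hq f m
  have hdiv : divA D q K Γ (-2) (baseA D q N Γ f φ) m = divA D q K Γ (-2) (ricA D Γ) m
      - N * φ * divA D q K Γ (-1) H m + N * φ ^ 2 * Q := by
    have e1 : ∀ i, tw D q (-2) i (mixA K (baseA D q N Γ f φ) m i)
        = tw D q (-2) i (mixA K (ricA D Γ) m i) - N * φ * tw D q (-1) i (mixA K H m i)
          + N * φ ^ 2 * (mixA K H m i * tw D q 1 i f) := by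
      intro i
      have e2 := hφ' i
      rw [mix1]
      simp only [tw, map_sub, Derivation.leibniz, smul_eq_mul, hN] at e2 ⊢
      linear_combination (-N * mixA K H m i) * e2
    simp only [divA, e1]
    simp only [mix1, mul_sub, sum_sub_distrib, sum_add_distrib, hQ, mul_sum, mul_add]
    have e3 : ∀ A : ι → ι → ι → P, ∀ B : ι → ι → P, ∑ i, ∑ n, A i i n * (N * φ * B i n)
        = N * φ * ∑ i, ∑ n, A i i n * B i n := by
      intro A B
      simp only [mul_sum]
      exact sum_ext₂ fun _ _ => by ring
    have e4 := e3 Γ fun _ n => mixA K H m n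
    have e5 := e3 (fun i _ n => Γ i m n) fun i n => mixA K H i n
    rw [e4, e5]
    simp only [mul_sum]
    ring
  rw [hdiv, hH2, hR, con]
  have hQ2 : ∑ i, mixA K (baseA D q N Γ f φ) m i * tw D q 1 i f = rQ - N * φ * Q := by
    simp only [mix1, sub_mul, sum_sub_distrib, hQ, hrQ, mul_sum]
    congr 1
    exact sum_ext fun _ => by ring
  rw [hQ2, tr2]
  have hS : trA K (ricA D Γ) - N * φ * Δ - N * fibreA D q N K Γ f * φ ^ 2
      = trA K (ricA D Γ) - 2 * (N * (φ * Δ)) - (N * (N - 1)) * (φ * φ * g2) := by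
    simp only [fibreA, ← hH, ← hΔ, ← hg2]
    linear_combination (-N * φ * Δ) * hφ
  have hS3 : N * fibreA D q N K Γ f * φ ^ 3 = N * (φ ^ 2 * Δ + (N - 1) * φ ^ 3 * g2) := by
    simp only [fibreA, ← hH, ← hΔ, ← hg2]
    linear_combination (N * φ ^ 2 * Δ) * hφ
  rw [hS, hS3]
  have e2 := hφ' m
  simp only [tw, map_sub, Derivation.leibniz, smul_eq_mul, hN, derivation_two, dg2,
    Derivation.map_one_eq_zero] at e2 ⊢
  linear_combination (half P * 2 * N * Δ + half P * 2 * (N * (N - 1)) * φ * g2) * e2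
    + (N * φ * (D m Δ + -1 * q m * Δ) + N * (N - 1) * φ ^ 2 * Q - N * Δ * φ ^ 2 * (D m f + 1 * q m * f)
      - N * (N - 1) * φ ^ 3 * g2 * (D m f + 1 * q m * f)) * two_mul_half (P := P)

end IsLeviCivita

lemma chr_sub_chr (hK : G * K = 1) (hK' : G' * K' = 1) (k i j : ι) :
    chr D q G' K' k i j - chr D q G K k i j
      = ∑ l, K' k l * (lowChr D q (G' - G) l i j - ∑ m, (G' - G) l m * chr D q G K m i j) := by
  have e1 : ∀ l, lowChr D q (G' - G) l i j - ∑ m, (G' - G) l m * chr D q G K m i j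
      = lowChr D q G' l i j - ∑ m, G' l m * chr D q G K m i j := by
    intro l
    simp only [Matrix.sub_apply, sub_mul, sum_sub_distrib, sum_mul_chr hK]
    simp only [lowChr, tw, Matrix.sub_apply, map_sub]
    ring
  have hK'' : K' * G' = 1 := by rwa [mul_eq_one_comm] at hK'
  simp only [e1, mul_sub, sum_sub_distrib]
  congr 1
  simp only [mul_sum, ← mul_assoc]
  rw [sum_comm]
  simp only [← sum_mul, ← mul_apply, hK'', one_apply, ite_mul, one_mul,
    zero_mul, sum_ite_eq, Finset.mem_univ, if_true]

lemma ricA_sub_ricA (Γ Γ' : ι → ι → ι → P) (i j : ι) :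
    ricA D Γ' i j - ricA D Γ i j = ∑ k, D k ((Γ' - Γ) k i j) - D i (∑ k, (Γ' - Γ) k k j)
      + ∑ k, ∑ l, Γ k k l * (Γ' - Γ) l i j + ∑ k, ∑ l, (Γ' - Γ) k k l * Γ' l i j
      - ∑ k, ∑ l, Γ k i l * (Γ' - Γ) l k j - ∑ k, ∑ l, (Γ' - Γ) k i l * Γ' l k j := by
  simp only [ricA, Pi.sub_apply, map_sub, map_sum, sum_sub_distrib, mul_sub, sub_mul]
  ring

lemma hessA_sub_hessA (Γ Γ' : ι → ι → ι → P) (f : P) (i j : ι) :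
    hessA D q Γ' f i j - hessA D q Γ f i j = -∑ k, (Γ' - Γ) k i j * tw D q 1 k f := by
  simp only [hessA, Pi.sub_apply, sum_sub_distrib, sub_mul]
  ring

lemma hessA_add (Γ : ι → ι → ι → P) (f g : P) (i j : ι) :
    hessA D q Γ (f + g) i j = hessA D q Γ f i j + hessA D q Γ g i j := by
  simp only [hessA, tw, map_add, mul_add, sum_add_distrib]
  ring

/-- The contracted Bianchi identity of a formal warped product, for a tensor with components `T` along
the base and `-S` along the fibre. -/
def WarpedBianchi (D : ι → Der P) (q : ι → P) (N : P) (K : Matrix ι ι P)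
    (Γ : ι → ι → ι → P) (T : ι → ι → P) (S f φ : P) (m : ι) : Prop :=
  divA D q K Γ (-2) T m + N * φ * ∑ n, T m n * ∑ i, K n i * tw D q 1 i f
    = half P * tw D q (-2) m (trA K T - N * S * φ ^ 2) - N * S * φ ^ 3 * tw D q 1 m f

namespace IsLeviCivita

lemma ricA_symm (h : IsLeviCivita D q G K Γ) (hD : ∀ i j x, D i (D j x) = D j (D i x))
    (hq : ∀ i j, D i (q j) = D j (q i)) (i j : ι) : ricA D Γ i j = ricA D Γ j i := by
  have t1 : (curv D (cm Γ) i j).trace = 0 := by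
    have e := congrArg (fun M => (K * M).trace) (h.curv_antisymm hD hq i j)
    simp only [mul_add, Matrix.trace_add, ← mul_assoc, h.inv', one_mul, mul_zero,
      Matrix.trace_zero] at e
    rw [Matrix.trace_mul_comm, ← mul_assoc, h.inv, one_mul, Matrix.trace_transpose] at e
    linear_combination (half P) * e - (curv D (cm Γ) i j).trace * two_mul_half (P := P)
  have t2 : ∀ a b, (dM (D a) (cm Γ b)).trace = ∑ k, D a (Γ k k b) := fun a b => by
    simp only [Matrix.trace, Matrix.diag, dM, map_apply, cm, of_apply, h.symm _ b]
  rw [curv] at t1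
  simp only [Matrix.trace_add, Matrix.trace_sub, t2, Matrix.trace_mul_comm (cm Γ i)] at t1
  have t3 : ∑ k, D i (Γ k k j) = ∑ k, D j (Γ k k i) := by linear_combination t1
  have t4 : ∑ k, ∑ l, Γ k i l * Γ l k j = ∑ k, ∑ l, Γ k j l * Γ l k i := by
    rw [sum_comm]
    refine sum_ext₂ fun k l => ?_
    rw [h.symm l i k, h.symm k l j, mul_comm]
  simp only [ricA, t3, t4, h.symm _ i j]

end IsLeviCivita

section FrameChange

variable {P' : Type*} [CommRing P'] [Algebra ℝ P']

/-- A ring homomorphism that carries the derivations `D` to a commuting frame `D'`, the two being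
related by the Jacobian `J` with inverse `L`. -/
structure FrameMap (φ : P →+* P') (D : ι → Der P) (q : ι → P)
    (D' : ι → Der P') (q' : ι → P') (J L : Matrix ι ι P') : Prop where
  der : ∀ i x, D' i (φ x) = ∑ a, J i a * φ (D a x)
  closed : ∀ i j a, D' i (J j a) = D' j (J i a)
  inv : J * L = 1
  twist : ∀ i, q' i = ∑ a, J i a * φ (q a)
  comm : ∀ i j x, D i (D j x) = D j (D i x)
  comm' : ∀ i j x, D' i (D' j x) = D' j (D' i x)

/-- The components in the new frame of a covariant 2-tensor. -/
def pullTensor (φ : P →+* P') (J : Matrix ι ι P') (T : ι → ι → P) (i j : ι) : P' :=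
  ∑ a, ∑ b, J i a * J j b * φ (T a b)

/-- The connection in the new frame. -/
def pullConn (φ : P →+* P') (D' : ι → Der P') (J L : Matrix ι ι P')
    (Γ : ι → ι → ι → P) (k i j : ι) : P' :=
  ∑ b, L b k * (D' i (J j b) + ∑ a, ∑ c, J i a * J j c * φ (Γ b a c))

lemma mul_pullTensor_mul (φ : P →+* P') (J : Matrix ι ι P') (G : Matrix ι ι P) (i j : ι) :
    (J * G.map φ * J.transpose) i j = pullTensor φ J G i j := by
  simp only [mul_apply, map_apply, transpose_apply, pullTensor, sum_mul]
  rw [sum_comm]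
  exact sum_ext₂ fun _ _ => by ring

namespace FrameMap

variable {φ : P →+* P'} {D' : ι → Der P'} {q' : ι → P'} {J L : Matrix ι ι P'}

section

variable (h : FrameMap φ D q D' q' J L)
include h

lemma inv' : L * J = 1 := by
  have := h.inv
  rwa [mul_eq_one_comm] at this

lemma tr_inv : L.transpose * J.transpose = 1 := by rw [← transpose_mul, h.inv, transpose_one]

lemma tr_inv' : J.transpose * L.transpose = 1 := by rw [← transpose_mul, h.inv', transpose_one]

lemma cm_pullConn (i : ι) : J.transpose * cm (pullConn φ D' J L Γ) i
    = dM (D' i) J.transpose + (∑ a, J i a • (cm Γ a).map φ) * J.transpose := by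
  have : cm (pullConn φ D' J L Γ) i = L.transpose *
      (dM (D' i) J.transpose + (∑ a, J i a • (cm Γ a).map φ) * J.transpose) := by
    ext k j
    simp only [cm, of_apply, pullConn, mul_apply, transpose_apply,
      Matrix.add_apply, dM, map_apply, Matrix.sum_apply, Matrix.smul_apply, smul_eq_mul,
      sum_mul]
    refine sum_ext fun b => ?_
    congr 2
    exact sum_ext₂ fun _ _ => by ring
  rw [this, ← mul_assoc, h.tr_inv', one_mul]

lemma dM_map (i : ι) (A : Matrix ι ι P) :
    dM (D' i) (A.map φ) = ∑ a, J i a • (dM (D a) A).map φ := by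
  ext k j
  simp [dM, h.der, Matrix.sum_apply]

lemma isLeviCivita (hΓ : IsLeviCivita D q G K Γ) :
    IsLeviCivita D' q' (J * G.map φ * J.transpose) (L.transpose * K.map φ * L)
      (pullConn φ D' J L Γ) where
  symmG i j := by
    have : (J * G.map φ * J.transpose).transpose = J * G.map φ * J.transpose := by
      rw [transpose_mul, transpose_mul, Matrix.transpose_transpose,
        ← Matrix.transpose_map, hΓ.transG, mul_assoc]
    exact congrFun (congrFun this j) i
  inv := by
    calc J * G.map φ * J.transpose * (L.transpose * K.map φ * L)
        = J * G.map φ * (J.transpose * L.transpose) * K.map φ * L := by noncomm_ring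
      _ = J * (G * K).map φ * L := by rw [h.tr_inv', Matrix.map_mul]; noncomm_ring
      _ = 1 := by rw [hΓ.inv, Matrix.map_one φ (map_zero φ) (map_one φ), mul_one, h.inv]
  symm k i j := by
    simp only [pullConn]
    refine sum_ext fun b => ?_
    rw [h.closed i j b, sum_comm]
    congr 2
    exact sum_ext₂ fun _ _ => by rw [hΓ.symm b]; ring
  compat i j k := by
    set G' := J * G.map φ * J.transpose with hG'
    set C := cm (pullConn φ D' J L Γ) i with hC
    set Ch := ∑ a, J i a • (cm Γ a).map φ with hCh
    have e0 : J.transpose * C = dM (D' i) J.transpose + Ch * J.transpose := h.cm_pullConn i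
    have e0' : C.transpose * J = dM (D' i) J + J * Ch.transpose := by
      have := congrArg Matrix.transpose e0
      simpa only [transpose_mul, Matrix.transpose_add, Matrix.transpose_transpose,
        dM_transpose] using this
    have e1 : dM (D' i) (G.map φ) = G.map φ * Ch + Ch.transpose * G.map φ
        - (2 * q' i) • G.map φ := by
      rw [h.dM_map]
      simp only [hΓ.dM_G, hCh, h.twist, mul_sum, sum_mul, Finset.sum_smul,
        Matrix.transpose_sum, Matrix.transpose_smul, mul_smul_comm, smul_mul_assoc]
      rw [← sum_add_distrib, ← sum_sub_distrib]
      refine sum_ext fun a => ?_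
      ext x y
      simp only [Matrix.smul_apply, map_apply, Matrix.sub_apply, Matrix.add_apply,
        map_sub, map_add, smul_eq_mul, mul_apply, map_sum, map_mul,
        transpose_apply, map_ofNat]
      ring
    have e2 : dM (D' i) G' = G' * C + C.transpose * G' - (2 * q' i) • G' := by
      rw [hG', dM_mul, dM_mul, e1]
      have a1 : J * G.map φ * J.transpose * C = J * G.map φ * (J.transpose * C) := by noncomm_ring
      have a2 : C.transpose * (J * G.map φ * J.transpose)
          = (C.transpose * J) * G.map φ * J.transpose := by noncomm_ring
      rw [a1, a2, e0, e0']
      simp only [mul_sub, mul_smul_comm]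
      noncomm_ring
    have e3 := congrFun (congrFun e2 j) k
    have hsymm : G'.transpose = G' := by
      rw [hG', transpose_mul, transpose_mul, Matrix.transpose_transpose,
        ← Matrix.transpose_map, hΓ.transG, mul_assoc]
    simp only [dM, map_apply, Matrix.sub_apply, Matrix.add_apply, mul_apply (M := G'),
      mul_apply (N := G'),
      transpose_apply, Matrix.smul_apply, smul_eq_mul] at e3
    rw [tw, e3]
    have e4 : ∑ l, C l j * G' l k = ∑ l, G' k l * pullConn φ D' J L Γ l i j :=
      sum_ext fun l => by
        rw [mul_comm, show G' l k = G' k l from congrFun (congrFun hsymm k) l]; rfl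
    rw [e4]
    simp only [hC, cm, of_apply]
    ring

lemma curv_pullConn (i j : ι) : J.transpose * curv D' (cm (pullConn φ D' J L Γ)) i j
      = (∑ a, ∑ b, (J i a * J j b) • (curv D (cm Γ) a b).map φ) * J.transpose := by
  set C := cm (pullConn φ D' J L Γ) with hC
  set Ch : ι → Matrix ι ι P' := fun i => ∑ a, J i a • (cm Γ a).map φ with hCh
  have e0 : ∀ i, J.transpose * C i = dM (D' i) J.transpose + Ch i * J.transpose :=
    fun i => h.cm_pullConn i
  have e0' : ∀ i, dM (D' i) J.transpose = J.transpose * C i - Ch i * J.transpose := by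
    intro i; rw [e0]; abel
  have e1 : ∀ i j, dM (D' i) (Ch j) = (∑ b, D' i (J j b) • (cm Γ b).map φ)
      + ∑ a, ∑ b, (J i a * J j b) • (dM (D a) (cm Γ b)).map φ := by
    intro i j
    have : dM (D' i) (Ch j) = ∑ b, dM (D' i) (J j b • (cm Γ b).map φ) := by
      ext x y
      simp [hCh, dM, Matrix.sum_apply]
    rw [this]
    simp only [dM_smul, h.dM_map, sum_add_distrib, smul_sum, smul_smul]
    congr 1
    rw [sum_comm]
    exact sum_ext₂ fun _ _ => by rw [mul_comm]
  have e2 : ∀ i j, Ch i * Ch j = ∑ a, ∑ b, (J i a * J j b) • (cm Γ a * cm Γ b).map φ := by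
    intro i j
    simp only [hCh, sum_mul, mul_sum, smul_mul_assoc, mul_smul_comm, smul_sum, Matrix.map_mul]
    rw [sum_comm]
    exact sum_ext₂ fun _ _ => by rw [smul_smul, mul_comm]
  have e3 : ∑ a, ∑ b, (J i a * J j b) • (curv D (cm Γ) a b).map φ
      = dM (D' i) (Ch j) - dM (D' j) (Ch i) + Ch i * Ch j - Ch j * Ch i := by
    rw [e1, e1, e2, e2]
    have s1 : ∑ b, D' i (J j b) • (cm Γ b).map φ = ∑ b, D' j (J i b) • (cm Γ b).map φ :=
      sum_ext fun b => by rw [h.closed]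
    have s2 : ∑ a, ∑ b, (J j a * J i b) • (dM (D a) (cm Γ b)).map φ
        = ∑ a, ∑ b, (J i a * J j b) • (dM (D b) (cm Γ a)).map φ := by
      rw [sum_comm]
      exact sum_ext₂ fun _ _ => by rw [mul_comm]
    have s3 : ∑ a, ∑ b, (J j a * J i b) • (cm Γ a * cm Γ b).map φ
        = ∑ a, ∑ b, (J i a * J j b) • (cm Γ b * cm Γ a).map φ := by
      rw [sum_comm]
      exact sum_ext₂ fun _ _ => by rw [mul_comm]
    rw [s1, s2, s3]
    have s4 : ∀ a b, (J i a * J j b) • (curv D (cm Γ) a b).map φ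
        = (J i a * J j b) • (dM (D a) (cm Γ b)).map φ - (J i a * J j b) • (dM (D b) (cm Γ a)).map φ
          + (J i a * J j b) • (cm Γ a * cm Γ b).map φ
          - (J i a * J j b) • (cm Γ b * cm Γ a).map φ := by
      intro a b
      ext x y
      simp only [curv, Matrix.smul_apply, map_apply, Matrix.sub_apply, Matrix.add_apply,
        map_sub, map_add, smul_eq_mul]
      ring
    simp only [s4, sum_add_distrib, sum_sub_distrib]
    abel
  rw [e3]
  have f1 := congrArg (dM (D' i)) (e0 j)
  have f2 := congrArg (dM (D' j)) (e0 i)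
  simp only [dM_mul, dM_add, e0'] at f1 f2
  have f3 := dM_comm (h.comm' i j) J.transpose
  simp only [e0', dM_sub, dM_mul] at f3
  simp only [curv]
  rw [← sub_eq_zero] at f3 ⊢
  rw [← f3]
  noncomm_ring

lemma ricA_pullConn (i j : ι) :
    ricA D' (pullConn φ D' J L Γ) i j = pullTensor φ J (ricA D Γ) i j := by
  have e1 : ∀ k i, curv D' (cm (pullConn φ D' J L Γ)) k i
      = L.transpose * ((∑ a, ∑ b, (J k a * J i b) • (curv D (cm Γ) a b).map φ) * J.transpose) := by
    intro k i
    rw [← h.curv_pullConn, ← mul_assoc, h.tr_inv, one_mul]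
  rw [ricA_eq_curv]
  simp only [e1, mul_apply, Matrix.sum_apply, Matrix.smul_apply, map_apply,
    smul_eq_mul, transpose_apply, pullTensor, ricA_eq_curv, map_sum]
  have e2 : ∀ k, ∑ x, L x k * ∑ y, (∑ a, ∑ b, J k a * J i b * φ (curv D (cm Γ) a b x y)) * J j y
      = ∑ x, ∑ a, (L x k * J k a) * ∑ y, ∑ b, J i b * φ (curv D (cm Γ) a b x y) * J j y := by
    intro k
    refine sum_ext fun x => ?_
    simp only [sum_mul, mul_sum]
    rw [sum_comm]
    refine sum_ext₂ fun a y =>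
      sum_ext fun b => by ring
  simp only [e2]
  rw [sum_comm]
  have e3 : ∀ x, ∑ k, ∑ a, (L x k * J k a) * ∑ y, ∑ b, J i b * φ (curv D (cm Γ) a b x y) * J j y
      = ∑ y, ∑ b, J i b * φ (curv D (cm Γ) x b x y) * J j y := by
    intro x
    rw [sum_comm]
    simp only [← sum_mul, ← mul_apply, h.inv', one_apply, ite_mul, one_mul,
      zero_mul, sum_ite_eq, Finset.mem_univ, if_true]
  simp only [e3]
  simp only [mul_sum]
  rw [Finset.sum_comm_cycle]
  refine sum_ext fun a => ?_
  rw [sum_comm]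
  exact sum_ext₂ fun b c => by ring

lemma tw_map (f : P) (i : ι) : tw D' q' 1 i (φ f) = ∑ a, J i a * φ (tw D q 1 a f) := by
  simp only [tw, h.der, h.twist, map_add, map_mul, one_mul, mul_add, sum_add_distrib,
    sum_mul, mul_assoc]

lemma sum_inv (W v : ι → P') : ∑ k, (∑ b, L b k * W b) * ∑ y, J k y * v y = ∑ b, W b * v b := by
  have e : ∀ b y, ∑ k, L b k * W b * (J k y * v y) = if b = y then W b * v y else 0 := by
    intro b y
    have := congrFun (congrFun h.inv' b) y
    rw [mul_apply, one_apply] at this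
    rw [show (if b = y then W b * v y else 0) = (if b = y then 1 else 0) * (W b * v y) by
      split_ifs <;> simp, ← this, sum_mul]
    exact sum_ext fun k => by ring
  simp only [Finset.sum_mul_sum]
  rw [sum_comm]
  refine sum_ext fun b => ?_
  rw [sum_comm]
  simp only [e, sum_ite_eq, Finset.mem_univ, if_true]

lemma hessA_pullConn (f : P) (i j : ι) :
    hessA D' q' (pullConn φ D' J L Γ) (φ f) i j = pullTensor φ J (hessA D q Γ f) i j := by
  simp only [hessA, h.tw_map]
  have e1 : ∑ k, pullConn φ D' J L Γ k i j * ∑ a, J k a * φ (tw D q 1 a f)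
      = ∑ b, D' i (J j b) * φ (tw D q 1 b f)
        + ∑ a, ∑ c, J i a * J j c * φ (∑ b, Γ b a c * tw D q 1 b f) := by
    simp only [pullConn]
    rw [h.sum_inv]
    simp only [add_mul, sum_add_distrib, sum_mul, map_sum, map_mul, mul_sum]
    congr 1
    rw [sum_comm]
    refine sum_ext fun a => ?_
    rw [sum_comm]
    exact sum_ext₂ fun b c => by ring
  have e2 : tw D' q' 1 i (∑ a, J j a * φ (tw D q 1 a f))
      = ∑ b, D' i (J j b) * φ (tw D q 1 b f)
        + ∑ a, ∑ b, J i a * J j b * φ (tw D q 1 a (tw D q 1 b f)) := by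
    have e3 : ∀ a b, J i a * J j b * φ (tw D q 1 a (tw D q 1 b f))
        = J j b * (J i a * φ (D a (tw D q 1 b f)))
          + (J i a * φ (q a)) * (J j b * φ (tw D q 1 b f)) := by
      intro a b
      rw [tw, map_add, map_mul, map_mul, map_one]; ring
    simp only [e3, sum_add_distrib, ← mul_sum, ← sum_mul, ← h.twist]
    rw [tw, map_sum]
    simp only [Derivation.leibniz, smul_eq_mul, h.der, sum_add_distrib, mul_sum]
    rw [sum_comm (f := fun b a => J j b * (J i a * φ (D a (tw D q 1 b f))))]
    simp only [mul_comm (φ _) (D' i _), one_mul, ← mul_sum]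
    ring
  rw [e1, e2]
  simp only [pullTensor, hessA, map_sub, mul_sub, sum_sub_distrib]
  ring

lemma trA_pullTensor (T : ι → ι → P) :
    trA (L.transpose * K.map φ * L) (pullTensor φ J T) = φ (trA K T) := by
  have e1 : ∀ A B : Matrix ι ι P', trA A B = Matrix.trace (A * B.transpose) := by
    intro A B; rfl
  have e2 : pullTensor φ J T = J * (Matrix.of T).map φ * J.transpose := by
    ext i j
    rw [mul_pullTensor_mul]; rfl
  rw [e2, e1, transpose_mul, transpose_mul, Matrix.transpose_transpose]
  have e3 : L.transpose * K.map φ * L * (J * (((Matrix.of T).map φ).transpose * J.transpose))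
      = L.transpose * (K.map φ * (L * J) * ((Matrix.of T).map φ).transpose * J.transpose) := by
    noncomm_ring
  rw [e3, h.inv', mul_one, Matrix.trace_mul_comm, mul_assoc, mul_assoc, h.tr_inv', mul_one]
  simp [Matrix.trace, mul_apply, trA]

lemma baseA_pullConn (N f ψ : P) (i j : ι) : baseA D' q' (φ N) (pullConn φ D' J L Γ) (φ f) (φ ψ) i j
      = pullTensor φ J (baseA D q N Γ f ψ) i j := by
  simp only [baseA, h.ricA_pullConn, h.hessA_pullConn, pullTensor, map_sub, mul_sub,
    sum_sub_distrib, mul_sum, map_mul]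
  congr 1
  exact sum_ext₂ fun _ _ => by ring

lemma fibreA_pullConn (N f : P) :
    fibreA D' q' (φ N) (L.transpose * K.map φ * L) (pullConn φ D' J L Γ) (φ f)
      = φ (fibreA D q N K Γ f) := by
  have e1 : hessA D' q' (pullConn φ D' J L Γ) (φ f) = pullTensor φ J (hessA D q Γ f) := by
    funext i j; exact h.hessA_pullConn f i j
  have e2 : (fun i j => tw D' q' 1 i (φ f) * tw D' q' 1 j (φ f))
      = pullTensor φ J fun i j => tw D q 1 i f * tw D q 1 j f := by
    funext i j
    rw [h.tw_map, h.tw_map, Finset.sum_mul_sum]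
    exact sum_ext₂ fun _ _ => by rw [map_mul]; ring
  rw [fibreA, e1, e2, h.trA_pullTensor, h.trA_pullTensor, fibreA]
  simp only [map_add, map_mul, map_sub, map_one]

end

end FrameMap

end FrameChange

section FrameCorollaries

variable {P' : Type*} [CommRing P'] [Algebra ℝ P']
variable {φ : P →+* P'} {D' : ι → Der P'} {q' : ι → P'} {J L : Matrix ι ι P'}

namespace FrameMap

lemma mul_inv (h : FrameMap φ D q D' q' J L) (hK : G * K = 1) :
    (J * G.map φ * J.transpose) * (L.transpose * K.map φ * L) = 1 := by
  have e : G.map φ * K.map φ = 1 := by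
    rw [← Matrix.map_mul, hK]; ext i j; simp [one_apply, apply_ite φ]
  calc (J * G.map φ * J.transpose) * (L.transpose * K.map φ * L)
      = J * G.map φ * (J.transpose * L.transpose) * K.map φ * L := by noncomm_ring
    _ = J * (G.map φ * K.map φ) * L := by rw [h.tr_inv', mul_one]; noncomm_ring
    _ = 1 := by rw [e, mul_one, h.inv]

lemma chr_eq (h : FrameMap φ D q D' q' J L) (hG : ∀ i j, G i j = G j i) (hK : G * K = 1) :
    chr D' q' (J * G.map φ * J.transpose) (L.transpose * K.map φ * L)
      = pullConn φ D' J L (chr D q G K) :=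
  (h.isLeviCivita (isLeviCivita_chr hG hK)).eq_chr.symm

lemma baseA_chr (h : FrameMap φ D q D' q' J L) (hG : ∀ i j, G i j = G j i) (hK : G * K = 1)
    (N f ψ : P) (i j : ι) :
    baseA D' q' (φ N) (chr D' q' (J * G.map φ * J.transpose) (L.transpose * K.map φ * L))
      (φ f) (φ ψ) i j = pullTensor φ J (baseA D q N (chr D q G K) f ψ) i j := by
  rw [h.chr_eq hG hK, h.baseA_pullConn]

lemma fibreA_chr (h : FrameMap φ D q D' q' J L) (hG : ∀ i j, G i j = G j i) (hK : G * K = 1)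
    (N f : P) : fibreA D' q' (φ N) (L.transpose * K.map φ * L)
      (chr D' q' (J * G.map φ * J.transpose) (L.transpose * K.map φ * L)) (φ f)
      = φ (fibreA D q N K (chr D q G K) f) := by rw [h.chr_eq hG hK, h.fibreA_pullConn]

lemma of_commute (hd : ∀ i x, D' i (φ x) = φ (D i x)) (hq : ∀ i, q' i = φ (q i))
    (hD : ∀ i j x, D i (D j x) = D j (D i x)) (hD' : ∀ i j x, D' i (D' j x) = D' j (D' i x)) :
    FrameMap φ D q D' q' 1 1 where
  der i x := by simp [hd, one_apply]
  closed i j a := by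
    simp only [one_apply, apply_ite (D' _), Derivation.map_one_eq_zero, map_zero, ite_self]
  inv := one_mul _
  twist i := by simp [hq, one_apply]
  comm := hD
  comm' := hD'

lemma pullTensor_one (T : ι → ι → P) (i j : ι) : pullTensor φ 1 T i j = φ (T i j) := by
  simp [pullTensor, one_apply]

lemma baseA_map (h : FrameMap φ D q D' q' 1 1) (hG : ∀ i j, G i j = G j i) (hK : G * K = 1)
    (N f ψ : P) (i j : ι) : baseA D' q' (φ N) (chr D' q' (G.map φ) (K.map φ)) (φ f) (φ ψ) i j
      = φ (baseA D q N (chr D q G K) f ψ i j) := by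
  have := h.baseA_chr hG hK N f ψ i j
  simpa only [one_mul, mul_one, transpose_one, pullTensor_one] using this

lemma fibreA_map (h : FrameMap φ D q D' q' 1 1) (hG : ∀ i j, G i j = G j i) (hK : G * K = 1)
    (N f : P) : fibreA D' q' (φ N) (K.map φ) (chr D' q' (G.map φ) (K.map φ)) (φ f)
      = φ (fibreA D q N K (chr D q G K) f) := by
  have := h.fibreA_chr hG hK N f
  simpa only [one_mul, mul_one, transpose_one] using this

end FrameMap

section Rescale

variable {τ σ : P} (hτ : ∀ i, D i τ = q i * τ) (hσ : τ * σ = 1)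

include hτ

lemma tw_rescale_two (i : ι) (x : P) : tw D 0 2 i (τ ^ 2 * x) = τ ^ 2 * tw D q 2 i x := by
  simp only [tw, Derivation.leibniz, Derivation.leibniz_pow, smul_eq_mul, hτ, Pi.zero_apply,
    nsmul_eq_mul, Nat.cast_ofNat]
  ring

lemma tw_rescale_one (i : ι) (x : P) : tw D 0 1 i (τ * x) = τ * tw D q 1 i x := by
  simp only [tw, Derivation.leibniz, smul_eq_mul, hτ, Pi.zero_apply]
  ring

lemma lowChr_rescale (l i j : ι) : lowChr D 0 (τ ^ 2 • G) l i j = τ ^ 2 * lowChr D q G l i j := by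
  simp only [lowChr, Matrix.smul_apply, smul_eq_mul, tw_rescale_two hτ]
  ring

include hσ

lemma chr_rescale : chr D 0 (τ ^ 2 • G) (σ ^ 2 • K) = chr D q G K := by
  funext k i j
  simp only [chr, lowChr_rescale hτ, Matrix.smul_apply, smul_eq_mul]
  refine sum_ext fun l => ?_
  linear_combination (K k l * lowChr D q G l i j * (τ * σ + 1)) * hσ

omit hσ in
lemma hessA_rescale (Γ : ι → ι → ι → P) (f : P) (i j : ι) :
    hessA D 0 Γ (τ * f) i j = τ * hessA D q Γ f i j := by
  simp only [hessA, tw_rescale_one hτ, mul_sub, mul_sum]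
  congr 1
  exact sum_ext fun _ => by ring

lemma baseA_rescale (N f ψ : P) (i j : ι) :
    baseA D 0 N (chr D 0 (τ ^ 2 • G) (σ ^ 2 • K)) (τ * f) (σ * ψ) i j
      = baseA D q N (chr D q G K) f ψ i j := by
  rw [chr_rescale hτ hσ, baseA, hessA_rescale hτ, baseA]
  linear_combination (-N * ψ * hessA D q (chr D q G K) f i j) * hσ

lemma fibreA_rescale (N f : P) : fibreA D 0 N (σ ^ 2 • K) (chr D 0 (τ ^ 2 • G) (σ ^ 2 • K)) (τ * f)
      = fibreA D q N K (chr D q G K) f := by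
  have h1 : ∀ T : ι → ι → P, ∀ c, trA (σ ^ 2 • K) (fun i j => c * T i j)
      = σ ^ 2 * c * trA K T := by
    intro T c
    simp only [trA, Matrix.smul_apply, smul_eq_mul, mul_sum]
    exact sum_ext₂ fun _ _ => by ring
  have e1 : hessA D 0 (chr D q G K) (τ * f) = fun i j => τ * hessA D q (chr D q G K) f i j := by
    funext i j; exact hessA_rescale hτ _ f i j
  have e2 : (fun i j => tw D 0 1 i (τ * f) * tw D 0 1 j (τ * f))
      = fun i j => τ ^ 2 * (tw D q 1 i f * tw D q 1 j f) := by
    funext i j; rw [tw_rescale_one hτ, tw_rescale_one hτ]; ring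
  rw [chr_rescale hτ hσ, fibreA, e1, e2, h1, h1, fibreA]
  linear_combination ((f * trA K (hessA D q (chr D q G K) f)
    + (N - 1) * trA K fun i j => tw D q 1 i f * tw D q 1 j f) * (τ * σ + 1)) * hσ

end Rescale

end FrameCorollaries

end

section
open PowerSeries
variable {R : Type*} [CommRing R] [Algebra ℝ R] {d : ℕ} {δ : Fin d → Der R}
  {g₀ k₀ : Mat d R} {A : Fin d → R⟦X⟧} {G K G' K' : AMat d R⟦X⟧} {f φ f' φ' : R⟦X⟧} {N : R} {n : ℕ}

section

/-- The coefficientwise extension of a derivation to power series. -/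
def serD (δ : Der R) : Der R⟦X⟧ :=
  Derivation.mk' 
    { toFun := fun f => PowerSeries.mk fun n => δ (coeff n f)
      map_add' := fun f g => by ext n; simp
      map_smul' := fun c f => by ext n; simp }
    (fun f g => by
      ext n
      simp only [LinearMap.coe_mk, AddHom.coe_mk, coeff_mk, coeff_mul, map_sum, smul_eq_mul,
        Derivation.leibniz, map_add]
      rw [sum_add_distrib]
      congr 1
      rw [← Finset.Nat.sum_antidiagonal_swap]
      rfl)

@[simp]
lemma coeff_serD (δ : Der R) (n : ℕ) (f : R⟦X⟧) :
    coeff n (serD δ f) = δ (coeff n f) := by simp [serD, Derivation.mk']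

@[simp]
lemma constantCoeff_serD (δ : Der R) (f : R⟦X⟧) :
    constantCoeff (serD δ f) = δ (constantCoeff f) := by
  rw [← coeff_zero, coeff_serD, coeff_zero]

variable (R) in
/-- The formal derivative, as a derivation over the reals. -/
def serX : Der R⟦X⟧ := (PowerSeries.derivative R).restrictScalars ℝ

@[simp]
lemma coeff_serX (n : ℕ) (f : R⟦X⟧) : coeff n (serX R f) = (n + 1) * coeff (n + 1) f := by
  rw [mul_comm]; exact coeff_derivative f n

@[simp]
lemma constantCoeff_serX (f : R⟦X⟧) : constantCoeff (serX R f) = coeff 1 f := by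
  rw [← coeff_zero, coeff_serX]; simp

/-- The power series `f` begins in degree at least `k`. -/
def HasOrd (k : ℕ) (f : R⟦X⟧) : Prop := ∀ j < k, coeff j f = 0

lemma hasOrd_iff_dvd {k : ℕ} {f : R⟦X⟧} : HasOrd k f ↔ X ^ k ∣ f := X_pow_dvd_iff.symm

namespace HasOrd

variable {k l : ℕ} {g : R⟦X⟧}

lemma of_zero : HasOrd 0 f := fun _ h => absurd h (Nat.not_lt_zero _)

lemma zero : HasOrd k (0 : R⟦X⟧) := fun _ _ => by simp

lemma mono (h : HasOrd k f) (hl : l ≤ k) : HasOrd l f := fun j hj => h j (hj.trans_le hl)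

lemma add (hf : HasOrd k f) (hg : HasOrd k g) : HasOrd k (f + g) := fun j hj => by
  rw [map_add, hf j hj, hg j hj, add_zero]

lemma sub (hf : HasOrd k f) (hg : HasOrd k g) : HasOrd k (f - g) := fun j hj => by
  rw [map_sub, hf j hj, hg j hj, sub_zero]

lemma neg (hf : HasOrd k f) : HasOrd k (-f) := fun j hj => by rw [map_neg, hf j hj, neg_zero]

lemma sum {α : Type*} {s : Finset α} {F : α → R⟦X⟧} (h : ∀ a ∈ s, HasOrd k (F a)) :
    HasOrd k (∑ a ∈ s, F a) := fun j hj => by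
  rw [map_sum]; exact sum_eq_zero fun a ha => h a ha j hj

lemma mul (hf : HasOrd k f) (hg : HasOrd l g) : HasOrd (k + l) (f * g) := by
  rw [hasOrd_iff_dvd] at *
  rw [pow_add]; exact mul_dvd_mul hf hg

lemma mul_left (hf : HasOrd k f) (g : R⟦X⟧) : HasOrd k (g * f) := by
  simpa using (of_zero (f := g)).mul hf

lemma mul_right (hf : HasOrd k f) (g : R⟦X⟧) : HasOrd k (f * g) := by
  simpa using hf.mul (of_zero (f := g))

lemma X_pow_mul (m : ℕ) (f : R⟦X⟧) : HasOrd m (X ^ m * f) :=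
  hasOrd_iff_dvd.2 (dvd_mul_right _ _)

lemma exists_eq (h : HasOrd k f) : ∃ g, f = X ^ k * g := hasOrd_iff_dvd.1 h

lemma succ (h : HasOrd k f) (h' : coeff k f = 0) : HasOrd (k + 1) f := fun j hj => by
  rcases Nat.lt_succ_iff_lt_or_eq.1 hj with h1 | h1
  · exact h j h1
  · rw [h1, h']

lemma one (h' : constantCoeff f = 0) : HasOrd 1 f := by
  refine of_zero.succ ?_
  rwa [coeff_zero]

lemma constantCoeff_eq (h : HasOrd k f) (hk : 0 < k) : constantCoeff f = 0 := by
  rw [← coeff_zero]; exact h 0 hk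

lemma serD (h : HasOrd k f) (δ : Der R) : HasOrd k (serD δ f) := fun j hj => by
  rw [coeff_serD, h j hj, map_zero]

lemma serX (h : HasOrd (k + 1) f) : HasOrd k (serX R f) := fun j hj => by
  rw [coeff_serX, h (j + 1) (by omega), mul_zero]

lemma coeff_mul_left (h : HasOrd k f) (g : R⟦X⟧) :
    coeff k (g * f) = constantCoeff g * coeff k f := by
  obtain ⟨f', rfl⟩ := h.exists_eq
  have e : g * (X ^ k * f') = X ^ k * (g * f') := by ring
  rw [e]
  have := coeff_X_pow_mul (g * f') k 0
  have h2 := coeff_X_pow_mul f' k 0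
  rw [zero_add] at this h2
  rw [this, h2]; simp

lemma coeff_mul_right (h : HasOrd k f) (g : R⟦X⟧) :
    coeff k (f * g) = coeff k f * constantCoeff g := by rw [mul_comm, h.coeff_mul_left, mul_comm]

lemma coeff_succ_mul_left (h : HasOrd k f) (g : R⟦X⟧) :
    coeff (k + 1) (g * f) = constantCoeff g * coeff (k + 1) f + coeff 1 g * coeff k f := by
  obtain ⟨f', rfl⟩ := h.exists_eq
  have e : g * (X ^ k * f') = X ^ k * (g * f') := by ring
  rw [e]
  have h1 := coeff_X_pow_mul (g * f') k 1
  have h2 := coeff_X_pow_mul f' k 0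
  have h3 := coeff_X_pow_mul f' k 1
  rw [zero_add] at h2
  rw [add_comm] at h1 h3
  rw [h1, h2, h3, coeff_mul, Finset.Nat.antidiagonal_succ]
  simp

lemma coeff_succ_mul_right (h : HasOrd k f) (g : R⟦X⟧) :
    coeff (k + 1) (f * g) = coeff (k + 1) f * constantCoeff g + coeff k f * coeff 1 g := by
  rw [mul_comm, h.coeff_succ_mul_left]; ring

end HasOrd

lemma coeff_X_pow_mul_self (m : ℕ) (f : R⟦X⟧) : coeff m (X ^ m * f) = constantCoeff f := by
  have := coeff_X_pow_mul f m 0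
  rwa [zero_add, coeff_zero] at this

@[simp]
lemma constantCoeff_half : constantCoeff (half R⟦X⟧) = half R := by
  have h1 : half R⟦X⟧ = C (half R) := algebraMap_apply
  rw [h1, constantCoeff_C]

lemma coeff_half_mul (n : ℕ) (f : R⟦X⟧) : coeff n (half R⟦X⟧ * f) = half R * coeff n f := by
  have h1 : half R⟦X⟧ = C (half R) := algebraMap_apply
  rw [h1, coeff_C_mul]

/-- The index of the coordinate `t`. -/
abbrev zIdx (d : ℕ) : Idx d := inl ()

/-- The indices of the coordinates of `M`. -/
abbrev sIdx {d : ℕ} (i : Fin d) : Idx d := inr (inl i)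

notation "zI" => zIdx _

lemma sum_idx {A : Type*} [AddCommMonoid A] (F : Idx d → A) :
    ∑ i, F i = F zI + (∑ i, F (sIdx i) + F nI) := by simp [Fintype.sum_sum_type]

/-- The derivations `0, ∂_i, d/dX`. -/
def ambD (δ : Fin d → Der R) : Idx d → Der R⟦X⟧
  | inl _ => 0
  | inr (inl i) => serD (δ i)
  | inr (inr _) => serX R

/-- The twist of a homogeneous metric. -/
def ambQ (d : ℕ) (S : Type*) [CommRing S] : Idx d → S | inl _ => 1 | inr _ => 0

notation "chr[" δ "]" => chr (ambD δ) (ambQ _ _)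
notation "tw[" δ "]" => tw (ambD δ) (ambQ _ _)
notation "lowChr[" δ "]" => lowChr (ambD δ) (ambQ _ _)
notation "hess[" δ "]" => hessA (ambD δ) (ambQ _ _)
notation "base[" δ "]" => baseA (ambD δ) (ambQ _ _)
notation "fibre[" δ "]" => fibreA (ambD δ) (ambQ _ _)

section
variable (δ : Fin d → Der R)

lemma ambD_comm (hδ : ∀ i j x, δ i (δ j x) = δ j (δ i x)) (i j : Idx d) (x : R⟦X⟧) :
    ambD δ i (ambD δ j x) = ambD δ j (ambD δ i x) := by
  have h2 : ∀ (δ' : Der R) (n : ℕ) (y : R), δ' ((n + 1) * y) = (n + 1) * δ' y := by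
    intro δ' n y
    have : ((n : R) + 1) * y = (n + 1) • y := by simp [add_mul]
    rw [this, map_nsmul]; simp [add_mul]
  rcases i with i | i | i <;> rcases j with j | j | j <;> ext n <;>
    simp [ambD, hδ, h2]

lemma ambD_ambQ (i j : Idx d) : ambD δ i (ambQ d R⟦X⟧ j) = ambD δ j (ambQ d R⟦X⟧ i) := by
  rcases i with i | i | i <;> rcases j with j | j | j <;> simp [ambQ]

@[simp] lemma tw_z (w x : R⟦X⟧) : tw[δ] w zI x = w * x := by simp [tw, ambD, ambQ]
@[simp] lemma tw_s (w x : R⟦X⟧) (i : Fin d) : tw[δ] w (sIdx i) x = serD (δ i) x := by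
  simp [tw, ambD, ambQ]
@[simp] lemma tw_i (w x : R⟦X⟧) : tw[δ] w nI x = serX R x := by simp [tw, ambD, ambQ]

end

/-- The metric `G`, with inverse `K`, has the form prescribed by Weyl-normality. -/
structure Gauge (g₀ k₀ : Mat d R) (A : Fin d → R⟦X⟧)
    (G K : AMat d R⟦X⟧) : Prop where
  symm : ∀ i j, G i j = G j i
  inv : G * K = 1
  ii : G nI nI = 0
  zi : G zI nI = 1
  si : ∀ i, G (sIdx i) nI = A i
  zz : constantCoeff (G zI zI) = 0
  zs : ∀ i, constantCoeff (G zI (sIdx i)) = 0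
  ss : ∀ i j, constantCoeff (G (sIdx i) (sIdx j)) = g₀ i j
  inv₀ : g₀ * k₀ = 1

namespace Gauge

variable (h : Gauge g₀ k₀ A G K)

include h

lemma lc : IsLeviCivita (ambD δ) (ambQ d R⟦X⟧) G K (chr[δ] G K) :=
  isLeviCivita_chr h.symm h.inv

lemma symmK (i j) : K i j = K j i :=
  (isLeviCivita_chr (D := fun _ => 0) (q := fun _ => 0) h.symm h.inv).symmK i j

lemma iz : G nI zI = 1 := by rw [h.symm, h.zi]
lemma is (i) : G nI (sIdx i) = A i := by rw [h.symm, h.si]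
lemma sz (i) : constantCoeff (G (sIdx i) zI) = 0 := by rw [h.symm, h.zs]
lemma g₀_symm (i j) : g₀ i j = g₀ j i := by rw [← h.ss, h.symm, h.ss]

lemma constantCoeff_K_inf (j : Idx d) : constantCoeff (K nI j) = if zIdx d = j then 1 else 0 := by
  have e := congrArg constantCoeff (congrFun (congrFun h.inv zI) j)
  rw [mul_apply, sum_idx, one_apply] at e
  simp only [map_add, map_sum, map_mul, h.zz, h.zs, h.zi, zero_mul, sum_const_zero,
    one_mul, zero_add] at e
  rw [e]
  split_ifs <;> simp

lemma Kiz : constantCoeff (K nI zI) = 1 := by simp [h.constantCoeff_K_inf]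
lemma Kis (i) : constantCoeff (K nI (sIdx i)) = 0 := by simp [h.constantCoeff_K_inf]
lemma Kii : constantCoeff (K nI nI) = 0 := by simp [h.constantCoeff_K_inf]
lemma Kzi : constantCoeff (K zI nI) = 1 := by rw [h.symmK, h.Kiz]
lemma Ksi (i) : constantCoeff (K (sIdx i) nI) = 0 := by rw [h.symmK, h.Kis]

lemma inv₀' : k₀ * g₀ = 1 := by
  have := h.inv₀
  rwa [mul_eq_one_comm] at this

lemma Kss (i j) : constantCoeff (K (sIdx i) (sIdx j)) = k₀ i j := by
  set B : Mat d R := Matrix.of fun i j => constantCoeff (K (sIdx i) (sIdx j))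
    with hB
  have e : g₀ * B = 1 := by
    ext a b
    have e := congrArg constantCoeff (congrFun (congrFun h.inv (sIdx a)) (sIdx b))
    rw [mul_apply, sum_idx] at e
    simp only [map_add, map_sum, map_mul, h.sz, h.ss, h.si, h.Kis, zero_mul, mul_zero, add_zero,
      zero_add] at e
    rw [mul_apply]
    simp only [hB, of_apply, e, one_apply, Sum.inr.injEq, Sum.inl.injEq]
    split_ifs <;> simp
  have : B = k₀ := by
    calc B = k₀ * g₀ * B := by rw [h.inv₀', one_mul]
      _ = k₀ := by rw [mul_assoc, e, mul_one]
  rw [← this]; rfl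

lemma k₀_symm (i j) : k₀ i j = k₀ j i := by rw [← h.Kss, h.symmK, h.Kss]

lemma coeff_one_Kii : coeff 1 (K nI nI) = -coeff 1 (G zI zI) := by
  have e := congrArg (coeff 1) (congrFun (congrFun h.inv zI) nI)
  rw [mul_apply, sum_idx] at e
  have a1 := (HasOrd.one h.zz).coeff_mul_right (K zI nI)
  have a2 : ∀ i, coeff 1 (G zI (sIdx i) * K (sIdx i) nI) = 0 := fun i => by
    rw [(HasOrd.one (h.zs i)).coeff_mul_right, h.Ksi, mul_zero]
  simp only [map_add, map_sum, a1, a2, h.zi, one_mul, h.Kzi, mul_one, sum_const_zero, zero_add] at e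
  rw [Matrix.one_apply_ne (by simp), map_zero] at e
  linear_combination e

lemma constantCoeff_chr_inf (i j) : constantCoeff (chr[δ] G K nI i j)
      = constantCoeff (lowChr[δ] G zI i j) := by simp [chr, h.Kiz, h.Kis, h.Kii]

lemma c_izz : constantCoeff (chr[δ] G K nI zI zI) = 0 := by
  rw [h.constantCoeff_chr_inf]; simp [lowChr, h.zz]

lemma c_izs (i) : constantCoeff (chr[δ] G K nI zI (sIdx i)) = 0 := by
  rw [h.constantCoeff_chr_inf]; simp [lowChr, h.zz, h.zs, h.sz]

lemma c_isz (i) : constantCoeff (chr[δ] G K nI (sIdx i) zI) = 0 := by rw [(h.lc).symm, h.c_izs]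

lemma c_iss (i j) : constantCoeff (chr[δ] G K nI (sIdx i) (sIdx j)) = -g₀ i j := by
  rw [h.constantCoeff_chr_inf]
  simp only [lowChr, tw_s, tw_z, map_mul, map_sub, map_add, constantCoeff_serD, h.sz, h.ss,
    constantCoeff_half, map_zero, map_ofNat]
  linear_combination (-g₀ i j) * two_mul_half (P := R)

lemma c_iiz : constantCoeff (chr[δ] G K nI nI zI) = half R * coeff 1 (G zI zI) := by
  rw [h.constantCoeff_chr_inf]; simp [lowChr, h.iz]

lemma c_izi : constantCoeff (chr[δ] G K nI zI nI)
    = half R * coeff 1 (G zI zI) := by rw [(h.lc).symm, h.c_iiz]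

lemma c_lzz : constantCoeff (lowChr[δ] G nI zI zI) = 2 - half R * coeff 1 (G zI zI) := by
  simp only [lowChr, tw_z, tw_i, h.zi, map_mul, map_sub, map_add, constantCoeff_serX,
    constantCoeff_half, map_ofNat, map_one]
  linear_combination 2 * two_mul_half (P := R)

lemma c_zzz : constantCoeff (chr[δ] G K zI zI zI) = 2 - half R * coeff 1 (G zI zI) := by
  have e1 : constantCoeff (lowChr[δ] G zI zI zI) = 0 := by simp [lowChr, h.zz]
  have e2 : ∀ i, constantCoeff
      (lowChr[δ] G (sIdx i) zI zI) = 0 := fun i => by simp [lowChr, h.zz, h.zs]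
  rw [chr, sum_idx]
  simp only [map_add, map_sum, map_mul, e1, e2, h.c_lzz, h.Kzi, mul_zero, sum_const_zero,
    zero_add, one_mul]

lemma c_szz (i) : constantCoeff (chr[δ] G K (sIdx i) zI zI) = 0 := by
  have e1 : constantCoeff (lowChr[δ] G zI zI zI) = 0 := by simp [lowChr, h.zz]
  have e2 : ∀ i, constantCoeff
      (lowChr[δ] G (sIdx i) zI zI) = 0 := fun i => by simp [lowChr, h.zz, h.zs]
  rw [chr, sum_idx]
  simp only [map_add, map_sum, map_mul, e1, e2, h.Ksi, mul_zero, sum_const_zero, zero_add, zero_mul]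

lemma c_szs (k i) : constantCoeff (chr[δ] G K (sIdx k) zI (sIdx i)) = if k = i then 1 else 0 := by
  have e1 : constantCoeff (lowChr[δ] G zI zI (sIdx i)) = 0 := by simp [lowChr, h.zz, h.zs, h.sz]
  have e2 : ∀ j, constantCoeff
      (lowChr[δ] G (sIdx j) zI (sIdx i)) = g₀ j i := fun j => by
    simp only [lowChr, tw_s, tw_z, map_mul, map_sub, map_add, constantCoeff_serD, h.zs, h.ss,
      constantCoeff_half, map_zero, map_ofNat]
    rw [h.g₀_symm i j]
    linear_combination (g₀ j i) * two_mul_half (P := R)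
  rw [chr, sum_idx]
  simp only [map_add, map_sum, map_mul, e1, e2, h.Ksi, h.Kss, mul_zero, zero_add, zero_mul,
    add_zero]
  have := congrFun (congrFun h.inv₀' k) i
  rwa [mul_apply, one_apply] at this

lemma c_ssz (k i) : constantCoeff (chr[δ] G K (sIdx k) (sIdx i) zI)
      = if k = i then 1 else 0 := by rw [(h.lc).symm, h.c_szs]

lemma c_trace : ∑ k, constantCoeff (chr[δ] G K k k zI) = d + 2 := by
  rw [sum_idx, h.c_zzz, h.c_iiz]
  simp only [h.c_ssz, if_true, Finset.sum_const, Finset.card_univ, Fintype.card_fin, nsmul_eq_mul,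
    mul_one]
  ring

end Gauge

end

local notation "Γ₀" => chr[δ] G K
local notation "Γ₁" => chr[δ] G' K'

/-- The indicator of the index `∞`. -/
def eInf {d : ℕ} : Idx d → R | inr (inr _) => 1 | _ => 0

/-- Twisted derivatives of coefficients along tangential directions. -/
def tR (δ : Fin d → Der R) : Idx d → R → R
  | inl _, x => 2 * x | inr (inl i), x => δ i x
  | inr (inr _), _ => 0

lemma eInf_of_ne {i : Idx d} (h : i ≠ nI) : eInf (R := R) i = 0 := by
  rcases i with i | i | i
  · rfl
  · rfl
  · exact absurd rfl h

lemma HasOrd.tw {n : ℕ} {f : R⟦X⟧} (h : HasOrd (n + 1) f) (w : R⟦X⟧) (i : Idx d) :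
    HasOrd n (tw[δ] w i f) := by
  rcases i with i | i | i
  · rw [tw_z]; exact (h.mul_left _).mono (by omega)
  · rw [tw_s]; exact (h.serD _).mono (by omega)
  · rw [tw_i]; exact h.serX

lemma HasOrd.tw_of_ne {n : ℕ} {f : R⟦X⟧} (h : HasOrd n f) (w : R⟦X⟧) {i : Idx d}
    (hi : i ≠ nI) : HasOrd n (WeylAmbient.tw (ambD δ) (ambQ d R⟦X⟧) w i f) := by
  rcases i with i | i | i
  · rw [tw_z]; exact h.mul_left _
  · rw [tw_s]; exact h.serD _
  · exact absurd rfl hi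

lemma HasOrd.ambD {n : ℕ} {f : R⟦X⟧} (h : HasOrd (n + 1) f) (i : Idx d) :
    HasOrd n (ambD δ i f) := by
  rcases i with i | i | i
  · exact HasOrd.zero
  · exact (h.serD _).mono (by omega)
  · exact h.serX

lemma HasOrd.ambD_of_ne {n : ℕ} {f : R⟦X⟧} (h : HasOrd n f) {i : Idx d} (hi : i ≠ nI) :
    HasOrd n (WeylAmbient.ambD δ i f) := by
  rcases i with i | i | i
  · exact HasOrd.zero
  · exact h.serD _
  · exact absurd rfl hi

lemma coeff_tw {n : ℕ} {f : R⟦X⟧} (h : HasOrd (n + 1) f) (w : R⟦X⟧) (i : Idx d) :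
    coeff n (tw[δ] w i f) = eInf i * ((n + 1) * coeff (n + 1) f) := by
  rcases i with i | i | i
  · rw [tw_z, h.mul_left w n (by omega)]; simp [eInf]
  · rw [tw_s, h.serD _ n (by omega)]; simp [eInf]
  · rw [tw_i]; simp [eInf]

lemma coeff_tw_two {n : ℕ} {f : R⟦X⟧} {i : Idx d} (hi : i ≠ nI) :
    coeff n (tw[δ] 2 i f) = tR δ i (coeff n f) := by
  rcases i with i | i | i
  · have : (2 : R⟦X⟧) = C (2 : R) := (map_ofNat (C : R →+* R⟦X⟧) 2).symm
    rw [tw_z, this, coeff_C_mul]; rfl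
  · rw [tw_s]; simp [tR]
  · exact absurd rfl hi

/-- `G'` differs from `G` in degree at least `n + 1`, both metrics being in the same gauge. -/
structure Variation (g₀ k₀ : Mat d R) (A : Fin d → R⟦X⟧)
    (G K G' K' : AMat d R⟦X⟧) (n : ℕ) : Prop where
  g : Gauge g₀ k₀ A G K
  g' : Gauge g₀ k₀ A G' K'
  ord : ∀ i j, HasOrd (n + 1) (G' i j - G i j)

namespace Variation

variable (v : Variation g₀ k₀ A G K G' K' n)

variable (G G' n) in
/-- The leading coefficient of the variation. -/
def lead (i j : Idx d) : R := coeff (n + 1) (G' i j - G i j)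

variable (G G' K' n) in
/-- The leading coefficient with an index raised. -/
def up (k j : Idx d) : R := ∑ l, constantCoeff (K' k l) * lead G G' n j l

include v

lemma lead_symm (i j) : lead G G' n i j = lead G G' n j i := by
  rw [lead, v.g.symm i j, v.g'.symm i j]; rfl

lemma lead_inf (i) : lead G G' n i nI = 0 := by
  rcases i with i | i | i
  · rw [lead, v.g.zi, v.g'.zi, sub_self, map_zero]
  · rw [lead, v.g.si, v.g'.si, sub_self, map_zero]
  · rw [lead, v.g.ii, v.g'.ii, sub_self, map_zero]

lemma up_inf_left (j) : up G G' K' n nI j = lead G G' n j zI := by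
  simp [up, v.g'.constantCoeff_K_inf]

lemma up_inf_right (k) : up G G' K' n k nI = 0 := by
  simp only [up]
  exact sum_eq_zero fun l _ => by rw [v.lead_symm nI l, v.lead_inf, mul_zero]

lemma hasOrd_lowChr (l i j) : HasOrd n (lowChr[δ] (G' - G) l i j) := by
  rw [lowChr]
  exact ((((v.ord _ _).tw _ _).add ((v.ord _ _).tw _ _)).sub ((v.ord _ _).tw _ _)).mul_left _

lemma hasOrd_mul_chr (l i j) : HasOrd (n + 1) (∑ m, (G' - G) l m * Γ₀ m i j) :=
  HasOrd.sum fun _ _ => (v.ord _ _).mul_right _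

lemma hasOrd_aux (l i j) : HasOrd n (lowChr[δ] (G' - G) l i j - ∑ m, (G' - G) l m * Γ₀ m i j) :=
  (v.hasOrd_lowChr l i j).sub ((v.hasOrd_mul_chr l i j).mono (by omega))

lemma coeff_aux (l i j) : coeff n (lowChr[δ] (G' - G) l i j - ∑ m, (G' - G) l m * Γ₀ m i j)
    = half R * ((n + 1) * (eInf i * lead G G' n j l + eInf j * lead G G' n i l
      - eInf l * lead G G' n i j)) := by
  rw [map_sub, v.hasOrd_mul_chr l i j n (by omega), lowChr, coeff_half_mul]
  simp only [map_add, map_sub, Matrix.sub_apply, coeff_tw (v.ord _ _)]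
  simp only [lead, map_sub]
  ring

lemma hasOrd_chr (k i j) : HasOrd n ((Γ₁ - Γ₀) k i j) := by
  simp only [Pi.sub_apply, chr_sub_chr v.g.inv v.g'.inv]
  exact HasOrd.sum fun l _ => (v.hasOrd_aux l i j).mul_left _

lemma coeff_chr (k i j) : coeff n ((Γ₁ - Γ₀) k i j)
    = half R * ((n + 1) * (eInf i * up G G' K' n k j + eInf j * up G G' K' n k i
      - constantCoeff (K' k nI) * lead G G' n i j)) := by
  simp only [Pi.sub_apply, chr_sub_chr v.g.inv v.g'.inv, map_sum,
    (v.hasOrd_aux _ i j).coeff_mul_left, v.coeff_aux, up, mul_sum]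
  have : constantCoeff (K' k nI) * lead G G' n i j
      = ∑ l, constantCoeff (K' k l) * (eInf l * lead G G' n i j) := by rw [sum_idx]; simp [eInf]
  rw [this, ← sum_add_distrib, ← sum_sub_distrib, mul_sum, mul_sum]
  exact sum_ext fun l => by ring

lemma coeff_succ_chr_inf {i j} (hi : i ≠ nI) (hj : j ≠ nI) : coeff (n + 1) ((Γ₁ - Γ₀) nI i j)
      = half R * (tR δ i (lead G G' n j zI) + tR δ j (lead G G' n i zI) - 2 * lead G G' n i j)
        - ∑ m, lead G G' n zI m * constantCoeff (Γ₀ m i j)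
        + half R * (n + 1) * coeff 1 (G' zI zI) * lead G G' n i j := by
  simp only [Pi.sub_apply, chr_sub_chr v.g.inv v.g'.inv, map_sum,
    (v.hasOrd_aux _ i j).coeff_succ_mul_left, v.coeff_aux, eInf_of_ne hi, eInf_of_ne hj,
    v.g'.constantCoeff_K_inf]
  rw [sum_idx]
  simp only [eInf, v.g'.coeff_one_Kii]
  have e1 : coeff (n + 1) (lowChr[δ] (G' - G) zI i j)
      = half R * (tR δ i (lead G G' n j zI) + tR δ j (lead G G' n i zI) - 2 * lead G G' n i j) := by
    rw [lowChr, coeff_half_mul, map_sub, map_add, coeff_tw_two hi, coeff_tw_two hj,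
      coeff_tw_two (by simp)]
    rfl
  have e2 : coeff (n + 1) (∑ m, (G' - G) zI m * Γ₀ m i j)
      = ∑ m, lead G G' n zI m * constantCoeff (Γ₀ m i j) := by
    rw [map_sum]
    exact sum_ext fun m => (v.ord _ _).coeff_mul_right _
  simp only [map_sub, e1, e2, if_true, reduceCtorEq, if_false]
  simp only [zero_mul, mul_zero, add_zero, sub_zero, zero_add, zero_sub, one_mul, sum_const_zero]
  ring

lemma sum_coeff_chr (l) : ∑ k, coeff n ((Γ₁ - Γ₀) k k l)
    = half R * ((n + 1) * (eInf l * ∑ k, up G G' K' n k k)) := by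
  simp only [v.coeff_chr, ← mul_sum, sum_sub_distrib, sum_add_distrib]
  have e1 : ∑ k, eInf k * up G G' K' n k l = lead G G' n l zI := by
    rw [sum_idx]; simp [eInf, v.up_inf_left]
  have e2 : ∑ k, constantCoeff (K' k nI) * lead G G' n k l
      = lead G G' n l zI := by simp [v.g'.symmK _ nI, v.g'.constantCoeff_K_inf, v.lead_symm l]
  rw [e1, e2]; ring

lemma hasOrd_ricA {i j} (hi : i ≠ nI) (hj : j ≠ nI) :
    HasOrd n (ricA (ambD δ) Γ₁ i j - ricA (ambD δ) Γ₀ i j) := by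
  rw [ricA_sub_ricA]
  have h1 : HasOrd n (∑ k, ambD δ k ((Γ₁ - Γ₀) k i j)) := by
    refine HasOrd.sum fun k _ => ?_
    by_cases hk : k = nI
    · subst hk
      refine HasOrd.ambD ((v.hasOrd_chr _ _ _).succ ?_) _
      rw [v.coeff_chr, eInf_of_ne hi, eInf_of_ne hj, v.g'.Kii]; simp
    · exact (v.hasOrd_chr _ _ _).ambD_of_ne hk
  have h2 : HasOrd n (ambD δ i (∑ k, (Γ₁ - Γ₀) k k j)) :=
    (HasOrd.sum fun k _ => v.hasOrd_chr _ _ _).ambD_of_ne hi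
  refine ((((h1.sub h2).add ?_).add ?_).sub ?_).sub ?_ <;>
    refine HasOrd.sum fun k _ => HasOrd.sum fun l _ => ?_
  · exact (v.hasOrd_chr _ _ _).mul_left _
  · exact (v.hasOrd_chr _ _ _).mul_right _
  · exact (v.hasOrd_chr _ _ _).mul_left _
  · exact (v.hasOrd_chr _ _ _).mul_right _

lemma coeff_ricA {i j} (hi : i ≠ nI) (hj : j ≠ nI) :
    coeff n (ricA (ambD δ) Γ₁ i j - ricA (ambD δ) Γ₀ i j)
      = (n + 1) * (half R * (tR δ i (lead G G' n j zI) + tR δ j (lead G G' n i zI)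
          - 2 * lead G G' n i j) - ∑ m, lead G G' n zI m * constantCoeff (Γ₀ m i j)
        + half R * (n + 1) * coeff 1 (G' zI zI) * lead G G' n i j)
        - half R * (n + 1) * (d + 2) * lead G G' n i j
        + half R * (n + 1) * (∑ k, up G G' K' n k k) * constantCoeff (Γ₁ nI i j)
        - half R * (n + 1) * (∑ l, constantCoeff (Γ₀ nI i l) * up G G' K' n l j
          - ∑ k, constantCoeff (Γ₀ k i zI) * lead G G' n k j)
        - half R * (n + 1) * (∑ k, up G G' K' n k i * constantCoeff (Γ₁ nI k j)
          - ∑ l, lead G G' n i l * constantCoeff (Γ₁ l zI j)) := by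
  have ei : eInf (R := R) i = 0 := eInf_of_ne hi
  have ej : eInf (R := R) j = 0 := eInf_of_ne hj
  have kz : ∀ k, constantCoeff (K' k nI) = if zIdx d = k then 1 else 0 := fun k => by
    rw [v.g'.symmK, v.g'.constantCoeff_K_inf]
  rw [ricA_sub_ricA]
  simp only [map_add, map_sub]
  have t1 : coeff n (∑ k, ambD δ k ((Γ₁ - Γ₀) k i j))
      = (n + 1) * coeff (n + 1) ((Γ₁ - Γ₀) nI i j) := by
    rw [map_sum, sum_idx]
    have a1 : ∀ k : Fin d, coeff n (ambD δ (sIdx k) ((Γ₁ - Γ₀) (sIdx k) i j)) = 0 := fun k => by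
      change coeff n (serD (δ k) _) = 0
      rw [coeff_serD, v.coeff_chr, ei, ej, v.g'.Ksi]; simp
    simp only [a1, sum_const_zero, zero_add]
    change coeff n (0 : R⟦X⟧) + coeff n (serX R _) = _
    rw [coeff_serX]; simp
  have t2 : coeff n (ambD δ i (∑ k, (Γ₁ - Γ₀) k k j)) = 0 := by
    have : HasOrd (n + 1) (∑ k, (Γ₁ - Γ₀) k k j) := by
      refine (HasOrd.sum fun k _ => v.hasOrd_chr _ _ _).succ ?_
      rw [map_sum, v.sum_coeff_chr, ej]; simp
    exact this.ambD_of_ne hi n (by omega)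
  have t3 : coeff n (∑ k, ∑ l, Γ₀ k k l * (Γ₁ - Γ₀) l i j)
      = -(half R * (n + 1) * (d + 2) * lead G G' n i j) := by
    simp only [map_sum, (v.hasOrd_chr _ _ _).coeff_mul_left, v.coeff_chr, ei, ej, kz]
    rw [sum_comm]
    simp only [← sum_mul]
    rw [Finset.sum_eq_single zI]
    · rw [v.g.c_trace]; simp; ring
    · intro b _ hb; simp [hb.symm]
    · simp
  have t4 : coeff n (∑ k, ∑ l, (Γ₁ - Γ₀) k k l * Γ₁ l i j)
      = half R * (n + 1) * (∑ k, up G G' K' n k k) * constantCoeff (Γ₁ nI i j) := by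
    simp only [map_sum, (v.hasOrd_chr _ _ _).coeff_mul_right]
    rw [sum_comm]
    simp only [← sum_mul, v.sum_coeff_chr]
    rw [sum_idx]
    simp only [eInf]
    simp only [zero_mul, mul_zero, sum_const_zero, zero_add, one_mul]
    ring
  have t5 : coeff n (∑ k, ∑ l, Γ₀ k i l * (Γ₁ - Γ₀) l k j)
      = half R * (n + 1) * (∑ l, constantCoeff (Γ₀ nI i l) * up G G' K' n l j
          - ∑ k, constantCoeff (Γ₀ k i zI) * lead G G' n k j) := by
    simp only [map_sum, (v.hasOrd_chr _ _ _).coeff_mul_left, v.coeff_chr, ej, kz]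
    have b1 : ∑ k, ∑ l, constantCoeff (Γ₀ k i l) * (eInf k * up G G' K' n l j)
        = ∑ l, constantCoeff (Γ₀ nI i l) * up G G' K' n l j := by rw [sum_idx]; simp [eInf]
    have b2 : ∑ k, ∑ l, constantCoeff (Γ₀ k i l) * ((if zIdx d = l then 1 else 0)
        * lead G G' n k j) = ∑ k, constantCoeff (Γ₀ k i zI) * lead G G' n k j := by
      refine sum_ext fun k => ?_
      simp
    rw [← b1, ← b2, ← sum_sub_distrib, mul_sum]
    refine sum_ext fun k => ?_
    rw [← sum_sub_distrib, mul_sum]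
    exact sum_ext fun l => by ring
  have t6 : coeff n (∑ k, ∑ l, (Γ₁ - Γ₀) k i l * Γ₁ l k j)
      = half R * (n + 1) * (∑ k, up G G' K' n k i * constantCoeff (Γ₁ nI k j)
          - ∑ l, lead G G' n i l * constantCoeff (Γ₁ l zI j)) := by
    simp only [map_sum, (v.hasOrd_chr _ _ _).coeff_mul_right, v.coeff_chr, ei, kz]
    have b1 : ∑ k, ∑ l, (eInf l * up G G' K' n k i) * constantCoeff (Γ₁ l k j)
        = ∑ k, up G G' K' n k i * constantCoeff (Γ₁ nI k j) := by
      refine sum_ext fun k => ?_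
      rw [sum_idx]; simp [eInf]
    have b2 : ∑ k, ∑ l, ((if zIdx d = k then 1 else 0) * lead G G' n i l)
        * constantCoeff (Γ₁ l k j) = ∑ l, lead G G' n i l * constantCoeff (Γ₁ l zI j) := by
      rw [sum_comm]
      refine sum_ext fun k => ?_
      simp
    rw [← b1, ← b2, ← sum_sub_distrib, mul_sum]
    refine sum_ext fun k => ?_
    rw [← sum_sub_distrib, mul_sum]
    exact sum_ext fun l => by ring
  rw [t1, t2, t3, t4, t5, t6, v.coeff_succ_chr_inf hi hj]
  ring

end Variation

section

lemma half_mul_two : half R * 2 = 1 := by rw [mul_comm, two_mul_half]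

section GaugeValues

variable (h : Gauge g₀ k₀ A G K)

include h

lemma Gauge.lower_raise (x : Fin d → R) (i : Fin d) : ∑ k, (∑ j, k₀ k j * x j) * g₀ k i = x i := by
  have e : ∀ j, ∑ k, k₀ k j * g₀ k i = if j = i then 1 else 0 := by
    intro j
    have := congrFun (congrFun h.inv₀' j) i
    rw [mul_apply, one_apply] at this
    rw [← this]
    exact sum_ext fun k => by rw [h.k₀_symm]
  simp only [sum_mul]
  rw [sum_comm]
  have : ∀ j, ∑ k, k₀ k j * x j * g₀ k i = (if j = i then 1 else 0) * x j := by
    intro j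
    rw [← e, sum_mul]
    exact sum_ext fun k => by ring
  simp only [this, ite_mul, one_mul, zero_mul, Finset.sum_ite_eq', Finset.mem_univ, if_true]

lemma Gauge.trace_one : ∑ i, ∑ j, k₀ i j * g₀ i j = d := by
  have e : ∀ i, ∑ j, k₀ i j * g₀ i j = 1 := by
    intro i
    have := congrFun (congrFun h.inv₀' i) i
    rw [mul_apply, Matrix.one_apply_eq] at this
    rw [← this]
    exact sum_ext fun k => by rw [h.g₀_symm]
  simp [e]

end GaugeValues

namespace Variation

variable (v : Variation g₀ k₀ A G K G' K' n)

section Hess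

variable (hf : constantCoeff f = 1) (hφ : f * φ = 1)

include v

lemma hasOrd_hessA (f : R⟦X⟧) (i j) : HasOrd n (hess[δ] Γ₁ f i j - hess[δ] Γ₀ f i j) := by
  rw [hessA_sub_hessA]
  exact (HasOrd.sum fun k _ => (v.hasOrd_chr _ _ _).mul_right _).neg

lemma hasOrd_base {i j} (hi : i ≠ nI) (hj : j ≠ nI) : HasOrd n (base[δ] (C N) Γ₁ f φ i j
      - base[δ] (C N) Γ₀ f φ i j) := by
  have e : base[δ] (C N) Γ₁ f φ i j
      - base[δ] (C N) Γ₀ f φ i j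
      = (ricA (ambD δ) Γ₁ i j - ricA (ambD δ) Γ₀ i j)
        - C N * φ * (hess[δ] Γ₁ f i j - hess[δ] Γ₀ f i j) := by simp only [baseA]; ring
  rw [e]
  exact (v.hasOrd_ricA hi hj).sub ((v.hasOrd_hessA f i j).mul_left _)

include hf hφ

lemma coeff_base {i j} (hi : i ≠ nI) (hj : j ≠ nI) : coeff n (base[δ] (C N) Γ₁ f φ i j
      - base[δ] (C N) Γ₀ f φ i j) = coeff n (ricA (ambD δ) Γ₁ i j - ricA (ambD δ) Γ₀ i j)
      - half R * (n + 1) * N * lead G G' n i j := by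
  have e : base[δ] (C N) Γ₁ f φ i j
      - base[δ] (C N) Γ₀ f φ i j
      = (ricA (ambD δ) Γ₁ i j - ricA (ambD δ) Γ₀ i j)
        - C N * φ * (hess[δ] Γ₁ f i j - hess[δ] Γ₀ f i j) := by simp only [baseA]; ring
  have hφ0 : constantCoeff φ = 1 := by
    have := congrArg constantCoeff hφ
    rwa [map_mul, hf, one_mul, map_one] at this
  rw [e, map_sub, (v.hasOrd_hessA f i j).coeff_mul_left, hessA_sub_hessA, map_neg, map_sum]
  simp only [(v.hasOrd_chr _ _ _).coeff_mul_right, v.coeff_chr, eInf_of_ne hi, eInf_of_ne hj,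
    v.g'.symmK _ nI, v.g'.constantCoeff_K_inf]
  rw [Finset.sum_eq_single zI]
  · simp only [tw_z, map_mul, constantCoeff_C, hφ0, hf, map_one]
    simp only [if_true]
    ring
  · intro b _ hb; simp [hb.symm]
  · simp

end Hess

section Up

include v

lemma up_sz (h0 : lead G G' n zI zI = 0) (k : Fin d) :
    up G G' K' n (sIdx k) zI = ∑ l, k₀ k l * lead G G' n zI (sIdx l) := by
  simp only [up, sum_idx, h0, v.lead_inf, v.g'.Kss, mul_zero, zero_add, add_zero]

lemma up_ss (h1 : ∀ i, lead G G' n zI (sIdx i) = 0) (k j : Fin d) :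
    up G G' K' n (sIdx k) (sIdx j) = ∑ l, k₀ k l * lead G G' n (sIdx j) (sIdx l) := by
  simp only [up, sum_idx, v.lead_symm _ zI, h1, v.lead_inf, v.g'.Kss, mul_zero, zero_add, add_zero]

lemma sum_up (h0 : lead G G' n zI zI = 0) (h1 : ∀ i, lead G G' n zI (sIdx i) = 0) :
    ∑ k, up G G' K' n k k = ∑ a, ∑ b, k₀ a b * lead G G' n (sIdx a) (sIdx b) := by
  rw [sum_idx, v.up_inf_right]
  simp only [v.up_ss h1]
  simp only [up, sum_idx, h0, h1, v.lead_inf, mul_zero, zero_add, add_zero, sum_const_zero]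

end Up

variable (hα : coeff 1 (G zI zI) = 2) (hα' : coeff 1 (G' zI zI) = 2)
variable (hf : constantCoeff f = 1) (hφ : f * φ = 1)

section Ricci

include v hα hα'

lemma coeff_ric_zz : coeff n (ricA (ambD δ) Γ₁ zI zI - ricA (ambD δ) Γ₀ zI zI)
    = (n + 1) * (n - half R * d) * lead G G' n zI zI := by
  rw [v.coeff_ricA (by simp) (by simp)]
  simp only [sum_idx, v.g.c_zzz, v.g'.c_zzz, v.g.c_szz, v.g'.c_szz, v.g.c_izz, v.g'.c_izz,
    v.g.c_izs, v.g'.c_isz, v.g.c_izi, v.g'.c_iiz, hα, hα', half_mul_two, v.up_inf_left,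
    mul_zero, zero_mul, sum_const_zero, zero_add, add_zero, tR]
  linear_combination ((n + 1) * lead G G' n zI zI * (n - 1 + 2)) * half_mul_two (R := R)

lemma coeff_ric_zs (h0 : lead G G' n zI zI = 0) (i : Fin d) :
    coeff n (ricA (ambD δ) Γ₁ zI (sIdx i) - ricA (ambD δ) Γ₀ zI (sIdx i))
    = (n + 1) * (n - half R * d) * lead G G' n zI (sIdx i) := by
  rw [v.coeff_ricA (by simp) (by simp)]
  simp only [sum_idx, v.g.c_zzz, v.g.c_szz, v.g.c_izz,
    v.g.c_izs, v.g'.c_izs, v.g.c_izi, hα, hα', half_mul_two,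
    v.g.c_szs, v.g'.c_szs, v.g'.c_iss, v.up_inf_left, v.lead_inf, h0,
    v.lead_symm _ zI, v.up_sz h0, mul_neg, sum_neg_distrib, v.g.lower_raise,
    v.lead_symm nI, map_zero,
    mul_zero, zero_mul, sum_const_zero, zero_add, add_zero, tR, mul_ite, mul_one,
    Finset.sum_ite_eq', Finset.mem_univ, if_true]
  linear_combination ((n + 1) * lead G G' n zI (sIdx i) * (n + 1)) * half_mul_two (R := R)

lemma coeff_ric_ss (h0 : lead G G' n zI zI = 0)
    (h1 : ∀ i, lead G G' n zI (sIdx i) = 0) (i j : Fin d) :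
    coeff n (ricA (ambD δ) Γ₁ (sIdx i) (sIdx j) - ricA (ambD δ) Γ₀ (sIdx i) (sIdx j))
    = (n + 1) * ((n + 1 - half R * d) * lead G G' n (sIdx i) (sIdx j)
      - half R * (∑ a, ∑ b, k₀ a b * lead G G' n (sIdx a) (sIdx b)) * g₀ i j) := by
  have e1 : ∑ l, g₀ i l * ∑ k, k₀ l k * lead G G' n (sIdx j) (sIdx k)
      = lead G G' n (sIdx i) (sIdx j) := by
    rw [v.lead_symm, ← v.g.lower_raise (fun k => lead G G' n (sIdx j) (sIdx k)) i]
    exact sum_ext fun l => by rw [v.g.g₀_symm]; ring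
  rw [v.coeff_ricA (by simp) (by simp), v.sum_up h0 h1]
  simp only [sum_idx, v.g'.c_izs, hα',
    v.g'.c_szs, v.g'.c_iss, v.g.c_iss, v.up_inf_left, v.lead_inf, h0, h1,
    v.g.c_isz, v.g.c_ssz, v.lead_symm _ zI,
    v.up_ss h1, mul_neg, neg_mul, sum_neg_distrib, v.g.lower_raise, e1,
    v.lead_symm nI, map_zero, ite_mul, one_mul,
    mul_zero, zero_mul, sum_const_zero, zero_add, add_zero, tR, mul_ite, mul_one,
    Finset.sum_ite_eq', Finset.mem_univ, if_true]
  linear_combination ((n + 1) * lead G G' n (sIdx i) (sIdx j) * (n + 1)) * half_mul_two (R := R)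

end Ricci

section Base

include v hα hα' hf hφ

lemma coeff_base_zz : coeff n (base[δ] (C N) Γ₁ f φ zI zI - base[δ] (C N) Γ₀ f φ zI zI)
    = (n + 1) * (n - half R * (d + N)) * lead G G' n zI zI := by
  rw [v.coeff_base hf hφ (by simp) (by simp), v.coeff_ric_zz hα hα']; ring

lemma coeff_base_zs (h0 : lead G G' n zI zI = 0) (i : Fin d) :
    coeff n (base[δ] (C N) Γ₁ f φ zI (sIdx i) - base[δ] (C N) Γ₀ f φ zI (sIdx i))
    = (n + 1) * (n - half R * (d + N)) * lead G G' n zI (sIdx i) := by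
  rw [v.coeff_base hf hφ (by simp) (by simp), v.coeff_ric_zs hα hα' h0]; ring

lemma coeff_base_ss (h0 : lead G G' n zI zI = 0)
    (h1 : ∀ i, lead G G' n zI (sIdx i) = 0) (i j : Fin d) :
    coeff n (base[δ] (C N) Γ₁ f φ (sIdx i) (sIdx j) - base[δ] (C N) Γ₀ f φ (sIdx i) (sIdx j))
    = (n + 1) * ((n + 1 - half R * (d + N)) * lead G G' n (sIdx i) (sIdx j)
      - half R * (∑ a, ∑ b, k₀ a b * lead G G' n (sIdx a) (sIdx b)) * g₀ i j) := by
  rw [v.coeff_base hf hφ (by simp) (by simp), v.coeff_ric_ss hα hα' h0 h1]; ring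

end Base

section Other

include v

lemma hasOrd_inv (i j) : HasOrd (n + 1) (K' i j - K i j) := by
  have hK : K' - K = K' * (G - G') * K := by
    have h1 : K' * G' = 1 := by
      have := v.g'.inv
      rwa [mul_eq_one_comm] at this
    rw [mul_sub, sub_mul, h1, mul_assoc, v.g.inv, mul_one, one_mul]
  rw [← Matrix.sub_apply, hK, mul_apply]
  refine HasOrd.sum fun l _ => HasOrd.mul_right ?_ _
  rw [mul_apply]
  refine HasOrd.sum fun m _ => HasOrd.mul_left ?_ _
  rw [Matrix.sub_apply, ← neg_sub]
  exact (v.ord _ _).neg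

lemma fibre_sub (N f : R⟦X⟧) : fibre[δ] N K' Γ₁ f - fibre[δ] N K Γ₀ f
    = f * ∑ i, ∑ j, K i j * (hess[δ] Γ₁ f i j - hess[δ] Γ₀ f i j)
      + (f * ∑ i, ∑ j, (K' i j - K i j) * hess[δ] Γ₁ f i j
        + (N - 1) * ∑ i, ∑ j, (K' i j - K i j) * (tw[δ] 1 i f * tw[δ] 1 j f)) := by
  simp only [fibreA, trA, mul_sub, sub_mul, sum_sub_distrib]
  ring

lemma hasOrd_fibre_aux (N f : R⟦X⟧) :
    HasOrd (n + 1) (f * ∑ i, ∑ j, (K' i j - K i j) * hess[δ] Γ₁ f i j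
        + (N - 1) * ∑ i, ∑ j, (K' i j - K i j) * (tw[δ] 1 i f * tw[δ] 1 j f)) := by
  refine (HasOrd.mul_left ?_ _).add (HasOrd.mul_left ?_ _) <;>
    exact HasOrd.sum fun i _ => HasOrd.sum fun j _ => (v.hasOrd_inv i j).mul_right _

lemma hasOrd_fibre (N f : R⟦X⟧) : HasOrd n (fibre[δ] N K' Γ₁ f - fibre[δ] N K Γ₀ f) := by
  rw [v.fibre_sub]
  refine HasOrd.add (HasOrd.mul_left ?_ _) ((v.hasOrd_fibre_aux N f).mono (by omega))
  exact HasOrd.sum fun i _ => HasOrd.sum fun j _ => (v.hasOrd_hessA f i j).mul_left _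

include hf in
lemma coeff_fibre (N : R⟦X⟧) (h0 : lead G G' n zI zI = 0) (h1 : ∀ i, lead G G' n zI (sIdx i) = 0) :
    coeff n (fibre[δ] N K' Γ₁ f - fibre[δ] N K Γ₀ f)
      = half R * (n + 1) * ∑ a, ∑ b, k₀ a b * lead G G' n (sIdx a) (sIdx b) := by
  have hh : ∀ i j, HasOrd n (hess[δ] Γ₁ f i j - hess[δ] Γ₀ f i j) := v.hasOrd_hessA f
  have o : HasOrd n (∑ i, ∑ j, K i j * (hess[δ] Γ₁ f i j - hess[δ] Γ₀ f i j)) :=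
    HasOrd.sum fun i _ => HasOrd.sum fun j _ => (hh i j).mul_left _
  rw [v.fibre_sub, map_add, v.hasOrd_fibre_aux N f n (by omega), add_zero,
    o.coeff_mul_left, hf, one_mul]
  have hz : up G G' K' n zI zI = 0 := by
    simp only [up, sum_idx, h0, h1, v.lead_inf, mul_zero, zero_add, sum_const_zero]
  have e1 : ∀ i j, coeff n (hess[δ] Γ₁ f i j - hess[δ] Γ₀ f i j)
      = -∑ k, half R * ((n + 1) * (eInf i * up G G' K' n k j + eInf j * up G G' K' n k i
      - constantCoeff (K' k nI) * lead G G' n i j))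
        * constantCoeff (tw[δ] 1 k f) := by
    intro i j
    rw [hessA_sub_hessA, map_neg, map_sum]
    simp only [(v.hasOrd_chr _ _ _).coeff_mul_right, v.coeff_chr]
  have tws : ∀ k : Fin d, constantCoeff (tw[δ] 1 (sIdx k) f) = 0 := by
    intro k; rw [tw_s, constantCoeff_serD, hf, Derivation.map_one_eq_zero]
  have twz : constantCoeff (tw[δ] 1 zI f) = 1 := by rw [tw_z, one_mul, hf]
  simp only [map_sum, (hh _ _).coeff_mul_left, e1]
  simp only [sum_idx, tws, twz, v.g.Kiz, v.g.Kis, v.g.Kii, v.g.Kzi, v.g.Ksi, v.g.Kss, v.g'.Kzi,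
    v.g'.Kii, eInf, hz, v.up_inf_left, h0, h1, v.lead_inf, v.lead_symm nI,
    v.lead_symm _ zI, v.up_inf_right,
    mul_zero, zero_mul, zero_add, add_zero, mul_one, one_mul, sum_const_zero, neg_zero,
    sub_zero, zero_sub, mul_neg, neg_neg, mul_sum]
  exact sum_ext₂ fun _ _ => by ring

lemma hasOrd_base_any {k : ℕ} (hn : n = k + 1) (N f φ : R⟦X⟧) (i j) : HasOrd k (base[δ] N Γ₁ f φ i j
      - base[δ] N Γ₀ f φ i j) := by
  subst hn
  have e : base[δ] N Γ₁ f φ i j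
      - base[δ] N Γ₀ f φ i j
      = (ricA (ambD δ) Γ₁ i j - ricA (ambD δ) Γ₀ i j)
        - N * φ * (hess[δ] Γ₁ f i j - hess[δ] Γ₀ f i j) := by simp only [baseA]; ring
  rw [e]
  refine HasOrd.sub ?_ (((v.hasOrd_hessA f i j).mono (by omega)).mul_left _)
  rw [ricA_sub_ricA]
  refine HasOrd.sub (HasOrd.sub (HasOrd.add (HasOrd.add (HasOrd.sub ?_ ?_) ?_) ?_) ?_) ?_
  · exact HasOrd.sum fun k _ => (v.hasOrd_chr _ _ _).ambD _
  · exact (HasOrd.sum fun k _ => v.hasOrd_chr _ _ _).ambD _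
  · exact (HasOrd.sum fun _ _ => HasOrd.sum fun _ _ =>
      (v.hasOrd_chr _ _ _).mul_left _).mono (Nat.le_succ _)
  · exact (HasOrd.sum fun _ _ => HasOrd.sum fun _ _ =>
      (v.hasOrd_chr _ _ _).mul_right _).mono (Nat.le_succ _)
  · exact (HasOrd.sum fun _ _ => HasOrd.sum fun _ _ =>
      (v.hasOrd_chr _ _ _).mul_left _).mono (Nat.le_succ _)
  · exact (HasOrd.sum fun _ _ => HasOrd.sum fun _ _ =>
      (v.hasOrd_chr _ _ _).mul_right _).mono (Nat.le_succ _)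

lemma coeff_base_ii {k : ℕ} (hn : n = k + 1) (N f φ : R⟦X⟧)
    (h0 : lead G G' n zI zI = 0) (h1 : ∀ i, lead G G' n zI (sIdx i) = 0) :
    coeff k (base[δ] N Γ₁ f φ nI nI - base[δ] N Γ₀ f φ nI nI) = -(half R * (k + 1) * (k + 2)
        * ∑ a, ∑ b, k₀ a b * lead G G' n (sIdx a) (sIdx b)) := by
  subst hn
  have e : base[δ] N Γ₁ f φ nI nI
      - base[δ] N Γ₀ f φ nI nI
      = (ricA (ambD δ) Γ₁ nI nI - ricA (ambD δ) Γ₀ nI nI)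
        - N * φ * (hess[δ] Γ₁ f nI nI - hess[δ] Γ₀ f nI nI) := by simp only [baseA]; ring
  rw [e, ricA_sub_ricA]
  simp only [map_add, map_sub]
  have o1 : coeff k (N * φ * (hess[δ] Γ₁ f nI nI - hess[δ] Γ₀ f nI nI)) = 0 :=
    ((v.hasOrd_hessA f _ _).mul_left _) k (by omega)
  have o2 : coeff k (∑ a, ambD δ a ((Γ₁ - Γ₀) a nI nI)) = 0 := by
    rw [map_sum]
    refine sum_eq_zero fun a _ => ?_
    have h : HasOrd (k + 2) ((Γ₁ - Γ₀) a nI nI) := by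
      refine (v.hasOrd_chr _ _ _).succ ?_
      rw [v.coeff_chr, v.up_inf_right, v.lead_inf]; ring
    exact h.ambD a k (by omega)
  have o3 : coeff k (ambD δ nI (∑ a, (Γ₁ - Γ₀) a a nI))
      = half R * (k + 1) * (k + 2) * ∑ a, ∑ b, k₀ a b * lead G G' (k + 1) (sIdx a) (sIdx b) := by
    change coeff k (serX R _) = _
    rw [coeff_serX, map_sum, v.sum_coeff_chr, v.sum_up h0 h1]
    simp only [eInf]
    push_cast
    ring
  have o4 : coeff k (∑ a, ∑ l, Γ₀ a a l * (Γ₁ - Γ₀) l nI nI) = 0 :=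
    HasOrd.sum (fun _ _ => HasOrd.sum fun _ _ => (v.hasOrd_chr _ _ _).mul_left _) k (by omega)
  have o5 : coeff k (∑ a, ∑ l, (Γ₁ - Γ₀) a a l * Γ₁ l nI nI) = 0 :=
    HasOrd.sum (fun _ _ => HasOrd.sum fun _ _ => (v.hasOrd_chr _ _ _).mul_right _) k (by omega)
  have o6 : coeff k (∑ a, ∑ l, Γ₀ a nI l * (Γ₁ - Γ₀) l a nI) = 0 :=
    HasOrd.sum (fun _ _ => HasOrd.sum fun _ _ => (v.hasOrd_chr _ _ _).mul_left _) k (by omega)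
  have o7 : coeff k (∑ a, ∑ l, (Γ₁ - Γ₀) a nI l * Γ₁ l a nI) = 0 :=
    HasOrd.sum (fun _ _ => HasOrd.sum fun _ _ => (v.hasOrd_chr _ _ _).mul_right _) k (by omega)
  rw [o1, o2, o3, o4, o5, o6, o7]
  ring

end Other

end Variation

end

namespace Gauge

variable (h : Gauge g₀ k₀ A G K) {Δ : R⟦X⟧} (hΔ : HasOrd (n + 1) Δ)

local notation "tw₁" => tw[δ] 1
local notation "H₀" => hess[δ] Γ₀

include hΔ

lemma hasOrd_sum_chr_tw (i j : Idx d) : HasOrd n (∑ k, Γ₀ k i j * tw₁ k Δ) :=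
  HasOrd.sum fun _ _ => (hΔ.tw _ _).mul_left _

lemma coeff_sum_chr_tw (i j : Idx d) : coeff n (∑ k, Γ₀ k i j * tw₁ k Δ)
    = constantCoeff (Γ₀ nI i j) * ((n + 1) * coeff (n + 1) Δ) := by
  simp only [map_sum, (hΔ.tw _ _).coeff_mul_left, coeff_tw hΔ]
  rw [sum_idx]
  simp [eInf]

lemma hasOrd_hess_var {i : Idx d} (hi : i ≠ nI) (j : Idx d) : HasOrd n (H₀ Δ i j) :=
  ((hΔ.tw _ _).tw_of_ne _ hi).sub (hasOrd_sum_chr_tw hΔ i j)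

lemma coeff_hess_var {i j : Idx d} (hi : i ≠ nI) (hj : j ≠ nI) : coeff n (H₀ Δ i j)
      = -(constantCoeff (Γ₀ nI i j) * ((n + 1) * coeff (n + 1) Δ)) := by
  rw [hessA, map_sub, coeff_sum_chr_tw hΔ i j, ((hΔ.tw_of_ne 1 hj).tw_of_ne 1 hi) n (by omega),
    zero_sub]

lemma coeff_hess_var_zi : coeff n (H₀ Δ zI nI)
    = (1 - constantCoeff (Γ₀ nI zI nI)) * ((n + 1) * coeff (n + 1) Δ) := by
  rw [hessA, map_sub, coeff_sum_chr_tw hΔ, tw_z, tw_i, one_mul, coeff_serX]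
  ring

lemma hasOrd_hess_var_any (hn : n = m + 1) (i j : Idx d) : HasOrd m (H₀ Δ i j) := by
  subst hn
  exact ((hΔ.tw _ _).tw _ _).sub ((hasOrd_sum_chr_tw hΔ i j).mono (Nat.le_succ _))

lemma coeff_hess_var_ii (hn : n = m + 1) : coeff m (H₀ Δ nI nI)
    = (m + 1) * (m + 2) * coeff (n + 1) Δ := by
  subst hn
  rw [hessA, map_sub, hasOrd_sum_chr_tw hΔ _ _ m (by omega), tw_i, tw_i, coeff_serX, coeff_serX]
  push_cast
  ring

include h

lemma coeff_K_hess_var_ii (hα : coeff 1 (G zI zI) = 2) : coeff n (K nI nI * H₀ Δ nI nI)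
      = -(2 * n * (n + 1) * coeff (n + 1) Δ) := by
  cases n with
  | zero => rw [coeff_zero, map_mul, h.Kii]; simp
  | succ m =>
    rw [(hasOrd_hess_var_any hΔ rfl _ _).coeff_succ_mul_left, h.Kii, h.coeff_one_Kii, hα,
      coeff_hess_var_ii hΔ rfl]
    push_cast
    ring

lemma coeff_tr_hess_var (hδ : ∀ i j x, δ i (δ j x) = δ j (δ i x)) (hα : coeff 1 (G zI zI) = 2) :
    coeff n (trA K (H₀ Δ)) = (d - 2 * n) * ((n + 1) * coeff (n + 1) Δ) := by
  have sym : ∀ i j, H₀ Δ i j = H₀ Δ j i := (h.lc).hessA_symm (ambD_comm δ hδ) (ambD_ambQ δ) Δ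
  have e1 : ∀ i j, i ≠ nI → coeff n (K i j * H₀ Δ i j)
      = constantCoeff (K i j) * coeff n (H₀ Δ i j) := fun i j hi =>
    (hasOrd_hess_var hΔ hi _).coeff_mul_left _
  have e2 : ∀ j, j ≠ nI → coeff n (K nI j * H₀ Δ nI j)
      = constantCoeff (K nI j) * coeff n (H₀ Δ j nI) := fun i hi => by
    rw [sym, (hasOrd_hess_var hΔ hi _).coeff_mul_left]
  have tr := h.trace_one
  have e3 : ∑ i, ∑ j, k₀ i j * (g₀ i j * ((n + 1) * coeff (n + 1) Δ))
      = d * ((n + 1) * coeff (n + 1) Δ) := by simp only [← mul_assoc, ← sum_mul, tr]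
  simp only [trA, map_sum]
  simp only [sum_idx, h.coeff_K_hess_var_ii hΔ hα]
  rw [e1 _ _ (by simp), e1 _ _ (by simp), e2 _ (by simp)]
  simp only [e1 (sIdx _) _ (by simp), e1 zI _ (by simp), e2 (sIdx _) (by simp), h.Kiz,
    h.Kzi, h.Ksi, h.Kis, coeff_hess_var hΔ (i := zIdx d) (j := zIdx d) (by simp) (by simp),
    coeff_hess_var hΔ (i := zIdx d) (j := sIdx _) (by simp) (by simp),
    coeff_hess_var hΔ (i := sIdx _) (j := zIdx d) (by simp) (by simp),
    coeff_hess_var hΔ (i := sIdx _) (j := sIdx _) (by simp) (by simp),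
    coeff_hess_var_zi hΔ, h.c_izz, h.c_izs, h.c_isz, h.c_iss, h.c_izi, hα, half_mul_two, h.Kss,
    neg_mul, neg_neg, zero_mul, mul_zero, neg_zero, sub_self, sum_const_zero, zero_add,
    add_zero, e3]
  ring

lemma coeff_tr_tw (f : R⟦X⟧) (hf : constantCoeff f = 1) :
    coeff n (trA K (fun i j => tw₁ i f * tw₁ j Δ)) = (n + 1) * coeff (n + 1) Δ := by
  have hz : constantCoeff (tw₁ zI f) = 1 := by rw [tw_z, one_mul, hf]
  have hs : ∀ i, constantCoeff (tw₁ (sIdx i) f) = 0 := fun i => by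
    rw [tw_s, constantCoeff_serD, hf, Derivation.map_one_eq_zero]
  simp only [trA, map_sum, ← mul_assoc, (hΔ.tw _ _).coeff_mul_left, coeff_tw hΔ]
  simp only [sum_idx, eInf, map_mul, h.Kzi, hz, h.Ksi, h.Kii]
  simp

lemma hasOrd_tr_hess_var (hδ : ∀ i j x, δ i (δ j x) = δ j (δ i x)) : HasOrd n (trA K (H₀ Δ)) := by
  have sym : ∀ i j, H₀ Δ i j = H₀ Δ j i := (h.lc).hessA_symm (ambD_comm δ hδ) (ambD_ambQ δ) Δ
  refine HasOrd.sum fun i _ => HasOrd.sum fun j _ => ?_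
  by_cases hi : i = nI
  · by_cases hj : j = nI
    · subst hi hj
      cases n with
      | zero => exact HasOrd.of_zero
      | succ m =>
        have := (HasOrd.one h.Kii).mul (hasOrd_hess_var_any (δ := δ) (G := G) (K := K) hΔ rfl nI nI)
        rwa [add_comm] at this
    · rw [sym]; exact (hasOrd_hess_var hΔ hj _).mul_left _
  · exact (hasOrd_hess_var hΔ hi _).mul_left _

end Gauge

/-- Two warping functions with values `1` at `ρ = 0`, and the inverses `φ` of `f`. -/
structure WarpVariation (f φ f' φ' : R⟦X⟧) (n : ℕ) : Prop where
  f₀ : constantCoeff f = 1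
  f₀' : constantCoeff f' = 1
  inv : f * φ = 1
  inv' : f' * φ' = 1
  ord : HasOrd (n + 1) (f' - f)

namespace WarpVariation

variable (w : WarpVariation f φ f' φ' n)

local notation "tw₁" => tw[δ] 1
local notation "H₀" => hess[δ] Γ₀
local notation "E₀" => base[δ] (C N) Γ₀ f φ
local notation "E₁" => base[δ] (C N) Γ₀ f' φ'
local notation "S₀" => fibre[δ] (C N) K Γ₀ f
local notation "S₁" => fibre[δ] (C N) K Γ₀ f'

include w

lemma φ₀' : constantCoeff φ' = 1 := by
  have := congrArg constantCoeff w.inv'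
  rwa [map_mul, w.f₀', one_mul, map_one] at this

lemma hasOrd_inv : HasOrd (n + 1) (φ' - φ) := by
  have e : φ' - φ = (f' - f) * (-(φ * φ')) := by linear_combination (-φ') * w.inv + φ * w.inv'
  rw [e]
  exact w.ord.mul_right _

lemma base_sub (i j) : E₁ i j - E₀ i j = -(C N * φ' * H₀ (f' - f) i j)
    - (φ' - φ) * (C N * H₀ f i j) := by
  have e : H₀ f' i j = H₀ (f' - f) i j + H₀ f i j := by rw [← hessA_add, sub_add_cancel]
  simp only [baseA, e]
  ring

lemma hasOrd_base {i : Idx d} (hi : i ≠ nI) (j) : HasOrd n (E₁ i j - E₀ i j) := by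
  rw [w.base_sub]
  exact ((Gauge.hasOrd_hess_var w.ord hi j).mul_left _).neg.sub
    ((w.hasOrd_inv.mul_right _).mono (Nat.le_succ _))

lemma coeff_base {i j : Idx d} (hi : i ≠ nI) (hj : j ≠ nI) : coeff n (E₁ i j - E₀ i j)
      = N * ((n + 1) * coeff (n + 1) (f' - f)) * constantCoeff (Γ₀ nI i j) := by
  rw [w.base_sub, map_sub, (w.hasOrd_inv.mul_right _) n (by omega), map_neg,
    (Gauge.hasOrd_hess_var w.ord hi j).coeff_mul_left, Gauge.coeff_hess_var w.ord hi hj, map_mul,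
    constantCoeff_C, w.φ₀']
  ring

lemma hasOrd_base_any {m : ℕ} (hn : n = m + 1) (i j) : HasOrd m (E₁ i j - E₀ i j) := by
  rw [w.base_sub]
  exact ((Gauge.hasOrd_hess_var_any w.ord hn i j).mul_left _).neg.sub
    ((w.hasOrd_inv.mul_right _).mono (by omega))

lemma coeff_base_ii {m : ℕ} (hn : n = m + 1) : coeff m (E₁ nI nI - E₀ nI nI)
      = -(N * ((m + 1) * (m + 2)) * coeff (n + 1) (f' - f)) := by
  rw [w.base_sub, map_sub, (w.hasOrd_inv.mul_right _) m (by omega), map_neg,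
    (Gauge.hasOrd_hess_var_any w.ord hn _ _).coeff_mul_left, Gauge.coeff_hess_var_ii w.ord hn,
    map_mul, constantCoeff_C, w.φ₀']
  ring

lemma fibre_sub (sym : ∀ i j, K i j = K j i) : S₁ - S₀ = f' * trA K (H₀ (f' - f))
    + (f' - f) * trA K (H₀ f) + (C N - 1) * (trA K (fun i j => tw₁ i f * tw₁ j (f' - f))
      + trA K (fun i j => tw₁ i f' * tw₁ j (f' - f))) := by
  have e1 : trA K (H₀ f') = trA K (H₀ (f' - f)) + trA K (H₀ f) := by
    have : ∀ i j, H₀ f' i j = H₀ (f' - f) i j + H₀ f i j := fun i j => by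
      rw [← hessA_add, sub_add_cancel]
    simp only [trA, this, mul_add, sum_add_distrib]
  have e2 : trA K (fun i j => tw₁ i f * tw₁ j f') = trA K (fun i j => tw₁ i f' * tw₁ j f) := by
    simp only [trA]
    rw [sum_comm]
    exact sum_ext₂ fun i j => by rw [sym]; ring
  have e3 : ∀ j, tw₁ j (f' - f) = tw₁ j f' - tw₁ j f := fun j => by simp only [tw, map_sub]; ring
  have e4 : ∀ u v v' : Idx d → R⟦X⟧, trA K (fun i j => u i * (v j - v' j))
      = trA K (fun i j => u i * v j) - trA K (fun i j => u i * v' j) := by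
    intro u v v'
    simp only [trA, mul_sub, sum_sub_distrib]
  simp only [fibreA, e1, e3, e4, e2]
  ring

variable (δ K) in
lemma hasOrd_tr_tw (g : R⟦X⟧) : HasOrd n (trA K (fun i j => tw₁ i g * tw₁ j (f' - f))) := by
  unfold trA
  exact HasOrd.sum fun i _ => HasOrd.sum fun j _ =>
    ((w.ord.tw (δ := δ) 1 j).mul_left (tw₁ i g)).mul_left (K i j)

variable (h : Gauge g₀ k₀ A G K) (hδ : ∀ i j x, δ i (δ j x) = δ j (δ i x))
  (hα : coeff 1 (G zI zI) = 2)

include h hδ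

lemma hasOrd_fibre : HasOrd n (S₁ - S₀) := by
  rw [w.fibre_sub h.symmK]
  have o1 := h.hasOrd_tr_hess_var w.ord hδ
  have o2 := w.hasOrd_tr_tw δ K f
  have o3 := w.hasOrd_tr_tw δ K f'
  exact ((o1.mul_left _).add ((w.ord.mul_right _).mono (Nat.le_succ _))).add
    ((o2.add o3).mul_left _)

include hα in
lemma coeff_fibre : coeff n (S₁ - S₀)
    = (d + N - 2 * (n + 1) + N) * ((n + 1) * coeff (n + 1) (f' - f)) := by
  have o1 := h.hasOrd_tr_hess_var w.ord hδ
  have o2 := w.hasOrd_tr_tw δ K f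
  have o3 := w.hasOrd_tr_tw δ K f'
  have hN : constantCoeff (C N - 1 : R⟦X⟧) = N - 1 := by simp
  rw [w.fibre_sub h.symmK, map_add, map_add, (w.ord.mul_right _) n (by omega),
    o1.coeff_mul_left, h.coeff_tr_hess_var w.ord hδ hα, (o2.add o3).coeff_mul_left, map_add,
    h.coeff_tr_tw w.ord f w.f₀, h.coeff_tr_tw w.ord f' w.f₀', w.f₀', hN]
  ring

end WarpVariation

namespace Gauge

variable (h : Gauge g₀ k₀ A G K)

local notation "twA" => tw[δ]

include h

lemma coeff_one_c_izz : coeff 1 (Γ₀ nI zI zI) = coeff 1 (G zI zI)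
      * (half R * coeff 1 (G zI zI) - 1) := by
  have o1 : HasOrd 1 (lowChr[δ] G zI zI zI) :=
    HasOrd.one (by simp [lowChr, h.zz])
  have o2 : ∀ i, HasOrd 1 (lowChr[δ] G (sIdx i) zI zI) := fun i =>
    HasOrd.one (by simp [lowChr, h.zz, h.zs])
  have e1 : lowChr[δ] G zI zI zI = G zI zI := by
    simp only [lowChr, tw_z]
    linear_combination G zI zI * two_mul_half (P := R⟦X⟧)
  rw [chr, sum_idx, map_add, map_add, map_sum, o1.coeff_mul_left, h.Kiz, e1,
    (HasOrd.one h.Kii).coeff_mul_right, h.coeff_one_Kii, h.c_lzz]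
  simp only [(o2 _).coeff_mul_left, h.Kis, zero_mul, sum_const_zero]
  ring

lemma constantCoeff_base_zz {N : R} {f φ : R⟦X⟧} (hf : constantCoeff f = 1) (hφ : f * φ = 1) :
    constantCoeff (base[δ] (C N) Γ₀ f φ zI zI) = (d + N) * (1 - half R * coeff 1 (G zI zI)) := by
  have hφ0 : constantCoeff φ = 1 := by
    have := congrArg constantCoeff hφ
    rwa [map_mul, hf, one_mul, map_one] at this
  have t1 : ∑ k, ∑ l, constantCoeff (Γ₀ k k l) * constantCoeff (Γ₀ l zI zI)
      = (d + 2) * (2 - half R * coeff 1 (G zI zI)) := by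
    rw [sum_comm, sum_idx]
    simp only [h.c_zzz, h.c_szz, h.c_izz, mul_zero, sum_const_zero, add_zero, ← sum_mul, h.c_trace]
  have t2 : ∑ k, constantCoeff (ambD δ k (Γ₀ k zI zI))
      = coeff 1 (Γ₀ nI zI zI) := by
    rw [sum_idx]
    simp [ambD, h.c_szz]
  simp only [baseA, ricA, hessA, map_sub, map_add, map_sum, map_mul, t1, t2, constantCoeff_C, hφ0,
    h.coeff_one_c_izz]
  simp only [sum_idx, h.c_zzz, h.c_szz, h.c_izz, h.c_izs, h.c_isz, h.c_szs, h.c_ssz, h.c_izi,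
    h.c_iiz, ambD, tw_z, hf, one_mul, mul_zero, zero_mul, add_zero, zero_add,
    Derivation.zero_apply, map_zero, sum_const_zero, mul_ite, mul_one, Finset.sum_ite_eq',
    Finset.mem_univ, if_true, Finset.sum_const, Finset.card_univ,
    Fintype.card_fin, nsmul_eq_mul]
  linear_combination (coeff 1 (G zI zI) - coeff 1 (G zI zI) ^ 2 * half R) * two_mul_half (P := R)

end Gauge

section Leading

variable (h : Gauge g₀ k₀ A G K) (hα : coeff 1 (G zI zI) = 2) {T : Idx d → Idx d → R⟦X⟧} {S : R⟦X⟧}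
  {k : ℕ}

local notation "twA" => tw[δ]

lemma coeff_mixA (hT : ∀ i j, HasOrd k (T i j)) (m i : Idx d) :
    coeff k (mixA K T m i) = ∑ n, coeff k (T m n) * constantCoeff (K n i) := by
  simp only [mixA, map_sum, (hT _ _).coeff_mul_right]

lemma hasOrd_mixA (hT : ∀ i j, HasOrd k (T i j)) (m i : Idx d) : HasOrd k (mixA K T m i) :=
  HasOrd.sum fun _ _ => (hT _ _).mul_right _

lemma coeff_divA (hT : ∀ i j, HasOrd k (T i j)) (m : Idx d) :
    coeff k (divA (ambD δ) (ambQ d R⟦X⟧) K Γ₀ (-2) T m)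
      = -2 * coeff k (mixA K T m zI) + ∑ i : Fin d, δ i (coeff k (mixA K T m (sIdx i)))
        + (k + 1) * coeff (k + 1) (mixA K T m nI)
        + ∑ n, (∑ i, constantCoeff (Γ₀ i i n)) * coeff k (mixA K T m n)
        - ∑ i, ∑ n, constantCoeff (Γ₀ i m n) * coeff k (mixA K T i n) := by
  have e : (-2 : R⟦X⟧) = C (-2 : R) := by rw [map_neg, map_ofNat]
  have e2 : ∑ i, ∑ n, constantCoeff (Γ₀ i i n) * coeff k (mixA K T m n)
      = ∑ n, (∑ i, constantCoeff (Γ₀ i i n)) * coeff k (mixA K T m n) := by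
    rw [sum_comm]
    simp only [sum_mul]
  rw [divA, map_sub, map_add, ← e2]
  simp only [map_sum, (hasOrd_mixA hT _ _).coeff_mul_left]
  congr 2
  rw [sum_idx, e, tw_z, tw_i, coeff_C_mul, coeff_serX]
  simp only [tw_s, coeff_serD]
  ring

lemma coeff_trA (hT : ∀ i j, HasOrd k (T i j)) :
    coeff k (trA K T) = ∑ i, ∑ j, constantCoeff (K i j) * coeff k (T i j) := by
  simp only [trA, map_sum, (hT _ _).coeff_mul_left]

variable (hs : ∀ i j, T i j = T j i) (hf : constantCoeff f = 1) (hφ : constantCoeff φ = 1)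
  (hT : ∀ i j, HasOrd k (T i j)) (hT' : ∀ i j, i ≠ nI → j ≠ nI → HasOrd (k + 1) (T i j))
  (hz : ∀ i, i ≠ nI → HasOrd (k + 2) (T zI i)) (hS : HasOrd (k + 1) S)

include h hT hT'

lemma coeff_mixA_tangential {m : Idx d} (hm : m ≠ nI) (i : Idx d) :
    coeff k (mixA K T m i) = coeff k (T m nI) * if zIdx d = i then 1 else 0 := by
  rw [coeff_mixA hT, sum_idx, hT' m _ hm (by simp) k (by omega), ← h.constantCoeff_K_inf]
  simp only [hT' m (sIdx _) hm (by simp) k (Nat.lt_succ_self k), zero_mul, sum_const_zero,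
    zero_add]

include hs in
lemma coeff_trA_leading : coeff k (trA K T) = 2 * coeff k (T zI nI) := by
  rw [coeff_trA hT]
  simp only [sum_idx, hT' zI zI (by simp) (by simp) k (Nat.lt_succ_self k),
    hT' zI (sIdx _) (by simp) (by simp) k (Nat.lt_succ_self k),
    hT' (sIdx _) zI (by simp) (by simp) k (Nat.lt_succ_self k),
    hT' (sIdx _) (sIdx _) (by simp) (by simp) k (Nat.lt_succ_self k), h.Kiz, h.Kzi, h.Kii, h.Kis,
    h.Ksi, hs nI zI, mul_zero, zero_mul, sum_const_zero, add_zero, zero_add]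
  ring

include hf in
lemma coeff_grad_leading {m : Idx d} (hm : m ≠ nI) :
    coeff k (∑ n, T m n * ∑ i, K n i * twA 1 i f) = coeff k (T m nI) := by
  have e : ∑ i, constantCoeff (K nI i * twA 1 i f) = 1 := by simp [h.Kiz, h.Kis, h.Kii, hf]
  simp only [map_sum, (hT _ _).coeff_mul_right]
  rw [sum_idx, hT' m _ hm (by simp) k (by omega)]
  simp only [hT' m (sIdx _) hm (by simp) k (Nat.lt_succ_self k), zero_mul, sum_const_zero,
    zero_add]
  rw [e, mul_one]

include hz hα hs

lemma coeff_succ_mixA_inf {m : Idx d} (hm : m ≠ nI) :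
    coeff (k + 1) (mixA K T m nI) = -2 * coeff k (T m nI) := by
  have e0 : HasOrd (k + 2) (T m zI) := by rw [hs]; exact hz m hm
  rw [mixA, map_sum, sum_idx, (e0.mul_right _) (k + 1) (by omega),
    (hT _ _).coeff_succ_mul_right, h.Kii, h.coeff_one_Kii, hα]
  simp only [(hT' m (sIdx _) hm (by simp)).coeff_mul_right, h.Ksi, mul_zero,
    sum_const_zero]
  ring

lemma coeff_divA_tangential {m : Idx d} (hm : m ≠ nI) :
    coeff k (divA (ambD δ) (ambQ d R⟦X⟧) K Γ₀ (-2) T m) = (d - 2 * (k + 1)) * coeff k (T m nI)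
        - ∑ i, ∑ n, constantCoeff (Γ₀ i m n) * coeff k (mixA K T i n) := by
  rw [coeff_divA hT, coeff_succ_mixA_inf h hα hs hT hT' hz hm]
  simp only [coeff_mixA_tangential h hT hT' hm, sum_idx (fun n => (∑ i, _) * _)]
  simp only [if_true, reduceCtorEq, if_false, mul_zero, map_zero, sum_const_zero, add_zero,
    mul_one, h.c_trace]
  ring

variable (hB : ∀ m, WarpedBianchi (ambD δ) (ambQ d R⟦X⟧) (C N) K (chr[δ] G K) T S f φ m)

include hS hB hf hφ

lemma bianchi_leading_z : (d + N - 2 * (k + 1)) * coeff k (T zI nI) = 0 := by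
  have b := congrArg (coeff k) (show _ = _ from hB zI)
  have o : HasOrd k (∑ n, T zI n * ∑ i, K n i * twA 1 i f) :=
    HasOrd.sum fun _ _ => (hT _ _).mul_right _
  have o2 : coeff k (C N * S * φ ^ 2) = 0 := ((hS.mul_left _).mul_right _) k (by omega)
  have o3 : coeff k (C N * S * φ ^ 3 * twA 1 zI f) = 0 :=
    (((hS.mul_left _).mul_right _).mul_right _) k (by omega)
  have e : (-2 : R⟦X⟧) = C (-2 : R) := by rw [map_neg, map_ofNat]
  rw [map_add, coeff_divA_tangential h hα hs hT hT' hz (by simp), map_sub, coeff_half_mul,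
    o.coeff_mul_left, coeff_grad_leading h hf hT hT' (by simp), o3] at b
  rw [tw_z, e, coeff_C_mul, map_sub, o2, coeff_trA_leading h hs hT hT'] at b
  have x : ∑ i, ∑ n, constantCoeff (Γ₀ i zI n) * coeff k (mixA K T i n)
      = 2 * coeff k (T zI nI) := by
    rw [sum_idx]
    simp only [coeff_mixA_tangential h hT hT' (by simp : zIdx d ≠ nI),
      coeff_mixA_tangential h hT hT' (by simp : sIdx _ ≠ nI), coeff_mixA hT nI]
    simp only [sum_idx, h.c_zzz, h.c_szz, h.c_izz, h.c_izs, h.c_izi, hα, half_mul_two, h.Kzi,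
      h.Ksi, h.Kii, hs nI zI, if_true, reduceCtorEq, if_false, mul_zero, zero_mul,
      sum_const_zero, add_zero, zero_add, mul_one, one_mul]
    ring
  rw [x, map_mul, constantCoeff_C, hφ] at b
  linear_combination b - 2 * coeff k (T zI nI) * two_mul_half (P := R)

lemma bianchi_leading_s (h0 : coeff k (T zI nI) = 0) (s : Fin d) :
    (d + N - 2 * (k + 1)) * coeff k (T (sIdx s) nI) = 0 := by
  have b := congrArg (coeff k) (show _ = _ from hB (sIdx s))
  have o : HasOrd k (∑ n, T (sIdx s) n * ∑ i, K n i * twA 1 i f) :=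
    HasOrd.sum fun _ _ => (hT _ _).mul_right _
  have o2 : coeff k (C N * S * φ ^ 2) = 0 := ((hS.mul_left _).mul_right _) k (by omega)
  have o3 : coeff k (C N * S * φ ^ 3 * twA 1 (sIdx s) f) = 0 :=
    (((hS.mul_left _).mul_right _).mul_right _) k (by omega)
  rw [map_add, coeff_divA_tangential h hα hs hT hT' hz (by simp), map_sub, coeff_half_mul,
    o.coeff_mul_left, coeff_grad_leading h hf hT hT' (by simp), o3] at b
  rw [tw_s, coeff_serD, map_sub, o2, coeff_trA_leading h hs hT hT', h0] at b
  have e1 : ∑ n, g₀ s n * ∑ l, coeff k (T nI (sIdx l)) * k₀ l n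
      = coeff k (T nI (sIdx s)) := by
    rw [← h.lower_raise (fun l => coeff k (T nI (sIdx l))) s]
    refine sum_ext fun n => ?_
    rw [mul_comm, h.g₀_symm]
    congr 1
    exact sum_ext fun l => by rw [h.k₀_symm]; ring
  have x : ∑ i, ∑ n, constantCoeff (Γ₀ i (sIdx s) n) * coeff k (mixA K T i n) = 0 := by
    rw [sum_idx]
    simp only [coeff_mixA_tangential h hT hT' (by simp : zIdx d ≠ nI),
      coeff_mixA_tangential h hT hT' (by simp : sIdx _ ≠ nI), coeff_mixA hT nI]
    simp only [sum_idx, h.c_ssz, h.c_isz, h.c_iss, h0, h.Kis, h.Kss,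
      h.Ksi, h.Kii, hs nI zI, if_true, reduceCtorEq, if_false, mul_zero, zero_mul,
      sum_const_zero, add_zero, zero_add, mul_one, one_mul, neg_mul,
      sum_neg_distrib, e1, ite_mul, Finset.sum_ite_eq', Finset.mem_univ]
    rw [hs nI]
    ring_nf
  rw [x, map_mul, constantCoeff_C, hφ] at b
  simp only [mul_zero, sub_zero, map_zero] at b
  linear_combination b

end Leading

section LeadingTrace

variable (h : Gauge g₀ k₀ A G K) {T : Idx d → Idx d → R⟦X⟧} {S : R⟦X⟧} {k : ℕ}

local notation "twA" => tw[δ]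

lemma bianchi_leading_trace (h : Gauge g₀ k₀ A G K) (hs : ∀ i j, T i j = T j i)
    (hφ : constantCoeff φ = 1) (hT : ∀ i j, HasOrd (k + 1) (T i j))
    (hz : ∀ i, i ≠ nI → HasOrd (k + 2) (T zI i)) (hS : HasOrd (k + 1) S) {c : R}
    (hc : ∀ i j : Fin d, coeff (k + 1) (T (sIdx i) (sIdx j)) = c * g₀ i j)
    (hcS : coeff (k + 1) S = -c) (hB : WarpedBianchi (ambD δ) (ambQ d R⟦X⟧) (C N) K Γ₀ T S f φ nI) :
    (k + 1) * (d + N) * c = 0 := by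
  have b := congrArg (coeff k) (show _ = _ from hB)
  have o1 : coeff k (C N * φ * ∑ n, T nI n * ∑ i, K n i * twA 1 i f) = 0 :=
    ((HasOrd.sum fun _ _ => (hT _ _).mul_right _).mul_left _) k (by omega)
  have o3 : coeff k (C N * S * φ ^ 3 * twA 1 nI f) = 0 :=
    (((hS.mul_left _).mul_right _).mul_right _) k (by omega)
  have hT0 : ∀ i j, coeff k (T i j) = 0 := fun i j => hT i j k (by omega)
  have hz0 : ∀ i, i ≠ nI → coeff (k + 1) (T zI i) = 0 := fun i hi =>
    hz i hi (k + 1) (by omega)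
  have m0 : ∀ i n, coeff k (mixA K T i n) = 0 := fun i n => hasOrd_mixA hT i n k (by omega)
  have S2 : coeff (k + 1) (C N * S * φ ^ 2) = -(N * c) := by
    rw [(hS.mul_left _).coeff_mul_right, hS.coeff_mul_left, hcS, map_pow, hφ, constantCoeff_C]
    ring
  have tr : ∑ i, ∑ j, k₀ i j * (c * g₀ i j) = c * d := by
    rw [← h.trace_one, mul_sum]
    refine sum_ext fun i => ?_
    rw [mul_sum]
    exact sum_ext fun j => by ring
  have tr2 : coeff (k + 1) (trA K T) = 2 * coeff (k + 1) (T nI zI) + c * d := by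
    rw [coeff_trA hT]
    simp only [sum_idx, hz0 zI (by simp), hz0 (sIdx _) (by simp), hs (sIdx _) zI,
      h.Kzi, h.Kiz, h.Kis, h.Ksi, h.Kii, h.Kss, hc, tr, hs zI nI, mul_zero, zero_mul,
      sum_const_zero, add_zero, zero_add, one_mul]
    ring
  have mi : coeff (k + 1) (mixA K T nI nI)
      = coeff (k + 1) (T nI zI) := by
    rw [coeff_mixA hT, sum_idx]
    simp [h.Kzi, h.Ksi, h.Kii]
  rw [map_add, o1, map_sub, o3, coeff_divA (fun i j => (hT i j).mono (Nat.le_succ k)),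
    coeff_half_mul, tw_i, coeff_serX, map_sub, S2, tr2, mi] at b
  simp only [m0, mul_zero, map_zero, sum_const_zero, add_zero, zero_add, sub_zero] at b
  linear_combination (-2) * b + ((k + 1) * (-(N * c) - c * d)
    - 2 * (k + 1) * coeff (k + 1) (T nI zI)) * two_mul_half (P := R)

end LeadingTrace

lemma isUnit_half : IsUnit (half R) := IsUnit.of_mul_eq_one 2 half_mul_two

lemma isUnit_natCast_succ (n : ℕ) : IsUnit ((n : R) + 1) := by
  have h : ((n : R) + 1) = algebraMap ℝ R (n + 1) := by simp
  rw [h]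
  exact (IsUnit.mk0 _ (by positivity)).map _

/-- `N` is a constant such that the dimension parameter `D = d + N` is regular. -/
structure RegularParam (δ : Fin d → Der R) (N : R) : Prop where
  comm : ∀ i j x, δ i (δ j x) = δ j (δ i x)
  const : ∀ i, δ i N = 0
  one : IsUnit ((d : R) + N - 1)
  even : ∀ k : ℕ, IsUnit ((d : R) + N - 2 * k)

namespace RegularParam

variable (hN : RegularParam δ N)

include hN

lemma unit : IsUnit ((d : R) + N) := by simpa using hN.even 0

lemma unit' (k : ℕ) : IsUnit ((k : R) - half R * (d + N)) := by
  have e : (k : R) - half R * (d + N) = -(half R * (d + N - 2 * k)) := by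
    linear_combination (-(k : R)) * two_mul_half (P := R)
  rw [e]
  exact (isUnit_half.mul (hN.even k)).neg

lemma const' (i : Idx d) : ambD δ i (C N) = 0 := by
  rcases i with i | i | i
  · rfl
  · ext n
    simp only [ambD, coeff_serD, map_zero, coeff_C]
    split_ifs
    · exact hN.const i
    · exact map_zero _
  · ext n
    simp [ambD]

end RegularParam

lemma exists_mul_eq_one {ι : Type*} [Fintype ι] [DecidableEq ι] {G : Matrix ι ι R⟦X⟧}
    {B : Matrix ι ι R} (h : G.map constantCoeff * B = 1) : ∃ K, G * K = 1 := by
  have h1 : IsUnit (G.map constantCoeff).det := by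
    rw [← Matrix.isUnit_iff_isUnit_det]
    exact IsUnit.of_mul_eq_one _ h
  have h2 : IsUnit G.det := by
    rw [isUnit_iff_constantCoeff, RingHom.map_det]
    exact h1
  exact ⟨G⁻¹, Matrix.mul_nonsing_inv _ h2⟩

section Uniqueness

open Variation (lead)

local notation "E₀₀" => base[δ] (C N) Γ₀ f φ
local notation "E₁₀" => base[δ] (C N) Γ₁ f φ
local notation "E₁₁" => base[δ] (C N) Γ₁ f' φ'
local notation "S₀₀" => fibre[δ] (C N) K Γ₀ f
local notation "S₁₁" => fibre[δ] (C N) K' Γ₁ f'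

lemma sum_sum_mul_left (c : R) (F H : Fin d → Fin d → R) :
    ∑ i, ∑ j, F i j * (c * H i j) = c * ∑ i, ∑ j, F i j * H i j := by
  simp only [mul_sum]
  exact sum_ext₂ fun _ _ => by ring

lemma agree_succ (hN : RegularParam δ N) (v : Variation g₀ k₀ A G K G' K' n)
    (w : WarpVariation f φ f' φ' n) (hα : coeff 1 (G zI zI) = 2)
    (hα' : coeff 1 (G' zI zI) = 2) (hE : ∀ i j, E₁₁ i j = E₀₀ i j)
    (hS : S₁₁ = S₀₀ ∨ N = 0 ∧ f' = f) :
    (∀ i j, HasOrd (n + 2) (G' i j - G i j)) ∧ HasOrd (n + 2) (f' - f) := by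
  have split : ∀ i j, (E₁₁ i j - E₁₀ i j) + (E₁₀ i j - E₀₀ i j) = 0 := fun i j => by rw [hE]; ring
  have cast1 : ((n + 1 : ℕ) : R) = n + 1 := by push_cast; ring
  have un := isUnit_natCast_succ (R := R) n
  have uc : IsUnit ((n : R) + 1 - half R * (d + N)) := by rw [← cast1]; exact hN.unit' (n + 1)
  set ψ := coeff (n + 1) (f' - f) with hψ
  have h0 : lead G G' n zI zI = 0 := by
    have e := congrArg (coeff n) (split zI zI)
    rw [map_add, w.coeff_base (by simp) (by simp), v.coeff_base_zz hα hα' w.f₀ w.inv, v.g'.c_izz,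
      mul_zero, zero_add, map_zero] at e
    exact ((un.mul (hN.unit' n)).mul_right_eq_zero).1 e
  have h1 : ∀ i, lead G G' n zI (sIdx i) = 0 := by
    intro i
    have e := congrArg (coeff n) (split zI (sIdx i))
    rw [map_add, w.coeff_base (by simp) (by simp), v.coeff_base_zs hα hα' w.f₀ w.inv h0,
      v.g'.c_izs, mul_zero, zero_add, map_zero] at e
    exact ((un.mul (hN.unit' n)).mul_right_eq_zero).1 e
  set t := ∑ a, ∑ b, k₀ a b * lead G G' n (sIdx a) (sIdx b) with ht
  have hss : ∀ i j, ((n : R) + 1 - half R * (d + N)) * lead G G' n (sIdx i) (sIdx j)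
      = half R * (t + 2 * N * ψ) * g₀ i j := by
    intro i j
    have e := congrArg (coeff n) (split (sIdx i) (sIdx j))
    rw [map_add, w.coeff_base (by simp) (by simp), v.coeff_base_ss hα hα' w.f₀ w.inv h0 h1,
      v.g'.c_iss, map_zero, ← ht, ← hψ] at e
    refine un.mul_left_cancel ?_
    linear_combination e - ((n + 1) * N * ψ * g₀ i j) * two_mul_half (P := R)
  have hsψ : (n + 1 - half R * (d + N)) * (2 * N * ψ) = N * (half R * (t + 2 * N * ψ)) := by
    rcases hS with hS | ⟨hS, -⟩
    · have e : (S₁₁ - fibre[δ] (C N) K' Γ₁ f)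
          + (fibre[δ] (C N) K' Γ₁ f - S₀₀) = 0 := by rw [hS]; ring
      have e := congrArg (coeff n) e
      rw [map_add, w.coeff_fibre v.g' hN.comm hα', v.coeff_fibre w.f₀ (C N) h0 h1, map_zero, ← ht,
        ← hψ] at e
      refine un.mul_left_cancel ?_
      linear_combination (-N) * e + N * ((n + 1) * ψ * N - (n + 1) * (d + N) * ψ
        - 2 * (n + 1) * N * ψ) * two_mul_half (P := R)
    · rw [hS]; ring
  have htr : ((n : R) + 1 - half R * (d + N)) * t = half R * (t + 2 * N * ψ) * d := by
    have a1 := sum_sum_mul_left ((n : R) + 1 - half R * (d + N)) k₀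
      (fun i j => lead G G' n (sIdx i) (sIdx j))
    have a2 := sum_sum_mul_left (half R * (t + 2 * N * ψ)) k₀ g₀
    simp only [hss, ← ht] at a1
    rw [v.g.trace_one] at a2
    rw [← a1]
    exact a2
  have hτ : t + 2 * N * ψ = 0 := by
    cases n with
    | zero =>
      refine (hN.one.mul_right_eq_zero).1 ?_
      push_cast at htr hsψ
      linear_combination (-1) * htr - hsψ - (d + N) * (t + 2 * N * ψ) * two_mul_half (P := R)
    | succ k =>
      have e := congrArg (coeff k) (split nI nI)
      rw [map_add, w.coeff_base_ii rfl, v.coeff_base_ii rfl _ _ _ h0 h1, map_zero, ← ht, ← hψ] at e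
      have u2 : IsUnit ((k : R) + 2) := by
        have := isUnit_natCast_succ (R := R) (k + 1)
        push_cast at this
        rwa [add_assoc, one_add_one_eq_two] at this
      refine (((isUnit_half.mul (isUnit_natCast_succ k)).mul u2).mul_right_eq_zero).1 ?_
      linear_combination (-1) * e + N * (k + 1) * (k + 2) * ψ * two_mul_half (P := R)
  have h2 : ∀ i j, lead G G' n (sIdx i) (sIdx j) = 0 := by
    intro i j
    have := hss i j
    rw [hτ, mul_zero, zero_mul] at this
    exact (uc.mul_right_eq_zero).1 this
  have h3 : ψ = 0 := by
    have t0 : t = 0 := by simp [ht, h2]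
    rcases hS with hS | ⟨-, hf⟩
    · have e : (S₁₁ - fibre[δ] (C N) K' Γ₁ f)
          + (fibre[δ] (C N) K' Γ₁ f - S₀₀) = 0 := by rw [hS]; ring
      have e := congrArg (coeff n) e
      rw [map_add, w.coeff_fibre v.g' hN.comm hα', v.coeff_fibre w.f₀ (C N) h0 h1, map_zero, ← ht,
        ← hψ, t0] at e
      rw [t0] at hτ
      have u3 := hN.even (n + 1)
      rw [cast1] at u3
      refine ((u3.mul un).mul_right_eq_zero).1 ?_
      linear_combination e - (n + 1) * half R * hτ - (n + 1) * N * ψ * (-two_mul_half (P := R))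
    · rw [hψ, hf]; simp
  refine ⟨fun i j => (v.ord i j).succ ?_, w.ord.succ h3⟩
  change lead G G' n i j = 0
  rcases i with i | i | i <;> rcases j with j | j | j
  · exact h0
  · exact h1 j
  · exact v.lead_inf _
  · rw [v.lead_symm]; exact h1 i
  · exact h2 i j
  · exact v.lead_inf _
  · rw [v.lead_symm]; exact v.lead_inf _
  · rw [v.lead_symm]; exact v.lead_inf _
  · exact v.lead_inf _

/-- `(G, f)` solves the formal ambient equations in Weyl-normal gauge. -/
structure IsFormalSolution (δ : Fin d → Der R) (g₀ k₀ : Mat d R)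
    (A : Fin d → R⟦X⟧) (N : R) (G K : AMat d R⟦X⟧) (f φ : R⟦X⟧) : Prop where
  gauge : Gauge g₀ k₀ A G K
  f₀ : constantCoeff f = 1
  inv : f * φ = 1
  base : ∀ i j, base[δ] (C N) (chr[δ] G K) f φ i j = 0

lemma IsFormalSolution.coeff_one_zz (hN : RegularParam δ N)
    (s : IsFormalSolution δ g₀ k₀ A N G K f φ) : coeff 1 (G zI zI) = 2 := by
  have e := s.gauge.constantCoeff_base_zz (δ := δ) (N := N) s.f₀ s.inv
  rw [s.base, map_zero] at e
  have := (hN.unit.mul_right_eq_zero).1 e.symm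
  linear_combination (-2) * this + (-coeff 1 (G zI zI)) * two_mul_half (P := R)

lemma eq_of_forall_hasOrd {a b : R⟦X⟧} (h : ∀ n, HasOrd (n + 1) (a - b)) : a = b := by
  ext n
  have := h n n (by omega)
  rwa [map_sub, sub_eq_zero] at this

lemma IsFormalSolution.unique (hN : RegularParam δ N)
    (s : IsFormalSolution δ g₀ k₀ A N G K f φ) (s' : IsFormalSolution δ g₀ k₀ A N G' K' f' φ')
    (hS : S₀₀ = 0 ∧ S₁₁ = 0 ∨ N = 0 ∧ f' = f) : G' = G ∧ f' = f := by
  have main : ∀ n, (∀ i j, HasOrd (n + 1) (G' i j - G i j)) ∧ HasOrd (n + 1) (f' - f) := by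
    intro n
    induction n with
    | zero =>
      refine ⟨fun i j => HasOrd.one ?_, HasOrd.one (by rw [map_sub, s.f₀, s'.f₀, sub_self])⟩
      have g := s.gauge
      have g' := s'.gauge
      rcases i with i | i | i <;> rcases j with j | j | j <;> rw [map_sub, sub_eq_zero]
      · rw [g.zz, g'.zz]
      · rw [g.zs, g'.zs]
      · rw [g.zi, g'.zi]
      · rw [g.sz, g'.sz]
      · rw [g.ss, g'.ss]
      · rw [g.si, g'.si]
      · rw [g.iz, g'.iz]
      · rw [g.is, g'.is]
      · rw [g.ii, g'.ii]
    | succ n ih =>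
      refine agree_succ hN ⟨s.gauge, s'.gauge, ih.1⟩ ⟨s.f₀, s'.f₀, s.inv, s'.inv, ih.2⟩
        (s.coeff_one_zz hN) (s'.coeff_one_zz hN) (fun i j => by rw [s.base, s'.base]) ?_
      rcases hS with ⟨h1, h2⟩ | h
      · exact Or.inl (h2.trans h1.symm)
      · exact Or.inr h
  exact ⟨by ext1 i j; exact eq_of_forall_hasOrd fun n => (main n).1 i j,
    eq_of_forall_hasOrd fun n => (main n).2⟩

end Uniqueness

section

open Variation (lead)

/-- The symmetric matrix with prescribed `00`, `0i`, `ij` components, and zero `∞` components. -/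
def tangMatrix (η : R) (θ : Fin d → R) (h : Mat d R) : AMat d R
  | inl _, inl _ => η
  | inl _, inr (inl i) => θ i
  | inr (inl i), inl _ => θ i
  | inr (inl i), inr (inl j) => h i j
  | _, _ => 0

lemma tangMatrix_symm (η : R) (θ : Fin d → R) {h : Mat d R}
    (hs : ∀ i j, h i j = h j i) (i j) : tangMatrix η θ h i j = tangMatrix η θ h j i := by
  rcases i with i | i | i <;> rcases j with j | j | j <;> simp [tangMatrix, hs]

lemma exists_variation {G K : AMat d R⟦X⟧} (g : Gauge g₀ k₀ A G K) (n : ℕ) (η : R)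
    (θ : Fin d → R) {h : Mat d R} (hs : ∀ i j, h i j = h j i) (hη : n = 0 → η = 0) :
    ∃ G' K', Variation g₀ k₀ A G K G' K' n ∧ (∀ i j, lead G G' n i j = tangMatrix η θ h i j)
      ∧ coeff 1 (G' zI zI) = coeff 1 (G zI zI) := by
  set G' : AMat d R⟦X⟧ :=
    fun i j => G i j + X ^ (n + 1) * C (tangMatrix η θ h i j) with hG'
  have hd : ∀ i j, G' i j - G i j = X ^ (n + 1) * C (tangMatrix η θ h i j) := fun i j => by
    simp [hG']
  have hc : ∀ i j, constantCoeff (G' i j) = constantCoeff (G i j) := fun i j => by simp [hG']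
  have hK : G'.map constantCoeff * K.map constantCoeff = 1 := by
    have e : G'.map constantCoeff = G.map constantCoeff := by ext i j; exact hc i j
    rw [e, ← Matrix.map_mul, g.inv]
    ext i j
    simp [one_apply]
  obtain ⟨K', hK'⟩ := exists_mul_eq_one hK
  have hi : ∀ i, tangMatrix η θ h i nI = 0 := by
    intro i
    rcases i with i | i | i <;> rfl
  have gi : ∀ i, G' i nI = G i nI := fun i => by simp [hG', hi]
  refine ⟨G', K', ⟨g, ⟨fun i j => ?_, hK', ?_, ?_, fun i => ?_, ?_, fun i => ?_, fun i j => ?_,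
    g.inv₀⟩, fun i j => ?_⟩, fun i j => ?_, ?_⟩
  · simp only [hG', g.symm i j, tangMatrix_symm η θ hs i j]
  · rw [gi, g.ii]
  · rw [gi, g.zi]
  · rw [gi, g.si]
  · rw [hc, g.zz]
  · rw [hc, g.zs]
  · rw [hc, g.ss]
  · rw [hd]; exact HasOrd.X_pow_mul _ _
  · rw [lead, hd, coeff_X_pow_mul_self, constantCoeff_C]
  · have e : G' zI zI = G zI zI + X ^ (n + 1) * C η := rfl
    rw [e, map_add]
    cases n with
    | zero => simp [hη rfl]
    | succ n => rw [HasOrd.X_pow_mul (n + 1 + 1) (C η) 1 (by omega), add_zero]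

lemma exists_warpVariation {f φ : R⟦X⟧} (hf : constantCoeff f = 1) (hφ : f * φ = 1) (n : ℕ)
    (ψ : R) : ∃ f' φ', WarpVariation f φ f' φ' n ∧ coeff (n + 1) (f' - f) = ψ := by
  set f' := f + X ^ (n + 1) * C ψ with hf'
  have h0 : constantCoeff f' = 1 := by simp [hf', hf]
  have hd : f' - f = X ^ (n + 1) * C ψ := by simp [hf']
  have hu : IsUnit f' := by rw [isUnit_iff_constantCoeff, h0]; exact isUnit_one
  obtain ⟨φ', hφ'⟩ := hu.exists_right_inv
  refine ⟨f', φ', ⟨hf, h0, hφ, hφ', ?_⟩, ?_⟩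
  · rw [hd]; exact HasOrd.X_pow_mul _ _
  · rw [hd, coeff_X_pow_mul_self, constantCoeff_C]

/-- The equations hold to order `n`. -/
structure IsStage (δ : Fin d → Der R) (g₀ k₀ : Mat d R)
    (A : Fin d → R⟦X⟧) (N : R) (n : ℕ) (G K : AMat d R⟦X⟧) (f φ : R⟦X⟧) :
    Prop where
  gauge : Gauge g₀ k₀ A G K
  f₀ : constantCoeff f = 1
  inv : f * φ = 1
  α : coeff 1 (G zI zI) = 2
  tang : ∀ i j, i ≠ nI → j ≠ nI → HasOrd n
    (base[δ] (C N) (chr[δ] G K) f φ i j)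
  inf : ∀ i, HasOrd (n - 1)
    (base[δ] (C N) (chr[δ] G K) f φ i nI)
  fibre : HasOrd n (fibre[δ] (C N) K (chr[δ] G K) f)

lemma HasOrd.of_sub {k : ℕ} {a b : R⟦X⟧} (h : HasOrd k (a - b)) (hb : HasOrd k b) : HasOrd k a := by
  simpa using h.add hb

namespace IsStage

local notation "E₀₀" => base[δ] (C N) Γ₀ f φ
local notation "E₁₀" => base[δ] (C N) Γ₁ f φ
local notation "E₀₁" => base[δ] (C N) Γ₀ f' φ'
local notation "S₀₀" => fibre[δ] (C N) K Γ₀ f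

lemma symm (hN : RegularParam δ N) (s : IsStage δ g₀ k₀ A N n G K f φ) (i j) :
    E₀₀ i j = E₀₀ j i := by
  have lc := (s.gauge.lc (δ := δ))
  have h1 := lc.hessA_symm (ambD_comm δ hN.comm) (ambD_ambQ δ) f i j
  have h2 := lc.ricA_symm (ambD_comm δ hN.comm) (ambD_ambQ δ) i j
  rw [baseA, baseA, h1, h2]

lemma variation (s : IsStage δ g₀ k₀ A N n G K f φ) (v : Variation g₀ k₀ A G K G' K' n)
    (hα : coeff 1 (G' zI zI) = 2) : IsStage δ g₀ k₀ A N n G' K' f φ where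
  gauge := v.g'
  f₀ := s.f₀
  inv := s.inv
  α := hα
  tang i j hi hj := (v.hasOrd_base hi hj).of_sub (s.tang i j hi hj)
  inf i := by
    cases n with
    | zero => exact HasOrd.of_zero
    | succ k => exact (v.hasOrd_base_any rfl _ _ _ _ _).of_sub (s.inf i)
  fibre := (v.hasOrd_fibre _ _).of_sub s.fibre

lemma warpVariation (hN : RegularParam δ N) (s : IsStage δ g₀ k₀ A N n G K f φ)
    (w : WarpVariation f φ f' φ' n) : IsStage δ g₀ k₀ A N n G K f' φ' where
  gauge := s.gauge
  f₀ := w.f₀'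
  inv := w.inv'
  α := s.α
  tang i j hi hj := (w.hasOrd_base hi j).of_sub (s.tang i j hi hj)
  inf i := by
    cases n with
    | zero => exact HasOrd.of_zero
    | succ k => exact (w.hasOrd_base_any rfl _ _).of_sub (s.inf i)
  fibre := (w.hasOrd_fibre s.gauge hN.comm).of_sub s.fibre

lemma bianchi (hN : RegularParam δ N) (s : IsStage δ g₀ k₀ A N n G K f φ) (m : Idx d) :
    WarpedBianchi (ambD δ) (ambQ d R⟦X⟧) (C N) K Γ₀ E₀₀ S₀₀ f φ m :=
  (s.gauge.lc (δ := δ)).warped_bianchi (ambD_comm δ hN.comm) (ambD_ambQ δ) hN.const' s.inv m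

lemma unit_cast_two (k : ℕ) : IsUnit ((k : R) + 2) := by
  have := isUnit_natCast_succ (R := R) (k + 1)
  push_cast at this
  rwa [add_assoc, one_add_one_eq_two] at this

lemma succ (hN : RegularParam δ N) (s : IsStage δ g₀ k₀ A N n G K f φ) :
    ∃ G' K' f' φ', IsStage δ g₀ k₀ A N (n + 1) G' K' f' φ' ∧
      (∀ i j, HasOrd (n + 1) (G' i j - G i j)) ∧ HasOrd (n + 1) (f' - f) := by
  have cast1 : ((n + 1 : ℕ) : R) = n + 1 := by push_cast; ring
  have un := isUnit_natCast_succ (R := R) n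
  have uc : IsUnit ((n : R) + 1 - half R * (d + N)) := by rw [← cast1]; exact hN.unit' (n + 1)
  have z0 : ∀ i j, (0 : Mat d R) i j = (0 : Mat d R) j i :=
    fun _ _ => rfl
  -- the component `00`
  obtain ⟨u₁, hu₁⟩ := (un.mul (hN.unit' n)).exists_right_inv
  obtain ⟨G₁, K₁, v₁, l₁, α₁⟩ := exists_variation s.gauge n
    (-(u₁ * coeff n (E₀₀ zI zI))) 0 z0 (by
      rintro rfl
      rw [coeff_zero, s.gauge.constantCoeff_base_zz s.f₀ s.inv, s.α, half_mul_two]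
      simp)
  rw [s.α] at α₁
  have s₁ := s.variation v₁ α₁
  set E₁ := base[δ] (C N) (chr[δ] G₁ K₁) f φ with hE₁
  have zz₁ : coeff n (E₁ zI zI) = 0 := by
    have e := v₁.coeff_base_zz (δ := δ) (N := N) s.α α₁ s.f₀ s.inv
    rw [map_sub, l₁] at e
    simp only [tangMatrix] at e
    linear_combination e - coeff n (E₀₀ zI zI) * hu₁
  -- the components `0i`
  obtain ⟨G₂, K₂, v₂, l₂, α₂⟩ := exists_variation s₁.gauge n 0
    (fun i => -(u₁ * coeff n (E₁ zI (sIdx i)))) z0 (fun _ => rfl)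
  rw [α₁] at α₂
  have s₂ := s₁.variation v₂ α₂
  set E₂ := base[δ] (C N) (chr[δ] G₂ K₂) f φ with hE₂
  have zz₂ : coeff n (E₂ zI zI) = 0 := by
    have e := v₂.coeff_base_zz (δ := δ) (N := N) α₁ α₂ s.f₀ s.inv
    rw [map_sub, l₂, ← hE₁, zz₁] at e
    simp only [tangMatrix, mul_zero, sub_zero] at e
    exact e
  have zs₂ : ∀ i, coeff n (E₂ zI (sIdx i)) = 0 := fun i => by
    have e := v₂.coeff_base_zs (δ := δ) (N := N) α₁ α₂ s.f₀ s.inv (l₂ _ _) i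
    rw [map_sub, l₂] at e
    simp only [tangMatrix] at e
    linear_combination e - coeff n (E₁ zI (sIdx i)) * hu₁
  -- the components `ij` and the warping function
  set r : Mat d R := fun i j => coeff n (E₂ (sIdx i) (sIdx j)) with hr
  set σ := coeff n (fibre[δ] (C N) K₂ (chr[δ] G₂ K₂) f) with hσ
  have rs : ∀ i j, r i j = r j i := fun i j => by
    rw [hr]
    simp only [hE₂]
    rw [s₂.symm hN]
  set tr := ∑ i, ∑ j, k₀ i j * r i j with htr
  obtain ⟨τ, c, hc, hc0, hck⟩ : ∃ τ c : R, (d + N) * c = (n + 1) * (n + 1 - (d + N)) * τ - N * σ + tr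
      ∧ (n = 0 → c = 0) ∧ (∀ k, n = k + 1 → half R * (k + 1) * (k + 2) * τ
        = coeff k (E₂ nI nI)) := by
    cases n with
    | zero =>
      obtain ⟨y, hy⟩ := hN.one.exists_right_inv
      refine ⟨y * (tr - N * σ), 0, ?_, fun _ => rfl, fun k hk => absurd hk (by simp)⟩
      push_cast
      linear_combination (tr - N * σ) * hy
    | succ k =>
      obtain ⟨x, hx⟩ := ((isUnit_half.mul (isUnit_natCast_succ k)).mul
        (unit_cast_two (R := R) k)).exists_right_inv
      obtain ⟨y, hy⟩ := hN.unit.exists_right_inv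
      refine ⟨x * coeff k (E₂ nI nI), y * (((k + 1 : ℕ) + 1)
        * ((k + 1 : ℕ) + 1 - (d + N)) * (x * coeff k (E₂ nI nI)) - N * σ + tr),
        ?_, fun h => absurd h (by simp), ?_⟩
      · rw [← mul_assoc, hy, one_mul]
      · intro k' hk'
        obtain rfl : k = k' := by omega
        rw [← mul_assoc, hx, one_mul]
  obtain ⟨w, hw⟩ := uc.exists_right_inv
  obtain ⟨y, hy⟩ := un.exists_right_inv
  set h : Mat d R :=
    fun i j => w * (half R * τ * g₀ i j + y * (c * g₀ i j - r i j)) with hh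
  have hsymm : ∀ i j, h i j = h j i := fun i j => by simp only [hh, rs i j, s.gauge.g₀_symm i j]
  set ψ := half R * w * (half R * τ + y * (c + σ)) with hψ
  set t := ∑ i, ∑ j, k₀ i j * h i j with ht
  have t_eq : t = w * (half R * τ * d + y * (c * d - tr)) := by
    have e : ∀ i j, k₀ i j * h i j
        = k₀ i j * ((w * (half R * τ + y * c)) * g₀ i j) - k₀ i j * (w * y * r i j) := by
      intro i j; simp only [hh]; ring
    rw [ht]
    simp only [e, sum_sub_distrib]
    have a1 := sum_sum_mul_left (w * (half R * τ + y * c)) k₀ g₀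
    have a2 := sum_sum_mul_left (w * y) k₀ r
    rw [s.gauge.trace_one] at a1
    rw [← htr] at a2
    linear_combination a1 - a2
  have hτ : t + 2 * N * ψ = τ := by
    refine uc.mul_left_cancel ?_
    rw [t_eq, hψ]
    linear_combination ((half R * τ * d + y * (c * d - tr)) + N * (half R * τ + y * (c + σ))) * hw
      + N * (half R * τ + y * (c + σ)) * two_mul_half (P := R) * w
        * (n + 1 - half R * (d + N))
      + y * hc + τ * (n + 1 - (d + N)) * hy + (d + N) * τ * two_mul_half (P := R)
  obtain ⟨G₃, K₃, v₃, l₃, α₃⟩ := exists_variation s₂.gauge n 0 0 hsymm (fun _ => rfl)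
  rw [α₂] at α₃
  have s₃ := s₂.variation v₃ α₃
  obtain ⟨f', φ', wv, lψ⟩ := exists_warpVariation s.f₀ s.inv n ψ
  have s₄ := s₃.warpVariation hN wv
  set E₃ := base[δ] (C N) (chr[δ] G₃ K₃) f φ with hE₃
  set E₄ := base[δ] (C N) (chr[δ] G₃ K₃) f' φ' with hE₄
  have l0 : lead G₂ G₃ n zI zI = 0 := l₃ _ _
  have l1 : ∀ i, lead G₂ G₃ n zI (sIdx i) = 0 := fun i => l₃ _ _
  have lt : ∑ a, ∑ b, k₀ a b * lead G₂ G₃ n (sIdx a) (sIdx b) = t := by simp only [l₃]; rfl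
  have zz₄ : coeff n (E₄ zI zI) = 0 := by
    have e := v₃.coeff_base_zz (δ := δ) (N := N) α₂ α₃ s.f₀ s.inv
    have e' := wv.coeff_base (δ := δ) (N := N) (G := G₃) (K := K₃) (i := zIdx d) (j := zIdx d)
      (by simp) (by simp)
    rw [map_sub, v₃.g'.c_izz] at e'
    rw [map_sub, l0, ← hE₂, zz₂] at e
    linear_combination e + e'
  have zs₄ : ∀ i, coeff n (E₄ zI (sIdx i)) = 0 := fun i => by
    have e := v₃.coeff_base_zs (δ := δ) (N := N) α₂ α₃ s.f₀ s.inv l0 i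
    have e' := wv.coeff_base (δ := δ) (N := N) (G := G₃) (K := K₃) (i := zIdx d) (j := sIdx i)
      (by simp) (by simp)
    rw [map_sub, v₃.g'.c_izs] at e'
    rw [map_sub, l1, ← hE₂, zs₂] at e
    linear_combination e + e'
  have ss₄ : ∀ i j, coeff n (E₄ (sIdx i) (sIdx j)) = c * g₀ i j := fun i j => by
    have e := v₃.coeff_base_ss (δ := δ) (N := N) α₂ α₃ s.f₀ s.inv l0 l1 i j
    have e' := wv.coeff_base (δ := δ) (N := N) (G := G₃) (K := K₃) (i := sIdx i) (j := sIdx j)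
      (by simp) (by simp)
    rw [map_sub, v₃.g'.c_iss, lψ] at e'
    have e2 : lead G₂ G₃ n (sIdx i) (sIdx j)
      = w * (half R * τ * g₀ i j + y * (c * g₀ i j - r i j)) := l₃ _ _
    have e3 : coeff n (E₂ (sIdx i) (sIdx j)) = r i j := rfl
    rw [map_sub, lt, e2, ← hE₂, e3] at e
    linear_combination e + e' - half R * g₀ i j * (n + 1) * hτ
      + (n + 1) * (half R * τ * g₀ i j + y * (c * g₀ i j - r i j)) * hw
      + (c * g₀ i j - r i j) * hy - N * ψ * g₀ i j * (n + 1) * (-1) * two_mul_half (P := R)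
  have S₄ : coeff n (fibre[δ] (C N) K₃ (chr[δ] G₃ K₃) f') = -c := by
    have e := v₃.coeff_fibre (δ := δ) s.f₀ (C N) l0 l1
    have e' := wv.coeff_fibre (N := N) v₃.g' hN.comm α₃
    rw [map_sub, lt, ← hσ] at e
    rw [map_sub, lψ] at e'
    linear_combination e + e' + half R * (n + 1) * hτ
      - (n + 1) * (2 * (n + 1) - 2 * half R * (d + N)) * hψ
      - 2 * half R * (n + 1) * (half R * τ + y * (c + σ)) * hw
      - (n + 1) * (half R * τ + y * (c + σ) + N * ψ + (d + N) * ψ) * two_mul_half (P := R)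
      - (σ + c) * hy
  have sy := s₄.symm hN
  have hz : ∀ i, i ≠ nI → HasOrd (n + 1) (E₄ zI i) := by
    intro i hi
    refine (s₄.tang _ _ (by simp) hi).succ ?_
    rcases i with i | i | i
    · exact zz₄
    · exact zs₄ i
    · exact absurd rfl hi
  have hφ' : constantCoeff φ' = 1 := wv.φ₀'
  have inf₄ : ∀ i, HasOrd n (E₄ i nI) := by
    cases n with
    | zero => exact fun _ => HasOrd.of_zero
    | succ k =>
      have hT : ∀ i j, HasOrd k (E₄ i j) := by
        intro i j
        by_cases hj : j = nI
        · rw [hj]; exact s₄.inf i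
        by_cases hi : i = nI
        · rw [hi, hE₄, sy]; exact s₄.inf j
        exact (s₄.tang i j hi hj).mono (Nat.le_succ k)
      have b1 := bianchi_leading_z v₃.g' α₃ sy wv.f₀' hφ' hT s₄.tang hz s₄.fibre (s₄.bianchi hN)
      have u := hN.even (k + 1)
      push_cast at u
      have b1 := (u.mul_right_eq_zero).1 b1
      have b2 := fun i => (u.mul_right_eq_zero).1 (bianchi_leading_s v₃.g' α₃ sy wv.f₀' hφ' hT
        s₄.tang hz s₄.fibre (s₄.bianchi hN) b1 i)
      have b3 : coeff k (E₄ nI nI) = 0 := by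
        have e := v₃.coeff_base_ii (δ := δ) rfl (C N) f φ l0 l1
        have e' := wv.coeff_base_ii (δ := δ) (N := N) (G := G₃) (K := K₃) rfl
        rw [map_sub, lt, ← hE₂, ← hck k rfl] at e
        rw [map_sub, lψ] at e'
        linear_combination e + e' - half R * (k + 1) * (k + 2) * hτ
          + N * (k + 1) * (k + 2) * ψ * two_mul_half (P := R)
      intro i
      refine (hT i _).succ ?_
      rcases i with i | i | i
      · exact b1
      · exact b2 i
      · exact b3
  have hT : ∀ i j, HasOrd n (E₄ i j) := by
    intro i j
    by_cases hj : j = nI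
    · rw [hj]; exact inf₄ i
    by_cases hi : i = nI
    · rw [hi, hE₄, sy]; exact inf₄ j
    exact s₄.tang i j hi hj
  have c0 : c = 0 := by
    cases n with
    | zero => exact hc0 rfl
    | succ k =>
      have b := bianchi_leading_trace v₃.g' sy hφ' hT hz s₄.fibre ss₄ S₄ (s₄.bianchi hN _)
      exact (((isUnit_natCast_succ k).mul hN.unit).mul_right_eq_zero).1 b
  refine ⟨G₃, K₃, f', φ', ⟨v₃.g', wv.f₀', wv.inv', α₃, fun i j hi hj => ?_, inf₄, ?_⟩,
    fun i j => ?_, wv.ord⟩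
  · refine (s₄.tang i j hi hj).succ ?_
    rcases i with i | i | i <;> rcases j with j | j | j
    · exact zz₄
    · exact zs₄ j
    · exact absurd rfl hj
    · rw [sy]; exact zs₄ i
    · exact (ss₄ i j).trans (by rw [c0, zero_mul])
    · exact absurd rfl hj
    · exact absurd rfl hi
    · exact absurd rfl hi
    · exact absurd rfl hi
  · exact s₄.fibre.succ (by rw [S₄, c0, neg_zero])
  · have e : G₃ i j - G i j = (G₃ i j - G₂ i j) + ((G₂ i j - G₁ i j) + (G₁ i j - G i j)) := by ring
    rw [e]
    exact (v₃.ord i j).add ((v₂.ord i j).add (v₁.ord i j))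

end IsStage

lemma exists_isStage_zero (hg : ∀ i j, g₀ i j = g₀ j i) (hk : g₀ * k₀ = 1)
    (A : Fin d → R⟦X⟧) : ∃ G K f φ, IsStage δ g₀ k₀ A N 0 G K f φ := by
  set G : AMat d R⟦X⟧ := fun i j => match i, j with
    | inl _, inl _ => 2 * X
    | inl _, inr (inl _) => 0
    | inl _, inr (inr _) => 1
    | inr (inl _), inl _ => 0
    | inr (inl i), inr (inl j) => C (g₀ i j)
    | inr (inl i), inr (inr _) => A i
    | inr (inr _), inl _ => 1
    | inr (inr _), inr (inl j) => A j
    | inr (inr _), inr (inr _) => 0 with hG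
  set a : Fin d → R := fun i => constantCoeff (A i) with ha
  set B : AMat d R := fun i j => match i, j with
    | inl _, inl _ => ∑ i, a i * ∑ j, k₀ i j * a j
    | inl _, inr (inl i) => -∑ j, a j * k₀ j i
    | inl _, inr (inr _) => 1
    | inr (inl i), inl _ => -∑ j, k₀ i j * a j
    | inr (inl i), inr (inl j) => k₀ i j
    | inr (inl i), inr (inr _) => 0
    | inr (inr _), inl _ => 1
    | inr (inr _), inr (inl j) => 0
    | inr (inr _), inr (inr _) => 0 with hB
  have gk : ∀ i j, ∑ l, g₀ i l * k₀ l j = if i = j then 1 else 0 := fun i j => by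
    have := congrFun (congrFun hk i) j
    rwa [mul_apply, one_apply] at this
  have ga : ∀ i, ∑ l, g₀ i l * ∑ j, k₀ l j * a j = a i := by
    intro i
    simp only [mul_sum, ← mul_assoc]
    rw [sum_comm]
    simp only [← sum_mul, gk, ite_mul, one_mul, zero_mul, sum_ite_eq, Finset.mem_univ, if_true]
  have hGB : G.map constantCoeff * B = 1 := by
    have zz : G.map constantCoeff zI zI = 0 := by change constantCoeff (2 * X : R⟦X⟧) = 0; simp
    have zs : ∀ i, G.map constantCoeff zI (sIdx i) = 0 := fun i => map_zero constantCoeff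
    have zi : G.map constantCoeff zI nI = 1 := map_one constantCoeff
    have sz : ∀ i, G.map constantCoeff (sIdx i) zI = 0 := fun i => map_zero constantCoeff
    have ss : ∀ i j, G.map constantCoeff (sIdx i) (sIdx j) = g₀ i j := fun i j =>
      constantCoeff_C _
    have si : ∀ i, G.map constantCoeff (sIdx i) nI = a i := fun i => rfl
    have iz : G.map constantCoeff nI zI = 1 := map_one constantCoeff
    have is : ∀ i, G.map constantCoeff nI (sIdx i) = a i := fun i => rfl
    have ii : G.map constantCoeff nI nI = 0 := map_zero constantCoeff
    ext i j
    rw [mul_apply, sum_idx]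
    rcases i with ⟨⟩ | i | ⟨⟩ <;> rcases j with ⟨⟩ | j | ⟨⟩ <;>
      simp only [hB, zz, zs, zi, sz, ss, si, iz, is, ii] <;>
      simp [one_apply, gk, ga]
  obtain ⟨K, hK⟩ := exists_mul_eq_one hGB
  refine ⟨G, K, 1, 1, ⟨fun i j => ?_, hK, rfl, rfl, fun _ => rfl, by simp [hG], fun _ => by simp [hG],
    fun _ _ => by simp [hG], hk⟩, map_one _, one_mul _, ?_, fun _ _ _ _ => HasOrd.of_zero,
    fun _ => HasOrd.of_zero, HasOrd.of_zero⟩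
  · rcases i with i | i | i <;> rcases j with j | j | j <;>
      first | rfl | exact congrArg C (hg i j)
  · have : G zI zI = C 2 * X := by simp only [hG]; rw [map_ofNat]
    rw [this, coeff_C_mul, coeff_one_X, mul_one]

lemma exists_limit {a : ℕ → R⟦X⟧} (h : ∀ n, HasOrd (n + 1) (a (n + 1) - a n)) :
    ∃ b, ∀ n, HasOrd (n + 1) (b - a n) := by
  refine ⟨PowerSeries.mk fun n => coeff n (a n), fun n m hm => ?_⟩
  have e : ∀ n, m ≤ n → coeff m (a n) = coeff m (a m) := by
    intro n hn
    induction n, hn using Nat.le_induction with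
    | base => rfl
    | succ n hn ih =>
      have := h n m (by omega)
      rw [map_sub, sub_eq_zero] at this
      rw [this, ih]
  rw [map_sub, coeff_mk, e n (by omega), sub_self]

lemma exists_seq_stages (hN : RegularParam δ N) (hg : ∀ i j, g₀ i j = g₀ j i)
    (hk : g₀ * k₀ = 1) (A : Fin d → R⟦X⟧) : ∃ (G K : ℕ → AMat d R⟦X⟧) (f φ : ℕ → R⟦X⟧),
      (∀ n, IsStage δ g₀ k₀ A N n (G n) (K n) (f n) (φ n)) ∧
      (∀ i j n, HasOrd (n + 1) (G (n + 1) i j - G n i j)) ∧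
      ∀ n, HasOrd (n + 1) (f (n + 1) - f n) := by
  let Q := AMat d R⟦X⟧ × AMat d R⟦X⟧ × R⟦X⟧ × R⟦X⟧
  let st : ℕ → Type _ := fun n =>
    {p : Q // IsStage δ g₀ k₀ A N n p.1 p.2.1 p.2.2.1 p.2.2.2}
  have step : ∀ n (x : st n), ∃ y : st (n + 1),
      (∀ i j, HasOrd (n + 1) (y.1.1 i j - x.1.1 i j)) ∧
        HasOrd (n + 1) (y.1.2.2.1 - x.1.2.2.1) := by
    intro n x
    obtain ⟨G', K', f', φ', h1, h2, h3⟩ := x.2.succ hN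
    exact ⟨⟨(G', K', f', φ'), h1⟩, h2, h3⟩
  choose next hnext using step
  obtain ⟨G, K, f, φ, h⟩ := exists_isStage_zero (δ := δ) (N := N) hg hk A
  let s : ∀ n, st n := fun n => Nat.rec (⟨(G, K, f, φ), h⟩ : st 0) next n
  exact ⟨fun n => (s n).1.1, fun n => (s n).1.2.1, fun n => (s n).1.2.2.1, fun n => (s n).1.2.2.2,
    fun n => (s n).2, fun i j n => (hnext n (s n)).1 i j, fun n => (hnext n (s n)).2⟩

lemma exists_isFormalSolution (hN : RegularParam δ N) (hg : ∀ i j, g₀ i j = g₀ j i)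
    (hk : g₀ * k₀ = 1) (A : Fin d → R⟦X⟧) : ∃ G K f φ, IsFormalSolution δ g₀ k₀ A N G K f φ ∧
      fibre[δ] (C N) K (chr[δ] G K) f = 0 := by
  obtain ⟨Gs, Ks, fs, φs, hs, hG, hf⟩ := exists_seq_stages hN hg hk A
  choose Gl hGl using fun i j => exists_limit (a := fun n => Gs n i j) (hG i j)
  obtain ⟨G, hG⟩ : ∃ G : AMat d R⟦X⟧, ∀ i j n,
      HasOrd (n + 1) (G i j - Gs n i j) := ⟨Matrix.of Gl, hGl⟩
  obtain ⟨f, hf⟩ := exists_limit hf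
  have c0 : ∀ i j, constantCoeff (G i j) = constantCoeff (Gs 0 i j) := fun i j => by
    have := (hG i j 0).constantCoeff_eq (by omega)
    rwa [map_sub, sub_eq_zero] at this
  have g0 := (hs 0).gauge
  have hf0 : constantCoeff f = 1 := by
    have := (hf 0).constantCoeff_eq (by omega)
    rwa [map_sub, sub_eq_zero, (hs 0).f₀] at this
  obtain ⟨φ, hφ⟩ : ∃ φ, f * φ = 1 := by
    have hu : IsUnit f := by rw [isUnit_iff_constantCoeff, hf0]; exact isUnit_one
    exact hu.exists_right_inv
  have lim : ∀ i j (b : R⟦X⟧), (∀ n, Gs n i j = b) → G i j = b := fun i j b hb =>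
    eq_of_forall_hasOrd fun n => by rw [← hb n]; exact hG i j n
  obtain ⟨K, hK⟩ : ∃ K, G * K = 1 := by
    have e : Matrix.map G constantCoeff
        = (Gs 0).map constantCoeff := by ext i j; exact c0 i j
    have : Matrix.map G constantCoeff
        * (Ks 0).map constantCoeff = 1 := by
      rw [e, ← Matrix.map_mul, g0.inv]
      ext i j
      simp [one_apply]
    exact exists_mul_eq_one this
  have g : Gauge g₀ k₀ A G K :=
    { symm := fun i j => eq_of_forall_hasOrd fun n => by
        have h1 := hG i j n
        have h2 := hG j i n
        rw [(hs n).gauge.symm j i] at h2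
        have := h1.sub h2
        rwa [sub_sub_sub_cancel_right] at this
      inv := hK
      ii := lim _ _ _ fun n => (hs n).gauge.ii
      zi := lim _ _ _ fun n => (hs n).gauge.zi
      si := fun i => lim _ _ _ fun n => (hs n).gauge.si i
      zz := by rw [c0, g0.zz]
      zs := fun i => by rw [c0, g0.zs]
      ss := fun i j => by rw [c0, g0.ss]
      inv₀ := hk }
  have α : coeff 1 (G zI zI) = 2 := by
    have := hG zI zI 1 1 (by omega)
    rwa [map_sub, sub_eq_zero, (hs 1).α] at this
  have st : ∀ n, IsStage δ g₀ k₀ A N n G K f φ := fun n =>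
    ((hs n).variation ⟨(hs n).gauge, g, fun i j => hG i j n⟩ α).warpVariation hN
      ⟨(hs n).f₀, hf0, (hs n).inv, hφ, hf n⟩
  have zero : ∀ {b : R⟦X⟧}, (∀ n, HasOrd n b) → b = 0 := fun h =>
    eq_of_forall_hasOrd fun n => by rw [sub_zero]; exact h (n + 1)
  refine ⟨G, K, f, φ, ⟨g, hf0, hφ, fun i j => zero fun n => ?_⟩, zero fun n => (st n).fibre⟩
  by_cases hj : j = nI
  · rw [hj]; exact (st (n + 1)).inf i
  by_cases hi : i = nI
  · rw [hi, (st n).symm hN]; exact (st (n + 1)).inf j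
  exact (st n).tang i j hi hj

end

section

variable {R' : Type*} [CommRing R'] [Algebra ℝ R'] {δ' : Fin d → Der R'} {φ : R →+* R'}
  {j l : Mat d R'}

/-- A change of coordinates on the base. -/
structure BaseMap (φ : R →+* R') (δ : Fin d → Der R) (δ' : Fin d → Der R')
    (j l : Mat d R') : Prop where
  der : ∀ i x, δ' i (φ x) = ∑ a, j i a * φ (δ a x)
  closed : ∀ i k a, δ' i (j k a) = δ' k (j i a)
  inv : j * l = 1
  comm : ∀ i j x, δ i (δ j x) = δ j (δ i x)
  comm' : ∀ i j x, δ' i (δ' j x) = δ' j (δ' i x)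

/-- The block matrix `1 ⊕ j ⊕ 1`. -/
def ambJ (j : Mat d R') : AMat d R'⟦X⟧
  | inl _, inl _ => 1 | inr (inl i), inr (inl a) => C (j i a)
  | inr (inr _), inr (inr _) => 1
  | _, _ => 0

lemma ambJ_z (j : Mat d R') (T : Idx d → R'⟦X⟧) : ∑ a, ambJ j zI a * T a = T zI := by
  rw [sum_idx]; simp [ambJ]

lemma ambJ_i (j : Mat d R') (T : Idx d → R'⟦X⟧) : ∑ a, ambJ j nI a * T a = T nI := by
  rw [sum_idx]; simp [ambJ]

lemma ambJ_s (j : Mat d R') (T : Idx d → R'⟦X⟧) (i : Fin d) :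
    ∑ a, ambJ j (sIdx i) a * T a = ∑ a, C (j i a) * T (sIdx a) := by rw [sum_idx]; simp [ambJ]

lemma ambJ_mul (h : j * l = 1) : ambJ j * ambJ l = 1 := by
  have hc : ∀ a b, ∑ k, C (j a k) * C (l k b) = (C ((1 : Mat d R') a b) : R'⟦X⟧) := by
    intro a b
    rw [← h, mul_apply, map_sum]
    exact sum_ext fun _ => (map_mul _ _ _).symm
  ext1 a b
  rw [mul_apply]
  rcases a with a | a | a
  · rw [ambJ_z]; rcases b with b | b | b <;> simp [ambJ, one_apply]
  · rw [ambJ_s]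
    rcases b with b | b | b
    · simp [ambJ, one_apply]
    · refine (hc a b).trans ?_
      simp [one_apply, apply_ite (C : R' →+* R'⟦X⟧)]
    · simp [ambJ, one_apply]
  · rw [ambJ_i]; rcases b with b | b | b <;> simp [ambJ, one_apply]

lemma serD_C (δ : Der R) (x : R) : serD δ (C x) = C (δ x) := by
  ext n
  rw [coeff_serD, coeff_C, coeff_C]
  split_ifs
  · rfl
  · exact map_zero _

lemma serX_C (x : R) : serX R (C x) = 0 := by
  ext n
  simp [coeff_serX]

namespace BaseMap

lemma frameMap (h : BaseMap φ δ δ' j l) : FrameMap (mapX φ) (ambD δ) (ambQ d R⟦X⟧)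
    (ambD δ') (ambQ d R'⟦X⟧) (ambJ j) (ambJ l) where
  der i x := by
    rcases i with i | i | i
    · rw [ambJ_z]; exact (map_zero _).symm
    · rw [ambJ_s]
      ext n
      simp only [ambD, map_sum, coeff_C_mul, coeff_map, coeff_serD, h.der]
    · rw [ambJ_i]
      ext n
      simp [ambD, coeff_serX]
  closed i k a := by
    rcases i with i | i | i <;> rcases k with k | k | k <;> rcases a with a | a | a <;>
      first
        | exact congrArg (C : R' →+* R'⟦X⟧) (h.closed i k a) |> (serD_C _ _).trans |>.trans
            (serD_C _ _).symm
        | simp [ambD, ambJ, serX_C]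
  inv := ambJ_mul h.inv
  twist i := by
    rcases i with i | i | i
    · rw [ambJ_z]; simp [ambQ]
    · rw [ambJ_s]; simp [ambQ]
    · rw [ambJ_i]; simp [ambQ]
  comm := ambD_comm _ h.comm
  comm' := ambD_comm _ h.comm'

lemma base_inv (h : BaseMap φ δ δ' j l) {g₀ k₀ : Mat d R} (hk : g₀ * k₀ = 1) :
    (j * g₀.map φ * j.transpose) * (l.transpose * k₀.map φ * l) = 1 := by
  have e : g₀.map φ * k₀.map φ = 1 := by
    rw [← Matrix.map_mul, hk]; ext a b; simp [one_apply, apply_ite φ]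
  have e2 : j.transpose * l.transpose = 1 := by
    rw [← transpose_mul, mul_eq_one_comm.1 h.inv, transpose_one]
  calc (j * g₀.map φ * j.transpose) * (l.transpose * k₀.map φ * l)
      = j * g₀.map φ * (j.transpose * l.transpose) * k₀.map φ * l := by noncomm_ring
    _ = j * (g₀.map φ * k₀.map φ) * l := by rw [e2, mul_one]; noncomm_ring
    _ = 1 := by rw [e, mul_one, h.inv]

variable {ψ : R⟦X⟧}

/-- The ambient metric in new coordinates. -/
def pullG (φ : R →+* R') (j : Mat d R') (G : AMat d R⟦X⟧) : AMat d R'⟦X⟧ :=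
  ambJ j * G.map (mapX φ) * (ambJ j).transpose

/-- The inverse ambient metric in new coordinates. -/
def pullK (φ : R →+* R') (l : Mat d R') (K : AMat d R⟦X⟧) : AMat d R'⟦X⟧ :=
  (ambJ l).transpose * K.map (mapX φ) * ambJ l

lemma pullG_apply (G : AMat d R⟦X⟧) (a b : Idx d) : pullG φ j G a b
    = ∑ c, ambJ j a c * ∑ e, ambJ j b e * mapX φ (G c e) := by
  refine (mul_pullTensor_mul _ _ _ a b).trans (sum_ext fun _ => ?_)
  rw [mul_sum]
  exact sum_ext fun _ => by ring

lemma pullG_zz (G : AMat d R⟦X⟧) : pullG φ j G zI zI = mapX φ (G zI zI) := by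
  rw [pullG_apply, ambJ_z, ambJ_z]

lemma pullG_zi (G : AMat d R⟦X⟧) : pullG φ j G zI nI = mapX φ (G zI nI) := by
  rw [pullG_apply, ambJ_z, ambJ_i]

lemma pullG_ii (G : AMat d R⟦X⟧) : pullG φ j G nI nI = mapX φ (G nI nI) := by
  rw [pullG_apply, ambJ_i, ambJ_i]

lemma pullG_zs (G : AMat d R⟦X⟧) (i : Fin d) : pullG φ j G zI (sIdx i)
    = ∑ a, C (j i a) * mapX φ (G zI (sIdx a)) := by rw [pullG_apply, ambJ_z, ambJ_s]

lemma pullG_si (G : AMat d R⟦X⟧) (i : Fin d) : pullG φ j G (sIdx i) nI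
    = ∑ a, C (j i a) * mapX φ (G (sIdx a) nI) := by
  rw [pullG_apply, ambJ_s]
  exact sum_ext fun _ => by rw [ambJ_i]

lemma pullG_ss (G : AMat d R⟦X⟧) (i k : Fin d) : pullG φ j G (sIdx i) (sIdx k)
    = ∑ a, C (j i a) * ∑ b, C (j k b) * mapX φ (G (sIdx a) (sIdx b)) := by
  rw [pullG_apply, ambJ_s]
  exact sum_ext fun _ => by rw [ambJ_s]

lemma gauge (h : BaseMap φ δ δ' j l) (s : Gauge g₀ k₀ A G K) :
    Gauge (j * g₀.map φ * j.transpose) (l.transpose * k₀.map φ * l)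
      (fun i => ∑ a, C (j i a) * mapX φ (A a)) (pullG φ j G) (pullK φ l K) where
  symm a b := by
    rw [pullG_apply, pullG_apply]
    simp only [mul_sum]
    rw [sum_comm]
    exact sum_ext₂ fun _ _ => by rw [s.symm]; ring
  inv := h.frameMap.mul_inv s.inv
  ii := by rw [pullG_ii, s.ii, map_zero]
  zi := by rw [pullG_zi, s.zi, map_one]
  si i := by rw [pullG_si]; simp only [s.si]
  zz := by
    rw [pullG_zz, ← coeff_zero, coeff_map, coeff_zero, s.zz, map_zero]
  zs i := by
    rw [pullG_zs, map_sum]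
    refine sum_eq_zero fun a _ => ?_
    rw [map_mul, ← coeff_zero, ← coeff_zero (map φ _),
      coeff_map, coeff_zero (G _ _), s.zs, map_zero, mul_zero]
  ss i k := by
    have e : ∀ F : R⟦X⟧, constantCoeff (mapX φ F) = φ (constantCoeff F) := fun F => by
      rw [← coeff_zero, coeff_map, coeff_zero]
    simp only [pullG_ss, map_sum, map_mul, constantCoeff_C, e, s.ss, mul_apply,
      map_apply, transpose_apply, mul_sum, sum_mul]
    rw [sum_comm]
    exact sum_ext₂ fun _ _ => by ring
  inv₀ := h.base_inv s.inv₀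

lemma isFormalSolution (h : BaseMap φ δ δ' j l) (s : IsFormalSolution δ g₀ k₀ A N G K f ψ) :
    IsFormalSolution δ' (j * g₀.map φ * j.transpose) (l.transpose * k₀.map φ * l)
      (fun i => ∑ a, C (j i a) * mapX φ (A a)) (φ N) (pullG φ j G) (pullK φ l K)
      (mapX φ f) (mapX φ ψ) where
  gauge := h.gauge s.gauge
  f₀ := by
    rw [← coeff_zero, coeff_map, coeff_zero, s.f₀, map_one]
  inv := by rw [← map_mul, s.inv, map_one]
  base a b := by
    have e := h.frameMap.baseA_chr s.gauge.symm s.gauge.inv (C N) f ψ a b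
    rw [map_C] at e
    refine e.trans ?_
    rw [pullTensor]
    exact sum_eq_zero fun _ _ => sum_eq_zero fun _ _ => by rw [s.base, map_zero, mul_zero]

lemma fibre (h : BaseMap φ δ δ' j l) (s : IsFormalSolution δ g₀ k₀ A N G K f ψ)
    (hs : fibre[δ] (C N) K (chr[δ] G K) f = 0) : fibre[δ'] (C (φ N)) (pullK φ l K)
      (chr[δ'] (pullG φ j G) (pullK φ l K)) (mapX φ f) = 0 := by
  have e := h.frameMap.fibreA_chr s.gauge.symm s.gauge.inv (C N) f
  rw [map_C, hs, map_zero] at e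
  exact e

lemma of_commute (hd : ∀ i x, δ' i (φ x) = φ (δ i x)) (hc : ∀ i j x, δ i (δ j x) = δ j (δ i x))
    (hc' : ∀ i j x, δ' i (δ' j x) = δ' j (δ' i x)) : BaseMap φ δ δ' 1 1 where
  der i x := by simp [hd, one_apply]
  closed i k a := by
    simp only [one_apply, apply_ite (δ' _), Derivation.map_one_eq_zero, map_zero, ite_self]
  inv := one_mul _
  comm := hc
  comm' := hc'

lemma ambJ_one : ambJ (1 : Mat d R') = 1 := by
  ext1 a b
  rcases a with a | a | a <;> rcases b with b | b | b <;>
    simp [ambJ, one_apply, apply_ite (C : R' →+* R'⟦X⟧)]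

lemma pullG_one (G : AMat d R⟦X⟧) : pullG φ 1 G = G.map (mapX φ) := by
  rw [pullG, ambJ_one, one_mul, transpose_one, mul_one]

end BaseMap

end

end

section
open Filter
variable {𝕜 : Type*} [RCLike 𝕜] {V : Type*} [NormedAddCommGroup V] [NormedSpace ℝ V] {Ω : Opens V}
  {E : Type*} [NormedAddCommGroup E] [NormedSpace ℝ E] {d : ℕ} {M : Type*} [TopologicalSpace M]
  [ChartedSpace ℰ d M] [IsManifold (𝓡 d) ∞ M] {p q : ℕ} {r : WeylPair d M p q} {A : Acceleration d M}
  {U : Set (Total M)} {g : TwoTensor d M 𝕜} {f : Total M → 𝕜} {D : 𝕜} {x₀ x₁ : M}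

section SmoothFunctions

variable (𝕜)

variable {𝕜} in
open Classical in
/-- The extension by zero of a function on an open set. -/
def extz (F : Ω → 𝕜) (y : V) : 𝕜 := if h : y ∈ Ω then F ⟨y, h⟩ else 0

variable {𝕜} in
lemma extz_of_mem (F : Ω → 𝕜) {y : V} (h : y ∈ Ω) : extz F y = F ⟨y, h⟩ := dif_pos h

/-- The algebra of smooth functions on an open set. -/
def smAlg (Ω : Opens V) : Subalgebra ℝ (Ω → 𝕜) where
  carrier := {F | SmoothOn (extz F) Ω}
  add_mem' {F G} hF hG := (hF.add hG).congr fun y hy => by simp [extz_of_mem _ hy]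
  mul_mem' {F G} hF hG := (hF.mul hG).congr fun y hy => by simp [extz_of_mem _ hy]
  algebraMap_mem' c := (contDiffOn_const (c := algebraMap ℝ 𝕜 c)).congr fun y hy => by
    simp [extz_of_mem _ hy]

/-- The ring of smooth functions on an open set. -/
def Sm (Ω : Opens V) : Type _ := smAlg 𝕜 Ω

instance (Ω : Opens V) : CommRing (Sm 𝕜 Ω) := inferInstanceAs (CommRing (smAlg 𝕜 Ω))

instance (Ω : Opens V) : Algebra ℝ (Sm 𝕜 Ω) := inferInstanceAs (Algebra ℝ (smAlg 𝕜 Ω))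

variable {𝕜}

/-- The smooth function on `Ω` given by a function on the ambient space. -/
def smMk (F : V → 𝕜) (h : SmoothOn F Ω) : Sm 𝕜 Ω :=
  (⟨fun y => F y, h.congr fun y hy => by rw [extz_of_mem _ hy]⟩ : smAlg 𝕜 Ω)

/-- Evaluation at a point. -/
def ev (y : V) (hy : y ∈ Ω) : Sm 𝕜 Ω →ₐ[ℝ] 𝕜 :=
  (Pi.evalAlgHom ℝ (fun _ : Ω => 𝕜) ⟨y, hy⟩).comp (smAlg 𝕜 Ω).val

@[simp]
lemma ev_smMk (F : V → 𝕜) (h : SmoothOn F Ω) (y : V) (hy : y ∈ Ω) : ev y hy (smMk F h) = F y := rfl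

lemma sm_ext {F G : Sm 𝕜 Ω} (h : ∀ y hy, ev y hy F = ev y hy G) : F = G :=
  Subtype.ext (funext fun y => h y.1 y.2)

lemma extz_eq_ev (F : Sm 𝕜 Ω) {y : V} (hy : y ∈ Ω) : extz F.1 y = ev y hy F := extz_of_mem _ hy

lemma contDiffOn_extz (F : Sm 𝕜 Ω) : SmoothOn (extz F.1) Ω := F.2

lemma contDiffAt_extz (F : Sm 𝕜 Ω) {y : V} (hy : y ∈ Ω) : ContDiffAt ℝ ∞ (extz F.1) y :=
  (contDiffOn_extz F).contDiffAt (Ω.2.mem_nhds hy)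

lemma differentiableAt_extz (F : Sm 𝕜 Ω) {y : V} (hy : y ∈ Ω) :
    DifferentiableAt ℝ (extz F.1) y := (contDiffAt_extz F hy).differentiableAt (by simp)

lemma extz_eventuallyEq {F : Sm 𝕜 Ω} {f : V → 𝕜} (h : ∀ y hy, ev y hy F = f y) {y : V}
    (hy : y ∈ Ω) : extz F.1 =ᶠ[𝓝 y] f := by
  filter_upwards [Ω.2.mem_nhds hy] with z hz
  rw [extz_eq_ev F hz, h]

lemma contDiffOn_fderiv_apply {F : V → 𝕜} (h : SmoothOn F Ω) (v : V) :
    SmoothOn (fun y => fderiv ℝ F y v) Ω :=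
  (h.fderiv_of_isOpen Ω.2 (m := ∞) (by simp)).clm_apply contDiffOn_const

variable (𝕜 Ω) in
/-- The derivative in the direction `v`. -/
def smD (v : V) : Derivation ℝ (Sm 𝕜 Ω) (Sm 𝕜 Ω) :=
  Derivation.mk'
    { toFun := fun F => smMk _ (contDiffOn_fderiv_apply (contDiffOn_extz F) v)
      map_add' := fun F G => sm_ext fun y hy => by
        have e : extz (F + G).1 =ᶠ[𝓝 y] extz F.1 + extz G.1 := extz_eventuallyEq
          (fun z hz => by rw [map_add, Pi.add_apply, extz_eq_ev F hz, extz_eq_ev G hz]) hy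
        rw [map_add, ev_smMk, ev_smMk, ev_smMk, e.fderiv_eq,
          fderiv_add (differentiableAt_extz F hy) (differentiableAt_extz G hy)]
        rfl
      map_smul' := fun c F => sm_ext fun y hy => by
        have e : extz (c • F).1 =ᶠ[𝓝 y] c • extz F.1 := extz_eventuallyEq
          (fun z hz => by rw [map_smul, Pi.smul_apply, extz_eq_ev F hz]) hy
        rw [RingHom.id_apply, map_smul, ev_smMk, ev_smMk, e.fderiv_eq,
          fderiv_const_smul (differentiableAt_extz F hy)]
        rfl }
    (fun F G => sm_ext fun y hy => by
      have e : extz (F * G).1 =ᶠ[𝓝 y] extz F.1 * extz G.1 := extz_eventuallyEq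
        (fun z hz => by rw [map_mul, Pi.mul_apply, extz_eq_ev F hz, extz_eq_ev G hz]) hy
      simp only [LinearMap.coe_mk, AddHom.coe_mk, smul_eq_mul, map_add, map_mul, ev_smMk]
      rw [e.fderiv_eq, fderiv_mul (differentiableAt_extz F hy) (differentiableAt_extz G hy)]
      simp only [add_apply, smul_apply, smul_eq_mul, extz_eq_ev F hy, extz_eq_ev G hy])

lemma ev_smD_extz (v : V) (F : Sm 𝕜 Ω) (y : V) (hy : y ∈ Ω) :
    ev y hy (smD 𝕜 Ω v F) = fderiv ℝ (extz F.1) y v := rfl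

lemma ev_smD (v : V) {F : Sm 𝕜 Ω} {f : V → 𝕜} (h : ∀ y hy, ev y hy F = f y) (y : V)
    (hy : y ∈ Ω) : ev y hy (smD 𝕜 Ω v F) = fderiv ℝ f y v := by
  rw [ev_smD_extz, (extz_eventuallyEq h hy).fderiv_eq]

lemma smD_comm (v w : V) (F : Sm 𝕜 Ω) : smD 𝕜 Ω v (smD 𝕜 Ω w F) = smD 𝕜 Ω w (smD 𝕜 Ω v F) := by
  refine sm_ext fun y hy => ?_
  have hf : ∀ u : V, ∀ z hz, ev z hz (smD 𝕜 Ω u F) = fderiv ℝ (extz F.1) z u := fun u z hz => rfl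
  rw [ev_smD v (hf w), ev_smD w (hf v)]
  have h2 := contDiffAt_extz F hy
  have hd : DifferentiableAt ℝ (fderiv ℝ (extz F.1)) y :=
    (h2.fderiv_right (m := 1) (by rw [one_add_one_eq_two]; exact ENat.LEInfty.out)).differentiableAt (by simp)
  have hs : IsSymmSndFDerivAt ℝ (extz F.1) y := h2.isSymmSndFDerivAt (by simp; exact ENat.LEInfty.out)
  rw [fderiv_clm_apply hd (differentiableAt_const _), fderiv_clm_apply hd (differentiableAt_const _)]
  simpa using hs v w

lemma sm_isUnit {F : Sm 𝕜 Ω} (h : ∀ y hy, ev y hy F ≠ 0) : IsUnit F := by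
  have hs : SmoothOn (fun y => (extz F.1 y)⁻¹) Ω :=
    (contDiffOn_extz F).inv fun y hy => by rw [extz_eq_ev F hy]; exact h y hy
  refine IsUnit.of_mul_eq_one (smMk _ hs) (sm_ext fun y hy => ?_)
  rw [map_mul, ev_smMk, extz_eq_ev F hy, mul_inv_cancel₀ (h y hy), map_one]

/-- The constant function. -/
def smC (c : 𝕜) : Sm 𝕜 Ω := smMk (fun _ => c) contDiffOn_const

@[simp] lemma ev_smC (c : 𝕜) (y : V) (hy : y ∈ Ω) : ev y hy (smC c) = c := rfl

lemma smD_smC (v : V) (c : 𝕜) : smD 𝕜 Ω v (smC c : Sm 𝕜 Ω) = 0 := by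
  refine sm_ext fun y hy => ?_
  rw [ev_smD v (f := fun _ => c) (fun _ _ => rfl)]
  simp

variable {V' : Type*} [NormedAddCommGroup V'] [NormedSpace ℝ V'] {Ω' : Opens V'}

/-- The pullback of smooth functions along a smooth map. -/
def smComap (τ : V' → V) (hτ : SmoothOn τ Ω') (hm : ∀ y ∈ Ω', τ y ∈ Ω) : Sm 𝕜 Ω →ₐ[ℝ] Sm 𝕜 Ω' where
  toFun F := smMk (fun y => extz F.1 (τ y)) ((contDiffOn_extz F).comp hτ hm)
  map_one' := sm_ext fun y hy => by rw [ev_smMk, extz_eq_ev _ (hm y hy), map_one, map_one]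
  map_mul' F G := sm_ext fun y hy => by simp only [map_mul, ev_smMk, extz_eq_ev _ (hm y hy)]
  map_zero' := sm_ext fun y hy => by rw [ev_smMk, extz_eq_ev _ (hm y hy), map_zero, map_zero]
  map_add' F G := sm_ext fun y hy => by simp only [map_add, ev_smMk, extz_eq_ev _ (hm y hy)]
  commutes' c := sm_ext fun y hy => by
    rw [ev_smMk, extz_eq_ev _ (hm y hy), AlgHom.commutes, AlgHom.commutes]

lemma ev_smComap (τ : V' → V) (hτ : SmoothOn τ Ω') (hm : ∀ y ∈ Ω', τ y ∈ Ω)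
    (F : Sm 𝕜 Ω) (y : V') (hy : y ∈ Ω') : ev y hy (smComap τ hτ hm F) = ev (τ y) (hm y hy) F := by
  change extz F.1 (τ y) = _
  rw [extz_eq_ev]

lemma ev_smD_smComap (τ : V' → V) (hτ : SmoothOn τ Ω') (hm : ∀ y ∈ Ω', τ y ∈ Ω)
    (v : V') (F : Sm 𝕜 Ω) (y : V') (hy : y ∈ Ω') :
    ev y hy (smD 𝕜 Ω' v (smComap τ hτ hm F)) = ev (τ y) (hm y hy) (smD 𝕜 Ω (fderiv ℝ τ y v) F) := by
  have hd : DifferentiableAt ℝ τ y := (hτ.contDiffAt (Ω'.2.mem_nhds hy)).differentiableAt (by simp)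
  rw [ev_smD v (f := fun y => extz F.1 (τ y)) (fun _ _ => rfl), ev_smD_extz,
    fderiv_fun_comp y (differentiableAt_extz F (hm y hy)) hd]
  rfl

lemma smD_sum {ι : Type*} (s : Finset ι) (c : ι → ℝ) (v : ι → V) (F : Sm 𝕜 Ω) :
    smD 𝕜 Ω (∑ i ∈ s, c i • v i) F = ∑ i ∈ s, c i • smD 𝕜 Ω (v i) F :=
  sm_ext fun y hy => by simp [ev_smD_extz, map_sum]

end SmoothFunctions

section TaylorHom

open PowerSeries

variable {R : Type*} [CommRing R] [Algebra ℝ R] (D : Der R)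

/-- The formal Taylor series `∑ (Dⁿ x / n!) Xⁿ`. -/
def taylorSeries (x : R) : R⟦X⟧ :=
  PowerSeries.mk fun n => ((n.factorial : ℝ)⁻¹) • (D^[n] x)

lemma coeff_taylorSeries (n : ℕ) (x : R) :
    coeff n (taylorSeries D x) = ((n.factorial : ℝ)⁻¹) • (D^[n] x) := coeff_mk _ _

lemma serX_taylorSeries (x : R) : serX R (taylorSeries D x) = taylorSeries D (D x) := by
  ext n
  rw [coeff_serX, coeff_taylorSeries, coeff_taylorSeries, ← Function.iterate_succ_apply]
  have h : ((n : R) + 1) = algebraMap ℝ R (n + 1) := by simp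
  rw [h, ← Algebra.smul_def, smul_smul]
  congr 1
  rw [Nat.factorial_succ]
  push_cast
  field_simp

lemma succ_mul_coeff_inj {n : ℕ} {a b : R⟦X⟧}
    (h : coeff n (serX R a) = coeff n (serX R b)) : coeff (n + 1) a = coeff (n + 1) b := by
  rw [coeff_serX, coeff_serX] at h
  exact (isUnit_natCast_succ n).mul_left_cancel h

lemma taylorSeries_mul (x y : R) :
    taylorSeries D (x * y) = taylorSeries D x * taylorSeries D y := by
  have main : ∀ n x y, coeff n (taylorSeries D (x * y))
      = coeff n (taylorSeries D x * taylorSeries D y) := by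
    intro n
    induction n with
    | zero => intro x y; simp [coeff_taylorSeries, coeff_mul]
    | succ n ih =>
      intro x y
      refine succ_mul_coeff_inj ?_
      rw [serX_taylorSeries, Derivation.leibniz, Derivation.leibniz, serX_taylorSeries,
        serX_taylorSeries]
      have add : ∀ a b, taylorSeries D (a + b) = taylorSeries D a + taylorSeries D b := by
        intro a b
        ext m
        simp [coeff_taylorSeries, iterate_map_add]
      simp only [smul_eq_mul, add, map_add, ih]
  ext n
  exact main n x y

/-- The formal Taylor expansion as a ring homomorphism. -/
def taylorHom : R →+* R⟦X⟧ where
  toFun := taylorSeries D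
  map_one' := by
    ext n
    cases n with
    | zero => simp [coeff_taylorSeries]
    | succ n => simp [coeff_taylorSeries, coeff_one]
  map_mul' := taylorSeries_mul D
  map_zero' := by ext n; simp [coeff_taylorSeries]
  map_add' x y := by ext n; simp [coeff_taylorSeries, iterate_map_add]

lemma coeff_taylorHom (n : ℕ) (x : R) :
    coeff n (taylorHom D x) = ((n.factorial : ℝ)⁻¹) • (D^[n] x) := coeff_taylorSeries D n x

lemma serX_taylorHom (x : R) : serX R (taylorHom D x) = taylorHom D (D x) :=
  serX_taylorSeries D x

lemma serD_taylorHom (δ : Der R) (h : ∀ x, δ (D x) = D (δ x)) (x : R) :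
    serD δ (taylorHom D x) = taylorHom D (δ x) := by
  have e : ∀ n x, δ (D^[n] x) = D^[n] (δ x) := by
    intro n
    induction n with
    | zero => intro x; rfl
    | succ n ih => intro x; rw [Function.iterate_succ_apply, ih, h, ← Function.iterate_succ_apply]
  ext n
  rw [coeff_serD, coeff_taylorHom, coeff_taylorHom, Derivation.map_smul, e]

end TaylorHom

section Vanishing

lemma iteratedDeriv_eq_zero_of_isBigO {g : ℝ → 𝕜} (hg : ContDiffAt ℝ ∞ g 0)
    (h : ∀ k : ℕ, g =O[𝓝 0] fun ρ => ‖ρ‖ ^ k) (n : ℕ) : iteratedDeriv n g 0 = 0 := by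
  induction n using Nat.strong_induction_on with
  | _ n ih =>
    obtain ⟨u, hu, hgu⟩ := (hg.of_le (ENat.LEInfty.out : (n : WithTop ℕ∞) ≤ ∞)).contDiffOn' le_rfl
      (by simp)
    simp only [Set.insert_eq_of_mem, Set.mem_univ, Set.univ_inter] at hgu
    obtain ⟨r, hr, hru⟩ := Metric.isOpen_iff.1 hu 0 hgu.1
    have ho := taylor_isLittleO (convex_ball (0 : ℝ) r) (Metric.mem_ball_self hr)
      (hgu.2.mono hru)
    rw [nhdsWithin_eq_nhds.2 (Metric.ball_mem_nhds _ hr)] at ho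
    have hT : ∀ x, taylorWithinEval g n (Metric.ball 0 r) 0 x
        = (((n.factorial : ℝ)⁻¹ * x ^ n)) • iteratedDeriv n g 0 := by
      intro x
      rw [taylor_within_apply, Finset.sum_range_succ, sum_eq_zero, zero_add,
        iteratedDerivWithin_of_isOpen Metric.isOpen_ball (Metric.mem_ball_self hr), sub_zero]
      intro k hk
      rw [iteratedDerivWithin_of_isOpen Metric.isOpen_ball (Metric.mem_ball_self hr),
        ih k (Finset.mem_range.1 hk), smul_zero]
    simp only [hT, sub_zero] at ho
    have h1 : g =o[𝓝 0] fun ρ : ℝ => ρ ^ n := by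
      refine (h (n + 1)).trans_isLittleO ?_
      have := Asymptotics.isLittleO_norm_pow_norm_pow (E' := ℝ) (Nat.lt_succ_self n)
      exact this.trans_isBigO (Asymptotics.isBigO_of_le _ fun x => by simp)
    have h2 := h1.sub ho
    simp only [sub_sub_cancel] at h2
    by_contra hc
    have hf : (0 : ℝ) < n.factorial := by positivity
    have hpos : 0 < ‖iteratedDeriv n g 0‖ / (2 * n.factorial) := by positivity
    have h3 := (Asymptotics.isLittleO_iff.1 h2) hpos
    obtain ⟨x, hx, hx0⟩ := ((h3.filter_mono nhdsWithin_le_nhds).and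
      (self_mem_nhdsWithin (a := (0 : ℝ)) (s := {0}ᶜ))).exists
    have hxn : 0 < ‖x ^ n‖ := norm_pos_iff.2 (pow_ne_zero _ hx0)
    rw [norm_smul, norm_mul, norm_inv, Real.norm_natCast] at hx
    have e : (n.factorial : ℝ)⁻¹ * ‖x ^ n‖ * ‖iteratedDeriv n g 0‖
        = 2 * (‖iteratedDeriv n g 0‖ / (2 * n.factorial) * ‖x ^ n‖) := by field_simp
    have : 0 < ‖iteratedDeriv n g 0‖ / (2 * n.factorial) * ‖x ^ n‖ := by positivity
    linarith

lemma isBigO_pow_of_iterate {Ω : Set (E × ℝ)} (hΩ : IsOpen Ω) {y₀ : E} (hy₀ : (y₀, (0 : ℝ)) ∈ Ω)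
    (F : ℕ → E × ℝ → 𝕜) (hd : ∀ n, ∀ w ∈ Ω, HasDerivAt (fun ρ => F n (w.1, ρ)) (F (n + 1) w) w.2)
    (hc : ∀ n, ContinuousAt (F n) (y₀, 0)) (h0 : ∀ n y, (y, (0 : ℝ)) ∈ Ω → F n (y, 0) = 0) (k : ℕ) :
    ∀ n, ∃ C : ℝ, ∀ᶠ w in 𝓝 (y₀, (0 : ℝ)), ‖F n w‖ ≤ C * |w.2| ^ k := by
  induction k with
  | zero =>
    intro n
    refine ⟨‖F n (y₀, 0)‖ + 1, ?_⟩
    have := ((hc n).norm).eventually_lt_const (lt_add_one _)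
    filter_upwards [this] with w hw
    simpa using hw.le
  | succ k ih =>
    intro n
    obtain ⟨C, hC⟩ := ih (n + 1)
    refine ⟨C, ?_⟩
    obtain ⟨r, hr, hball⟩ := Metric.eventually_nhds_iff_ball.1 (hC.and (hΩ.mem_nhds hy₀))
    filter_upwards [Metric.ball_mem_nhds (y₀, (0 : ℝ)) hr] with w hw
    rw [← ball_prod_same] at hw hball
    have hseg : ∀ s ∈ Set.uIcc 0 w.2, ((w.1, s) : E × ℝ) ∈ Metric.ball y₀ r ×ˢ Metric.ball 0 r := by
      intro s hs
      refine ⟨hw.1, ?_⟩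
      have h2 : |w.2| < r := by simpa using hw.2
      have : |s| ≤ |w.2| := by
        have := Set.abs_sub_left_of_mem_uIcc hs
        simpa using this
      simpa using this.trans_lt h2
    have hC0 : ∀ s ∈ Set.uIcc 0 w.2, ‖F (n + 1) (w.1, s)‖ ≤ C * |w.2| ^ k := by
      intro s hs
      refine (hball _ (hseg s hs)).1.trans ?_
      have h1 : |s| ≤ |w.2| := by simpa using Set.abs_sub_left_of_mem_uIcc hs
      have hCnn : 0 ≤ C ∨ |w.2| ^ k = 0 := by
        by_contra hcon
        push Not at hcon
        have := (hball _ (hseg w.2 Set.right_mem_uIcc)).1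
        have h3 : 0 < |w.2| ^ k := lt_of_le_of_ne (by positivity) (Ne.symm hcon.2)
        have := (norm_nonneg _).trans this
        nlinarith [hcon.1]
      rcases hCnn with hCnn | h0'
      · exact mul_le_mul_of_nonneg_left (pow_le_pow_left₀ (abs_nonneg _) h1 k) hCnn
      · have : |s| ^ k = 0 := le_antisymm (h0' ▸ pow_le_pow_left₀ (abs_nonneg _) h1 k) (by positivity)
        rw [this, h0']
    have mv := (convex_uIcc (0 : ℝ) w.2).norm_image_sub_le_of_norm_hasDerivWithin_le
      (f := fun ρ => F n (w.1, ρ)) (fun s hs => (hd n (w.1, s) (hball _ (hseg s hs)).2).hasDerivWithinAt)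
      hC0 Set.left_mem_uIcc Set.right_mem_uIcc
    rw [h0 n _ (hball _ (hseg 0 Set.left_mem_uIcc)).2, sub_zero, sub_zero, Real.norm_eq_abs] at mv
    rw [pow_succ, ← mul_assoc]
    exact mv

end Vanishing

section Jets

variable {Ω : Opens (E × ℝ)} {W : Opens E} (hW : ∀ x ∈ W, (x, (0 : ℝ)) ∈ Ω)

/-- Restriction to `ρ = 0`. -/
def smRes : Sm 𝕜 Ω →ₐ[ℝ] Sm 𝕜 W :=
  smComap (fun x => (x, (0 : ℝ))) (contDiffOn_id.prodMk contDiffOn_const) hW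

lemma ev_smRes (F : Sm 𝕜 Ω) (x : E) (hx : x ∈ W) :
    ev x hx (smRes hW F) = ev (x, 0) (hW x hx) F := ev_smComap _ _ _ _ _ _

lemma smD_smRes (v : E) (F : Sm 𝕜 Ω) : smD 𝕜 W v (smRes hW F) = smRes hW (smD 𝕜 Ω (v, 0) F) := by
  refine sm_ext fun x hx => ?_
  rw [smRes, ev_smD_smComap, ev_smComap]
  have : fderiv ℝ (fun x : E => (x, (0 : ℝ))) x v = (v, 0) := by
    rw [DifferentiableAt.fderiv_prodMk differentiableAt_fun_id (differentiableAt_const _)]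
    simp
  rw [this]

/-- The Taylor expansion in `ρ`. -/
def jet : Sm 𝕜 Ω →+* (Sm 𝕜 W)⟦X⟧ :=
  (mapX (smRes hW).toRingHom).comp (taylorHom (smD 𝕜 Ω (0, 1)))

lemma coeff_jet (n : ℕ) (F : Sm 𝕜 Ω) : coeff n (jet hW F)
    = ((n.factorial : ℝ)⁻¹) • smRes hW ((smD 𝕜 Ω (0, 1))^[n] F) := by
  change coeff n (mapX (smRes hW).toRingHom (taylorHom _ F)) = _
  rw [coeff_map, coeff_taylorHom]
  exact map_smul (smRes hW) _ _

lemma constantCoeff_jet (F : Sm 𝕜 Ω) : constantCoeff (jet hW F) = smRes hW F := by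
  rw [← coeff_zero, coeff_jet]
  simp

lemma serX_jet (F : Sm 𝕜 Ω) : serX (Sm 𝕜 W) (jet hW F) = jet hW (smD 𝕜 Ω (0, 1) F) := by
  have e := serX_taylorHom (smD 𝕜 Ω ((0 : E), (1 : ℝ))) F
  have h : ∀ f : (Sm 𝕜 Ω)⟦X⟧, serX (Sm 𝕜 W) (mapX (smRes hW).toRingHom f)
      = mapX (smRes hW).toRingHom (serX (Sm 𝕜 Ω) f) := by
    intro f; ext1 n; simp [coeff_map]
  change serX (Sm 𝕜 W) (mapX (smRes hW).toRingHom (taylorHom (smD 𝕜 Ω (0, 1)) F))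
    = mapX (smRes hW).toRingHom (taylorHom (smD 𝕜 Ω (0, 1)) (smD 𝕜 Ω (0, 1) F))
  rw [h, e]

lemma serD_jet (v : E) (F : Sm 𝕜 Ω) : serD (smD 𝕜 W v) (jet hW F) = jet hW (smD 𝕜 Ω (v, 0) F) := by
  have e := serD_taylorHom (smD 𝕜 Ω ((0 : E), (1 : ℝ))) (smD 𝕜 Ω (v, 0))
    (fun x => smD_comm _ _ _) F
  change serD (smD 𝕜 W v)
      (mapX (smRes hW).toRingHom (taylorHom (smD 𝕜 Ω (0, 1)) F))
    = mapX (smRes hW).toRingHom (taylorHom (smD 𝕜 Ω (0, 1)) (smD 𝕜 Ω (v, 0) F))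
  rw [← e]
  ext1 n
  simp only [coeff_map, coeff_serD]
  exact smD_smRes hW v _

lemma ev_iterate (n : ℕ) (F : Sm 𝕜 Ω) (x : E) (ρ : ℝ) (h : (x, ρ) ∈ Ω) :
    ev (x, ρ) h ((smD 𝕜 Ω (0, 1))^[n] F) = iteratedDeriv n (fun r => extz F.1 (x, r)) ρ := by
  induction n generalizing ρ with
  | zero => exact (extz_eq_ev F h).symm
  | succ n ih =>
    rw [Function.iterate_succ_apply', iteratedDeriv_succ]
    set F' := (smD 𝕜 Ω ((0 : E), (1 : ℝ)))^[n] F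
    have hd : DifferentiableAt ℝ (extz F'.1) (x, ρ) := differentiableAt_extz F' h
    have e1 : HasDerivAt (fun r => extz F'.1 (x, r)) (fderiv ℝ (extz F'.1) (x, ρ) (0, 1)) ρ := by
      have h1 : HasDerivAt (fun r : ℝ => (x, r)) ((0 : E), (1 : ℝ)) ρ :=
        (hasDerivAt_const ρ x).prodMk (hasDerivAt_id ρ)
      exact hd.hasFDerivAt.comp_hasDerivAt ρ h1
    have e2 : (fun r => extz F'.1 (x, r)) =ᶠ[𝓝 ρ]
        iteratedDeriv n (fun r => extz F.1 (x, r)) := by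
      have : ∀ᶠ r in 𝓝 ρ, (x, r) ∈ Ω :=
        (Continuous.prodMk_right x).continuousAt.eventually_mem (Ω.2.mem_nhds h)
      filter_upwards [this] with r hr
      rw [extz_eq_ev F' hr, ih r hr]
    rw [ev_smD_extz, ← e2.deriv_eq, e1.deriv]

lemma ev_coeff_jet (n : ℕ) (F : Sm 𝕜 Ω) (x : E) (hx : x ∈ W) : ev x hx (coeff n (jet hW F))
      = ((n.factorial : ℝ)⁻¹) • iteratedDeriv n (fun r => extz F.1 (x, r)) 0 := by
  rw [coeff_jet, map_smul, ev_smRes, ev_iterate]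

lemma jet_eq_zero_of_isBigO {F : Sm 𝕜 Ω} (h : ∀ x ∈ W, ∀ k : ℕ,
    (fun ρ => extz F.1 (x, ρ)) =O[𝓝 0] fun ρ : ℝ => ‖ρ‖ ^ k) : jet hW F = 0 := by
  ext1 n
  refine sm_ext fun x hx => ?_
  have hs : ContDiffAt ℝ ∞ (fun ρ => extz F.1 (x, ρ)) 0 :=
    (contDiffAt_extz F (hW x hx)).comp (0 : ℝ) (contDiffAt_const.prodMk contDiffAt_id)
  rw [ev_coeff_jet, iteratedDeriv_eq_zero_of_isBigO hs (h x hx) n]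
  simp

lemma isBigO_of_jet_eq_zero {F : Sm 𝕜 Ω} (h : jet hW F = 0) {x : E} (hx : x ∈ W) (k : ℕ) :
    ∃ C : ℝ, ∀ᶠ w in 𝓝 (x, (0 : ℝ)), ‖extz F.1 w‖ ≤ C * |w.2| ^ k := by
  have hO : IsOpen ((Ω : Set (E × ℝ)) ∩ Prod.fst ⁻¹' (W : Set E)) :=
    Ω.2.inter (W.2.preimage continuous_fst)
  refine isBigO_pow_of_iterate hO ⟨hW x hx, hx⟩
    (fun n => extz ((smD 𝕜 Ω ((0 : E), (1 : ℝ)))^[n] F).1) (fun n w hw => ?_) (fun n => ?_)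
    (fun n y hy => ?_) k 0
  · rw [Function.iterate_succ_apply', extz_eq_ev _ hw.1, ev_smD_extz]
    have h1 : HasDerivAt (fun r : ℝ => (w.1, r)) ((0 : E), (1 : ℝ)) w.2 :=
      (hasDerivAt_const _ _).prodMk (hasDerivAt_id _)
    have hd : HasFDerivAt (extz ((smD 𝕜 Ω ((0 : E), (1 : ℝ)))^[n] F).1) _ (w.1, w.2) :=
      (differentiableAt_extz ((smD 𝕜 Ω ((0 : E), (1 : ℝ)))^[n] F) hw.1).hasFDerivAt
    exact hd.comp_hasDerivAt w.2 h1
  · exact (differentiableAt_extz _ (hW x hx)).continuousAt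
  · have e := congrArg (ev y hy.2) (congrArg (coeff n) h)
    rw [coeff_jet, map_smul, ev_smRes, map_zero, map_zero] at e
    rw [extz_eq_ev _ hy.1]
    exact (smul_eq_zero.1 e).resolve_left (by positivity)

end Jets

section Bridge

variable {ι : Type*} [Fintype ι] [DecidableEq ι] {e : ι → V} {Gf : V → Matrix ι ι 𝕜} {ff : V → 𝕜}
  {G K : Matrix ι ι (Sm 𝕜 Ω)} {F φ : Sm 𝕜 Ω}

variable (𝕜 Ω e) in
/-- The coordinate derivations of the ring of smooth functions. -/
def coordD (i : ι) : Derivation ℝ (Sm 𝕜 Ω) (Sm 𝕜 Ω) := smD 𝕜 Ω (e i)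

lemma pd_eq {H : Sm 𝕜 Ω} {h : V → 𝕜} (hh : ∀ y hy, ev y hy H = h y) (i : ι) (y : V) (hy : y ∈ Ω) :
    ev y hy (coordD 𝕜 Ω e i H) = pd e i h y := ev_smD _ hh y hy

lemma ev_half (y : V) (hy : y ∈ Ω) : ev y hy (half (Sm 𝕜 Ω)) = 1 / 2 := by
  rw [half, AlgHom.commutes, map_div₀, map_one, map_ofNat]

variable (hG : ∀ y hy i j, ev y hy (G i j) = Gf y i j) (hK : G * K = 1)
  (hF : ∀ y hy, ev y hy F = ff y) (hφ : F * φ = 1)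

include hG hK

lemma ev_inv (y : V) (hy : y ∈ Ω) (i j : ι) : ev y hy (K i j) = (Gf y)⁻¹ i j := by
  have h : Gf y * K.map (ev y hy) = 1 := by
    have e : G.map (ev y hy) = Gf y := by ext a b; exact hG y hy a b
    rw [← e, ← Matrix.map_mul, hK]
    ext i j
    simp [one_apply, apply_ite (ev y hy)]
  rw [Matrix.inv_eq_right_inv h]
  rfl

lemma ev_chr (y : V) (hy : y ∈ Ω) (k i j : ι) :
    ev y hy (chr (coordD 𝕜 Ω e) 0 G K k i j) = christoffel e Gf k i j y := by
  simp only [chr, lowChr, tw, christoffel, map_sum, map_mul, map_add, map_sub, ev_half,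
    ev_inv hG hK, Pi.zero_apply, mul_zero, zero_mul, add_zero,
    pd_eq (fun z hz => hG z hz _ _)]
  rw [mul_sum]
  exact sum_ext fun _ => by ring

lemma ev_ricA (y : V) (hy : y ∈ Ω) (i j : ι) :
    ev y hy (ricA (coordD 𝕜 Ω e) (chr (coordD 𝕜 Ω e) 0 G K) i j) = ricci e Gf i j y := by
  simp only [ricA, ricci, map_sum, map_mul, map_add, map_sub, ev_chr hG hK,
    pd_eq (fun z hz => ev_chr hG hK z hz _ _ _)]

include hF

lemma ev_hessA (y : V) (hy : y ∈ Ω) (i j : ι) :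
    ev y hy (hessA (coordD 𝕜 Ω e) 0 (chr (coordD 𝕜 Ω e) 0 G K) F i j) = hessian e Gf ff i j y := by
  simp only [hessA, hessian, tw, map_sum, map_mul, map_sub, ev_chr hG hK,
    Pi.zero_apply, mul_zero, zero_mul, add_zero, pd_eq hF, pd_eq (fun z hz => pd_eq hF _ z hz)]

include hφ

lemma ev_baseA (N : 𝕜) (y : V) (hy : y ∈ Ω) (i j : ι) :
    ev y hy (baseA (coordD 𝕜 Ω e) 0 (smC N) (chr (coordD 𝕜 Ω e) 0 G K) F φ i j)
      = warpedRicciBase N e Gf ff i j y := by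
  have h : ff y * ev y hy φ = 1 := by rw [← hF y hy, ← map_mul, hφ, map_one]
  rw [baseA, map_sub, map_mul, map_mul, ev_ricA hG hK, ev_hessA hG hK hF, ev_smC, warpedRicciBase,
    eq_inv_of_mul_eq_one_right h, div_eq_mul_inv]

omit hφ

lemma ev_fibreA (N : 𝕜) (y : V) (hy : y ∈ Ω) :
    ev y hy (fibreA (coordD 𝕜 Ω e) 0 (smC N) K (chr (coordD 𝕜 Ω e) 0 G K) F)
      = -warpedRicciFibre N e Gf ff y := by
  simp only [fibreA, trA, warpedRicciFibre, laplacian, gradSq, map_add, map_mul, map_sum, map_sub,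
    map_one, ev_smC, ev_hessA hG hK hF, hF, ev_inv hG hK, tw, Pi.zero_apply, mul_zero, zero_mul,
    add_zero, pd_eq hF, neg_neg]

end Bridge

section Cone

variable {Ω : Opens (ℰ d × ℝ)}

variable (𝕜 Ω) in
/-- The derivations along `M × ℝ`, extended by zero to the homogeneity direction. -/
def slabD : Idx d → Derivation ℝ (Sm 𝕜 Ω) (Sm 𝕜 Ω)
  | inl _ => 0
  | inr (inl i) => smD 𝕜 Ω (single i 1, 0)
  | inr (inr _) => smD 𝕜 Ω (0, 1)

lemma slabD_comm (i j : Idx d) (x : Sm 𝕜 Ω) :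
    slabD 𝕜 Ω i (slabD 𝕜 Ω j x) = slabD 𝕜 Ω j (slabD 𝕜 Ω i x) := by
  rcases i with i | i | i <;> rcases j with j | j | j <;>
    simp only [slabD, Derivation.coe_zero, Pi.zero_apply, map_zero] <;> exact smD_comm _ _ _

variable (Ω) in
/-- The points `(t, x, ρ)` with `t > 0` and `(x, ρ) ∈ Ω`. -/
def cone : Opens (Coord d) :=
  ⟨{y | 0 < y.1 ∧ y.2 ∈ Ω}, (isOpen_lt continuous_const continuous_fst).inter
    (Ω.2.preimage continuous_snd)⟩

lemma mem_cone {y : Coord d} : y ∈ cone Ω ↔ 0 < y.1 ∧ y.2 ∈ Ω := Iff.rfl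

/-- The factor that relates `∂_t` to `t ∂_t`. -/
def wt (t : ℝ) : Idx d → ℝ | inl _ => t⁻¹ | inr _ => 1

variable (𝕜 Ω) in
/-- Pullback of functions of `(x, ρ)` to the cone. -/
def coneMap : Sm 𝕜 Ω →ₐ[ℝ] Sm 𝕜 (cone Ω) :=
  smComap Prod.snd contDiffOn_snd fun _ hy => hy.2

lemma ev_coneMap (F : Sm 𝕜 Ω) (y : Coord d) (hy : y ∈ cone Ω) :
    ev y hy (coneMap 𝕜 Ω F) = ev y.2 hy.2 F := ev_smComap _ _ _ _ _ _

lemma coordD_coneMap (i : Idx d) (F : Sm 𝕜 Ω) :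
    coordD 𝕜 (cone Ω) (coordBasis d) i (coneMap 𝕜 Ω F) = coneMap 𝕜 Ω (slabD 𝕜 Ω i F) := by
  refine sm_ext fun y hy => ?_
  rw [ev_coneMap, coordD, coneMap, ev_smD_smComap, fderiv_snd]
  rcases i with i | i | i
  · change ev _ _ (smD 𝕜 Ω 0 F) = ev _ _ 0
    rw [ev_smD_extz, map_zero, map_zero]
  · rfl
  · rfl

variable (𝕜 Ω) in
/-- A real smooth function of `t`, as a function on the cone. -/
def coneT (c : ℝ → ℝ) (hc : SmoothOn c (Set.Ioi 0)) : Sm 𝕜 (cone Ω) :=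
  smMk (fun y => ((c y.1 : ℝ) : 𝕜)) ((RCLike.ofRealCLM (K := 𝕜)).contDiff.comp_contDiffOn
    (hc.comp contDiffOn_fst fun (y : Coord d) (hy : y ∈ cone Ω) => hy.1))

lemma contDiffOn_inv_Ioi : SmoothOn (fun t : ℝ => t⁻¹) (Set.Ioi 0) :=
  contDiffOn_id.inv fun _ ht => (Set.mem_Ioi.1 ht).ne'

variable (𝕜 Ω) in
/-- The coordinate function `t`. -/
def coneVar : Sm 𝕜 (cone Ω) := coneT 𝕜 Ω id contDiffOn_id

variable (𝕜 Ω) in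
/-- The function `1 / t`. -/
def coneInv : Sm 𝕜 (cone Ω) := coneT 𝕜 Ω (fun t => t⁻¹) contDiffOn_inv_Ioi

lemma ev_coneVar (y : Coord d) (hy : y ∈ cone Ω) : ev y hy (coneVar 𝕜 Ω) = (y.1 : 𝕜) := rfl

lemma ev_coneInv (y : Coord d) (hy : y ∈ cone Ω) : ev y hy (coneInv 𝕜 Ω) = ((y.1⁻¹ : ℝ) : 𝕜) := rfl

lemma coneVar_mul_coneInv : coneVar 𝕜 Ω * coneInv 𝕜 Ω = 1 := sm_ext fun y hy => by
  rw [map_mul, ev_coneVar, ev_coneInv, ← ofReal_mul, mul_inv_cancel₀ hy.1.ne', map_one, ofReal_one]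

lemma coordD_coneT (c : ℝ → ℝ) (hc : SmoothOn c (Set.Ioi 0)) (i : Idx d) (y : Coord d)
    (hy : y ∈ cone Ω) : ev y hy (coordD 𝕜 (cone Ω) (coordBasis d) i (coneT 𝕜 Ω c hc))
      = ((deriv c y.1 * (coordBasis d i).1 : ℝ) : 𝕜) := by
  have hd : DifferentiableAt ℝ c y.1 :=
    (hc.contDiffAt (isOpen_Ioi.mem_nhds hy.1)).differentiableAt (by simp)
  rw [coordD, ev_smD _ (f := fun y : Coord d => ((c y.1 : ℝ) : 𝕜)) (fun _ _ => rfl)]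
  have h : HasFDerivAt (fun y : Coord d => ((c y.1 : ℝ) : 𝕜))
      (RCLike.ofRealCLM.comp ((fderiv ℝ c y.1).comp (ContinuousLinearMap.fst ℝ _ _))) y :=
    RCLike.ofRealCLM.hasFDerivAt.comp y (hd.hasFDerivAt.comp y hasFDerivAt_fst)
  rw [h.fderiv]
  simp only [ContinuousLinearMap.comp_apply, RCLike.ofRealCLM_apply]
  congr 1
  change fderiv ℝ c y.1 (coordBasis d i).1 = _
  rw [fderiv_eq_smul_deriv, smul_eq_mul, mul_comm]

variable (𝕜 Ω) in
/-- The twist in the coordinate frame. -/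
def coneQ : Idx d → Sm 𝕜 (cone Ω) | inl _ => coneInv 𝕜 Ω | inr _ => 0

variable (𝕜 Ω) in
/-- The weights of the coordinate frame with respect to the homogeneous frame. -/
def coneWt : Idx d → Sm 𝕜 (cone Ω) | inl _ => coneInv 𝕜 Ω | inr _ => 1

variable (𝕜 Ω) in
/-- The inverse weights. -/
def coneWt' : Idx d → Sm 𝕜 (cone Ω) | inl _ => coneVar 𝕜 Ω | inr _ => 1

lemma ev_coneWt (i : Idx d) (y : Coord d) (hy : y ∈ cone Ω) :
    ev y hy (coneWt 𝕜 Ω i) = ((wt y.1 i : ℝ) : 𝕜) := by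
  rcases i with i | i
  · rfl
  · simp [coneWt, wt]

lemma coordD_coneVar (i : Idx d) :
    coordD 𝕜 (cone Ω) (coordBasis d) i (coneVar 𝕜 Ω) = coneQ 𝕜 Ω i * coneVar 𝕜 Ω := by
  refine sm_ext fun y hy => ?_
  rw [coneVar, coordD_coneT, map_mul]
  rcases i with i | i | i
  · change _ = ((y.1⁻¹ : ℝ) : 𝕜) * ((y.1 : ℝ) : 𝕜)
    rw [← ofReal_mul, inv_mul_cancel₀ hy.1.ne']
    simp [coordBasis]
  · simp [coordBasis, coneQ]
  · simp [coordBasis, coneQ]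

lemma coordD_coneWt {i j : Idx d} (hij : i ≠ j) :
    coordD 𝕜 (cone Ω) (coordBasis d) i (coneWt 𝕜 Ω j) = 0 := by
  rcases j with j | j
  · refine sm_ext fun y hy => ?_
    rw [coneWt, coneInv, coordD_coneT]
    rcases i with i | i | i
    · exact absurd rfl hij
    · simp [coordBasis]
    · simp [coordBasis]
  · exact Derivation.map_one_eq_zero _

variable (𝕜 Ω) in
lemma frameMap_cone : FrameMap (coneMap 𝕜 Ω : Sm 𝕜 Ω →+* Sm 𝕜 (cone Ω)) (slabD 𝕜 Ω)
    (ambQ d (Sm 𝕜 Ω)) (coordD 𝕜 (cone Ω) (coordBasis d)) (coneQ 𝕜 Ω)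
    (diagonal (coneWt 𝕜 Ω)) (diagonal (coneWt' 𝕜 Ω)) where
  der i x := by
    have : ∀ a, diagonal (coneWt 𝕜 Ω) i a * (coneMap 𝕜 Ω : Sm 𝕜 Ω →+* _) (slabD 𝕜 Ω a x)
        = if i = a then coneWt 𝕜 Ω i * coneMap 𝕜 Ω (slabD 𝕜 Ω a x) else 0 := by
      intro a; simp [Matrix.diagonal_apply]
    rw [sum_ext fun a => this a, sum_ite_eq, if_pos (Finset.mem_univ _)]
    change coordD 𝕜 (cone Ω) (coordBasis d) i (coneMap 𝕜 Ω x) = _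
    rw [coordD_coneMap]
    rcases i with i | i
    · simp [slabD]
    · simp [coneWt]
  closed i j a := by
    by_cases hij : i = j
    · rw [hij]
    · by_cases hja : j = a
      · subst hja
        rw [Matrix.diagonal_apply_eq, Matrix.diagonal_apply_ne _ hij, map_zero, coordD_coneWt hij]
      · rw [Matrix.diagonal_apply_ne _ hja, map_zero]
        by_cases hia : i = a
        · subst hia
          rw [Matrix.diagonal_apply_eq, coordD_coneWt (Ne.symm hij)]
        · rw [Matrix.diagonal_apply_ne _ hia, map_zero]
  inv := by
    rw [Matrix.diagonal_mul_diagonal, ← Matrix.diagonal_one]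
    congr 1
    funext i
    rcases i with i | i
    · exact (mul_comm _ _).trans coneVar_mul_coneInv
    · exact one_mul _
  twist i := by
    have : ∀ a, diagonal (coneWt 𝕜 Ω) i a * (coneMap 𝕜 Ω : Sm 𝕜 Ω →+* _) (ambQ d _ a)
        = if i = a then coneWt 𝕜 Ω i * coneMap 𝕜 Ω (ambQ d _ a) else 0 := by
      intro a; simp [Matrix.diagonal_apply]
    rw [sum_ext fun a => this a, sum_ite_eq, if_pos (Finset.mem_univ _)]
    rcases i with i | i
    · simp [ambQ, coneQ, coneWt]
    · simp [ambQ, coneQ]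
  comm := slabD_comm
  comm' _ _ x := smD_comm _ _ x

variable {Gf : Coord d → AMat d 𝕜} {ff : Coord d → 𝕜} {G K : AMat d (Sm 𝕜 Ω)} {F φ : Sm 𝕜 Ω}

lemma diagonal_mul_map_mul (G : AMat d (Sm 𝕜 Ω)) (i j : Idx d) :
    (diagonal (coneWt 𝕜 Ω) * G.map (coneMap 𝕜 Ω : Sm 𝕜 Ω →+* Sm 𝕜 (cone Ω))
      * (diagonal (coneWt 𝕜 Ω)).transpose) i j
    = coneWt 𝕜 Ω i * coneWt 𝕜 Ω j * coneMap 𝕜 Ω (G i j) := by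
  rw [Matrix.diagonal_transpose, Matrix.mul_diagonal, Matrix.diagonal_mul]
  simp only [map_apply, RingHom.coe_coe]
  ring

/-- `Gf` is the homogeneous metric `t² Ĝ` in coordinates. -/
structure IsCone (Gf : Coord d → AMat d 𝕜)
    (G K : AMat d (Sm 𝕜 Ω)) : Prop where
  symm : ∀ i j, G i j = G j i
  inv : G * K = 1
  eq : ∀ y (hy : y ∈ cone Ω) i j,
    Gf y i j = ((y.1 ^ 2 * (wt y.1 i * wt y.1 j) : ℝ) : 𝕜) * ev y.2 hy.2 (G i j)

namespace IsCone

local notation "Gc" => coneVar 𝕜 Ω ^ 2 • (diagonal (coneWt 𝕜 Ω) *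
  G.map (coneMap 𝕜 Ω : Sm 𝕜 Ω →+* Sm 𝕜 (cone Ω)) * Matrix.transpose (diagonal (coneWt 𝕜 Ω)))
local notation "Kc" => coneInv 𝕜 Ω ^ 2 • (Matrix.transpose (diagonal (coneWt' 𝕜 Ω)) *
  K.map (coneMap 𝕜 Ω : Sm 𝕜 Ω →+* Sm 𝕜 (cone Ω)) * diagonal (coneWt' 𝕜 Ω))

lemma ev_metric (h : IsCone Gf G K) (y : Coord d) (hy : y ∈ cone Ω) (i j : Idx d) :
    ev y hy ((Gc) i j) = Gf y i j := by
  rw [h.eq y hy, Matrix.smul_apply, diagonal_mul_map_mul, smul_eq_mul]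
  simp only [map_mul, map_pow, ev_coneWt, ev_coneMap, ev_coneVar]
  ring

lemma mul_eq_one (h : IsCone Gf G K) : (Gc) * (Kc) = 1 := by
  rw [Matrix.smul_mul, Matrix.mul_smul, (frameMap_cone 𝕜 Ω).mul_inv h.inv, smul_smul, ← mul_pow,
    coneVar_mul_coneInv, one_pow, one_smul]

lemma warpedRicciBase_eq (h : IsCone Gf G K)
    (hF : ∀ y (hy : y ∈ cone Ω), ff y = (y.1 : 𝕜) * ev y.2 hy.2 F) (hφ : F * φ = 1) (N : 𝕜)
    (y : Coord d) (hy : y ∈ cone Ω) (i j : Idx d) :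
    warpedRicciBase N (coordBasis d) Gf ff i j y = ((wt y.1 i * wt y.1 j : ℝ) : 𝕜) * ev y.2 hy.2
      (baseA (slabD 𝕜 Ω) (ambQ d _) (smC N) (chr (slabD 𝕜 Ω) (ambQ d _) G K) F φ i j) := by
  have hF' : ∀ y hy, ev y hy (coneVar 𝕜 Ω * (coneMap 𝕜 Ω : Sm 𝕜 Ω →+* _) F) = ff y := by
    intro y hy
    rw [hF y hy, map_mul, ev_coneVar]
    exact congrArg _ (ev_coneMap F y hy)
  have hφ' : coneVar 𝕜 Ω * (coneMap 𝕜 Ω : Sm 𝕜 Ω →+* _) F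
      * (coneInv 𝕜 Ω * (coneMap 𝕜 Ω : Sm 𝕜 Ω →+* _) φ) = 1 := by
    rw [mul_mul_mul_comm, coneVar_mul_coneInv, ← map_mul, hφ, map_one, one_mul]
  have hN : (smC N : Sm 𝕜 (cone Ω)) = (coneMap 𝕜 Ω : Sm 𝕜 Ω →+* _) (smC N) :=
    sm_ext fun y hy => by rw [ev_smC]; exact ((ev_coneMap _ y hy).trans (ev_smC N _ _)).symm
  rw [← ev_baseA h.ev_metric h.mul_eq_one hF' hφ' N y hy,
    baseA_rescale coordD_coneVar coneVar_mul_coneInv, hN,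
    (frameMap_cone 𝕜 Ω).baseA_chr h.symm h.inv]
  have e : ∀ T : Idx d → Idx d → Sm 𝕜 Ω, pullTensor (coneMap 𝕜 Ω : Sm 𝕜 Ω →+* Sm 𝕜 (cone Ω))
      (diagonal (coneWt 𝕜 Ω)) T i j = coneWt 𝕜 Ω i * coneWt 𝕜 Ω j * coneMap 𝕜 Ω (T i j) :=
    fun T => (mul_pullTensor_mul _ _ (Matrix.of T) i j).symm.trans (diagonal_mul_map_mul _ i j)
  rw [e]
  simp only [map_mul, ev_coneWt, ev_coneMap]

lemma warpedRicciFibre_eq (h : IsCone Gf G K)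
    (hF : ∀ y (hy : y ∈ cone Ω), ff y = (y.1 : 𝕜) * ev y.2 hy.2 F) (N : 𝕜)
    (y : Coord d) (hy : y ∈ cone Ω) : warpedRicciFibre N (coordBasis d) Gf ff y = -ev y.2 hy.2
      (fibreA (slabD 𝕜 Ω) (ambQ d _) (smC N) K (chr (slabD 𝕜 Ω) (ambQ d _) G K) F) := by
  have hF' : ∀ y hy, ev y hy (coneVar 𝕜 Ω * (coneMap 𝕜 Ω : Sm 𝕜 Ω →+* _) F) = ff y := by
    intro y hy
    rw [hF y hy, map_mul, ev_coneVar]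
    exact congrArg _ (ev_coneMap F y hy)
  have hN : (smC N : Sm 𝕜 (cone Ω)) = (coneMap 𝕜 Ω : Sm 𝕜 Ω →+* _) (smC N) :=
    sm_ext fun y hy => by rw [ev_smC]; exact ((ev_coneMap _ y hy).trans (ev_smC N _ _)).symm
  rw [eq_neg_iff_add_eq_zero, ← neg_eq_iff_add_eq_zero,
    ← ev_fibreA h.ev_metric h.mul_eq_one hF' N y hy,
    fibreA_rescale coordD_coneVar coneVar_mul_coneInv, hN,
    (frameMap_cone 𝕜 Ω).fibreA_chr h.symm h.inv]
  exact ev_coneMap _ y hy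

lemma acceleration_eq (h : IsCone Gf G K) (y : Coord d) (hy : y ∈ cone Ω) (i : Idx d) :
    ∑ k, christoffel (coordBasis d) Gf k nI nI y * Gf y k i = ((y.1 ^ 2 * wt y.1 i : ℝ) : 𝕜)
        * ev y.2 hy.2 (lowChr (slabD 𝕜 Ω) (ambQ d _) G i nI nI) := by
  have e1 : ∑ k, christoffel (coordBasis d) Gf k nI nI y * Gf y k i
      = ev y hy (∑ k, (Gc) i k * chr (coordD 𝕜 (cone Ω) (coordBasis d)) 0 (Gc) (Kc) k nI nI) := by
    rw [map_sum]
    refine sum_ext fun k => ?_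
    rw [map_mul, ev_chr h.ev_metric h.mul_eq_one, h.ev_metric, mul_comm]
    congr 1
    rw [← h.ev_metric y hy, ← h.ev_metric y hy, Matrix.smul_apply, Matrix.smul_apply,
      diagonal_mul_map_mul, diagonal_mul_map_mul, h.symm, mul_comm (coneWt 𝕜 Ω i)]
  rw [e1, sum_mul_chr h.mul_eq_one, lowChr_rescale coordD_coneVar]
  have e2 : lowChr (coordD 𝕜 (cone Ω) (coordBasis d)) (coneQ 𝕜 Ω)
      (diagonal (coneWt 𝕜 Ω) * G.map (coneMap 𝕜 Ω : Sm 𝕜 Ω →+* Sm 𝕜 (cone Ω))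
        * (diagonal (coneWt 𝕜 Ω)).transpose) i nI nI
      = coneWt 𝕜 Ω i
        * coneMap 𝕜 Ω (lowChr (slabD 𝕜 Ω) (ambQ d _) G i nI nI) := by
    have hh : coneMap 𝕜 Ω (half (Sm 𝕜 Ω)) = half _ := AlgHom.commutes _ _
    simp only [lowChr, tw, diagonal_mul_map_mul, map_mul, map_add, map_sub, ← coordD_coneMap, hh,
      map_ofNat]
    rcases i with i | i | i
    · have hw := coordD_coneWt (𝕜 := 𝕜) (Ω := Ω) (i := nI) (j := inl i) (by simp)
      simp only [Derivation.leibniz, hw, smul_eq_mul]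
      simp only [coneWt, coneQ, ambQ, map_one, map_zero, Derivation.map_one_eq_zero,
        coordD_coneMap, slabD, Derivation.coe_zero, Pi.zero_apply]
      ring
    · simp only [coneWt, coneQ, ambQ, map_zero, one_mul, mul_one]
    · simp only [coneWt, coneQ, ambQ, map_zero, one_mul, mul_one]
  rw [e2]
  simp only [map_mul, map_pow, ev_coneWt, ev_coneVar, ev_coneMap, mul_assoc]

end IsCone

end Cone

section JetLemmas

lemma eq_of_serX {R : Type*} [CommRing R] [Algebra ℝ R] {a b : PowerSeries R}
    (h : serX R a = serX R b) (h₀ : constantCoeff a = constantCoeff b) : a = b := by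
  ext n
  rcases n with _ | n
  · simpa using h₀
  · exact succ_mul_coeff_inj (by rw [h])

lemma jet_congr {E : Type*} [NormedAddCommGroup E] [NormedSpace ℝ E] {Ω Ω' : Opens (E × ℝ)}
    {W : Opens E} (hW : ∀ x ∈ W, (x, (0 : ℝ)) ∈ Ω) (hW' : ∀ x ∈ W, (x, (0 : ℝ)) ∈ Ω')
    {F : Sm 𝕜 Ω} {F' : Sm 𝕜 Ω'} (h : ∀ w ∈ Ω, w ∈ Ω' → extz F.1 w = extz F'.1 w) :
    jet hW F = jet hW' F' := by
  ext1 n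
  refine sm_ext fun x hx => ?_
  rw [ev_coeff_jet, ev_coeff_jet]
  congr 1
  refine Filter.EventuallyEq.iteratedDeriv_eq n ?_
  have hc : ContinuousAt (fun ρ : ℝ => (x, ρ)) 0 := (Continuous.prodMk_right x).continuousAt
  filter_upwards [hc.eventually_mem (Ω.2.mem_nhds (hW x hx)),
    hc.eventually_mem (Ω'.2.mem_nhds (hW' x hx))] with ρ h1 h2 using h _ h1 h2

variable {Ω : Opens (ℰ d × ℝ)} {W : Opens ℰ d} (hW : ∀ x ∈ W, (x, (0 : ℝ)) ∈ Ω)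

variable (𝕜 W) in
/-- The coordinate derivations along `M`. -/
def baseD (i : Fin d) : Derivation ℝ (Sm 𝕜 W) (Sm 𝕜 W) := smD 𝕜 W (single i 1)

lemma ambD_jet (i : Idx d) (F : Sm 𝕜 Ω) :
    ambD (baseD 𝕜 W) i (jet hW F) = jet hW (slabD 𝕜 Ω i F) := by
  rcases i with i | i | i
  · exact (map_zero _).symm
  · exact serD_jet hW _ F
  · exact serX_jet hW F

lemma baseD_comm (i j : Fin d) (x : Sm 𝕜 W) :
    baseD 𝕜 W i (baseD 𝕜 W j x) = baseD 𝕜 W j (baseD 𝕜 W i x) := smD_comm _ _ _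

lemma frameMap_jet : FrameMap (jet hW : Sm 𝕜 Ω →+* (Sm 𝕜 W)⟦X⟧) (slabD 𝕜 Ω)
    (ambQ d (Sm 𝕜 Ω)) (ambD (baseD 𝕜 W)) (ambQ d ((Sm 𝕜 W)⟦X⟧)) 1 1 :=
  FrameMap.of_commute (ambD_jet hW) (fun i => by rcases i with i | i <;> simp [ambQ]) slabD_comm
    (ambD_comm _ baseD_comm)

lemma jet_smC (c : 𝕜) : jet hW (smC c : Sm 𝕜 Ω) = PowerSeries.C (smC c : Sm 𝕜 W) := by
  refine eq_of_serX ?_ ?_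
  · rw [serX_jet, smD_smC, map_zero]
    ext n
    simp [coeff_serX]
  · rw [constantCoeff_jet, PowerSeries.constantCoeff_C]
    exact sm_ext fun x hx => by rw [ev_smRes, ev_smC, ev_smC]

lemma ev_constantCoeff_jet (F : Sm 𝕜 Ω) (x : ℰ d) (hx : x ∈ W) :
    ev x hx (constantCoeff (jet hW F)) = ev (x, 0) (hW x hx) F := by
  rw [constantCoeff_jet, ev_smRes]

lemma jet_eq_zero_of_vanishes {F : Coord d → 𝕜} {P : Sm 𝕜 Ω}
    (hF : ∀ w (hw : w ∈ Ω), F (1, w) = ev w hw P)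
    (h : ∀ x ∈ W, VanishesToInfiniteOrder F ((1, x, 0) : Coord d)) : jet hW P = 0 := by
  refine jet_eq_zero_of_isBigO hW fun x hx k => ?_
  have hc : Filter.Tendsto (fun ρ : ℝ => ((1, x, ρ) : Coord d)) (𝓝 0) (𝓝 (1, x, 0)) := by
    have : Continuous (fun ρ : ℝ => ((1, x, ρ) : Coord d)) := by fun_prop
    exact this.tendsto 0
  have h1 := (h x hx k).comp_tendsto hc
  refine (h1.congr' ?_ (Filter.Eventually.of_forall fun ρ => ?_))
  · filter_upwards [(Continuous.prodMk_right x).continuousAt.eventually_mem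
      (Ω.2.mem_nhds (hW x hx))] with ρ hρ
    rw [Function.comp_apply, hF _ hρ, extz_eq_ev P hρ]
  · simp [Prod.norm_def]

lemma vanishes_of_jet_eq_zero {F : Coord d → 𝕜} {P : Sm 𝕜 Ω} {c : ℝ → ℝ}
    (hF : ∀ y (hy : y ∈ cone Ω), F y = ((c y.1 : ℝ) : 𝕜) * ev y.2 hy.2 P) (h : jet hW P = 0)
    {t : ℝ} (ht : 0 < t) (hc : ContinuousAt c t) {x : ℰ d} (hx : x ∈ W) :
    VanishesToInfiniteOrder F ((t, x, 0) : Coord d) := by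
  intro k
  obtain ⟨C, hC⟩ := isBigO_of_jet_eq_zero hW h hx k
  have h1 : Filter.Tendsto (fun y : Coord d => y.2) (𝓝 (t, x, 0)) (𝓝 (x, 0)) :=
    continuous_snd.tendsto _
  have h2 : ∀ᶠ y : Coord d in 𝓝 (t, x, 0), y ∈ cone Ω :=
    (cone Ω).2.mem_nhds ⟨ht, hW x hx⟩
  have h3 : ∀ᶠ y : Coord d in 𝓝 (t, x, 0), |c y.1| ≤ |c t| + 1 := by
    have : ContinuousAt (fun y : Coord d => |c y.1|) (t, x, 0) :=
      (ContinuousAt.comp (f := fun y : Coord d => y.1) (x := (t, x, 0)) hc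
        continuousAt_fst).abs
    exact (this.eventually_lt continuousAt_const (lt_add_one |c t|)).mono fun y hy => hy.le
  refine Asymptotics.IsBigO.of_bound ((|c t| + 1) * |C|) ?_
  filter_upwards [h1.eventually hC, h2, h3] with y hy1 hy2 hy3
  rw [hF y hy2, norm_mul, RCLike.norm_ofReal, ← extz_eq_ev P hy2.2]
  have h4 : |y.2.2| ≤ ‖y - (t, x, 0)‖ := by
    have e : y.2.2 = (y - ((t, x, 0) : Coord d)).2.2 := by simp
    rw [← Real.norm_eq_abs, e]
    exact (norm_snd_le _).trans (norm_snd_le _)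
  have h5 : ‖extz P.1 y.2‖ ≤ |C| * ‖y - (t, x, 0)‖ ^ k :=
    hy1.trans (mul_le_mul (le_abs_self C) (pow_le_pow_left₀ (abs_nonneg _) h4 k) (by positivity)
      (abs_nonneg _))
  rw [norm_pow, norm_norm, mul_assoc]
  exact mul_le_mul hy3 h5 (norm_nonneg _) (by positivity)

end JetLemmas

section ChartLemmas

/-- The target of a chart. -/
def chartO (x₀ : M) : Opens ℰ d :=
  ⟨(extChartAt (𝓡 d) x₀).target, isOpen_extChartAt_target x₀⟩

/-- The point of `M` with given coordinates. -/
def pt (x₀ : M) (x : ℰ d) : M := (extChartAt (𝓡 d) x₀).symm x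

lemma continuousOn_pt (x₀ : M) : ContinuousOn (pt x₀) (chartO (d := d) x₀ : Set ℰ d) :=
  continuousOn_extChartAt_symm x₀

lemma mem_target_total (z₀ : Total M) (y : Coord d) :
    y ∈ (extChartAt (totalModel d) z₀).target ↔ y.2.1 ∈ chartO z₀.2.1 := by
  rw [extChartAt_prod, PartialEquiv.prod_target, extChartAt_prod, PartialEquiv.prod_target]
  simp [chartO, Set.mem_prod, chartAt_self_eq]

lemma mem_chartDomain (z₀ : Total M) (U : Set (Total M)) (y : Coord d) :
    y ∈ chartDomain (totalModel d) z₀ U ↔ y.2.1 ∈ chartO z₀.2.1 ∧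
      (y.1, pt z₀.2.1 y.2.1, y.2.2) ∈ U := by
  rw [chartDomain, Set.mem_inter_iff, mem_target_total]
  rfl

lemma mdifferentiableAt_pt {x₀ : M} {x : ℰ d} (hx : x ∈ chartO x₀) :
    MDifferentiableAt 𝓘(ℝ, ℰ d) (𝓡 d) (pt x₀) x :=
  (((contMDiffOn_extChartAt_symm (I := 𝓡 d) (n := ∞) x₀).contMDiffAt
    ((chartO x₀).2.mem_nhds hx)).mdifferentiableAt (by simp))

lemma chartVec_total {z₀ : Total M} {y : Coord d} (hy : y.2.1 ∈ chartO z₀.2.1) (u : Coord d) :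
    chartVec (totalModel d) z₀ y u = vec ((y.1, pt z₀.2.1 y.2.1, y.2.2) : Total M) u.1
      (chartVec (𝓡 d) z₀.2.1 y.2.1 u.2.1) u.2.2 := by
  have h1 : HasMFDerivAt 𝓘(ℝ, Coord d) 𝓘(ℝ, ℝ) (fun y : Coord d => y.1) y
      (ContinuousLinearMap.fst ℝ ℝ (ℰ d × ℝ)) := hasFDerivAt_fst.hasMFDerivAt
  have h3 : HasMFDerivAt 𝓘(ℝ, Coord d) 𝓘(ℝ, ℝ) (fun y : Coord d => y.2.2) y
      ((ContinuousLinearMap.snd ℝ ℰ d ℝ).comp (ContinuousLinearMap.snd ℝ ℝ (ℰ d × ℝ))) :=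
    (ContinuousLinearMap.hasFDerivAt ((ContinuousLinearMap.snd ℝ ℰ d ℝ).comp
      (ContinuousLinearMap.snd ℝ ℝ (ℰ d × ℝ)))).hasMFDerivAt
  have h2' : HasMFDerivAt 𝓘(ℝ, Coord d) 𝓘(ℝ, ℰ d)
      (fun y : Coord d => y.2.1) y
      ((ContinuousLinearMap.fst ℝ ℰ d ℝ).comp (ContinuousLinearMap.snd ℝ ℝ (ℰ d × ℝ))) :=
    (ContinuousLinearMap.hasFDerivAt ((ContinuousLinearMap.fst ℝ ℰ d ℝ).comp
      (ContinuousLinearMap.snd ℝ ℝ (ℰ d × ℝ)))).hasMFDerivAt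
  have h2 : HasMFDerivAt 𝓘(ℝ, Coord d) (𝓡 d) (fun y : Coord d => pt z₀.2.1 y.2.1) y _ :=
    HasMFDerivAt.comp y (g := pt z₀.2.1) (f := fun y : Coord d => y.2.1)
      (mdifferentiableAt_pt hy).hasMFDerivAt h2'
  have h : HasMFDerivAt 𝓘(ℝ, Coord d) (totalModel d)
      (extChartAt (totalModel d) z₀).symm y _ := h1.prodMk (h2.prodMk h3)
  rw [chartVec, h.mfderiv]
  rfl

lemma tensor_congr (T : TwoTensor d M 𝕜) {z z' : Total M} (h : z = z') (u v : Coord d) :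
    T z u v = T z' u v := by subst h; rfl

/-- The ambient frame vector with index `i` at the point with coordinates `y`. -/
def frameVec (x₀ : M) (y : Coord d) (i : Idx d) :
    TangentSpace (totalModel d) ((y.1, pt x₀ y.2.1, y.2.2) : Total M) :=
  vec ((y.1, pt x₀ y.2.1, y.2.2) : Total M) (coordBasis d i).1
    (chartVec (𝓡 d) x₀ y.2.1 (coordBasis d i).2.1) (coordBasis d i).2.2

lemma comps_apply (T : TwoTensor d M 𝕜) {z₀ : Total M} {y : Coord d}
    (hy : y.2.1 ∈ chartO z₀.2.1) (i j : Idx d) : comps T z₀ y i j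
      = T (y.1, pt z₀.2.1 y.2.1, y.2.2) (frameVec z₀.2.1 y i) (frameVec z₀.2.1 y j) := by
  rw [comps, of_apply, chartVec_total hy, chartVec_total hy]
  rfl

/-- The part of the coordinate domain `{(x, ρ)}` that corresponds to `U` (at `t = 1`). -/
def slabO (x₀ : M) {U : Set (Total M)} (hU : IsOpen U) : Opens (ℰ d × ℝ) :=
  ⟨{w | w.1 ∈ chartO x₀ ∧ ((1 : ℝ), pt x₀ w.1, w.2) ∈ U}, by
    have h : ContinuousOn (fun w : ℰ d × ℝ => ((1 : ℝ), pt x₀ w.1, w.2))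
        {w | w.1 ∈ chartO x₀} :=
      continuousOn_const.prodMk (((continuousOn_pt x₀).comp continuousOn_fst fun _ h => h).prodMk
        continuousOn_snd)
    exact h.isOpen_inter_preimage ((chartO x₀).2.preimage continuous_fst) hU⟩

lemma HasSignature.det_ne_zero {W : Type*} [AddCommGroup W] [Module ℝ W] {p q : ℕ} {B : W →ₗ[ℝ] W →ₗ[ℝ] ℝ}
    (hB : HasSignature (fun u v => B u v) p q) {ι : Type*} [Fintype ι] [DecidableEq ι]
    (b : ι → W) (hs : ∀ w, ∃ c : ι → ℝ, w = ∑ i, c i • b i)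
    (hi : ∀ c : ι → ℝ, ∑ i, c i • b i = 0 → c = 0) :
    (Matrix.of fun i j => B (b i) (b j)).det ≠ 0 := by
  intro h
  obtain ⟨v, hv, hv'⟩ := Matrix.exists_mulVec_eq_zero_iff.2 h
  refine hv (hi v ?_)
  set w := ∑ i, v i • b i with hw
  have h1 : ∀ u, B u w = 0 := by
    intro u
    obtain ⟨c, rfl⟩ := hs u
    have h2 : ∀ i, B (b i) w = 0 := fun i => by
      have := congrFun hv' i
      simp only [Matrix.mulVec, dotProduct, of_apply, Pi.zero_apply] at this
      rw [hw, map_sum, ← this]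
      exact sum_ext fun j => by rw [map_smul, smul_eq_mul, mul_comm]
    simp [map_sum, LinearMap.sum_apply, h2]
  obtain ⟨e, he⟩ := hB
  have h3 := h1 (e.symm ((e w).1, -(e w).2))
  rw [show B (e.symm ((e w).1, -(e w).2)) w = _ from he _ w] at h3
  simp only [LinearEquiv.apply_symm_apply, Pi.neg_apply, neg_mul, sum_neg_distrib,
    sub_neg_eq_add] at h3
  have p1 : 0 ≤ ∑ i, (e w).1 i * (e w).1 i := sum_nonneg fun i _ => mul_self_nonneg _
  have p2 : 0 ≤ ∑ i, (e w).2 i * (e w).2 i := sum_nonneg fun i _ => mul_self_nonneg _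
  have q1 := (Finset.sum_eq_zero_iff_of_nonneg fun i _ => mul_self_nonneg ((e w).1 i)).1
    (le_antisymm (by linarith) p1)
  have q2 := (Finset.sum_eq_zero_iff_of_nonneg fun i _ => mul_self_nonneg ((e w).2 i)).1
    (le_antisymm (by linarith) p2)
  have : e w = 0 := Prod.ext (funext fun i => mul_self_eq_zero.1 (q1 i (Finset.mem_univ _)))
    (funext fun i => mul_self_eq_zero.1 (q2 i (Finset.mem_univ _)))
  exact e.map_eq_zero_iff.1 this

lemma exists_chartVec_equiv {x₀ : M} {x : ℰ d} (hx : x ∈ chartO x₀) :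
    ∃ e : ℰ d ≃L[ℝ] TangentSpace (𝓡 d) (pt x₀ x), ∀ u, chartVec (𝓡 d) x₀ x u = e u := by
  have h := isInvertible_mfderivWithin_extChartAt_symm (I := 𝓡 d) (x := x₀) (y := x) hx
  have hr : Set.range (𝓡 d) = Set.univ := (𝓡 d).range_eq_univ
  rw [hr, mfderivWithin_univ] at h
  obtain ⟨e, he⟩ := h
  exact ⟨e, fun u => by rw [chartVec, ← he]; rfl⟩

end ChartLemmas

local notation:max "𝒮" x:max => Sm 𝕜 (chartO (d := d) x)

section LocalData

variable (𝕜 r A x₀)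

lemma contDiffOn_ofReal {V : Type*} [NormedAddCommGroup V] [NormedSpace ℝ V] {f : V → ℝ}
    {s : Set V} (h : SmoothOn f s) : SmoothOn (fun y => ((f y : ℝ) : 𝕜)) s :=
  (RCLike.ofRealCLM (K := 𝕜)).contDiff.comp_contDiffOn h

/-- The components of the metric `g` in a chart. -/
def locg : Mat d (𝒮 x₀) :=
  Matrix.of fun i j => smMk _ (contDiffOn_ofReal 𝕜 (r.smooth_g x₀ (single i 1) (single j 1)))

lemma ev_locg (x : ℰ d) (hx : x ∈ chartO x₀) (i j : Fin d) :
    ev x hx (locg 𝕜 r x₀ i j) = ((r.g (pt x₀ x) (chartVec (𝓡 d) x₀ x (single i 1))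
      (chartVec (𝓡 d) x₀ x (single j 1)) : ℝ) : 𝕜) := rfl

lemma sum_smul_single (c : Fin d → ℝ) : ∑ i, c i • (single i 1 : ℰ d) = WithLp.toLp 2 c := by
  ext j
  simp [Finset.sum_apply, Pi.single_apply]

lemma exists_locg_inv : ∃ k₀, locg 𝕜 r x₀ * k₀ = 1 := by
  refine ⟨(locg 𝕜 r x₀)⁻¹, Matrix.mul_nonsing_inv _ (sm_isUnit fun x hx => ?_)⟩
  obtain ⟨e, he⟩ := exists_chartVec_equiv hx
  have h := (r.signature (pt x₀ x)).det_ne_zero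
    (fun i => e (single i (1 : ℝ))) (fun w => ⟨fun i => e.symm w i, by
      simp only [← map_smul, ← map_sum]
      rw [sum_smul_single]
      exact (e.apply_symm_apply w).symm⟩) (fun c hc => by
      simp only [← map_smul, ← map_sum] at hc
      rw [sum_smul_single, e.map_eq_zero_iff] at hc
      exact (WithLp.toLp_eq_zero 2).1 hc)
  have e1 : ev x hx (locg 𝕜 r x₀).det = ((Matrix.of fun i j => r.g (pt x₀ x)
      (e (single i (1 : ℝ))) (e (single j (1 : ℝ)))).det : ℝ) := by
    have h1 := RingHom.map_det (algebraMap ℝ 𝕜) (Matrix.of fun i j => r.g (pt x₀ x)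
      (e (single i (1 : ℝ))) (e (single j (1 : ℝ))))
    rw [RCLike.algebraMap_eq_ofReal] at h1
    rw [h1]
    refine (AlgHom.map_det (ev x hx) (locg 𝕜 r x₀)).trans (congrArg _ ?_)
    ext i j
    change ev x hx (locg 𝕜 r x₀ i j) = _
    rw [ev_locg, he, he]
    rfl
  rw [e1]
  exact RCLike.ofReal_ne_zero.2 h

/-- The components of the 1-form `a` in a chart. -/
def loca (i : Fin d) : 𝒮 x₀ :=
  smMk _ (contDiffOn_ofReal 𝕜 (r.smooth_a x₀ (single i 1)))

/-- The part of the coordinate domain where the acceleration is defined. -/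
def accO : Opens (ℰ d × ℝ) :=
  ⟨{w | w.1 ∈ chartO x₀ ∧ (pt x₀ w.1, w.2) ∈ A.dom},
    (((continuousOn_pt x₀).comp continuousOn_fst fun _ h => h).prodMk
      continuousOn_snd).isOpen_inter_preimage ((chartO x₀).2.preimage continuous_fst) A.isOpen_dom⟩

lemma accO_mem (x : ℰ d) (hx : x ∈ chartO x₀) : (x, (0 : ℝ)) ∈ accO A x₀ := ⟨hx, A.zero_mem _⟩

/-- The components of the acceleration in a chart. -/
def locφ (i : Fin d) : Sm 𝕜 (accO A x₀) :=
  smMk _ (contDiffOn_ofReal 𝕜 (A.smooth x₀ (single i 1)))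

/-- The formal expansion of `a + ∫ φ dρ`. -/
def locA (i : Fin d) : (𝒮 x₀)⟦X⟧ :=
  PowerSeries.mk fun n => Nat.casesOn n (loca 𝕜 r x₀ i) fun m =>
    ((m + 1 : ℝ)⁻¹) • coeff m (jet (accO_mem A x₀) (locφ 𝕜 A x₀ i))

lemma constantCoeff_locA (i : Fin d) : constantCoeff (locA 𝕜 r A x₀ i) = loca 𝕜 r x₀ i := by
  rw [← coeff_zero, locA, PowerSeries.coeff_mk]
  rfl

lemma serX_locA (i : Fin d) : serX (𝒮 x₀) (locA 𝕜 r A x₀ i)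
    = jet (accO_mem A x₀) (locφ 𝕜 A x₀ i) := by
  ext1 n
  rw [coeff_serX, locA, PowerSeries.coeff_mk]
  change _ * ((n + 1 : ℝ)⁻¹ • _) = _
  have h : ((n : 𝒮 x₀) + 1) = algebraMap ℝ _ (n + 1) := by simp
  rw [h, ← Algebra.smul_def, smul_smul, mul_inv_cancel₀ (by positivity), one_smul]

end LocalData

namespace IsWeylPreAmbient

lemma mem_iff (h : IsWeylPreAmbient r U g) {t : ℝ} {x : M} {ρ : ℝ} :
    (t, x, ρ) ∈ U ↔ 0 < t ∧ ((1 : ℝ), x, ρ) ∈ U := by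
  refine ⟨fun hz => ⟨h.pos _ hz, ?_⟩, fun ⟨ht, hz⟩ => ?_⟩
  · have := h.dil_mem t⁻¹ (inv_pos.2 (h.pos _ hz)) _ hz
    rwa [dil, inv_mul_cancel₀ (h.pos _ hz).ne'] at this
  · have := h.dil_mem t ht _ hz
    rwa [dil, mul_one] at this

/-- The coordinate domain of `U` at `t = 1`. -/
abbrev slab (_h : IsWeylPreAmbient r U g) (x₀ : M) : Opens (ℰ d × ℝ) :=
  slabO x₀ _h.isOpen

lemma mem_cone_iff (h : IsWeylPreAmbient r U g) (z₀ : Total M) (y : Coord d) :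
    y ∈ chartDomain (totalModel d) z₀ U ↔ y ∈ cone (h.slab z₀.2.1) := by
  rw [mem_chartDomain, h.mem_iff, mem_cone]
  exact ⟨fun ⟨a, b, c⟩ => ⟨b, a, c⟩, fun ⟨b, a, c⟩ => ⟨a, b, c⟩⟩

lemma slab_mem (h : IsWeylPreAmbient r U g) (x₀ : M) (x : ℰ d)
    (hx : x ∈ chartO x₀) : (x, (0 : ℝ)) ∈ h.slab x₀ :=
  ⟨hx, h.initial_mem _ ⟨one_pos, rfl⟩⟩

lemma slice_mem (h : IsWeylPreAmbient r U g) {x₀ : M} {w : ℰ d × ℝ} (hw : w ∈ h.slab x₀) :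
    ((1, w) : Coord d) ∈ chartDomain (totalModel d) ((1, x₀, 0) : Total M) U :=
  (h.mem_cone_iff _ _).2 ⟨one_pos, hw⟩

lemma contDiffOn_slice {G : Coord d → 𝕜} (h : IsWeylPreAmbient r U g) {x₀ : M}
    (hG : SmoothOn G (chartDomain (totalModel d) ((1, x₀, 0) : Total M) U)) :
    SmoothOn (fun w : ℰ d × ℝ => G (1, w)) (h.slab x₀ : Set (ℰ d × ℝ)) :=
  hG.comp (contDiffOn_const.prodMk contDiffOn_id)
    fun w (hw : w ∈ h.slab x₀) => h.slice_mem hw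

/-- The homogeneous ambient metric at `t = 1`, as a matrix of smooth functions of `(x, ρ)`. -/
def hatG (h : IsWeylPreAmbient r U g) (x₀ : M) : AMat d (Sm 𝕜 (h.slab x₀)) :=
  Matrix.of fun i j => smMk _ (h.contDiffOn_slice (h.smooth (1, x₀, 0) i j))

lemma ev_hatG (h : IsWeylPreAmbient r U g) (x₀ : M) (w : ℰ d × ℝ)
    (hw : w ∈ h.slab x₀) (i j : Idx d) : ev w hw (h.hatG x₀ i j)
      = g (1, pt x₀ w.1, w.2) (frameVec x₀ (1, w) i) (frameVec x₀ (1, w) j) :=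
  comps_apply g (z₀ := (1, x₀, 0)) (y := (1, w)) hw.1 i j

lemma frameVec_eq (x₀ : M) (t : ℝ) (w : ℰ d × ℝ) (i : Idx d) :
    vec ((1, pt x₀ w.1, w.2) : Total M) (t⁻¹ * (coordBasis d i).1)
      (chartVec (𝓡 d) x₀ w.1 (coordBasis d i).2.1) (coordBasis d i).2.2
      = wt t i • frameVec x₀ (1, w) i := by
  rcases i with i | i
  · have h0 : chartVec (𝓡 d) x₀ w.1 0 = 0 := map_zero _
    refine Prod.ext ?_ (Prod.ext ?_ ?_)
    · rfl
    · change chartVec (𝓡 d) x₀ w.1 0 = t⁻¹ • chartVec (𝓡 d) x₀ w.1 0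
      rw [h0, smul_zero]
    · exact (mul_zero _).symm
  · have h1 : wt t (inr i : Idx d) = 1 := rfl
    have h2 : (coordBasis d (inr i)).1 = 0 := by rcases i with i | i <;> rfl
    rw [h1, one_smul, frameVec, h2, mul_zero]

lemma comps_eq (h : IsWeylPreAmbient r U g) (z₀ : Total M) (y : Coord d)
    (hy : y ∈ cone (h.slab z₀.2.1)) (i j : Idx d) : comps g z₀ y i j
      = ((y.1 ^ 2 * (wt y.1 i * wt y.1 j) : ℝ) : 𝕜) * ev y.2 hy.2 (h.hatG z₀.2.1 i j) := by
  obtain ⟨t, w⟩ := y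
  have ht : 0 < t := hy.1
  rw [comps_apply g hy.2.1, ev_hatG]
  have e := h.homogeneous t ht (1, pt z₀.2.1 w.1, w.2) hy.2.2
    (t⁻¹ * (coordBasis d i).1) (t⁻¹ * (coordBasis d j).1)
    (chartVec (𝓡 d) z₀.2.1 w.1 (coordBasis d i).2.1) (chartVec (𝓡 d) z₀.2.1 w.1 (coordBasis d j).2.1)
    (coordBasis d i).2.2 (coordBasis d j).2.2
  rw [frameVec_eq, frameVec_eq] at e
  have e' : g (t, pt z₀.2.1 w.1, w.2) (frameVec z₀.2.1 (t, w) i) (frameVec z₀.2.1 (t, w) j)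
      = ((t ^ 2 : ℝ) : 𝕜) * g (1, pt z₀.2.1 w.1, w.2) (wt t i • frameVec z₀.2.1 (1, w) i)
        (wt t j • frameVec z₀.2.1 (1, w) j) := by
    rw [← e]
    have hz : ((t, pt z₀.2.1 w.1, w.2) : Total M) = dil t (1, pt z₀.2.1 w.1, w.2) := by
      rw [dil, mul_one]
    refine (tensor_congr g hz _ _).trans ?_
    rw [mul_inv_cancel_left₀ ht.ne', mul_inv_cancel_left₀ ht.ne']
    rfl
  refine e'.trans ?_
  rw [map_smul, map_smul, LinearMap.smul_apply, real_smul_eq_coe_mul,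
    real_smul_eq_coe_mul, ofReal_mul, ofReal_mul]
  ring

lemma isUnit_det_hatG (h : IsWeylPreAmbient r U g) (x₀ : M) : IsUnit (h.hatG x₀).det := by
  refine sm_isUnit fun w hw => ?_
  have e : ev w hw (h.hatG x₀).det = (comps g ((1, x₀, 0) : Total M) (1, w)).det :=
    (AlgHom.map_det (ev w hw) (h.hatG x₀)).trans (congrArg _ (by ext i j; rfl))
  rw [e]
  exact h.nondegenerate _ _ (h.slice_mem hw)

lemma isCone (h : IsWeylPreAmbient r U g) (z₀ : Total M) :
    IsCone (comps g z₀) (h.hatG z₀.2.1) (h.hatG z₀.2.1)⁻¹ where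
  symm i j := sm_ext fun w hw => by rw [ev_hatG, ev_hatG, h.symm _ hw.2]
  inv := Matrix.mul_nonsing_inv _ (h.isUnit_det_hatG _)
  eq := h.comps_eq z₀

lemma hatG_symm (h : IsWeylPreAmbient r U g) (x₀ : M) (i j : Idx d) :
    h.hatG x₀ i j = h.hatG x₀ j i := (h.isCone (1, x₀, 0)).symm i j

lemma hatG_inv (h : IsWeylPreAmbient r U g) (x₀ : M) : h.hatG x₀ * (h.hatG x₀)⁻¹ = 1 :=
  (h.isCone (1, x₀, 0)).inv

end IsWeylPreAmbient

namespace IsWeylNormal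

variable (h : IsWeylPreAmbient r U g) (hn : IsWeylNormal r A U g)

include h hn

lemma initial_frame (x₀ : M) (x : ℰ d) (hx : x ∈ chartO x₀) (i j : Idx d) :
    ev x hx (constantCoeff (jet (h.slab_mem x₀) (h.hatG x₀ i j)))
      = ((r.g (pt x₀ x) (chartVec (𝓡 d) x₀ x (coordBasis d i).2.1)
          (chartVec (𝓡 d) x₀ x (coordBasis d j).2.1)
        + (((coordBasis d i).1 + r.a (pt x₀ x) (chartVec (𝓡 d) x₀ x (coordBasis d i).2.1))
            * (coordBasis d j).2.2
          + ((coordBasis d j).1 + r.a (pt x₀ x) (chartVec (𝓡 d) x₀ x (coordBasis d j).2.1))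
            * (coordBasis d i).2.2) : ℝ) : 𝕜) := by
  rw [ev_constantCoeff_jet, IsWeylPreAmbient.ev_hatG]
  refine (hn.initial ((1, pt x₀ x, 0) : Total M) ⟨one_pos, rfl⟩ _ _ _ _ _ _).trans ?_
  simp only [one_pow, inv_one, one_mul]

lemma acceleration_slab (x₀ : M) (w : ℰ d × ℝ) (hw : w ∈ h.slab x₀) (i : Idx d) :
    ev w hw (lowChr (slabD 𝕜 _) (ambQ d _) (h.hatG x₀) i nI nI)
      = ((A.form (pt x₀ w.1) w.2 (chartVec (𝓡 d) x₀ w.1 (coordBasis d i).2.1) : ℝ) : 𝕜) := by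
  have e := hn.acceleration (1, x₀, 0) (1, w) (h.slice_mem hw) i
  have hwt : wt 1 i = 1 := by rcases i with i | i <;> simp [wt]
  rw [lineAcceleration, (h.isCone (1, x₀, 0)).acceleration_eq (1, w) ⟨one_pos, hw⟩, one_pow, hwt,
    one_mul, ofReal_one, one_mul, chartVec_total (z₀ := (1, x₀, 0)) hw.1] at e
  refine e.trans (congrArg (fun s : ℝ => (s : 𝕜)) ?_)
  change (1 : ℝ) ^ 2 * A.form (pt x₀ w.1) w.2 (chartVec (𝓡 d) x₀ w.1 (coordBasis d i).2.1) = _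
  rw [one_pow, one_mul]

omit h hn in
lemma lowChr_inf_inf {P : Type*} [CommRing P] [Algebra ℝ P] {D : Idx d → Der P}
    {G : AMat d P} (hG : ∀ i j, G i j = G j i) (i : Idx d) :
    lowChr D (ambQ d P) G i nI nI = D nI (G i nI) - half P * tw D (ambQ d P) 2 i (G nI nI) := by
  have e : ∀ x, tw D (ambQ d P) 2 nI x = D nI x := fun x => by simp [tw, ambQ]
  rw [lowChr, e, hG nI i]
  linear_combination (D nI (G i nI)) * two_mul_half (P := P)

omit h hn in
lemma chartVec_zero (x₀ : M) (x : ℰ d) :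
    (chartVec (𝓡 d) x₀ x 0 : TangentSpace (𝓡 d) (pt x₀ x)) = 0 := map_zero _

lemma lowChr_eq_zero (x₀ : M) {i : Idx d} (hi : (coordBasis d i).2.1 = 0) :
    lowChr (slabD 𝕜 _) (ambQ d _) (h.hatG x₀) i nI nI = 0 :=
  sm_ext fun w hw => by
    have e : A.form (pt x₀ w.1) w.2 (chartVec (𝓡 d) x₀ w.1 0) = 0 :=
      (congrArg (A.form (pt x₀ w.1) w.2) (chartVec_zero x₀ w.1)).trans (map_zero _)
    rw [acceleration_slab h hn, hi, map_zero]
    exact (congrArg (fun s : ℝ => (s : 𝕜)) e).trans ofReal_zero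

lemma jet_inf_inf (x₀ : M) : jet (h.slab_mem x₀) (h.hatG x₀ nI nI) = 0 := by
  refine eq_of_serX ?_ ?_
  · have e := lowChr_eq_zero h hn x₀ (i := nI) rfl
    rw [lowChr_inf_inf (h.hatG_symm x₀)] at e
    have e' : tw (slabD 𝕜 _) (ambQ d _) 2 nI (h.hatG x₀ nI nI)
        = slabD 𝕜 _ nI (h.hatG x₀ nI nI) := by simp [tw, ambQ]
    rw [e'] at e
    have e2 : slabD 𝕜 _ nI (h.hatG x₀ nI nI) = 0 := by
      linear_combination 2 * e + slabD 𝕜 _ nI (h.hatG x₀ nI nI)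
        * two_mul_half (P := Sm 𝕜 (h.slab x₀))
    rw [map_zero, serX_jet]
    exact (congrArg _ e2).trans (map_zero _)
  · refine sm_ext fun x hx => ?_
    rw [initial_frame h hn, map_zero, map_zero]
    change ((r.g _ (chartVec (𝓡 d) x₀ x 0) (chartVec (𝓡 d) x₀ x 0)
      + ((0 + r.a _ (chartVec (𝓡 d) x₀ x 0)) * 1 + (0 + r.a _ (chartVec (𝓡 d) x₀ x 0)) * 1) : ℝ)
        : 𝕜) = 0
    rw [chartVec_zero, map_zero, map_zero]
    norm_num

lemma serX_jet_inf (x₀ : M) (i : Idx d) :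
    serX (𝒮 x₀) (jet (h.slab_mem x₀) (h.hatG x₀ i nI)) = jet (h.slab_mem x₀)
        (lowChr (slabD 𝕜 _) (ambQ d _) (h.hatG x₀) i nI nI) := by
  have e : jet (h.slab_mem x₀) (half (Sm 𝕜 (h.slab x₀)) * tw (slabD 𝕜 _) (ambQ d _) 2 i
      (h.hatG x₀ nI nI)) = 0 := by
    rw [map_mul, tw, map_add, map_mul, jet_inf_inf h hn, mul_zero, add_zero, ← ambD_jet,
      jet_inf_inf h hn, map_zero, mul_zero]
  rw [serX_jet, lowChr_inf_inf (h.hatG_symm x₀), map_sub, e, sub_zero]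
  rfl

lemma jet_z_inf (x₀ : M) : jet (h.slab_mem x₀) (h.hatG x₀ zI nI) = 1 := by
  refine eq_of_serX ?_ ?_
  · rw [serX_jet_inf h hn, Derivation.map_one_eq_zero, lowChr_eq_zero h hn x₀ rfl, map_zero]
  · refine sm_ext fun x hx => ?_
    rw [initial_frame h hn, map_one, map_one]
    change ((r.g _ (chartVec (𝓡 d) x₀ x 0) (chartVec (𝓡 d) x₀ x 0)
      + ((1 + r.a _ (chartVec (𝓡 d) x₀ x 0)) * 1 + (0 + r.a _ (chartVec (𝓡 d) x₀ x 0)) * 0) : ℝ)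
        : 𝕜) = 1
    rw [chartVec_zero, map_zero, map_zero]
    norm_num

lemma jet_s_inf (x₀ : M) (i : Fin d) :
    jet (h.slab_mem x₀) (h.hatG x₀ (sIdx i) nI) = locA 𝕜 r A x₀ i := by
  refine eq_of_serX ?_ ?_
  · rw [serX_jet_inf h hn, serX_locA]
    refine jet_congr _ _ fun w hw hw' => ?_
    rw [extz_eq_ev _ hw, extz_eq_ev _ hw', acceleration_slab h hn]
    rfl
  · refine sm_ext fun x hx => ?_
    rw [initial_frame h hn, constantCoeff_locA]
    change ((r.g _ (chartVec (𝓡 d) x₀ x (single i 1)) (chartVec (𝓡 d) x₀ x 0)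
      + ((0 + r.a _ (chartVec (𝓡 d) x₀ x (single i 1))) * 1
        + (0 + r.a _ (chartVec (𝓡 d) x₀ x 0)) * 0) : ℝ) : 𝕜)
      = ((r.a _ (chartVec (𝓡 d) x₀ x (single i 1)) : ℝ) : 𝕜)
    rw [chartVec_zero, map_zero]
    congr 1
    ring

lemma gauge (x₀ : M) {k₀} (hk : locg 𝕜 r x₀ * k₀ = 1) :
    Gauge (locg 𝕜 r x₀) k₀ (locA 𝕜 r A x₀) ((h.hatG x₀).map (jet (h.slab_mem x₀)))
      ((h.hatG x₀)⁻¹.map (jet (h.slab_mem x₀))) where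
  symm i j := by rw [map_apply, map_apply, (h.hatG_symm x₀)]
  inv := by
    rw [← Matrix.map_mul, h.hatG_inv]
    ext1 i j
    simp [one_apply, apply_ite (jet (h.slab_mem x₀))]
  ii := jet_inf_inf h hn x₀
  zi := jet_z_inf h hn x₀
  si := jet_s_inf h hn x₀
  zz := sm_ext fun x hx => by
    rw [map_apply, initial_frame h hn, map_zero]
    change ((r.g _ (chartVec (𝓡 d) x₀ x 0) (chartVec (𝓡 d) x₀ x 0)
      + ((1 + r.a _ (chartVec (𝓡 d) x₀ x 0)) * 0 + (1 + r.a _ (chartVec (𝓡 d) x₀ x 0)) * 0) : ℝ)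
        : 𝕜) = 0
    rw [chartVec_zero, map_zero, mul_zero, add_zero, add_zero, ofReal_zero]
  zs i := sm_ext fun x hx => by
    rw [map_apply, initial_frame h hn, map_zero]
    change ((r.g _ (chartVec (𝓡 d) x₀ x 0) (chartVec (𝓡 d) x₀ x (single i 1))
      + ((1 + r.a _ (chartVec (𝓡 d) x₀ x 0)) * 0
        + (0 + r.a _ (chartVec (𝓡 d) x₀ x (single i 1))) * 0) : ℝ) : 𝕜) = 0
    rw [chartVec_zero, map_zero, LinearMap.zero_apply, mul_zero, mul_zero, add_zero, add_zero,
      ofReal_zero]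
  ss i j := sm_ext fun x hx => by
    rw [map_apply, initial_frame h hn, ev_locg]
    change ((r.g _ (chartVec (𝓡 d) x₀ x (single i 1)) (chartVec (𝓡 d) x₀ x (single j 1))
      + ((0 + r.a _ (chartVec (𝓡 d) x₀ x (single i 1))) * 0
        + (0 + r.a _ (chartVec (𝓡 d) x₀ x (single j 1))) * 0) : ℝ) : 𝕜) = _
    rw [mul_zero, mul_zero, add_zero, add_zero]
    rfl
  inv₀ := hk

end IsWeylNormal

/-- A smooth homogeneous function with `f = t` at `ρ = 0`. -/
structure IsWarp (U : Set (Total M)) (f : Total M → 𝕜) : Prop where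
  smooth : ∀ z₀ : Total M,
    SmoothOn (inChart f z₀) (chartDomain (totalModel d) z₀ U)
  ne_zero : ∀ z ∈ U, f z ≠ 0
  homogeneous : ∀ s : ℝ, 0 < s → ∀ z ∈ U, f (dil s z) = (s : 𝕜) * f z
  initial : ∀ z ∈ initialSurface M, f z = (z.1 : 𝕜)

lemma IsFormalWeylAmbient.isWarp {D : 𝕜} (h : IsFormalWeylAmbient D r U g f) :
    IsWarp (d := d) U f :=
  ⟨h.smooth_warp, h.warp_ne_zero, h.warp_homogeneous, h.warp_initial⟩

lemma isWarp_fst (h : IsWeylPreAmbient r U g) :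
    IsWarp (d := d) U (fun z : Total M => ((z.1 : ℝ) : 𝕜)) where
  smooth _ := contDiffOn_ofReal 𝕜 (f := fun y : Coord d => y.1) contDiffOn_fst
  ne_zero z hz := RCLike.ofReal_ne_zero.2 (h.pos z hz).ne'
  homogeneous _ _ _ _ := ofReal_mul _ _
  initial _ _ := rfl

lemma warpedRicciBase_zero {ι : Type*} [Fintype ι] [DecidableEq ι] {V : Type*}
    [NormedAddCommGroup V] [NormedSpace ℝ V] (e : ι → V) (G : V → Matrix ι ι 𝕜) (f : V → 𝕜)
    (i j : ι) : warpedRicciBase 0 e G f i j = ricci e G i j := by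
  funext y
  rw [warpedRicciBase, zero_div, zero_mul, sub_zero]

section JetEquations

variable {Ω : Opens (ℰ d × ℝ)} {W : Opens ℰ d} (hW : ∀ x ∈ W, (x, (0 : ℝ)) ∈ Ω)
  {G K : AMat d (Sm 𝕜 Ω)}

lemma baseA_jet (hG : ∀ i j, G i j = G j i) (hK : G * K = 1) (N : 𝕜) (F φ : Sm 𝕜 Ω) (i j : Idx d) :
    baseA (ambD (baseD 𝕜 W)) (ambQ d ((Sm 𝕜 W)⟦X⟧)) (PowerSeries.C (smC N))
      (chr (ambD (baseD 𝕜 W)) (ambQ d ((Sm 𝕜 W)⟦X⟧)) (G.map (jet hW)) (K.map (jet hW)))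
      (jet hW F) (jet hW φ) i j = jet hW (baseA (slabD 𝕜 Ω) (ambQ d (Sm 𝕜 Ω)) (smC N)
        (chr (slabD 𝕜 Ω) (ambQ d (Sm 𝕜 Ω)) G K) F φ i j) := by
  have e := (frameMap_jet hW).baseA_map hG hK (smC N) F φ i j
  rw [jet_smC] at e
  exact e

lemma fibreA_jet (hG : ∀ i j, G i j = G j i) (hK : G * K = 1) (N : 𝕜) (F : Sm 𝕜 Ω) :
    fibreA (ambD (baseD 𝕜 W)) (ambQ d ((Sm 𝕜 W)⟦X⟧)) (PowerSeries.C (smC N)) (K.map (jet hW))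
      (chr (ambD (baseD 𝕜 W)) (ambQ d ((Sm 𝕜 W)⟦X⟧)) (G.map (jet hW)) (K.map (jet hW)))
      (jet hW F) = jet hW (fibreA (slabD 𝕜 Ω) (ambQ d (Sm 𝕜 Ω)) (smC N) K
        (chr (slabD 𝕜 Ω) (ambQ d (Sm 𝕜 Ω)) G K) F) := by
  have e := (frameMap_jet hW).fibreA_map hG hK (smC N) F
  rw [jet_smC] at e
  exact e

end JetEquations

namespace IsWarp

variable (h : IsWeylPreAmbient r U g) (hf : IsWarp (d := d) U f)

/-- The warping function at `t = 1`. -/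
def hatF (x₀ : M) : Sm 𝕜 (h.slab x₀) := smMk _ (h.contDiffOn_slice (hf.smooth (1, x₀, 0)))

lemma ev_hatF (x₀ : M) (w : ℰ d × ℝ) (hw : w ∈ h.slab x₀) :
    ev w hw (hf.hatF h x₀) = f (1, pt x₀ w.1, w.2) := rfl

lemma inChart_eq (z₀ : Total M) (y : Coord d) (hy : y ∈ cone (h.slab z₀.2.1)) :
    inChart f z₀ y = (y.1 : 𝕜) * ev y.2 hy.2 (hf.hatF h z₀.2.1) := by
  have e := hf.homogeneous y.1 hy.1 ((1 : ℝ), pt z₀.2.1 y.2.1, y.2.2) hy.2.2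
  rw [dil, mul_one] at e
  exact e

include hf in
lemma isUnit_hatF (x₀ : M) : IsUnit (hf.hatF h x₀) :=
  sm_isUnit fun _ hw => hf.ne_zero _ hw.2

lemma exists_hatF_inv (x₀ : M) : ∃ φ, hf.hatF h x₀ * φ = 1 :=
  (hf.isUnit_hatF h x₀).exists_right_inv

lemma initial_mem_chartDomain (x₀ : M) {x : ℰ d} (hx : x ∈ chartO x₀) :
    ((1, x, 0) : Coord d) ∈ chartDomain (totalModel d) ((1, x₀, 0) : Total M) (initialSurface M) :=
  (mem_chartDomain _ _ _).2 ⟨hx, one_pos, rfl⟩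

lemma isFormalSolution (hn : IsWeylNormal r A U g) {N : 𝕜}
    (hb : ∀ (z₀ : Total M), ∀ y ∈ chartDomain (totalModel d) z₀ (initialSurface M), ∀ I J : Idx d,
      VanishesToInfiniteOrder (warpedRicciBase N (coordBasis d) (comps g z₀) (inChart f z₀) I J) y)
    (x₀ : M) {k₀} (hk : locg 𝕜 r x₀ * k₀ = 1) {φ : Sm 𝕜 (h.slab x₀)} (hφ : hf.hatF h x₀ * φ = 1) :
    IsFormalSolution (baseD 𝕜 (chartO x₀)) (locg 𝕜 r x₀) k₀ (locA 𝕜 r A x₀) (smC N)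
      ((h.hatG x₀).map (jet (h.slab_mem x₀))) ((h.hatG x₀)⁻¹.map (jet (h.slab_mem x₀)))
      (jet (h.slab_mem x₀) (hf.hatF h x₀)) (jet (h.slab_mem x₀) φ) where
  gauge := hn.gauge h x₀ hk
  f₀ := sm_ext fun x hx => by
    rw [ev_constantCoeff_jet, ev_hatF, hf.initial _ ⟨one_pos, rfl⟩, map_one, ofReal_one]
  inv := by rw [← map_mul, hφ, map_one]
  base i j := by
    rw [baseA_jet (h.slab_mem x₀) (h.hatG_symm x₀) (h.hatG_inv x₀)]
    refine jet_eq_zero_of_vanishes (h.slab_mem x₀) (F := warpedRicciBase N (coordBasis d)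
      (comps g ((1, x₀, 0) : Total M)) (inChart f (1, x₀, 0)) i j) (fun w hw => ?_)
      fun x hx => hb (1, x₀, 0) (1, x, 0) (initial_mem_chartDomain x₀ hx) i j
    have hwt : ∀ i : Idx d, wt 1 i = 1 := fun i => by rcases i with i | i <;> simp [wt]
    rw [(h.isCone (1, x₀, 0)).warpedRicciBase_eq (hf.inChart_eq h (1, x₀, 0)) hφ N (1, w)
      ⟨one_pos, hw⟩, hwt, hwt, mul_one, ofReal_one, one_mul]

lemma fibre_eq_zero {N : 𝕜}
    (hb : ∀ (z₀ : Total M), ∀ y ∈ chartDomain (totalModel d) z₀ (initialSurface M),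
      VanishesToInfiniteOrder
        (warpedRicciFibre N (coordBasis d) (comps g z₀) (inChart f z₀)) y) (x₀ : M) :
    fibreA (ambD (baseD 𝕜 (chartO x₀))) (ambQ d _) (PowerSeries.C (smC N))
      ((h.hatG x₀)⁻¹.map (jet (h.slab_mem x₀)))
      (chr (ambD (baseD 𝕜 (chartO x₀))) (ambQ d _) ((h.hatG x₀).map (jet (h.slab_mem x₀)))
        ((h.hatG x₀)⁻¹.map (jet (h.slab_mem x₀)))) (jet (h.slab_mem x₀) (hf.hatF h x₀)) = 0 := by
  rw [fibreA_jet (h.slab_mem x₀) (h.hatG_symm x₀) (h.hatG_inv x₀), ← neg_eq_zero, ← map_neg]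
  refine jet_eq_zero_of_vanishes (h.slab_mem x₀) (F := warpedRicciFibre N (coordBasis d)
      (comps g ((1, x₀, 0) : Total M)) (inChart f (1, x₀, 0))) (fun w hw => ?_)
      fun x hx => hb (1, x₀, 0) (1, x, 0) (initial_mem_chartDomain x₀ hx)
  rw [(h.isCone (1, x₀, 0)).warpedRicciFibre_eq (hf.inChart_eq h (1, x₀, 0)) N (1, w)
    ⟨one_pos, hw⟩, map_neg]

end IsWarp

section Uniqueness

lemma regularParam {D : 𝕜} (hD : Regular D) (W : Opens ℰ d) :
    RegularParam (baseD 𝕜 W) (smC (D - d)) where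
  comm := baseD_comm
  const i := smD_smC _ _
  one := sm_isUnit fun y hy => by
    rw [map_sub, map_add, map_natCast, map_one, ev_smC, add_sub_cancel]
    exact sub_ne_zero.2 hD.1
  even k := sm_isUnit fun y hy => by
    rw [map_sub, map_add, map_mul, map_natCast, map_natCast, map_ofNat, ev_smC, add_sub_cancel]
    exact sub_ne_zero.2 (hD.2 k)

lemma exists_smooth_sub {E : Type*} [NormedAddCommGroup E] [NormedSpace ℝ E]
    {Ω Ω' : Opens (E × ℝ)} {W : Opens E} (hW : ∀ x ∈ W, (x, (0 : ℝ)) ∈ Ω)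
    (hW' : ∀ x ∈ W, (x, (0 : ℝ)) ∈ Ω') (P : Sm 𝕜 Ω) (P' : Sm 𝕜 Ω') (h : jet hW P = jet hW' P') :
    ∃ (hr : ∀ x ∈ W, (x, (0 : ℝ)) ∈ Ω ⊓ Ω') (S : Sm 𝕜 (Ω ⊓ Ω')), jet hr S = 0 ∧
      ∀ w (hw : w ∈ Ω ⊓ Ω'), ev w hw S = ev w hw.1 P - ev w hw.2 P' := by
  have hr : ∀ x ∈ W, (x, (0 : ℝ)) ∈ Ω ⊓ Ω' := fun x hx => ⟨hW x hx, hW' x hx⟩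
  let a : Sm 𝕜 (Ω ⊓ Ω') := smMk (extz P.1) ((contDiffOn_extz P).mono Set.inter_subset_left)
  let b : Sm 𝕜 (Ω ⊓ Ω') := smMk (extz P'.1) ((contDiffOn_extz P').mono Set.inter_subset_right)
  refine ⟨hr, a - b, ?_, fun w hw => ?_⟩
  · have h1 : jet hr a = jet hW P := jet_congr _ _ fun w hw hw' => by rw [extz_eq_ev _ hw]; rfl
    have h2 : jet hr b = jet hW' P' := jet_congr _ _ fun w hw hw' => by rw [extz_eq_ev _ hw]; rfl
    rw [map_sub, h1, h2, h, sub_self]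
  · rw [map_sub, ev_smMk, ev_smMk, extz_eq_ev _ hw.1, extz_eq_ev _ hw.2]

variable {U' : Set (Total M)} {g' : TwoTensor d M 𝕜} {f' : Total M → 𝕜}

lemma agree_of_jets (h : IsWeylPreAmbient r U g) (h' : IsWeylPreAmbient r U' g')
    (hj : ∀ x₀ i j, jet (h.slab_mem x₀) (h.hatG x₀ i j) = jet (h'.slab_mem x₀) (h'.hatG x₀ i j)) :
    AgreeToInfiniteOrder g g' := by
  intro z₀ y hy i j
  obtain ⟨hx, ht, hρ⟩ := (mem_chartDomain _ _ _).1 hy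
  obtain ⟨t, x, ρ⟩ := y
  obtain rfl : ρ = 0 := hρ
  obtain ⟨hr, S, hS, hS'⟩ := exists_smooth_sub _ _ _ _ (hj z₀.2.1 i j)
  refine vanishes_of_jet_eq_zero (c := fun t => t ^ 2 * (wt t i * wt t j)) hr (fun y hy => ?_) hS ht
    ?_ hx
  · rw [h.comps_eq z₀ y ⟨hy.1, hy.2.1⟩, h'.comps_eq z₀ y ⟨hy.1, hy.2.2⟩, hS', mul_sub]
  · have hw : ∀ i : Idx d, ContinuousAt (fun t => wt t i) t := fun i => by
      rcases i with i | i
      · exact continuousAt_inv₀ (ne_of_gt ht)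
      · exact continuousAt_const
    exact (continuousAt_id.pow 2).mul ((hw i).mul (hw j))

lemma agreeFun_of_jets (h : IsWeylPreAmbient r U g) (h' : IsWeylPreAmbient r U' g')
    (hf : IsWarp (d := d) U f) (hf' : IsWarp (d := d) U' f')
    (hj : ∀ x₀, jet (h.slab_mem x₀) (hf.hatF h x₀) = jet (h'.slab_mem x₀) (hf'.hatF h' x₀)) :
    AgreeToInfiniteOrderFun (d := d) f f' := by
  intro z₀ y hy
  obtain ⟨hx, ht, hρ⟩ := (mem_chartDomain _ _ _).1 hy
  obtain ⟨t, x, ρ⟩ := y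
  obtain rfl : ρ = 0 := hρ
  obtain ⟨hr, S, hS, hS'⟩ := exists_smooth_sub _ _ _ _ (hj z₀.2.1)
  refine vanishes_of_jet_eq_zero (c := fun t => t) hr (fun y hy => ?_) hS ht continuousAt_id hx
  rw [hf.inChart_eq h z₀ y ⟨hy.1, hy.2.1⟩, hf'.inChart_eq h' z₀ y ⟨hy.1, hy.2.2⟩, hS', mul_sub]

lemma IsFormalWeylAmbient.unique {D : 𝕜} (hD : Regular D) (h : IsFormalWeylAmbient D r U g f)
    (hn : IsWeylNormal r A U g) (h' : IsFormalWeylAmbient D r U' g' f')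
    (hn' : IsWeylNormal r A U' g') :
    AgreeToInfiniteOrder g g' ∧ AgreeToInfiniteOrderFun (d := d) f f' := by
  have h1 := h.toIsWeylPreAmbient
  have h1' := h'.toIsWeylPreAmbient
  have key : ∀ x₀ : M, (h1'.hatG x₀).map (jet (h1'.slab_mem x₀))
      = (h1.hatG x₀).map (jet (h1.slab_mem x₀))
      ∧ jet (h1'.slab_mem x₀) (h'.isWarp.hatF h1' x₀)
        = jet (h1.slab_mem x₀) (h.isWarp.hatF h1 x₀) := by
    intro x₀
    obtain ⟨k₀, hk⟩ := exists_locg_inv 𝕜 r x₀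
    obtain ⟨φ, hφ⟩ := h.isWarp.exists_hatF_inv h1 x₀
    obtain ⟨φ', hφ'⟩ := h'.isWarp.exists_hatF_inv h1' x₀
    exact (h.isWarp.isFormalSolution h1 hn h.ricciFlat_base x₀ hk hφ).unique (regularParam hD _)
      (h'.isWarp.isFormalSolution h1' hn' h'.ricciFlat_base x₀ hk hφ')
      (Or.inl ⟨h.isWarp.fibre_eq_zero h1 h.ricciFlat_fibre x₀,
        h'.isWarp.fibre_eq_zero h1' h'.ricciFlat_fibre x₀⟩)
  exact ⟨agree_of_jets h1 h1' fun x₀ i j => (congrFun (congrFun (key x₀).1 i) j).symm,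
    agreeFun_of_jets h1 h1' h.isWarp h'.isWarp fun x₀ => (key x₀).2.symm⟩

lemma regular_natCast (hd : Odd d) (h3 : 3 ≤ d) : Regular (d : 𝕜) := by
  refine ⟨fun h => ?_, fun k h => ?_⟩
  · have : d = 1 := by exact_mod_cast h
    omega
  · have : d = 2 * k := by exact_mod_cast h
    exact (Nat.not_even_iff_odd.2 hd) ⟨k, by omega⟩

lemma IsWeylAmbient.unique (hD : Regular (d : 𝕜)) (h : IsWeylAmbient r U g)
    (hn : IsWeylNormal r A U g) (h' : IsWeylAmbient r U' g') (hn' : IsWeylNormal r A U' g') :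
    AgreeToInfiniteOrder g g' := by
  have h1 := h.toIsWeylPreAmbient
  have h1' := h'.toIsWeylPreAmbient
  refine agree_of_jets h1 h1' fun x₀ i j => ?_
  obtain ⟨k₀, hk⟩ := exists_locg_inv 𝕜 r x₀
  have hw := isWarp_fst h1
  have hw' := isWarp_fst h1'
  have e : hw.hatF h1 x₀ = 1 := sm_ext fun w hw => by rw [IsWarp.ev_hatF]; simp
  have e' : hw'.hatF h1' x₀ = 1 := sm_ext fun w hw => by rw [IsWarp.ev_hatF]; simp
  have s := hw.isFormalSolution h1 hn (N := (d : 𝕜) - d) (fun z₀ y hy I J => by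
    rw [sub_self, warpedRicciBase_zero]; exact h.ricciFlat z₀ y hy I J) x₀ hk
    (φ := 1) (by rw [e, one_mul])
  have s' := hw'.isFormalSolution h1' hn' (N := (d : 𝕜) - d) (fun z₀ y hy I J => by
    rw [sub_self, warpedRicciBase_zero]; exact h'.ricciFlat z₀ y hy I J) x₀ hk
    (φ := 1) (by rw [e', one_mul])
  have u := s.unique (regularParam hD _) s' (Or.inr ⟨sm_ext fun y hy => by
    rw [ev_smC, sub_self, map_zero], by rw [e, e', map_one, map_one]⟩)
  exact (congrFun (congrFun u.1 i) j).symm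

end Uniqueness

section OfReal

variable (𝕜)

/-- Real functions as `𝕜`-valued functions. -/
def smOfReal : Sm ℝ Ω →+* Sm 𝕜 Ω where
  toFun f := smMk (fun y => ((extz f.1 y : ℝ) : 𝕜)) (contDiffOn_ofReal 𝕜 (contDiffOn_extz f))
  map_one' := sm_ext fun y hy => by rw [ev_smMk, extz_eq_ev _ hy, map_one, map_one, ofReal_one]
  map_mul' f g := sm_ext fun y hy => by simp only [map_mul, ev_smMk, extz_eq_ev _ hy]
  map_zero' := sm_ext fun y hy => by rw [ev_smMk, extz_eq_ev _ hy, map_zero, map_zero, ofReal_zero]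
  map_add' f g := sm_ext fun y hy => by
    simp only [map_add, ev_smMk, extz_eq_ev _ hy]

lemma ev_smOfReal (f : Sm ℝ Ω) (y : V) (hy : y ∈ Ω) :
    ev y hy (smOfReal 𝕜 f) = ((ev y hy f : ℝ) : 𝕜) := by rw [← extz_eq_ev f hy]; rfl

lemma smD_smOfReal (v : V) (f : Sm ℝ Ω) : smD 𝕜 Ω v (smOfReal 𝕜 f) = smOfReal 𝕜 (smD ℝ Ω v f) := by
  refine sm_ext fun y hy => ?_
  have h := (RCLike.ofRealCLM (K := 𝕜)).hasFDerivAt.comp y (differentiableAt_extz f hy).hasFDerivAt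
  rw [ev_smD v (f := fun y => ((extz f.1 y : ℝ) : 𝕜)) (fun _ _ => rfl), ev_smOfReal, ev_smD_extz]
  exact DFunLike.congr_fun h.fderiv v

variable {Ω : Opens (E × ℝ)} {W : Opens E}

lemma jet_smOfReal (hW : ∀ x ∈ W, (x, (0 : ℝ)) ∈ Ω) (f : Sm ℝ Ω) :
    jet hW (smOfReal 𝕜 f) = mapX (smOfReal 𝕜) (jet hW f) := by
  ext1 n
  have h : ((smD 𝕜 Ω ((0 : E), (1 : ℝ)))^[n] (smOfReal 𝕜 f))
      = smOfReal 𝕜 ((smD ℝ Ω ((0 : E), (1 : ℝ)))^[n] f) := by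
    have : Function.Semiconj (smOfReal 𝕜 : Sm ℝ Ω → Sm 𝕜 Ω) (smD ℝ Ω ((0 : E), (1 : ℝ)))
      (smD 𝕜 Ω ((0 : E), (1 : ℝ))) := fun f => (smD_smOfReal 𝕜 _ f).symm
    exact ((this.iterate_right n) f).symm
  rw [coeff_map, coeff_jet, coeff_jet, h]
  refine sm_ext fun x hx => ?_
  rw [map_smul, ev_smRes, ev_smOfReal, ev_smOfReal, map_smul, ev_smRes, smul_eq_mul,
    ofReal_mul, real_smul_eq_coe_mul]

end OfReal

section LocalReal

variable (r A x₀)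

lemma locg_eq : locg 𝕜 r x₀ = (locg ℝ r x₀).map (smOfReal 𝕜) := by
  ext1 i j
  exact sm_ext fun x hx => by rw [map_apply, ev_smOfReal, ev_locg, ev_locg]; rfl

lemma locA_eq (i : Fin d) : locA 𝕜 r A x₀ i = mapX (smOfReal 𝕜) (locA ℝ r A x₀ i) := by
  have hs : ∀ F : PowerSeries (Sm ℝ (chartO (d := d) x₀)),
      serX _ (mapX (smOfReal 𝕜) F) = mapX (smOfReal 𝕜) (serX _ F) := by
    intro F; ext1 n; simp [coeff_serX]
  have hφ : locφ 𝕜 A x₀ i = smOfReal 𝕜 (locφ ℝ A x₀ i) :=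
    sm_ext fun w hw => by rw [ev_smOfReal]; rfl
  refine eq_of_serX ?_ ?_
  · rw [hs, serX_locA, serX_locA, hφ, jet_smOfReal]
  · rw [constantCoeff_locA, ← coeff_zero, coeff_map, coeff_zero, constantCoeff_locA]
    exact sm_ext fun w hw => by rw [ev_smOfReal]; rfl

end LocalReal

section Rational

variable (𝕜) in
/-- The regular values of the dimension parameter. -/
abbrev RegD : Type _ := {D : 𝕜 // Regular D}

variable (W : Opens ℰ d)

/-- A derivation that preserves a subalgebra. -/
def derivSub {R : Type*} [CommRing R] [Algebra ℝ R] (S : Subalgebra ℝ R) (δ : Der R)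
    (h : ∀ x ∈ S, δ x ∈ S) : Der S :=
  Derivation.mk'
    { toFun := fun x => ⟨δ x.1, h x.1 x.2⟩
      map_add' := fun x y => Subtype.ext (map_add δ x.1 y.1)
      map_smul' := fun c x => Subtype.ext (δ.map_smul c x.1) }
    (fun x y => Subtype.ext (δ.leibniz x.1 y.1))

variable (𝕜) in
/-- The coordinate derivations of families of functions. -/
def piD (i : Fin d) : Derivation ℝ (RegD 𝕜 → Sm 𝕜 W) (RegD 𝕜 → Sm 𝕜 W) :=
  Derivation.mk'
    { toFun := fun F D => baseD 𝕜 W i (F D)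
      map_add' := fun _ _ => funext fun _ => map_add _ _ _
      map_smul' := fun c F => funext fun D => (baseD 𝕜 W i).map_smul c (F D) }
    (fun _ _ => funext fun _ => (baseD 𝕜 W i).leibniz _ _)

variable (𝕜) in
/-- The scalar families that generate the rational functions without poles at regular values. -/
def ratScalar : Set (RegD 𝕜 → 𝕜) :=
  {fun D => D.1, fun D => (D.1 - 1)⁻¹} ∪ Set.range fun (k : ℕ) (D : RegD 𝕜) => (D.1 - 2 * (k : 𝕜))⁻¹

variable (𝕜) in
/-- Families of functions that depend rationally on `D`, without poles at regular values. -/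
def ratS : Subalgebra ℝ (RegD 𝕜 → Sm 𝕜 W) :=
  Algebra.adjoin ℝ ((Set.range fun (f : Sm ℝ W) (_ : RegD 𝕜) => smOfReal 𝕜 f) ∪
    (fun (c : RegD 𝕜 → 𝕜) (D : RegD 𝕜) => (smC (c D) : Sm 𝕜 W)) '' ratScalar 𝕜)

variable {W}

lemma piD_mem (i : Fin d) : ∀ F ∈ ratS 𝕜 W, piD 𝕜 W i F ∈ ratS 𝕜 W := by
  intro F hF
  induction hF using Algebra.adjoin_induction with
  | mem F hF =>
    rcases hF with ⟨f, rfl⟩ | ⟨c, -, rfl⟩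
    · have : piD 𝕜 W i (fun _ => smOfReal 𝕜 f) = fun _ => smOfReal 𝕜 (baseD ℝ W i f) :=
        funext fun D => smD_smOfReal 𝕜 _ f
      rw [this]
      exact Algebra.subset_adjoin (Or.inl ⟨_, rfl⟩)
    · have : piD 𝕜 W i (fun D => (smC (c D) : Sm 𝕜 W)) = 0 := funext fun D => smD_smC _ _
      rw [this]
      exact Subalgebra.zero_mem _
  | algebraMap c => rw [Derivation.map_algebraMap]; exact Subalgebra.zero_mem _
  | add F G _ _ hF hG => rw [map_add]; exact Subalgebra.add_mem _ hF hG
  | mul F G h1 h2 hF hG =>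
    rw [Derivation.leibniz]
    exact Subalgebra.add_mem _ (Subalgebra.mul_mem _ h1 hG) (Subalgebra.mul_mem _ h2 hF)

open Polynomial in
lemma exists_polynomials {F : RegD 𝕜 → Sm 𝕜 W} (hF : F ∈ ratS 𝕜 W) (y : ℰ d) (hy : y ∈ W) :
    ∃ P Q : ℝ[X], (∀ D : RegD 𝕜, aeval D.1 Q ≠ 0) ∧
      ∀ D : RegD 𝕜, aeval D.1 Q * ev y hy (F D) = aeval D.1 P := by
  induction hF using Algebra.adjoin_induction with
  | mem F hF =>
    rcases hF with ⟨f, rfl⟩ | ⟨c, hc, rfl⟩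
    · exact ⟨C (ev y hy f), 1, fun D => by simp, fun D => by
        rw [map_one, one_mul, ev_smOfReal, aeval_C, RCLike.algebraMap_eq_ofReal]⟩
    · rcases hc with (rfl | rfl) | ⟨k, rfl⟩
      · exact ⟨X, 1, fun D => by simp, fun D => by simp⟩
      · have h : ∀ D : RegD 𝕜, D.1 - 1 ≠ 0 := fun D => sub_ne_zero.2 D.2.1
        exact ⟨1, X - 1, fun D => by simpa using h D, fun D => by simp [h D]⟩
      · have h : ∀ D : RegD 𝕜, D.1 - 2 * (k : 𝕜) ≠ 0 := fun D => sub_ne_zero.2 (D.2.2 k)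
        have e : ∀ D : 𝕜, aeval D (X - C (2 * (k : ℝ))) = D - 2 * (k : 𝕜) := fun D => by
          rw [map_sub, aeval_X, aeval_C, map_mul, map_ofNat, map_natCast]
        exact ⟨1, X - C (2 * (k : ℝ)), fun D => by rw [e]; exact h D, fun D => by
          rw [e, ev_smC, map_one, mul_inv_cancel₀ (h D)]⟩
  | algebraMap c =>
    refine ⟨C c, 1, fun D => by simp, fun D => ?_⟩
    rw [map_one, one_mul, Pi.algebraMap_apply, AlgHom.commutes, aeval_C]
  | add F G _ _ hF hG =>
    obtain ⟨P, Q, h1, h2⟩ := hF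
    obtain ⟨P', Q', h1', h2'⟩ := hG
    refine ⟨P * Q' + P' * Q, Q * Q', fun D => by rw [map_mul]; exact mul_ne_zero (h1 D) (h1' D),
      fun D => ?_⟩
    simp only [Pi.add_apply, map_add, map_mul]
    linear_combination aeval D.1 Q' * h2 D + aeval D.1 Q * h2' D
  | mul F G _ _ hF hG =>
    obtain ⟨P, Q, h1, h2⟩ := hF
    obtain ⟨P', Q', h1', h2'⟩ := hG
    refine ⟨P * P', Q * Q', fun D => by rw [map_mul]; exact mul_ne_zero (h1 D) (h1' D),
      fun D => ?_⟩
    simp only [Pi.mul_apply, map_mul]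
    rw [← h2, ← h2']
    ring

variable (𝕜 W) in
/-- The ring of families of functions that depend rationally on `D`. -/
def RatFam : Type _ := ratS 𝕜 W

instance : CommRing (RatFam 𝕜 W) := inferInstanceAs (CommRing (ratS 𝕜 W))

instance : Algebra ℝ (RatFam 𝕜 W) := inferInstanceAs (Algebra ℝ (ratS 𝕜 W))

/-- Rational families that do not depend on `D`. -/
def ratConst : Sm ℝ W →+* RatFam 𝕜 W :=
  (RingHom.pi fun _ : RegD 𝕜 => smOfReal 𝕜).codRestrict (ratS 𝕜 W).toSubring fun f =>
    Algebra.subset_adjoin (Or.inl ⟨f, rfl⟩)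

/-- The value at `D` of a rational family. -/
def ratEv (D : RegD 𝕜) : RatFam 𝕜 W →+* Sm 𝕜 W :=
  (Pi.evalRingHom (fun _ : RegD 𝕜 => Sm 𝕜 W) D).comp (ratS 𝕜 W).val.toRingHom

variable (𝕜 W) in
/-- The coordinate derivations of rational families. -/
def ratD (i : Fin d) : Derivation ℝ (RatFam 𝕜 W) (RatFam 𝕜 W) := derivSub _ (piD 𝕜 W i) (piD_mem i)

lemma ratScalar_mem {c : RegD 𝕜 → 𝕜} (hc : c ∈ ratScalar 𝕜) :
    (fun D : RegD 𝕜 => (smC (c D) : Sm 𝕜 W)) ∈ ratS 𝕜 W :=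
  Algebra.subset_adjoin (Or.inr ⟨c, hc, rfl⟩)

variable (W) in
/-- A scalar family as a rational family. -/
def ratC {c : RegD 𝕜 → 𝕜} (hc : c ∈ ratScalar 𝕜) : RatFam 𝕜 W :=
  (⟨_, ratScalar_mem hc⟩ : ratS 𝕜 W)

lemma ratEv_ratC {c : RegD 𝕜 → 𝕜} (hc : c ∈ ratScalar 𝕜) (D : RegD 𝕜) :
    ratEv D (ratC W hc) = smC (c D) := rfl

lemma ratScalar_id : (fun D : RegD 𝕜 => D.1) ∈ ratScalar 𝕜 := Or.inl (Or.inl rfl)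

variable (𝕜 W) in
/-- The family `D - d`. -/
def ratN : RatFam 𝕜 W := ratC W ratScalar_id - (d : RatFam 𝕜 W)

lemma ratEv_ratN (D : RegD 𝕜) : ratEv D (ratN 𝕜 W) = smC (D.1 - d) := by
  rw [ratN, map_sub, map_natCast, ratEv_ratC]
  exact sm_ext fun y hy => by rw [map_sub, map_natCast, ev_smC, ev_smC]

lemma RatFam.ext {F G : RatFam 𝕜 W} (h : ∀ D, ratEv D F = ratEv D G) : F = G :=
  Subtype.ext (funext h)

lemma ratEv_ratD (D : RegD 𝕜) (i : Fin d) (F : RatFam 𝕜 W) :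
    baseD 𝕜 W i (ratEv D F) = ratEv D (ratD 𝕜 W i F) := rfl

lemma ratD_comm (i j : Fin d) (F : RatFam 𝕜 W) :
    ratD 𝕜 W i (ratD 𝕜 W j F) = ratD 𝕜 W j (ratD 𝕜 W i F) :=
  RatFam.ext fun D => by simp only [← ratEv_ratD, baseD_comm]

lemma isUnit_rat {F : RatFam 𝕜 W} {c : RegD 𝕜 → 𝕜} (hc : c ∈ ratScalar 𝕜)
    (h : ∀ D, ratEv D F * smC (c D) = 1) : IsUnit F :=
  IsUnit.of_mul_eq_one (ratC W hc) (RatFam.ext fun D => by rw [map_mul, ratEv_ratC, h, map_one])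

lemma regularParam_rat : RegularParam (ratD 𝕜 W) (ratN 𝕜 W) where
  comm := ratD_comm
  const i := RatFam.ext fun D => by rw [← ratEv_ratD, ratEv_ratN, map_zero]; exact smD_smC _ _
  one := isUnit_rat (c := fun D => (D.1 - 1)⁻¹) (Or.inl (Or.inr rfl)) fun D => by
    rw [map_sub, map_add, map_natCast, map_one, ratEv_ratN]
    refine sm_ext fun y hy => ?_
    rw [map_mul, map_sub, map_add, map_natCast, map_one, ev_smC, ev_smC, add_sub_cancel]
    exact mul_inv_cancel₀ (sub_ne_zero.2 D.2.1)
  even k := isUnit_rat (c := fun D => (D.1 - 2 * (k : 𝕜))⁻¹) (Or.inr ⟨k, rfl⟩) fun D => by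
    rw [map_sub, map_add, map_mul, map_natCast, map_natCast, map_ofNat, ratEv_ratN]
    refine sm_ext fun y hy => ?_
    rw [map_mul, map_sub, map_add, map_mul, map_natCast, map_natCast, map_ofNat, map_one, ev_smC,
      ev_smC, add_sub_cancel]
    exact mul_inv_cancel₀ (sub_ne_zero.2 (D.2.2 k))

end Rational

section RationalSolution

variable (r A)

lemma HasSignature.symm {W : Type*} [AddCommGroup W] [Module ℝ W] {B : W → W → ℝ} {p q : ℕ}
    (h : HasSignature B p q) (u v : W) : B u v = B v u := by
  obtain ⟨e, he⟩ := h
  rw [he, he]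
  congr 1 <;> exact sum_ext fun _ => mul_comm _ _

lemma locg_symm (x₀ : M) (i j : Fin d) : locg 𝕜 r x₀ i j = locg 𝕜 r x₀ j i :=
  sm_ext fun x _ => congrArg (fun s : ℝ => (s : 𝕜)) ((r.signature (pt x₀ x)).symm _ _)

lemma map_mul_map_eq_one {ι R R' : Type*} [Fintype ι] [DecidableEq ι] [CommRing R] [CommRing R']
    {G K : Matrix ι ι R} (h : G * K = 1) (ψ : R →+* R') : G.map ψ * K.map ψ = 1 := by
  rw [← Matrix.map_mul, h]; ext a b; simp [one_apply, apply_ite ψ]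

lemma rat_specialise {W : Opens ℰ d} {g₀ k₀ : Mat d (Sm ℝ W)} {A₀ : Fin d → (Sm ℝ W)⟦X⟧}
    {G K : AMat d ((RatFam 𝕜 W)⟦X⟧)} {f φ : (RatFam 𝕜 W)⟦X⟧}
    (s : IsFormalSolution (ratD 𝕜 W) (g₀.map ratConst) (k₀.map ratConst)
      (fun i => mapX ratConst (A₀ i)) (ratN 𝕜 W) G K f φ)
    (hs : fibreA (ambD (ratD 𝕜 W)) (ambQ d _) (PowerSeries.C (ratN 𝕜 W)) K
      (chr (ambD (ratD 𝕜 W)) (ambQ d _) G K) f = 0) (D : RegD 𝕜) :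
    IsFormalSolution (baseD 𝕜 W) (g₀.map (smOfReal 𝕜)) (k₀.map (smOfReal 𝕜))
      (fun i => mapX (smOfReal 𝕜) (A₀ i)) (smC (D.1 - d))
      (G.map (mapX (ratEv D))) (K.map (mapX (ratEv D))) (mapX (ratEv D) f) (mapX (ratEv D) φ) ∧
    fibreA (ambD (baseD 𝕜 W)) (ambQ d _) (PowerSeries.C (smC (D.1 - d))) (K.map (mapX (ratEv D)))
      (chr (ambD (baseD 𝕜 W)) (ambQ d _) (G.map (mapX (ratEv D)))
        (K.map (mapX (ratEv D)))) (mapX (ratEv D) f) = 0 := by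
  have hB : BaseMap (ratEv D) (ratD 𝕜 W) (baseD 𝕜 W) 1 1 :=
    BaseMap.of_commute (ratEv_ratD D) ratD_comm baseD_comm
  have e1 : ∀ m : Mat d (Sm ℝ W),
      (m.map (ratConst (𝕜 := 𝕜))).map (ratEv D) = m.map (smOfReal 𝕜) := fun m => rfl
  have e2 : (fun i => ∑ a, PowerSeries.C ((1 : Mat d (Sm 𝕜 W)) i a)
      * mapX (ratEv D) (mapX ratConst (A₀ a)))
      = fun i => mapX (smOfReal 𝕜) (A₀ i) := by
    funext i
    simp only [one_apply, apply_ite (PowerSeries.C : Sm 𝕜 W →+* _), map_one, map_zero,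
      ite_mul, one_mul, zero_mul, sum_ite_eq, Finset.mem_univ, if_true]
    ext1 n
    rfl
  have t1 := hB.isFormalSolution s
  have t2 := hB.fibre s hs
  have e3 : BaseMap.pullK (ratEv D) 1 K = K.map (mapX (ratEv D)) := by
    rw [BaseMap.pullK, BaseMap.ambJ_one, transpose_one, one_mul, mul_one]
  rw [e2, BaseMap.pullG_one, e3, one_mul, transpose_one, mul_one, one_mul, mul_one, e1, e1,
    ratEv_ratN] at t1
  rw [BaseMap.pullG_one, e3, ratEv_ratN] at t2
  exact ⟨t1, t2⟩

variable (𝕜) in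
lemma exists_rat {W : Opens ℰ d} {g₀ k₀ : Mat d (Sm ℝ W)} (A₀ : Fin d → (Sm ℝ W)⟦X⟧)
    (hg : ∀ i j, g₀ i j = g₀ j i) (hk : g₀ * k₀ = 1) :
    ∃ (G K : AMat d ((RatFam 𝕜 W)⟦X⟧)) (f φ : (RatFam 𝕜 W)⟦X⟧),
      IsFormalSolution (ratD 𝕜 W) (g₀.map ratConst) (k₀.map ratConst)
        (fun i => mapX ratConst (A₀ i)) (ratN 𝕜 W) G K f φ ∧
      fibreA (ambD (ratD 𝕜 W)) (ambQ d _) (PowerSeries.C (ratN 𝕜 W)) K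
        (chr (ambD (ratD 𝕜 W)) (ambQ d _) G K) f = 0 := by
  have h1 : ∀ i j, (g₀.map (ratConst (𝕜 := 𝕜))) i j = (g₀.map (ratConst (𝕜 := 𝕜))) j i :=
    fun i j => congrArg (ratConst (𝕜 := 𝕜)) (hg i j)
  have h2 : g₀.map (ratConst (𝕜 := 𝕜)) * k₀.map (ratConst (𝕜 := 𝕜)) = 1 :=
    map_mul_map_eq_one hk _
  have h3 := regularParam_rat (𝕜 := 𝕜) (W := W)
  have h4 := exists_isFormalSolution h3 h1 h2 (fun i => mapX ratConst (A₀ i))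
  exact h4

lemma exists_rational_solution (x₀ : M) : ∃ (k₀ : Mat d (𝒮 x₀))
      (G K : AMat d (PowerSeries (RatFam 𝕜 (chartO (d := d) x₀))))
      (f φ : PowerSeries (RatFam 𝕜 (chartO (d := d) x₀))),
      locg 𝕜 r x₀ * k₀ = 1 ∧ ∀ D : RegD 𝕜,
        IsFormalSolution (baseD 𝕜 (chartO x₀)) (locg 𝕜 r x₀) k₀ (locA 𝕜 r A x₀) (smC (D.1 - d))
          (G.map (mapX (ratEv D))) (K.map (mapX (ratEv D)))
          (mapX (ratEv D) f) (mapX (ratEv D) φ) ∧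
        fibreA (ambD (baseD 𝕜 (chartO x₀))) (ambQ d _) (PowerSeries.C (smC (D.1 - d)))
          (K.map (mapX (ratEv D)))
          (chr (ambD (baseD 𝕜 (chartO x₀))) (ambQ d _) (G.map (mapX (ratEv D)))
            (K.map (mapX (ratEv D)))) (mapX (ratEv D) f) = 0 := by
  obtain ⟨k, hk⟩ := exists_locg_inv ℝ r x₀
  obtain ⟨G, K, f, φ, s, hs⟩ := exists_rat 𝕜 (locA ℝ r A x₀) (locg_symm r x₀) hk
  refine ⟨k.map (smOfReal 𝕜), G, K, f, φ, ?_, fun D => ?_⟩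
  · rw [locg_eq]; exact map_mul_map_eq_one hk _
  · rw [locg_eq, funext (locA_eq r A x₀)]
    exact rat_specialise s hs D

variable {r A} in
lemma rhoCoeff_eq {U : Set (Total M)} {g : TwoTensor d M 𝕜} (h : IsWeylPreAmbient r U g) (m : ℕ)
    (z₀ : Total M) (I J : Idx d) {t : ℝ} (ht : 0 < t) {y : ℰ d}
    (hy : y ∈ chartO z₀.2.1) : rhoCoeff m g z₀ I J t y
      = ((t ^ 2 * (wt t I * wt t J) * m.factorial : ℝ) : 𝕜)
        * ev y hy (coeff m (jet (h.slab_mem z₀.2.1) (h.hatG z₀.2.1 I J))) := by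
  have e : (fun ρ : ℝ => comps g z₀ (t, y, ρ) I J) =ᶠ[𝓝 0] fun ρ =>
      ((t ^ 2 * (wt t I * wt t J) : ℝ) : 𝕜) * extz (h.hatG z₀.2.1 I J).1 (y, ρ) := by
    filter_upwards [(Continuous.prodMk_right y).continuousAt.eventually_mem
      ((h.slab z₀.2.1).2.mem_nhds (h.slab_mem z₀.2.1 y hy))] with ρ hρ
    rw [h.comps_eq z₀ (t, y, ρ) ⟨ht, hρ⟩, extz_eq_ev _ hρ]
  have hm : ((m.factorial : ℝ) : 𝕜) * (((m.factorial : ℝ)⁻¹ : ℝ) : 𝕜) = 1 := by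
    rw [← ofReal_mul, mul_inv_cancel₀ (by positivity), ofReal_one]
  rw [rhoCoeff, e.iteratedDeriv_eq, ev_coeff_jet, real_smul_eq_coe_mul,
    ofReal_mul _ (m.factorial : ℝ)]
  refine (iteratedDeriv_const_mul_field _ _).trans ?_
  linear_combination (-((t ^ 2 * (wt t I * wt t J) : ℝ) : 𝕜)
    * iteratedDeriv m (fun ρ => extz (h.hatG z₀.2.1 I J).1 (y, ρ)) 0) * hm

lemma exists_rational_rhoCoeff (m : ℕ) (z₀ : Total M) (I J : Idx d) {t : ℝ} (ht : 0 < t)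
    {y : ℰ d} (hy : y ∈ (extChartAt (𝓡 d) z₀.2.1).target) :
    ∃ P Q : Polynomial ℝ, (∀ D : 𝕜, Regular D → Polynomial.aeval D Q ≠ 0) ∧
      ∀ (D : 𝕜) (U : Set (Total M)) (g : TwoTensor d M 𝕜) (f : Total M → 𝕜), Regular D →
        IsFormalWeylAmbient D r U g f → IsWeylNormal r A U g →
        Polynomial.aeval D Q * rhoCoeff m g z₀ I J t y = Polynomial.aeval D P := by
  obtain ⟨k₀, G, K, f, φ, hk, hs⟩ := exists_rational_solution (𝕜 := 𝕜) r A z₀.2.1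
  obtain ⟨P, Q, hQ, hP⟩ := exists_polynomials (coeff m (G I J)).2 y hy
  refine ⟨Polynomial.C (t ^ 2 * (wt t I * wt t J) * m.factorial) * P, Q, fun D hD => hQ ⟨D, hD⟩,
    fun D U g f' hD h hn => ?_⟩
  have h1 := h.toIsWeylPreAmbient
  obtain ⟨φ', hφ'⟩ := h.isWarp.exists_hatF_inv h1 z₀.2.1
  have u := (hs ⟨D, hD⟩).1.unique (regularParam hD _)
    (h.isWarp.isFormalSolution h1 hn h.ricciFlat_base z₀.2.1 hk hφ')
    (Or.inl ⟨(hs ⟨D, hD⟩).2, h.isWarp.fibre_eq_zero h1 h.ricciFlat_fibre z₀.2.1⟩)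
  have e := congrArg (coeff m) (congrFun (congrFun u.1 I) J)
  rw [map_apply, map_apply, coeff_map] at e
  rw [rhoCoeff_eq h1 m z₀ I J ht hy, e, map_mul, Polynomial.aeval_C, ← hP ⟨D, hD⟩,
    RCLike.algebraMap_eq_ofReal]
  change _ = _ * (_ * ev y hy (ratEv ⟨D, hD⟩ (coeff m (G I J))))
  ring

end RationalSolution

section Borel

/-- A bump function around `0`. -/
def cutoff : ContDiffBump (0 : ℝ) := ⟨1, 2, one_pos, one_lt_two⟩

/-- The monomial `ρⁿ`, cut off at distance of order `(l n)⁻¹`. -/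
def cutMonomial (l : ℕ → ℝ) (n : ℕ) (ρ : ℝ) : ℝ := ρ ^ n * cutoff (l n * ρ)

/-- Borel's sum of the series `∑ aₙ ρⁿ`. -/
def borel (l : ℕ → ℝ) (a : ℕ → 𝕜) (ρ : ℝ) : 𝕜 := ∑' n, a n * (cutMonomial l n ρ : 𝕜)

lemma summable_borel {l : ℕ → ℝ} (hl : Tendsto l atTop atTop) (a : ℕ → 𝕜) (ρ : ℝ) :
    Summable fun n => a n * (cutMonomial l n ρ : 𝕜) := by
  have h : ∀ᶠ n in atTop, cutMonomial l n ρ = 0 := by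
    rcases eq_or_ne ρ 0 with rfl | hρ
    · filter_upwards [eventually_gt_atTop 0] with n hn
      rw [cutMonomial, zero_pow hn.ne', zero_mul]
    · filter_upwards [hl.eventually_ge_atTop (2 / |ρ|)] with n hn
      rw [cutMonomial, cutoff.zero_of_le_dist, mul_zero]
      rw [dist_zero_right, Real.norm_eq_abs, abs_mul]
      have h1 := (div_le_iff₀ (abs_pos.2 hρ)).1 hn
      exact h1.trans (mul_le_mul_of_nonneg_right (le_abs_self _) (abs_nonneg _))
  refine summable_of_hasFiniteSupport ?_
  rw [← Nat.cofinite_eq_atTop] at h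
  refine h.subset fun n hn h0 => hn ?_
  have h1 : cutMonomial l n ρ = 0 := h0
  simp [h1]

lemma borel_mul_left (l : ℕ → ℝ) (c : 𝕜) (a : ℕ → 𝕜) (ρ : ℝ) :
    borel l (fun n => c * a n) ρ = c * borel l a ρ := by
  simp only [borel, mul_assoc]
  exact tsum_mul_left

lemma borel_sum {l : ℕ → ℝ} (hl : Tendsto l atTop atTop) {ι : Type*} (s : Finset ι)
    (a : ι → ℕ → 𝕜) (ρ : ℝ) : borel l (fun n => ∑ i ∈ s, a i n) ρ = ∑ i ∈ s, borel l (a i) ρ := by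
  simp only [borel, sum_mul]
  exact Summable.tsum_finsetSum fun i _ => summable_borel hl _ _

lemma iteratedDeriv_slice {F : Type*} [NormedAddCommGroup F] [NormedSpace ℝ F] {f : E × ℝ → F}
    {n : ℕ} (hf : ContDiff ℝ n f) (y : E) (ρ : ℝ) :
    iteratedDeriv n (fun s => f (y, s)) ρ = iteratedFDeriv ℝ n f (y, ρ) fun _ => (0, 1) := by
  have h1 : (fun s : ℝ => f (y, s))
      = (fun z => f ((y, 0) + z)) ∘ ContinuousLinearMap.inr ℝ E ℝ := by funext s; simp
  have h2 : ContDiff ℝ n fun z => f ((y, 0) + z) := hf.comp (contDiff_const.add contDiff_id)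
  rw [iteratedDeriv_eq_iteratedFDeriv, h1,
    ContinuousLinearMap.iteratedFDeriv_comp_right _ h2 _ le_rfl, iteratedFDeriv_comp_add_left]
  simp [ContinuousMultilinearMap.compContinuousLinearMap_apply]

lemma contDiff_cutMonomial (l : ℕ → ℝ) (n : ℕ) : ContDiff ℝ ∞ (cutMonomial l n) :=
  (contDiff_id.pow n).mul (cutoff.contDiff.comp (contDiff_const.mul contDiff_id))

lemma iteratedDeriv_cutMonomial (l : ℕ → ℝ) (n m : ℕ) :
    iteratedDeriv m (cutMonomial l n) 0 = if n = m then (m.factorial : ℝ) else 0 := by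
  have h : cutMonomial l n =ᶠ[𝓝 0] fun ρ => ρ ^ n := by
    have h1 : Tendsto (fun ρ => l n * ρ) (𝓝 0) (𝓝 0) := by
      simpa using (continuous_const.mul continuous_id).tendsto (0 : ℝ) (f := fun ρ => l n * ρ)
    filter_upwards [h1.eventually cutoff.eventuallyEq_one] with ρ hρ
    rw [cutMonomial, hρ]
    simp
  rw [h.iteratedDeriv_eq, iteratedDeriv_fun_pow_zero]
  by_cases h1 : n = m
  · subst h1; simp
  · rw [if_neg h1, if_neg (Ne.symm h1), Nat.cast_zero]

variable (E) in
/-- Rescaling of the second variable. -/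
def scaleSnd (s : ℝ) : E × ℝ →L[ℝ] E × ℝ :=
  (ContinuousLinearMap.fst ℝ E ℝ).prod (s • ContinuousLinearMap.snd ℝ E ℝ)

lemma norm_scaleSnd_le {s : ℝ} (hs : 1 ≤ s) : ‖scaleSnd E s‖ ≤ s := by
  refine ContinuousLinearMap.opNorm_le_bound _ (by linarith) fun z => ?_
  have h1 : ‖z.1‖ ≤ ‖z‖ := norm_fst_le z
  have h2 : ‖z.2‖ ≤ ‖z‖ := norm_snd_le z
  have h3 : scaleSnd E s z = (z.1, s * z.2) := rfl
  rw [h3, Prod.norm_def]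
  refine max_le (h1.trans (le_mul_of_one_le_left (norm_nonneg _) hs)) ?_
  rw [norm_mul, Real.norm_of_nonneg (by linarith : 0 ≤ s)]
  exact mul_le_mul_of_nonneg_left h2 (by linarith)

lemma exists_bound_borel (c : ℕ → E → 𝕜) (hc : ∀ n, ContDiff ℝ ∞ (c n))
    (hs : ∀ n, HasCompactSupport (c n)) :
    ∃ C : ℕ → ℝ, ∀ l : ℕ → ℝ, (∀ n, 1 ≤ l n) → (∀ᶠ n in atTop, C n ≤ l n) →
      ContDiff ℝ ∞ (fun z : E × ℝ => borel l (fun n => c n z.1) z.2) ∧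
      ∀ m y, iteratedDeriv m (borel l fun n => c n y) 0 = (m.factorial : 𝕜) * c m y := by
  set P : ℕ → E × ℝ → 𝕜 := fun n z => c n z.1 * (cutMonomial (fun _ => 1) n z.2 : 𝕜) with hP
  have hofReal : ContDiff ℝ ∞ fun x : ℝ => (x : 𝕜) := (RCLike.ofRealCLM (K := 𝕜)).contDiff
  have cP : ∀ n, ContDiff ℝ ∞ (P n) := fun n => ((hc n).comp contDiff_fst).mul
    (hofReal.comp ((contDiff_cutMonomial _ n).comp contDiff_snd))
  have sP : ∀ n, HasCompactSupport (P n) := fun n => by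
    refine HasCompactSupport.intro ((hs n).isCompact.prod (isCompact_Icc (a := (-2 : ℝ)) (b := 2)))
      fun z hz => ?_
    by_cases h : z.1 ∈ tsupport (c n)
    · have h2 : cutoff z.2 = 0 := by
        refine cutoff.zero_of_le_dist ?_
        rw [dist_zero_right, Real.norm_eq_abs]
        by_contra h3
        exact hz ⟨h, abs_le.1 (not_le.1 h3).le⟩
      simp [hP, cutMonomial, h2]
    · simp [hP, image_eq_zero_of_notMem_tsupport h]
  have hB : ∀ k n, ∃ B, ∀ z, ‖iteratedFDeriv ℝ k (P n) z‖ ≤ B := fun k n =>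
    ((cP n).continuous_iteratedFDeriv (mod_cast le_top)).bounded_above_of_compact_support
      ((sP n).iteratedFDeriv k)
  choose B hB using hB
  have B0 : ∀ k n, 0 ≤ B k n := fun k n => (norm_nonneg _).trans (hB k n 0)
  refine ⟨fun n => 2 ^ n * ∑ k ∈ Finset.range n, B k n, fun l h1 hl => ?_⟩
  have l0 : ∀ n, 0 < l n := fun n => one_pos.trans_le (h1 n)
  set f : ℕ → E × ℝ → 𝕜 := fun n z => c n z.1 * (cutMonomial l n z.2 : 𝕜) with hf
  have fP : ∀ n, f n = fun z => ((l n)⁻¹ ^ n : ℝ) • (P n ∘ scaleSnd E (l n)) z := fun n => by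
    funext z
    have h : cutMonomial l n z.2 = (l n)⁻¹ ^ n * cutMonomial (fun _ => 1) n (l n * z.2) := by
      have := (l0 n).ne'
      simp only [cutMonomial, one_mul, mul_pow, inv_pow]
      field_simp
    have h3 : scaleSnd E (l n) z = (z.1, l n * z.2) := rfl
    simp only [hf, hP, Function.comp, h3, h, ofReal_mul, real_smul_eq_coe_mul]
    ring
  have cf : ∀ n, ContDiff ℝ ∞ (f n) := fun n => ((hc n).comp contDiff_fst).mul
    (hofReal.comp ((contDiff_cutMonomial _ n).comp contDiff_snd))
  have bf : ∀ k n z, ‖iteratedFDeriv ℝ k (f n) z‖ ≤ (l n)⁻¹ ^ n * (B k n * l n ^ k) := by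
    intro k n z
    have c1 : ContDiff ℝ k (P n ∘ scaleSnd E (l n)) :=
      ((cP n).comp (scaleSnd E (l n)).contDiff).of_le (mod_cast le_top)
    rw [fP, iteratedFDeriv_const_smul_apply' c1.contDiffAt, norm_smul, Real.norm_of_nonneg
      (pow_nonneg (inv_nonneg.2 (l0 n).le) _),
      ContinuousLinearMap.iteratedFDeriv_comp_right _ (cP n) _ (mod_cast le_top)]
    refine mul_le_mul_of_nonneg_left ?_ (pow_nonneg (inv_nonneg.2 (l0 n).le) _)
    refine (ContinuousMultilinearMap.norm_compContinuousLinearMap_le _ _).trans ?_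
    rw [Finset.prod_const, Finset.card_univ, Fintype.card_fin]
    exact mul_le_mul (hB k n _) (pow_le_pow_left₀ (norm_nonneg _) (norm_scaleSnd_le (h1 n)) _)
      (by positivity) (B0 k n)
  have sv : ∀ k : ℕ, Summable fun n => (l n)⁻¹ ^ n * (B k n * l n ^ k) := by
    intro k
    refine Summable.of_norm_bounded_eventually_nat
      (summable_geometric_of_lt_one (r := (1 / 2 : ℝ)) (by norm_num) (by norm_num)) ?_
    filter_upwards [hl, eventually_gt_atTop k] with n hn hk
    have p0 : 0 ≤ (l n)⁻¹ ^ n * (B k n * l n ^ k) :=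
      mul_nonneg (pow_nonneg (inv_nonneg.2 (l0 n).le) _) (mul_nonneg (B0 k n) (pow_nonneg (l0 n).le _))
    rw [Real.norm_of_nonneg p0]
    have e1 : B k n ≤ ∑ k ∈ Finset.range n, B k n :=
      Finset.single_le_sum (f := fun k => B k n) (fun k _ => B0 k n) (Finset.mem_range.2 hk)
    have e2 : l n ^ (k + 1) ≤ l n ^ n := pow_le_pow_right₀ (h1 n) hk
    have e3 : 2 ^ n * B k n ≤ l n := (mul_le_mul_of_nonneg_left e1 (by positivity)).trans hn
    rw [inv_pow, one_div, inv_pow, inv_mul_le_iff₀ (pow_pos (l0 n) n), ← div_eq_mul_inv,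
      le_div_iff₀ (by positivity)]
    calc B k n * l n ^ k * 2 ^ n = (2 ^ n * B k n) * l n ^ k := by ring
      _ ≤ l n * l n ^ k := mul_le_mul_of_nonneg_right e3 (pow_nonneg (l0 n).le _)
      _ = l n ^ (k + 1) := by ring
      _ ≤ l n ^ n := e2
  have smooth : ContDiff ℝ ∞ fun z => ∑' n, f n z :=
    contDiff_tsum cf (fun k _ => sv k) fun k n z _ => bf k n z
  refine ⟨smooth, fun m y => ?_⟩
  have e := iteratedDeriv_slice (n := m) (smooth.of_le (mod_cast le_top)) y 0
  have e1 : ∀ n, iteratedFDeriv ℝ m (f n) (y, 0) (fun _ => (0, 1))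
      = if n = m then (m.factorial : 𝕜) * c m y else 0 := fun n => by
    rw [← iteratedDeriv_slice ((cf n).of_le (mod_cast le_top)) y 0]
    have h : (fun s : ℝ => f n (y, s))
        = fun s => (ContinuousLinearMap.mul ℝ 𝕜 (c n y) ∘L RCLike.ofRealCLM) (cutMonomial l n s) := by
      funext s; simp [hf]
    rw [h]
    have h' := (ContinuousLinearMap.mul ℝ 𝕜 (c n y) ∘L RCLike.ofRealCLM).iteratedFDeriv_comp_left
      ((contDiff_cutMonomial l n).contDiffAt (x := 0)) (i := m) (mod_cast le_top)
    have h'' := iteratedDeriv_cutMonomial l n m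
    rw [iteratedDeriv_eq_iteratedFDeriv] at h''
    rw [iteratedDeriv_eq_iteratedFDeriv]
    refine (congrArg (fun L => L fun _ => (1 : ℝ)) h').trans ?_
    rw [ContinuousLinearMap.compContinuousMultilinearMap_coe, Function.comp, h'']
    split_ifs with hnm
    · subst hnm; simp [mul_comm]
    · simp
  refine e.trans ?_
  rw [iteratedFDeriv_tsum cf (fun k _ => sv k) (fun k n z _ => bf k n z) (mod_cast le_top)]
  have sm : Summable fun n => iteratedFDeriv ℝ m (f n) (y, 0) :=
    .of_norm_bounded (sv m) fun n => bf m n _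
  refine (ContinuousMultilinearMap.tsum_eval sm _).trans ?_
  simp only [e1, tsum_ite_eq]

lemma exists_eventually_ge {ι : Type*} [Countable ι] (C : ι → ℕ → ℝ) :
    ∃ l : ℕ → ℝ, (∀ n, 1 ≤ l n) ∧ Tendsto l atTop atTop ∧ ∀ i, ∀ᶠ n in atTop, C i n ≤ l n := by
  rcases isEmpty_or_nonempty ι with h | h
  · exact ⟨fun n => n + 1, fun n => by simp,
      tendsto_atTop_add_const_right _ _ tendsto_natCast_atTop_atTop, fun i => h.elim i⟩
  obtain ⟨e, he⟩ := exists_surjective_nat ι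
  have h0 : ∀ n, 0 ≤ ∑ k ∈ Finset.range n, |C (e k) n| := fun n =>
    sum_nonneg fun k _ => abs_nonneg _
  refine ⟨fun n => n + 1 + ∑ k ∈ Finset.range n, |C (e k) n|, fun n => ?_, ?_, fun i => ?_⟩
  · have := h0 n
    have h1 : (0 : ℝ) ≤ n := n.cast_nonneg
    linarith
  · refine tendsto_atTop_mono (fun n => ?_) tendsto_natCast_atTop_atTop
    have := h0 n
    linarith
  · obtain ⟨k, rfl⟩ := he i
    filter_upwards [eventually_gt_atTop k] with n hn
    have h1 : |C (e k) n| ≤ ∑ k ∈ Finset.range n, |C (e k) n| :=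
      Finset.single_le_sum (f := fun k => |C (e k) n|) (fun k _ => abs_nonneg _)
        (Finset.mem_range.2 hn)
    have h2 := le_abs_self (C (e k) n)
    have h3 : (0 : ℝ) ≤ n := n.cast_nonneg
    linarith

variable [HasContDiffBump E] [FiniteDimensional ℝ E]

lemma exists_bound_borel_ball (c : ℕ → E → 𝕜) (x : E) {s R : ℝ} (hs : 0 < s) (hR : s < R)
    (hc : ∀ n, SmoothOn (c n) (Metric.ball x (2 * R))) :
    ∃ C : ℕ → ℝ, ∀ l : ℕ → ℝ, (∀ n, 1 ≤ l n) → (∀ᶠ n in atTop, C n ≤ l n) →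
      SmoothOn (fun z : E × ℝ => borel l (fun n => c n z.1) z.2)
        (Metric.ball x s ×ˢ Set.univ) ∧ ∀ m, ∀ y ∈ Metric.ball x s,
        iteratedDeriv m (borel l fun n => c n y) 0 = (m.factorial : 𝕜) * c m y := by
  set χ : ContDiffBump x := ⟨s, R, hs, hR⟩
  have hR0 : 0 < R := hs.trans hR
  have e : ∀ y ∈ Metric.ball x s, ∀ n, χ y • c n y = c n y := fun y hy n => by
    rw [χ.one_of_mem_closedBall (Metric.ball_subset_closedBall hy), one_smul]
  obtain ⟨C, hC⟩ := exists_bound_borel (fun n y => χ y • c n y) (fun n => by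
      refine contDiff_iff_contDiffAt.2 fun y => ?_
      by_cases hy : y ∈ Metric.closedBall x R
      · have h : y ∈ Metric.ball x (2 * R) :=
          Metric.closedBall_subset_ball (by linarith) hy
        exact χ.contDiffAt.smul ((hc n).contDiffAt (Metric.isOpen_ball.mem_nhds h))
      · have h : (fun y => χ y • c n y) =ᶠ[𝓝 y] fun _ => 0 := by
          filter_upwards [Metric.isClosed_closedBall.isOpen_compl.mem_nhds hy] with y' hy'
          rw [χ.zero_of_le_dist (le_of_lt (not_le.1 hy')), zero_smul]
        exact contDiffAt_const.congr_of_eventuallyEq h)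
    (fun n => χ.hasCompactSupport.smul_right)
  refine ⟨C, fun l h1 hl => ⟨?_, fun m y hy => ?_⟩⟩
  · refine (hC l h1 hl).1.contDiffOn.congr fun z hz => ?_
    exact congrArg (fun a => borel l a z.2) (funext fun n => (e z.1 hz.1 n).symm)
  · have := (hC l h1 hl).2 m y
    simpa only [e y hy] using this

end Borel

section Transition

/-- The part of the chart around `x₀` that lies in the chart around `x₁`. -/
def transO (x₀ x₁ : M) : Opens ℰ d :=
  ⟨{y | y ∈ chartO x₀ ∧ pt x₀ y ∈ (extChartAt (𝓡 d) x₁).source},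
    (continuousOn_pt x₀).isOpen_inter_preimage (chartO x₀).2 (isOpen_extChartAt_source x₁)⟩

/-- The coordinate change. -/
def trans (x₀ x₁ : M) (y : ℰ d) : ℰ d :=
  extChartAt (𝓡 d) x₁ (pt x₀ y)

variable {y : ℰ d}

lemma trans_mem (hy : y ∈ transO x₀ x₁) : trans x₀ x₁ y ∈ chartO x₁ :=
  (extChartAt (𝓡 d) x₁).map_source hy.2

lemma pt_trans (hy : y ∈ transO x₀ x₁) : pt x₁ (trans x₀ x₁ y) = pt x₀ y :=
  (extChartAt (𝓡 d) x₁).left_inv hy.2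

lemma covector_congr {α : Type*} (T : M → ℰ d → α) {x x' : M}
    {u u' : ℰ d} (hx : x = x') (hu : u = u') : T x u = T x' u' := by subst hx hu; rfl

lemma bilin_congr {α : Type*} (T : M → ℰ d → ℰ d → α)
    {x x' : M} {u u' v v' : ℰ d} (hx : x = x') (hu : u = u') (hv : v = v') :
    T x u v = T x' u' v' := by subst hx hu hv; rfl

lemma linear_sum_smul {V : Type*} [AddCommGroup V] [Module ℝ V] (L : V →ₗ[ℝ] ℝ) (c : Fin d → ℝ)
    (v : Fin d → V) : L (∑ a, c a • v a) = ∑ a, c a * L (v a) := by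
  simp only [map_sum, map_smul, smul_eq_mul]

lemma bilin_sum_smul {V : Type*} [AddCommGroup V] [Module ℝ V] (B : V →ₗ[ℝ] V →ₗ[ℝ] ℝ)
    (c c' : Fin d → ℝ) (v : Fin d → V) :
    B (∑ a, c a • v a) (∑ b, c' b • v b) = ∑ a, ∑ b, c a * (c' b * B (v a) (v b)) := by
  simp only [map_sum, LinearMap.sum_apply, map_smul, LinearMap.smul_apply, smul_eq_mul, mul_sum]
  rw [sum_comm]
  exact sum_ext₂ fun _ _ => by ring

lemma contDiffOn_trans (x₀ x₁ : M) : SmoothOn (trans x₀ x₁) (transO (d := d) x₀ x₁ : Set ℰ d) := by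
  have h := contDiffOn_ext_coord_change (I := 𝓡 d) (n := ∞) x₁ x₀
  refine h.mono fun y hy => ?_
  rw [PartialEquiv.trans_source, PartialEquiv.symm_source]
  exact hy

lemma differentiableAt_trans (hy : y ∈ transO x₀ x₁) : DifferentiableAt ℝ (trans x₀ x₁) y :=
  ((contDiffOn_trans x₀ x₁).contDiffAt ((transO x₀ x₁).2.mem_nhds hy)).differentiableAt (by simp)

lemma chartVec_trans (hy : y ∈ transO x₀ x₁) (u : ℰ d) :
    (chartVec (𝓡 d) x₁ (trans x₀ x₁ y) (fderiv ℝ (trans x₀ x₁) y u) : ℰ d)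
      = (chartVec (𝓡 d) x₀ y u : ℰ d) := by
  have h1 : HasMFDerivAt 𝓘(ℝ, ℰ d) 𝓘(ℝ, ℰ d)
      (trans x₀ x₁) y (fderiv ℝ (trans x₀ x₁) y) :=
    (differentiableAt_trans hy).hasFDerivAt.hasMFDerivAt
  have h2 := (mdifferentiableAt_pt (trans_mem hy)).hasMFDerivAt.comp y h1
  have h3 : pt x₁ ∘ trans x₀ x₁ =ᶠ[𝓝 y] pt x₀ := by
    filter_upwards [(transO x₀ x₁).2.mem_nhds hy] with y' hy'
    exact pt_trans hy'
  have h4 := h3.mfderiv_eq (I := 𝓘(ℝ, ℰ d)) (I' := 𝓡 d)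
  exact (DFunLike.congr_fun (h2.mfderiv.symm.trans h4) u)

/-- The components of the coordinate change. -/
def transF (𝕜 : Type*) [RCLike 𝕜] (x₀ x₁ : M) (a : Fin d) : Sm 𝕜 (transO (d := d) x₀ x₁) :=
  smMk (fun y => ((trans x₀ x₁ y a : ℝ) : 𝕜))
    (contDiffOn_ofReal 𝕜 ((EuclideanSpace.proj a : ℰ d →L[ℝ] ℝ).contDiff.comp_contDiffOn
      (contDiffOn_trans x₀ x₁)))

/-- The Jacobian matrix of the coordinate change. -/
def transJ (𝕜 : Type*) [RCLike 𝕜] (x₀ x₁ : M) : Mat d (Sm 𝕜 (transO (d := d) x₀ x₁)) :=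
  Matrix.of fun i a => baseD 𝕜 _ i (transF 𝕜 x₀ x₁ a)

lemma ev_transJ (hy : y ∈ transO x₀ x₁) (i a : Fin d) : ev y hy (transJ 𝕜 x₀ x₁ i a)
    = ((fderiv ℝ (trans x₀ x₁) y (single i 1) a : ℝ) : 𝕜) := by
  have h : HasFDerivAt (fun y => ((trans x₀ x₁ y a : ℝ) : 𝕜)) ((RCLike.ofRealCLM (K := 𝕜)).comp
      ((EuclideanSpace.proj a : ℰ d →L[ℝ] ℝ).comp (fderiv ℝ (trans x₀ x₁) y))) y :=
    (RCLike.ofRealCLM (K := 𝕜)).hasFDerivAt.comp y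
      ((EuclideanSpace.proj a : ℰ d →L[ℝ] ℝ).hasFDerivAt.comp y
        (differentiableAt_trans hy).hasFDerivAt)
  have e := ev_smD (𝕜 := 𝕜) (Ω := transO x₀ x₁) (single i (1 : ℝ))
    (f := fun y => ((trans x₀ x₁ y a : ℝ) : 𝕜)) (F := transF 𝕜 x₀ x₁ a) (fun _ _ => rfl) y hy
  refine e.trans ?_
  rw [h.fderiv]
  rfl

lemma sum_smul_basis (u : ℰ d) : ∑ a, u a • (single a 1 : ℰ d) = u := sum_smul_single _

variable (𝕜) in
/-- The pullback of functions along the coordinate change. -/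
def transMap (x₀ x₁ : M) : 𝒮 x₁ →+* Sm 𝕜 (transO (d := d) x₀ x₁) :=
  (smComap (trans x₀ x₁) (contDiffOn_trans x₀ x₁) fun _ hy => trans_mem hy).toRingHom

variable (𝕜) in
/-- The restriction of functions to the overlap of two charts. -/
def overMap (x₀ x₁ : M) : 𝒮 x₀ →+* Sm 𝕜 (transO (d := d) x₀ x₁) :=
  (smComap (fun y => y) contDiffOn_id fun y (hy : y ∈ transO x₀ x₁) => hy.1).toRingHom

lemma chartVec_single_trans (hy : y ∈ transO x₀ x₁) (i : Fin d) :
    (chartVec (𝓡 d) x₀ y (single i 1) : ℰ d) = ∑ a, fderiv ℝ (trans x₀ x₁) y (single i 1) a •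
        (chartVec (𝓡 d) x₁ (trans x₀ x₁ y) (single a 1) : ℰ d) := by
  rw [← chartVec_trans hy]
  set u := fderiv ℝ (trans x₀ x₁) y (single i 1)
  let L : ℰ d →L[ℝ] ℰ d :=
    mfderiv 𝓘(ℝ, ℰ d) (𝓡 d) (extChartAt (𝓡 d) x₁).symm (trans x₀ x₁ y)
  have h := map_sum L (fun a => u a • (single a 1 : ℰ d))
    Finset.univ
  rw [sum_smul_basis] at h
  exact h.trans (sum_ext fun a => map_smul L _ _)

lemma isUnit_det_transJ (x₀ x₁ : M) : IsUnit (transJ (d := d) 𝕜 x₀ x₁).det := by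
  refine sm_isUnit fun y hy => ?_
  have e : ev y hy (transJ (d := d) 𝕜 x₀ x₁).det = (((Matrix.of fun i a =>
      fderiv ℝ (trans x₀ x₁) y (single i 1) a).det : ℝ) : 𝕜) := by
    have h1 := RingHom.map_det (algebraMap ℝ 𝕜) (Matrix.of fun i a =>
      fderiv ℝ (trans x₀ x₁) y (single i 1) a)
    rw [RCLike.algebraMap_eq_ofReal] at h1
    rw [h1]
    refine (AlgHom.map_det (ev y hy) (transJ (d := d) 𝕜 x₀ x₁)).trans (congrArg _ ?_)
    ext i j
    exact ev_transJ hy i j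
  rw [e, ofReal_ne_zero]
  intro h0
  obtain ⟨v, hv, hv'⟩ := Matrix.exists_vecMul_eq_zero_iff.2 h0
  refine hv ?_
  obtain ⟨e, he⟩ := exists_chartVec_equiv hy.1
  have h2 : fderiv ℝ (trans x₀ x₁) y (WithLp.toLp 2 v) = 0 := by
    rw [← sum_smul_single, map_sum]
    ext a
    have := congrFun hv' a
    simpa [Matrix.vecMul, dotProduct] using this
  have h3 := chartVec_trans hy (WithLp.toLp 2 v)
  rw [h2] at h3
  have h4 : e (WithLp.toLp 2 v) = 0 := (he _).symm.trans (h3.symm.trans (map_zero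
    (mfderiv 𝓘(ℝ, ℰ d) (𝓡 d) (extChartAt (𝓡 d) x₁).symm (trans x₀ x₁ y))))
  rw [e.map_eq_zero_iff] at h4
  exact (WithLp.toLp_eq_zero 2).1 h4

lemma baseMap_trans (x₀ x₁ : M) : BaseMap (transMap 𝕜 x₀ x₁)
    (baseD 𝕜 (chartO (d := d) x₁)) (baseD 𝕜 (transO x₀ x₁)) (transJ 𝕜 x₀ x₁)
    (transJ 𝕜 x₀ x₁)⁻¹ where
  der i x := sm_ext fun y hy => by
    refine (ev_smD_smComap _ (contDiffOn_trans x₀ x₁) _ _ _ y hy).trans ?_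
    conv_lhs => rw [← sum_smul_basis (fderiv ℝ (trans x₀ x₁) y (single i 1)), smD_sum]
    rw [map_sum, map_sum]
    refine sum_ext fun a => ?_
    rw [map_smul, map_mul, ev_transJ, real_smul_eq_coe_mul]
    exact congrArg _ (ev_smComap (trans x₀ x₁) (contDiffOn_trans x₀ x₁) (fun _ hy => trans_mem hy)
      _ y hy).symm
  closed i k a := baseD_comm _ _ _
  inv := Matrix.mul_nonsing_inv _ (isUnit_det_transJ x₀ x₁)
  comm := baseD_comm
  comm' := baseD_comm

lemma baseMap_over (x₀ x₁ : M) : BaseMap (overMap 𝕜 x₀ x₁)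
    (baseD 𝕜 (chartO (d := d) x₀)) (baseD 𝕜 (transO x₀ x₁)) 1 1 :=
  BaseMap.of_commute (fun i x => sm_ext fun y hy => by
    refine (ev_smD_smComap _ contDiffOn_id _ _ _ y hy).trans ?_
    rw [fderiv_id]
    exact (ev_smComap (fun y => y) contDiffOn_id (fun y (hy : y ∈ transO x₀ x₁) => hy.1) _ y hy).symm)
    baseD_comm baseD_comm

lemma ev_transMap (hy : y ∈ transO x₀ x₁) (F : 𝒮 x₁) :
    ev y hy (transMap 𝕜 x₀ x₁ F) = ev (trans x₀ x₁ y) (trans_mem hy) F :=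
  ev_smComap _ (contDiffOn_trans x₀ x₁) _ F y hy

lemma ev_overMap (hy : y ∈ transO x₀ x₁) (F : 𝒮 x₀) : ev y hy (overMap 𝕜 x₀ x₁ F) = ev y hy.1 F :=
  ev_smComap _ contDiffOn_id _ F y hy

section Tensoriality

variable (r A)

lemma locg_trans : (locg 𝕜 r x₀).map (overMap 𝕜 x₀ x₁)
    = transJ 𝕜 x₀ x₁ * (locg 𝕜 r x₁).map (transMap 𝕜 x₀ x₁) * (transJ 𝕜 x₀ x₁).transpose := by
  ext1 i k
  refine sm_ext fun y hy => ?_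
  have e := bilin_congr (fun x u v => r.g x u v) (pt_trans hy).symm (chartVec_single_trans hy i)
    (chartVec_single_trans hy k)
  rw [map_apply, ev_overMap hy, ev_locg]
  refine (congrArg (fun s : ℝ => (s : 𝕜)) (e.trans (bilin_sum_smul (r.g _) _ _ _))).trans ?_
  simp only [mul_apply, transpose_apply, map_apply, map_sum, map_mul,
    ev_transJ hy, ev_transMap hy, ev_locg, sum_mul]
  rw [sum_comm]
  exact sum_ext₂ fun _ _ => by ring

lemma locφ_trans {y : ℰ d} (hy : y ∈ transO x₀ x₁) (i : Fin d) :
    (fun ρ => extz (locφ 𝕜 A x₀ i).1 (y, ρ)) =ᶠ[𝓝 0] fun ρ => ∑ a, ev y hy (transJ 𝕜 x₀ x₁ i a) *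
      extz (locφ 𝕜 A x₁ a).1 (trans x₀ x₁ y, ρ) := by
  filter_upwards [(Continuous.prodMk_right y).continuousAt.eventually_mem
    ((accO A x₀).2.mem_nhds (accO_mem A x₀ y hy.1)),
    (Continuous.prodMk_right (trans x₀ x₁ y)).continuousAt.eventually_mem
    ((accO A x₁).2.mem_nhds (accO_mem A x₁ _ (trans_mem hy)))] with ρ h0 h1
  have e := covector_congr (fun x u => A.form x ρ u) (pt_trans hy).symm (chartVec_single_trans hy i)
  rw [extz_eq_ev _ h0]
  refine (congrArg (fun s : ℝ => (s : 𝕜)) (e.trans (linear_sum_smul (A.form _ ρ) _ _))).trans ?_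
  simp only [ofReal_sum, ofReal_mul, ev_transJ hy]
  exact sum_ext fun a => congrArg _ (extz_eq_ev (locφ 𝕜 A x₁ a) h1).symm

lemma serX_map {R R' : Type*} [CommRing R] [Algebra ℝ R] [CommRing R'] [Algebra ℝ R'] (φ : R →+* R')
    (F : R⟦X⟧) : serX R' (mapX φ F) = mapX φ (serX R F) := by
  ext1 n; simp [coeff_serX]

lemma constantCoeff_map' {R R' : Type*} [CommRing R] [CommRing R'] (φ : R →+* R')
    (F : R⟦X⟧) : constantCoeff (mapX φ F) = φ (constantCoeff F) := by
  rw [← coeff_zero, coeff_map, coeff_zero]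

lemma locA_trans (i : Fin d) : mapX (overMap 𝕜 x₀ x₁) (locA 𝕜 r A x₀ i)
    = ∑ a, PowerSeries.C (transJ 𝕜 x₀ x₁ i a) * mapX (transMap 𝕜 x₀ x₁) (locA 𝕜 r A x₁ a) := by
  refine eq_of_serX ?_ ?_
  · simp only [map_sum, Derivation.leibniz, serX_C, serX_map, serX_locA, mul_zero,
      add_zero, smul_eq_mul]
    ext1 n
    refine sm_ext fun y hy => ?_
    have hs : ∀ a ∈ Finset.univ, ContDiffAt ℝ n (fun ρ => ev y hy (transJ 𝕜 x₀ x₁ i a) *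
        extz (locφ 𝕜 A x₁ a).1 (trans x₀ x₁ y, ρ)) 0 := fun a _ =>
      contDiffAt_const.mul (((contDiffAt_extz (locφ 𝕜 A x₁ a)
        (accO_mem A x₁ _ (trans_mem hy))).comp (0 : ℝ) (contDiffAt_const.prodMk contDiffAt_id)).of_le
          (mod_cast le_top))
    simp only [coeff_map, map_sum, PowerSeries.coeff_C_mul, map_mul, ev_overMap hy, ev_transMap hy]
    rw [ev_coeff_jet, (locφ_trans A hy i).iteratedDeriv_eq, iteratedDeriv_fun_sum hs, smul_sum]
    refine sum_ext fun a => ?_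
    rw [ev_coeff_jet, iteratedDeriv_const_mul_field, mul_smul_comm]
  · refine sm_ext fun y hy => ?_
    have e := covector_congr (fun x u => r.a x u) (pt_trans hy).symm (chartVec_single_trans hy i)
    simp only [map_sum, map_mul, constantCoeff_map', constantCoeff_locA, PowerSeries.constantCoeff_C,
      ev_overMap hy, ev_transMap hy, ev_transJ hy]
    refine (congrArg (fun s : ℝ => (s : 𝕜)) (e.trans (linear_sum_smul (r.a _) _ _))).trans ?_
    simp only [ofReal_sum, ofReal_mul]
    rfl

/-- A formal solution in the chart around `x₀`. -/
structure ChartSolution (D : 𝕜) (x₀ : M) where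
  k : Mat d (𝒮 x₀)
  G : AMat d ((𝒮 x₀)⟦X⟧)
  K : AMat d ((𝒮 x₀)⟦X⟧)
  f : (𝒮 x₀)⟦X⟧
  φ : (𝒮 x₀)⟦X⟧
  sol : IsFormalSolution (baseD 𝕜 (chartO (d := d) x₀)) (locg 𝕜 r x₀) k (locA 𝕜 r A x₀)
    (smC (D - d)) G K f φ
  fibre : fibreA (ambD (baseD 𝕜 (chartO (d := d) x₀))) (ambQ d _) (PowerSeries.C (smC (D - d))) K
    (chr (ambD (baseD 𝕜 (chartO (d := d) x₀))) (ambQ d _) G K) f = 0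

lemma nonempty_chartSolution {D : 𝕜} (hD : Regular D) (x₀ : M) :
    Nonempty (ChartSolution r A D x₀) := by
  obtain ⟨k, hk⟩ := exists_locg_inv 𝕜 r x₀
  obtain ⟨G, K, f, φ, s, hs⟩ := exists_isFormalSolution (regularParam hD _) (locg_symm r x₀) hk
    (locA 𝕜 r A x₀)
  exact ⟨⟨k, G, K, f, φ, s, hs⟩⟩

namespace ChartSolution

variable {r A}

lemma restrict (s₀ : ChartSolution r A D x₀) (x₁ : M) :
    ∃ k K φ, IsFormalSolution (baseD 𝕜 (transO x₀ x₁)) ((locg 𝕜 r x₀).map (overMap 𝕜 x₀ x₁)) k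
        (fun i => mapX (overMap 𝕜 x₀ x₁) (locA 𝕜 r A x₀ i)) (smC (D - d))
        (s₀.G.map (mapX (overMap 𝕜 x₀ x₁))) K (mapX (overMap 𝕜 x₀ x₁) s₀.f) φ ∧
      fibreA (ambD (baseD 𝕜 (transO x₀ x₁))) (ambQ d _) (PowerSeries.C (smC (D - d))) K
        (chr (ambD (baseD 𝕜 (transO x₀ x₁))) (ambQ d _) (s₀.G.map (mapX (overMap 𝕜 x₀ x₁))) K)
        (mapX (overMap 𝕜 x₀ x₁) s₀.f) = 0 := by
  have t₀ := (baseMap_over x₀ x₁).isFormalSolution s₀.sol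
  have u₀ := (baseMap_over x₀ x₁).fibre s₀.sol s₀.fibre
  have e0 : overMap (d := d) 𝕜 x₀ x₁ (smC (D - d)) = smC (D - d) :=
    sm_ext fun y hy => by rw [ev_overMap hy, ev_smC, ev_smC]
  have eA : (fun i => ∑ a, PowerSeries.C ((1 : Mat d (Sm 𝕜 (transO x₀ x₁))) i a)
      * mapX (overMap 𝕜 x₀ x₁) (locA 𝕜 r A x₀ a))
      = fun i => mapX (overMap 𝕜 x₀ x₁) (locA 𝕜 r A x₀ i) := by
    funext i
    simp only [one_apply, apply_ite (PowerSeries.C : Sm 𝕜 (transO x₀ x₁) →+* _), map_one,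
      map_zero, ite_mul, one_mul, zero_mul, sum_ite_eq, Finset.mem_univ, if_true]
  rw [eA, one_mul, transpose_one, mul_one, e0, BaseMap.pullG_one] at t₀
  rw [e0, BaseMap.pullG_one] at u₀
  exact ⟨_, _, _, t₀, u₀⟩

lemma overlap (hD : Regular D) (s₀ : ChartSolution r A D x₀) (s₁ : ChartSolution r A D x₁) :
    s₀.G.map (mapX (overMap 𝕜 x₀ x₁)) = BaseMap.pullG (transMap 𝕜 x₀ x₁) (transJ 𝕜 x₀ x₁) s₁.G ∧
      mapX (overMap 𝕜 x₀ x₁) s₀.f = mapX (transMap 𝕜 x₀ x₁) s₁.f := by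
  obtain ⟨k, K, φ, t, u⟩ := s₀.restrict x₁
  have t₁ := (baseMap_trans x₀ x₁).isFormalSolution s₁.sol
  have u₁ := (baseMap_trans x₀ x₁).fibre s₁.sol s₁.fibre
  have e1 : transMap (d := d) 𝕜 x₀ x₁ (smC (D - d)) = smC (D - d) :=
    sm_ext fun y hy => by rw [ev_transMap hy, ev_smC, ev_smC]
  rw [e1, ← locg_trans, ← funext (locA_trans r A)] at t₁
  rw [e1] at u₁
  have ek := left_inv_eq_right_inv (mul_eq_one_comm.1 t.gauge.inv₀) t₁.gauge.inv₀
  subst ek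
  exact t₁.unique (regularParam hD _) t (Or.inl ⟨u₁, u⟩)

end ChartSolution

/-- The block matrix `1 ⊕ j ⊕ 1`. -/
def idxJ {R : Type*} [CommRing R] (j : Mat d R) : AMat d R
  | inl _, inl _ => 1
  | inr (inl i), inr (inl a) => j i a
  | inr (inr _), inr (inr _) => 1
  | _, _ => 0

lemma ambJ_eq_C {R : Type*} [CommRing R] (j : Mat d R) (a b : Idx d) :
    ambJ j a b = PowerSeries.C (idxJ j a b) := by
  rcases a with a | a | a <;> rcases b with b | b | b <;> simp [ambJ, idxJ]

variable (𝕜) in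
/-- The Jacobian matrix of a coordinate change of the ambient space. -/
def jac (x₀ x₁ : M) : AMat d (Sm 𝕜 (transO (d := d) x₀ x₁)) := idxJ (transJ 𝕜 x₀ x₁)

namespace ChartSolution

variable {r A} (hD : Regular D) (s₀ : ChartSolution r A D x₀) (s₁ : ChartSolution r A D x₁)
  {y : ℰ d} (hy : y ∈ transO x₀ x₁) (n : ℕ)

include hD

lemma ev_coeff_metric (a b : Idx d) : ev y hy.1 (coeff n (s₀.G a b)) = ∑ c : Idx d × Idx d,
      ev y hy (jac 𝕜 x₀ x₁ a c.1 * jac 𝕜 x₀ x₁ b c.2)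
        * ev (trans x₀ x₁ y) (trans_mem hy) (coeff n (s₁.G c.1 c.2)) := by
  have h := congrArg (fun F => ev y hy (coeff n F))
    (congrFun (congrFun (s₀.overlap hD s₁).1 a) b)
  simp only [BaseMap.pullG_apply, map_apply, coeff_map, ambJ_eq_C, map_sum,
    PowerSeries.coeff_C_mul, map_mul, ev_overMap hy, ev_transMap hy, mul_sum] at h
  simp only [Fintype.sum_prod_type, map_mul, mul_assoc]
  exact h

lemma ev_coeff_warp : ev y hy.1 (coeff n s₀.f)
    = ev (trans x₀ x₁ y) (trans_mem hy) (coeff n s₁.f) := by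
  have h := congrArg (fun F => ev y hy (coeff n F)) (s₀.overlap hD s₁).2
  simpa only [coeff_map, ev_overMap hy, ev_transMap hy] using h

end ChartSolution

end Tensoriality

end Transition

/-- The Borel sum of a power series with smooth coefficients. -/
def hat (l : ℕ → ℝ) (F : (𝒮 x₀)⟦X⟧) (z : ℰ d × ℝ) : 𝕜 :=
  borel l (fun n => extz (coeff n F).1 z.1) z.2

/-- The Borel sum is smooth over `y`, with the given power series as its Taylor series. -/
def HasHat (l : ℕ → ℝ) (F : (𝒮 x₀)⟦X⟧) (y : ℰ d) : Prop :=
  (∀ ρ, ContDiffAt ℝ ∞ (hat l F) (y, ρ)) ∧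
    ∀ m, iteratedDeriv m (fun ρ => hat l F (y, ρ)) 0
      = (m.factorial : 𝕜) * extz (coeff m F).1 y

lemma exists_borel_seq [SecondCountableTopology M] {κ : Type*} [Countable κ]
    (F : ∀ x : M, κ → (𝒮 x)⟦X⟧) :
    ∃ l : ℕ → ℝ, Tendsto l atTop atTop ∧ ∀ x : M, ∃ x₁ : M, x ∈ (extChartAt (𝓡 d) x₁).source ∧
      ∀ k, HasHat l (F x₁ k) (extChartAt (𝓡 d) x₁ x) := by
  have hR : ∀ x : M, ∃ R > 0, Metric.ball (extChartAt (𝓡 d) x x) (2 * R) ⊆ chartO (d := d) x := by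
    intro x
    obtain ⟨R, h0, hR⟩ := Metric.isOpen_iff.1 (chartO (d := d) x).2 _ (mem_extChartAt_target x)
    exact ⟨R / 2, by positivity, by rwa [mul_div_cancel₀ R two_ne_zero]⟩
  choose R h0 hR using hR
  have hC := fun (x : M) (k : κ) => exists_bound_borel_ball
    (fun n => extz (coeff n (F x k)).1) (extChartAt (𝓡 d) x x) (half_pos (h0 x))
    (half_lt_self (h0 x)) fun n => (contDiffOn_extz _).mono (hR x)
  choose C hC using hC
  obtain ⟨s, hs, hcover⟩ := TopologicalSpace.countable_cover_nhds (α := M) fun x =>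
    ((isOpen_extChartAt_preimage (I := 𝓡 d) x (Metric.isOpen_ball
      (x := extChartAt (𝓡 d) x x) (ε := R x / 2))).mem_nhds
        ⟨mem_chart_source _ x, Metric.mem_ball_self (half_pos (h0 x))⟩)
  have := hs.to_subtype
  obtain ⟨l, h1, hl, hCl⟩ := exists_eventually_ge fun i : s × κ => C i.1.1 i.2
  refine ⟨l, hl, fun x => ?_⟩
  obtain ⟨x₁, hx₁, hx⟩ := Set.mem_iUnion₂.1 (hcover.symm ▸ Set.mem_univ x)
  refine ⟨x₁, by rw [extChartAt_source]; exact hx.1, fun k => ?_⟩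
  have h := hC x₁ k l h1 (hCl (⟨x₁, hx₁⟩, k))
  exact ⟨fun ρ => h.1.contDiffAt ((Metric.isOpen_ball.prod isOpen_univ).mem_nhds ⟨hx.2, trivial⟩),
    fun m => h.2 m _ hx.2⟩

lemma hat_transfer {l : ℕ → ℝ} (hl : Tendsto l atTop atTop) {ι : Type*} [Fintype ι] {F₀ : (𝒮 x₀)⟦X⟧}
    {F₁ : ι → (𝒮 x₁)⟦X⟧} {c : ι → Sm 𝕜 (transO (d := d) x₀ x₁)}
    (h : ∀ y (hy : y ∈ transO x₀ x₁) n, ev y hy.1 (coeff n F₀) = ∑ i, ev y hy (c i)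
      * ev (trans x₀ x₁ y) (trans_mem hy) (coeff n (F₁ i)))
    {y : ℰ d} (hy : y ∈ transO x₀ x₁) (ρ : ℝ) :
    hat l F₀ (y, ρ) = ∑ i, extz (c i).1 y * hat l (F₁ i) (trans x₀ x₁ y, ρ) := by
  have e : (fun n => extz (coeff n F₀).1 y) = fun n => ∑ i, extz (c i).1 y
      * extz (coeff n (F₁ i)).1 (trans x₀ x₁ y) := by
    funext n
    simp only [extz_eq_ev _ hy.1, extz_eq_ev _ (trans_mem hy), extz_eq_ev _ hy, h y hy]
  rw [hat, e, borel_sum hl]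
  exact sum_ext fun i => borel_mul_left l _ _ _

lemma HasHat.transfer {l : ℕ → ℝ} (hl : Tendsto l atTop atTop) {ι : Type*} [Fintype ι]
    {F₀ : (𝒮 x₀)⟦X⟧} {F₁ : ι → (𝒮 x₁)⟦X⟧} {c : ι → Sm 𝕜 (transO (d := d) x₀ x₁)}
    (h : ∀ y (hy : y ∈ transO x₀ x₁) n, ev y hy.1 (coeff n F₀) = ∑ i, ev y hy (c i)
      * ev (trans x₀ x₁ y) (trans_mem hy) (coeff n (F₁ i)))
    {y : ℰ d} (hy : y ∈ transO x₀ x₁)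
    (hF : ∀ i, HasHat l (F₁ i) (trans x₀ x₁ y)) : HasHat l F₀ y := by
  refine ⟨fun ρ => ?_, fun m => ?_⟩
  · have e : hat l F₀ =ᶠ[𝓝 (y, ρ)] fun z =>
        ∑ i, extz (c i).1 z.1 * hat l (F₁ i) (trans x₀ x₁ z.1, z.2) := by
      filter_upwards [continuous_fst.continuousAt.preimage_mem_nhds
        ((transO x₀ x₁).2.mem_nhds hy)] with z hz
      exact hat_transfer hl h hz z.2
    refine ContDiffAt.congr_of_eventuallyEq (ContDiffAt.sum fun i _ => ?_) e
    have ht := (contDiffOn_trans x₀ x₁).contDiffAt ((transO x₀ x₁).2.mem_nhds hy)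
    exact ((contDiffAt_extz (c i) hy).comp (y, ρ) contDiffAt_fst).mul
      (((hF i).1 ρ).comp (y, ρ) ((ht.comp (y, ρ) contDiffAt_fst).prodMk contDiffAt_snd))
  · have e : (fun ρ => hat l F₀ (y, ρ)) = fun ρ =>
        ∑ i, extz (c i).1 y * hat l (F₁ i) (trans x₀ x₁ y, ρ) :=
      funext fun ρ => hat_transfer hl h hy ρ
    have hs : ∀ i ∈ Finset.univ, ContDiffAt ℝ m
        (fun ρ => extz (c i).1 y * hat l (F₁ i) (trans x₀ x₁ y, ρ)) 0 := fun i _ =>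
      contDiffAt_const.mul ((((hF i).1 0).comp (0 : ℝ)
        (contDiffAt_const.prodMk contDiffAt_id)).of_le (mod_cast le_top))
    rw [e, iteratedDeriv_fun_sum hs]
    simp only [iteratedDeriv_const_mul_field, (hF _).2]
    simp only [extz_eq_ev _ hy.1, extz_eq_ev _ (trans_mem hy), extz_eq_ev _ hy, h y hy, mul_sum]
    exact sum_ext fun i => by ring

lemma exists_hat [SecondCountableTopology M] (hD : Regular D) (S : ∀ x : M, ChartSolution r A D x) :
    ∃ l : ℕ → ℝ, Tendsto l atTop atTop ∧ ∀ x₀ : M, ∀ y ∈ chartO (d := d) x₀,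
      (∀ a b, HasHat l ((S x₀).G a b) y) ∧ HasHat l (S x₀).f y := by
  obtain ⟨l, hl, h⟩ := exists_borel_seq (κ := Option (Idx d × Idx d))
    fun x k => k.elim (S x).f fun c => (S x).G c.1 c.2
  refine ⟨l, hl, fun x₀ y hy => ?_⟩
  obtain ⟨x₁, hx, hF⟩ := h (pt x₀ y)
  have ht : y ∈ transO x₀ x₁ := ⟨hy, hx⟩
  refine ⟨fun a b => HasHat.transfer hl (fun y hy n => (S x₀).ev_coeff_metric hD (S x₁) hy n a b) ht
    fun c => hF (some c), HasHat.transfer hl (ι := Unit) (F₁ := fun _ => (S x₁).f) (c := fun _ => 1)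
      (fun y hy n => ?_) ht fun _ => hF none⟩
  rw [Fintype.sum_unique, map_one, one_mul]
  exact (S x₀).ev_coeff_warp hD (S x₁) hy n

section

open Set

section ParametricIntegral

lemma exists_bound_segment {P H : Type} [NormedAddCommGroup P] [NormedSpace ℝ P]
    [FiniteDimensional ℝ P] [NormedAddCommGroup H] {F : P × ℝ → H} {O : Set (P × ℝ)} {V : Set P}
    (hV : IsOpen V) (h : ∀ x ∈ V, ∀ s ∈ Icc (0 : ℝ) 1, (x, s) ∈ O) (hF : ContinuousOn F O) {x : P}
    (hx : x ∈ V) : ∃ K ∈ 𝓝 x, K ⊆ V ∧ ∃ C, ∀ x' ∈ K, ∀ s ∈ Icc (0 : ℝ) 1, ‖F (x', s)‖ ≤ C := by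
  obtain ⟨K, hK, hKV, hc⟩ := local_compact_nhds (hV.mem_nhds hx)
  obtain ⟨C, hC⟩ := (hc.prod isCompact_Icc).exists_bound_of_continuousOn
    (hF.mono fun z (hz : z ∈ K ×ˢ Icc (0 : ℝ) 1) => h z.1 (hKV hz.1) z.2 hz.2)
  exact ⟨K, hK, hKV, C, fun x' hx' s hs => hC (x', s) ⟨hx', hs⟩⟩

lemma continuousOn_segment {P H : Type} [NormedAddCommGroup P] [NormedAddCommGroup H]
    {F : P × ℝ → H} {O : Set (P × ℝ)} (hF : ContinuousOn F O) {x : P}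
    (h : ∀ s ∈ Icc (0 : ℝ) 1, (x, s) ∈ O) : ContinuousOn (fun s => F (x, s)) (uIcc 0 1) := by
  rw [uIcc_of_le zero_le_one]
  exact hF.comp (Continuous.prodMk_right x).continuousOn h

lemma contDiffOn_integral {P : Type} [NormedAddCommGroup P] [NormedSpace ℝ P]
    [FiniteDimensional ℝ P] {O : Set (P × ℝ)} {V : Set P} (hO : IsOpen O) (hV : IsOpen V)
    (h : ∀ x ∈ V, ∀ s ∈ Icc (0 : ℝ) 1, (x, s) ∈ O) (n : ℕ) :
    ∀ {H : Type} [NormedAddCommGroup H] [NormedSpace ℝ H] [CompleteSpace H] {F : P × ℝ → H},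
      ContDiffOn ℝ n F O → ContDiffOn ℝ n (fun x => ∫ s in (0 : ℝ)..1, F (x, s)) V := by
  have hI : ∀ {s : ℝ}, s ∈ uIoc (0 : ℝ) 1 → s ∈ Icc (0 : ℝ) 1 := fun hs => by
    rw [uIoc_of_le zero_le_one] at hs
    exact Ioc_subset_Icc_self hs
  have hmeas : ∀ {H : Type} [NormedAddCommGroup H] {F : P × ℝ → H} {x : P}, ContinuousOn F O →
      x ∈ V → MeasureTheory.AEStronglyMeasurable (fun s => F (x, s))
        (MeasureTheory.volume.restrict (uIoc (0 : ℝ) 1)) := fun hF hx =>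
    ((continuousOn_segment hF (h _ hx)).mono uIoc_subset_uIcc).aestronglyMeasurable
      measurableSet_uIoc
  induction n with
  | zero =>
    intro H _ _ _ F hF
    rw [Nat.cast_zero, contDiffOn_zero] at hF ⊢
    intro x hx
    obtain ⟨K, hK, hKV, C, hC⟩ := exists_bound_segment hV h hF hx
    refine (intervalIntegral.continuousAt_of_dominated_interval (bound := fun _ => C) ?_ ?_
      intervalIntegrable_const ?_).continuousWithinAt
    · filter_upwards [hV.mem_nhds hx] with x' hx' using hmeas hF hx'
    · filter_upwards [hK] with x' hx'
      exact .of_forall fun s hs => hC x' hx' s (hI hs)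
    · refine .of_forall fun s hs => ?_
      exact ContinuousAt.comp (f := fun x' => (x', s)) (hF.continuousAt (hO.mem_nhds (h x hx s (hI hs))))
        (Continuous.prodMk_left s).continuousAt
  | succ n ih =>
    intro H _ _ _ F hF
    set F' : P × ℝ → P →L[ℝ] H := fun z => (fderiv ℝ F z).comp (ContinuousLinearMap.inl ℝ P ℝ)
    rw [Nat.cast_add, Nat.cast_one] at hF ⊢
    have hF' : ContDiffOn ℝ n F' O :=
      ((contDiffOn_succ_iff_fderiv_of_isOpen hO).1 hF).2.2.clm_comp contDiffOn_const
    have hd : ∀ z ∈ O, HasFDerivAt (fun x => F (x, z.2)) (F' z) z.1 := fun z hz =>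
      HasFDerivAt.comp (f := fun x => (x, z.2)) z.1 ((hF.contDiffAt (hO.mem_nhds hz)).differentiableAt
        (by simp)).hasFDerivAt (hasFDerivAt_prodMk_left z.1 z.2)
    have key : ∀ x ∈ V, HasFDerivAt (fun x => ∫ s in (0 : ℝ)..1, F (x, s))
        (∫ s in (0 : ℝ)..1, F' (x, s)) x := by
      intro x hx
      obtain ⟨K, hK, hKV, C, hC⟩ := exists_bound_segment hV h hF'.continuousOn hx
      refine intervalIntegral.hasFDerivAt_integral_of_dominated_of_fderiv_le (𝕜 := ℝ)
        (F' := fun x s => F' (x, s)) (bound := fun _ => C) hK ?_ ?_ (hmeas hF'.continuousOn hx) ?_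
        intervalIntegrable_const ?_
      · filter_upwards [hV.mem_nhds hx] with x' hx' using hmeas hF.continuousOn hx'
      · exact (continuousOn_segment hF.continuousOn (h x hx)).intervalIntegrable
      · exact .of_forall fun s hs x' hx' => hC x' hx' s (hI hs)
      · exact .of_forall fun s hs x' hx' => hd (x', s) (h x' (hKV hx') s (hI hs))
    refine (contDiffOn_succ_iff_fderiv_of_isOpen hV).2
      ⟨fun x hx => (key x hx).differentiableAt.differentiableWithinAt, by simp, ?_⟩
    exact (ih hF').congr fun x hx => (key x hx).fderiv

end ParametricIntegral

section Star

variable {X : Type*} [TopologicalSpace X]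

/-- The part of a subset of `X × ℝ` that is star-shaped around `X × {0}`. -/
def star (O : Set (X × ℝ)) : Set (X × ℝ) := {z | ∀ s ∈ Icc (0 : ℝ) 1, (z.1, s * z.2) ∈ O}

lemma isOpen_star {O : Set (X × ℝ)} (hO : IsOpen O) : IsOpen (star O) := by
  rw [isOpen_iff_mem_nhds]
  intro z hz
  refine isCompact_Icc.eventually_forall_of_forall_eventually
    (P := fun (z : X × ℝ) (s : ℝ) => (z.1, s * z.2) ∈ O) fun s hs => ?_
  have h : Continuous fun w : (X × ℝ) × ℝ => (w.1.1, w.2 * w.1.2) := by fun_prop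
  exact h.continuousAt.preimage_mem_nhds (hO.mem_nhds (hz s hs))

lemma star_subset (O : Set (X × ℝ)) : star O ⊆ O := fun z hz => by
  have := hz 1 ⟨zero_le_one, le_rfl⟩
  rwa [one_mul] at this

lemma star_zero {O : Set (X × ℝ)} {x : X} (h : (x, (0 : ℝ)) ∈ O) : (x, (0 : ℝ)) ∈ star O :=
  fun s _ => by rwa [mul_zero]

lemma star_smul {O : Set (X × ℝ)} {x : X} {ρ s : ℝ} (h : (x, ρ) ∈ star O)
    (hs : s ∈ Icc (0 : ℝ) 1) : (x, s * ρ) ∈ star O := fun s' hs' => by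
  rw [← mul_assoc]
  exact h _ ⟨mul_nonneg hs'.1 hs.1, mul_le_one₀ hs'.2 hs.1 hs.2⟩

lemma ordConnected_star (O : Set (X × ℝ)) (x : X) : {ρ : ℝ | (x, ρ) ∈ star O}.OrdConnected := by
  refine ⟨fun a ha b hb c hc => ?_⟩
  rcases le_total 0 c with h0 | h0
  · rcases h0.eq_or_lt with rfl | h0
    · simpa using star_smul ha (s := 0) ⟨le_rfl, zero_le_one⟩
    · have hb0 := h0.trans_le hc.2
      have := star_smul hb (s := c / b) ⟨div_nonneg h0.le hb0.le, (div_le_one hb0).2 hc.2⟩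
      rwa [div_mul_cancel₀ _ hb0.ne'] at this
  · rcases h0.eq_or_lt with rfl | h0
    · simpa using star_smul ha (s := 0) ⟨le_rfl, zero_le_one⟩
    · have ha0 := hc.1.trans_lt h0
      have := star_smul ha (s := c / a)
        ⟨div_nonneg_of_nonpos h0.le ha0.le, (div_le_one_of_neg ha0).2 hc.1⟩
      rwa [div_mul_cancel₀ _ ha0.ne] at this

end Star

section Integral

variable (r A x₀)

/-- The star-shaped part of the coordinate domain of the acceleration. -/
def starO : Opens (ℰ d × ℝ) :=
  ⟨{w | w.1 ∈ chartO x₀ ∧ (pt x₀ w.1, w.2) ∈ star A.dom},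
    (((continuousOn_pt x₀).comp continuousOn_fst fun _ h => h).prodMk
      continuousOn_snd).isOpen_inter_preimage ((chartO x₀).2.preimage continuous_fst)
        (isOpen_star A.isOpen_dom)⟩

/-- The components of the acceleration in a chart, as functions. -/
def accF (i : Fin d) (w : ℰ d × ℝ) : ℝ :=
  A.form (pt x₀ w.1) w.2 (chartVec (𝓡 d) x₀ w.1 (single i 1))

/-- The components of `a + ∫ φ dρ` in a chart. -/
def intA (i : Fin d) (w : ℰ d × ℝ) : ℝ :=
  r.a (pt x₀ w.1) (chartVec (𝓡 d) x₀ w.1 (single i 1))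
    + w.2 * ∫ s in (0 : ℝ)..1, accF A x₀ i (w.1, s * w.2)

lemma contDiffOn_accF (i : Fin d) : SmoothOn (accF A x₀ i)
    (accO A x₀ : Set (ℰ d × ℝ)) := A.smooth x₀ (single i 1)

variable {x₀} in
lemma continuousOn_accF_segment {w : ℰ d × ℝ} (hw : w ∈ starO A x₀)
    (i : Fin d) : ContinuousOn (fun s => accF A x₀ i (w.1, s * w.2)) (uIcc 0 1) := by
  rw [uIcc_of_le zero_le_one]
  refine (contDiffOn_accF A x₀ i).continuousOn.comp ?_ fun s hs => ⟨hw.1, hw.2 s hs⟩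
  exact (by fun_prop : Continuous fun s : ℝ => (w.1, s * w.2)).continuousOn

lemma contDiffOn_intA (i : Fin d) : SmoothOn (intA r A x₀ i) (starO A x₀ : Set (ℰ d × ℝ)) := by
  have h1 : ContDiff ℝ ∞ fun z : (ℰ d × ℝ) × ℝ => (z.1.1, z.2 * z.1.2) := by fun_prop
  have h2 : SmoothOn (fun z : (ℰ d × ℝ) × ℝ =>
      accF A x₀ i (z.1.1, z.2 * z.1.2)) ((fun z => (z.1.1, z.2 * z.1.2)) ⁻¹' (accO A x₀)) :=
    (contDiffOn_accF A x₀ i).comp h1.contDiffOn fun _ h => h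
  refine ContDiffOn.add ((r.smooth_a x₀ _).comp contDiffOn_fst fun w hw => hw.1)
    (contDiffOn_snd.mul (contDiffOn_infty.2 fun n => ?_))
  exact contDiffOn_integral ((accO A x₀).2.preimage h1.continuous) (starO A x₀).2
    (fun w hw s hs => ⟨hw.1, hw.2 s hs⟩) n (contDiffOn_infty.1 h2 n)

variable {x₀}

lemma hasDerivAt_intA (i : Fin d) {y : ℰ d} {ρ : ℝ} (hw : (y, ρ) ∈ starO A x₀) :
    HasDerivAt (fun ρ => intA r A x₀ i (y, ρ)) (accF A x₀ i (y, ρ)) ρ := by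
  have e : (fun ρ => intA r A x₀ i (y, ρ)) = fun ρ =>
      r.a (pt x₀ y) (chartVec (𝓡 d) x₀ y (single i 1))
        + ∫ s in (0 : ℝ)..ρ, accF A x₀ i (y, s) := by
    funext ρ
    have := intervalIntegral.mul_integral_comp_mul_right (a := 0) (b := 1)
      (f := fun s => accF A x₀ i (y, s)) ρ
    rw [zero_mul, one_mul] at this
    rw [intA, ← this]
  have hO : ∀ s ∈ uIcc 0 ρ, (y, s) ∈ accO A x₀ := fun s hs => ⟨hw.1, star_subset _
    ((ordConnected_star A.dom (pt x₀ y)).uIcc_subset (star_zero (A.zero_mem _)) hw.2 hs)⟩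
  have ho : IsOpen {s : ℝ | (y, s) ∈ accO A x₀} := (accO A x₀).2.preimage (Continuous.prodMk_right y)
  have hc : ContinuousOn (fun s => accF A x₀ i (y, s)) {s : ℝ | (y, s) ∈ accO A x₀} :=
    (contDiffOn_accF A x₀ i).continuousOn.comp (Continuous.prodMk_right y).continuousOn fun _ h => h
  rw [e]
  exact (intervalIntegral.integral_hasDerivAt_right (hc.mono hO).intervalIntegrable
    (hc.stronglyMeasurableAtFilter ho _ (hO ρ right_mem_uIcc))
    (hc.continuousAt (ho.mem_nhds (hO ρ right_mem_uIcc)))).const_add _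

lemma intA_zero (i : Fin d) (y : ℰ d) : intA r A x₀ i (y, 0)
    = r.a (pt x₀ y) (chartVec (𝓡 d) x₀ y (single i 1)) := by rw [intA, zero_mul, add_zero]

lemma intA_trans {x₁ : M} {y : ℰ d} (hy : y ∈ transO x₀ x₁) {ρ : ℝ}
    (hw : (pt x₀ y, ρ) ∈ star A.dom) (i : Fin d) : intA r A x₀ i (y, ρ)
      = ∑ a, fderiv ℝ (trans x₀ x₁) y (single i 1) a * intA r A x₁ a (trans x₀ x₁ y, ρ) := by
  have e1 := (covector_congr (fun x u => r.a x u) (pt_trans hy).symm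
    (chartVec_single_trans hy i)).trans (linear_sum_smul (r.a _) _ _)
  have e2 : ∀ s, accF A x₀ i (y, s) = ∑ a, fderiv ℝ (trans x₀ x₁) y (single i 1) a
      * accF A x₁ a (trans x₀ x₁ y, s) := fun s =>
    (covector_congr (fun x u => A.form x s u) (pt_trans hy).symm
      (chartVec_single_trans hy i)).trans (linear_sum_smul (A.form _ s) _ _)
  have hw' : (trans x₀ x₁ y, ρ) ∈ starO A x₁ := ⟨trans_mem hy, by
    change (pt x₁ (trans x₀ x₁ y), ρ) ∈ star A.dom
    rwa [pt_trans hy]⟩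
  have hi := fun a (_ : a ∈ Finset.univ) =>
    ((continuousOn_accF_segment A hw' a).intervalIntegrable (μ := MeasureTheory.volume)).const_mul
      (fderiv ℝ (trans x₀ x₁) y (single i 1) a)
  simp only [intA, e2]
  rw [intervalIntegral.integral_finsetSum hi, mul_sum]
  refine (congrArg (· + _) e1).trans ?_
  rw [← sum_add_distrib]
  refine sum_ext fun a => ?_
  rw [intervalIntegral.integral_const_mul]
  ring

end Integral

end

section Signature

open QuadraticForm

variable {V W : Type*} [AddCommGroup V] [Module ℝ V] [AddCommGroup W] [Module ℝ W]
  [FiniteDimensional ℝ W]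

lemma HasSignature.finrank_eq {B : W → W → ℝ} (h : HasSignature B p q) :
    Module.finrank ℝ W = p + q := by
  obtain ⟨e, -⟩ := h
  rw [e.finrank_eq]
  simp

lemma HasSignature.comp_injective [FiniteDimensional ℝ V] {B : W → W → ℝ}
    (h : HasSignature B p q) (φ : V →ₗ[ℝ] W) (hφ : Function.Injective φ)
    (hd : Module.finrank ℝ V = Module.finrank ℝ W) :
    HasSignature (fun u v => B (φ u) (φ v)) p q := by
  obtain ⟨e, he⟩ := h
  exact ⟨(LinearMap.linearEquivOfInjective φ hφ hd).trans e, fun u v => he _ _⟩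

lemma hasSignature_of_definite (hd : Module.finrank ℝ W = p + q) (B : W →ₗ[ℝ] W →ₗ[ℝ] ℝ)
    (hB : ∀ u v, B u v = B v u) (P : (Fin p → ℝ) →ₗ[ℝ] W) (N : (Fin q → ℝ) →ₗ[ℝ] W)
    (hP : ∀ x, x ≠ 0 → 0 < B (P x) (P x)) (hN : ∀ x, x ≠ 0 → B (N x) (N x) < 0) :
    HasSignature (fun u v => B u v) p q := by
  let Q : QuadraticForm ℝ W := LinearMap.BilinMap.toQuadraticMap B
  have hpos : p ≤ sigPos Q := by
    have hi : Function.Injective P := (injective_iff_map_eq_zero P).2 fun x hx => by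
      by_contra h0
      have := hP x h0
      simp [hx] at this
    have h1 : (Q.restrict (LinearMap.range P)).PosDef := by
      rintro ⟨_, x, rfl⟩ hx
      exact hP x fun h0 => hx (Subtype.ext (by simp [h0]))
    simpa [LinearMap.finrank_range_of_inj hi] using le_sigPos_of_posDef Q h1
  have hneg : q ≤ sigNeg Q := by
    have hi : Function.Injective N := (injective_iff_map_eq_zero N).2 fun x hx => by
      by_contra h0
      have := hN x h0
      simp [hx] at this
    have h1 : ((-Q).restrict (LinearMap.range N)).PosDef := by
      rintro ⟨_, x, rfl⟩ hx
      exact neg_pos.2 (hN x fun h0 => hx (Subtype.ext (by simp [h0])))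
    simpa [LinearMap.finrank_range_of_inj hi] using le_sigNeg_of_negDef Q h1
  have hsum := sigPos_add_sigNeg_add_radical (Q := Q)
  obtain ⟨w, hw⟩ := Q.equivalent_signType_weighted_sum_squared
  have h1 := sigPos_of_equiv_weightedSumSquares hw
  have h2 := sigNeg_of_equiv_weightedSumSquares hw
  obtain ⟨e⟩ := hw
  let a : {i // 0 < ((w i : SignType) : ℝ)} ≃ Fin p := (Finite.equivFinOfCardEq (by
    change Nat.card {i | 0 < ((w i : SignType) : ℝ)} = p
    rw [Nat.card_coe_set_eq]; omega))
  let b : {i // ((w i : SignType) : ℝ) < 0} ≃ Fin q := (Finite.equivFinOfCardEq (by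
    change Nat.card {i | ((w i : SignType) : ℝ) < 0} = q
    rw [Nat.card_coe_set_eq]; omega))
  let T : W →ₗ[ℝ] (Fin p → ℝ) × (Fin q → ℝ) :=
    ((LinearMap.funLeft ℝ ℝ fun i => (a.symm i).1).prod
      (LinearMap.funLeft ℝ ℝ fun i => (b.symm i).1)) ∘ₗ e.toLinearEquiv.toLinearMap
  have hQ : ∀ u, B u u = ∑ i, (T u).1 i * (T u).1 i - ∑ i, (T u).2 i * (T u).2 i := by
    intro u
    have e1 : B u u = ∑ i, ((w i : SignType) : ℝ) * (e u i * e u i) := by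
      have := (e.map_app u).symm
      rw [QuadraticMap.weightedSumSquares_apply] at this
      exact this
    have e2 : ∀ i, ((w i : SignType) : ℝ) * (e u i * e u i)
        = (if 0 < ((w i : SignType) : ℝ) then e u i * e u i else 0)
          - if ((w i : SignType) : ℝ) < 0 then e u i * e u i else 0 := by
      intro i
      rcases w i <;> norm_num
    rw [e1, sum_ext fun i => e2 i, sum_sub_distrib, ← Finset.sum_filter,
      ← Finset.sum_filter, Finset.sum_subtype _ (p := fun i => 0 < ((w i : SignType) : ℝ)) (by simp),
      Finset.sum_subtype _ (p := fun i => ((w i : SignType) : ℝ) < 0) (by simp),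
      ← a.symm.sum_comp, ← b.symm.sum_comp]
    rfl
  have hT : Function.Injective T := (injective_iff_map_eq_zero T).2 fun u hu => by
    have hun : {i | 0 < ((w i : SignType) : ℝ)} ∪ {i | ((w i : SignType) : ℝ) < 0} = Set.univ := by
      refine Set.eq_of_subset_of_ncard_le (Set.subset_univ _) ?_
      have hdj : Disjoint {i | 0 < ((w i : SignType) : ℝ)} {i | ((w i : SignType) : ℝ) < 0} :=
        Set.disjoint_left.2 fun i (h : 0 < ((w i : SignType) : ℝ)) h' => lt_asymm h h'
      rw [Set.ncard_union_eq hdj, Set.ncard_univ, Nat.card_fin]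
      omega
    have h0 : e u = 0 := funext fun i => by
      rcases (hun.symm ▸ Set.mem_univ i : i ∈ _ ∪ _) with hi | hi
      · have h : e u (a.symm (a ⟨i, hi⟩)).1 = 0 := congrFun (congrArg Prod.fst hu) (a ⟨i, hi⟩)
        rwa [Equiv.symm_apply_apply] at h
      · have h : e u (b.symm (b ⟨i, hi⟩)).1 = 0 := congrFun (congrArg Prod.snd hu) (b ⟨i, hi⟩)
        rwa [Equiv.symm_apply_apply] at h
    exact e.toLinearEquiv.map_eq_zero_iff.1 h0
  refine ⟨LinearMap.linearEquivOfInjective T hT (by simp [hd]), fun u v => ?_⟩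
  have h3 := hQ (u + v)
  simp only [map_add, LinearMap.add_apply, hQ u, hQ v, hB v u, Prod.fst_add, Prod.snd_add,
    Pi.add_apply, add_mul, mul_add, sum_add_distrib] at h3
  have c1 : ∑ i, (T v).1 i * (T u).1 i = ∑ i, (T u).1 i * (T v).1 i :=
    sum_ext fun _ => mul_comm _ _
  have c2 : ∑ i, (T v).2 i * (T u).2 i = ∑ i, (T u).2 i * (T v).2 i :=
    sum_ext fun _ => mul_comm _ _
  rw [c1, c2] at h3
  change B u v = ∑ i, (T u).1 i * (T v).1 i - ∑ i, (T u).2 i * (T v).2 i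
  linarith

/-- The bilinear form with a given matrix. -/
def matForm {ι : Type*} [Fintype ι] (S : Matrix ι ι ℝ) : (ι → ℝ) →ₗ[ℝ] (ι → ℝ) →ₗ[ℝ] ℝ :=
  LinearMap.mk₂ ℝ (fun u v => ∑ c : ι × ι, u c.1 * v c.2 * S c.1 c.2)
    (fun _ _ _ => by simp [add_mul, sum_add_distrib])
    (fun _ _ _ => by simp [mul_sum, mul_assoc])
    (fun _ _ _ => by simp [mul_add, add_mul, sum_add_distrib])
    (fun _ _ _ => by simp [mul_sum, mul_assoc, mul_left_comm])

lemma matForm_symm {ι : Type*} [Fintype ι] {S : Matrix ι ι ℝ} (h : ∀ i j, S i j = S j i)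
    (u v : ι → ℝ) : matForm S u v = matForm S v u := by
  refine (Equiv.prodComm ι ι).sum_comp _ |>.symm.trans (sum_ext fun c => ?_)
  simp only [Equiv.prodComm_apply, Prod.fst_swap, Prod.snd_swap, h c.2]
  ring

lemma eventually_pos_matForm {ι κ : Type*} [Fintype ι] [Fintype κ] {S₀ : Matrix ι ι ℝ}
    (P : (κ → ℝ) →ₗ[ℝ] (ι → ℝ)) (h : ∀ x, x ≠ 0 → 0 < matForm S₀ (P x) (P x)) :
    ∀ᶠ S in 𝓝 S₀, ∀ x, x ≠ 0 → 0 < matForm S (P x) (P x) := by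
  have hP : Continuous P := P.continuous_of_finiteDimensional
  have hc : Continuous fun z : Matrix ι ι ℝ × (κ → ℝ) => matForm z.1 (P z.2) (P z.2) := by
    simp only [matForm, LinearMap.mk₂_apply]
    have hS : ∀ i j, Continuous fun z : Matrix ι ι ℝ × (κ → ℝ) => z.1 i j := fun i j =>
      (continuous_fst.matrix_elem i j)
    have hP' : ∀ i, Continuous fun z : Matrix ι ι ℝ × (κ → ℝ) => P z.2 i := fun i =>
      (continuous_apply i).comp (hP.comp continuous_snd)
    exact continuous_finsetSum _ fun c _ => ((hP' _).mul (hP' _)).mul (hS _ _)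
  have h1 : ∀ᶠ S in 𝓝 S₀, ∀ x ∈ Metric.sphere (0 : κ → ℝ) 1, 0 < matForm S (P x) (P x) :=
    (isCompact_sphere _ _).eventually_forall_of_forall_eventually
      (P := fun S x => 0 < matForm S (P x) (P x)) fun x hx =>
        (isOpen_Ioi.preimage hc).mem_nhds (h x (ne_zero_of_mem_unit_sphere ⟨x, hx⟩))
  filter_upwards [h1] with S hS x hx
  have hn : ‖x‖ ≠ 0 := norm_ne_zero_iff.2 hx
  have h2 := hS (‖x‖⁻¹ • x) (by simp [norm_smul, hn])
  simp only [map_smul, LinearMap.smul_apply, smul_eq_mul] at h2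
  rw [← mul_assoc] at h2
  exact pos_of_mul_pos_right h2 (mul_self_nonneg _)

lemma eventually_hasSignature {ι : Type*} [Fintype ι] {S₀ : Matrix ι ι ℝ}
    (h : HasSignature (fun u v => matForm S₀ u v) p q) :
    ∀ᶠ S in 𝓝 S₀, (∀ i j, S i j = S j i) → HasSignature (fun u v => matForm S u v) p q := by
  have hd := h.finrank_eq
  obtain ⟨e, he⟩ := h
  have hpos : ∀ {n : ℕ} (x : Fin n → ℝ), x ≠ 0 → 0 < ∑ i, x i * x i := fun x hx => by
    obtain ⟨i, hi⟩ := Function.ne_iff.1 hx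
    exact Finset.sum_pos' (fun _ _ => mul_self_nonneg _) ⟨i, Finset.mem_univ _, mul_self_pos.2 hi⟩
  have h1 := eventually_pos_matForm (S₀ := S₀)
    (e.symm.toLinearMap ∘ₗ LinearMap.inl ℝ _ _) fun x hx => by
      refine (hpos x hx).trans_eq ((he _ _).trans ?_).symm
      simp
  have h2 := eventually_pos_matForm (S₀ := -S₀)
    (e.symm.toLinearMap ∘ₗ LinearMap.inr ℝ _ _) fun x hx => by
      refine (hpos x hx).trans_eq ?_
      have := he (e.symm (0, x)) (e.symm (0, x))
      simp only [matForm, LinearMap.mk₂_apply] at this ⊢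
      simp [sum_neg_distrib] at this ⊢
      linarith
  filter_upwards [h1, (continuous_neg.tendsto S₀).eventually h2] with S h1 h2 hS
  refine hasSignature_of_definite hd (matForm S) (matForm_symm hS) _
    (e.symm.toLinearMap ∘ₗ LinearMap.inr ℝ _ _) h1 fun x hx => ?_
  have := h2 x hx
  simp only [matForm, LinearMap.mk₂_apply, Matrix.neg_apply, mul_neg, sum_neg_distrib] at this ⊢
  linarith

end Signature

section

/-- The real Jacobian matrix of a coordinate change of the ambient space. -/
def jacR (x₀ x₁ : M) (y : ℰ d) : AMat d ℝ :=
  idxJ (Matrix.of fun i a => fderiv ℝ (trans x₀ x₁) y (single i 1) a)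

lemma ev_jac {y : ℰ d} (hy : y ∈ transO x₀ x₁) (a b : Idx d) :
    ev y hy (jac 𝕜 x₀ x₁ a b) = (jacR x₀ x₁ y a b : 𝕜) := by
  rcases a with a | a | a <;> rcases b with b | b | b <;>
    simp [jac, jacR, idxJ, ev_transJ hy]

lemma idxJ_mul {R : Type*} [CommRing R] (j j' : Mat d R) : idxJ j * idxJ j' = idxJ (j * j') := by
  ext a b
  rcases a with a | a | a <;> rcases b with b | b | b <;> simp [mul_apply, idxJ]

lemma idxJ_one {R : Type*} [CommRing R] : idxJ (1 : Mat d R) = 1 := by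
  ext a b
  rcases a with a | a | a <;> rcases b with b | b | b <;> simp [one_apply, idxJ]

lemma det_jacR_ne_zero {y : ℰ d} (hy : y ∈ transO x₀ x₁) : (jacR x₀ x₁ y).det ≠ 0 := by
  have h : jac ℝ x₀ x₁ * idxJ (transJ (d := d) ℝ x₀ x₁)⁻¹ = 1 := by
    rw [jac, idxJ_mul, Matrix.mul_nonsing_inv _ (isUnit_det_transJ x₀ x₁), idxJ_one]
  have e : ev y hy (jac (d := d) ℝ x₀ x₁).det = (jacR x₀ x₁ y).det :=
    (AlgHom.map_det (ev y hy) _).trans (congrArg _ (by ext a b; exact ev_jac hy a b))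
  rw [← e]
  exact ((Matrix.isUnit_det_of_right_inverse h).map (ev y hy)).ne_zero

/-- The ambient metric at `t = 1`: the Borel sums of the formal solution, except that the components
with an index `∞` are the exact ones. -/
def hatM (l : ℕ → ℝ) (s : ChartSolution r A D x₀) (w : ℰ d × ℝ) : AMat d 𝕜
  | inr (inr _), inr (inr _) => 0
  | inr (inr _), inr (inl i) => (intA r A x₀ i w : 𝕜)
  | inr (inl i), inr (inr _) => (intA r A x₀ i w : 𝕜)
  | inr (inr _), inl _ => 1
  | inl _, inr (inr _) => 1
  | a, b => hat l (s.G a b) w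

variable {l : ℕ → ℝ} (s : ChartSolution r A D x₀) (s₁ : ChartSolution r A D x₁)

lemma hatM_symm (w : ℰ d × ℝ) (a b : Idx d) : hatM l s w a b = hatM l s w b a := by
  rcases a with a | a | a <;> rcases b with b | b | b <;> simp only [hatM, s.sol.gauge.symm]

lemma hatM_trans (hD : Regular D) (hl : Tendsto l atTop atTop) {y : ℰ d}
    (hy : y ∈ transO x₀ x₁) {ρ : ℝ} (hw : (pt x₀ y, ρ) ∈ star A.dom) (a b : Idx d) :
    hatM l s (y, ρ) a b = ∑ c : Idx d × Idx d, ((jacR x₀ x₁ y a c.1 * jacR x₀ x₁ y b c.2 : ℝ) : 𝕜)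
      * hatM l s₁ (trans x₀ x₁ y, ρ) c.1 c.2 := by
  have h1 := fun a b => hat_transfer hl (F₁ := fun c : Idx d × Idx d => s₁.G c.1 c.2)
    (c := fun c => jac 𝕜 x₀ x₁ a c.1 * jac 𝕜 x₀ x₁ b c.2)
    (fun y hy n => s.ev_coeff_metric hD s₁ hy n a b) hy ρ
  simp only [extz_eq_ev _ hy, map_mul, ev_jac hy] at h1
  have h2 := fun i => congrArg (fun s : ℝ => (s : 𝕜)) (intA_trans r A hy hw i)
  rcases a with a | a | a <;> rcases b with b | b | b <;>
    simp [hatM, h1, h2, Fintype.sum_prod_type, jacR, idxJ]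

lemma contDiffOn_hatM {l : ℕ → ℝ} (s : ChartSolution r A D x₀)
    (hs : ∀ y ∈ chartO (d := d) x₀, ∀ a b, HasHat l (s.G a b) y) (a b : Idx d) :
    SmoothOn (fun w => hatM l s w a b)
      (starO A x₀ : Set (ℰ d × ℝ)) := by
  have h1 : ∀ a b, SmoothOn (hat l (s.G a b))
      (starO A x₀ : Set (ℰ d × ℝ)) := fun a b w hw =>
    ((hs w.1 hw.1 a b).1 w.2).contDiffWithinAt
  have h2 := fun i => contDiffOn_ofReal 𝕜 (contDiffOn_intA r A x₀ i)
  rcases a with a | a | a <;> rcases b with b | b | b <;>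
    first | exact contDiffOn_const | exact h2 _ | exact h1 _ _

/-- The metric `G + 2 (dz + α) dρ`. -/
def hypMat (G : Mat d ℝ) (α : Fin d → ℝ) : AMat d ℝ
  | inr (inl i), inr (inl j) => G i j
  | inr (inr _), inr (inl i) => α i
  | inr (inl i), inr (inr _) => α i
  | inr (inr _), inl _ => 1
  | inl _, inr (inr _) => 1
  | _, _ => 0

lemma matForm_hypMat (G : Mat d ℝ) (α : Fin d → ℝ) (u v : Idx d → ℝ) :
    matForm (hypMat G α) u v = matForm G (fun i => u (sIdx i)) (fun i => v (sIdx i))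
      + (u zI + ∑ i, u (sIdx i) * α i) * v nI + (v zI + ∑ i, v (sIdx i) * α i) * u nI := by
  simp only [matForm, LinearMap.mk₂_apply, Fintype.sum_prod_type, Fintype.sum_sum_type,
    Finset.univ_unique, Finset.sum_singleton, hypMat, mul_zero, mul_one, sum_const_zero,
    zero_add, add_zero, add_mul, sum_mul, sum_add_distrib, zIdx, sIdx]
  have e : ∑ i, u (inr (inr default)) * v (inr (inl i)) * α i
      = ∑ i, v (inr (inl i)) * α i * u (inr (inr default)) :=
    sum_ext fun _ => by ring
  have e' : ∑ i, u (inr (inl i)) * v (inr (inr default)) * α i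
      = ∑ i, u (inr (inl i)) * α i * v (inr (inr default)) :=
    sum_ext fun _ => by ring
  rw [e, e']
  change _ = _ + (u (inl default) * v (inr (inr default)) + _)
    + (v (inl default) * u (inr (inr default)) + _)
  ring

lemma hasSignature_hypMat {G : Mat d ℝ} (hG : ∀ i j, G i j = G j i)
    (α : Fin d → ℝ) (h : HasSignature (fun u v => matForm G u v) p q) :
    HasSignature (fun u v => matForm (hypMat G α) u v) (p + 1) (q + 1) := by
  have hd := h.finrank_eq
  rw [Module.finrank_fin_fun] at hd
  obtain ⟨e, he⟩ := h
  let T (n : ℕ) (c : ℝ) (L : (Fin n → ℝ) →ₗ[ℝ] (Fin d → ℝ)) : (Fin (n + 1) → ℝ) →ₗ[ℝ] (Idx d → ℝ) :=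
    { toFun := fun x => Sum.elim (fun _ => x 0 - ∑ i, L (Fin.tail x) i * α i)
        (Sum.elim (L (Fin.tail x)) fun _ => c * x 0)
      map_add' := fun x y => by
        have : Fin.tail (x + y) = Fin.tail x + Fin.tail y := rfl
        ext (i | i | i) <;>
          simp only [this, map_add, Pi.add_apply, Sum.elim_inl, Sum.elim_inr, add_mul,
            sum_add_distrib] <;> ring
      map_smul' := fun a x => by
        have : Fin.tail (a • x) = a • Fin.tail x := rfl
        ext (i | i | i) <;>
          simp only [this, map_smul, Pi.smul_apply, Sum.elim_inl, Sum.elim_inr, smul_eq_mul,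
            mul_assoc, ← mul_sum, RingHom.id_apply] <;> ring }
  have hT : ∀ n c L x, matForm (hypMat G α) (T n c L x) (T n c L x)
      = matForm G (L (Fin.tail x)) (L (Fin.tail x)) + 2 * c * (x 0 * x 0) := fun n c L x => by
    rw [matForm_hypMat]
    change matForm G (L (Fin.tail x)) (L (Fin.tail x))
      + (x 0 - (∑ i, L (Fin.tail x) i * α i) + ∑ i, L (Fin.tail x) i * α i) * (c * x 0)
      + (x 0 - (∑ i, L (Fin.tail x) i * α i) + ∑ i, L (Fin.tail x) i * α i) * (c * x 0) = _
    ring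
  have hpos : ∀ {n : ℕ} (x : Fin (n + 1) → ℝ), x ≠ 0 →
      0 < ∑ i, Fin.tail x i * Fin.tail x i + 2 * (x 0 * x 0) := fun x hx => by
    obtain ⟨i, hi⟩ := Function.ne_iff.1 hx
    have h0 : 0 ≤ ∑ i, Fin.tail x i * Fin.tail x i := sum_nonneg fun _ _ => mul_self_nonneg _
    rcases Fin.eq_zero_or_eq_succ i with rfl | ⟨j, rfl⟩
    · have := mul_self_pos.2 hi
      linarith
    · have : 0 < ∑ i, Fin.tail x i * Fin.tail x i :=
        Finset.sum_pos' (fun _ _ => mul_self_nonneg _) ⟨j, Finset.mem_univ _, mul_self_pos.2 hi⟩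
      have := mul_self_nonneg (x 0)
      linarith
  refine hasSignature_of_definite ?_ _ (matForm_symm fun a b => ?_)
    (T p 1 (e.symm.toLinearMap ∘ₗ LinearMap.inl ℝ _ _))
    (T q (-1) (e.symm.toLinearMap ∘ₗ LinearMap.inr ℝ _ _)) (fun x hx => ?_) fun x hx => ?_
  · rw [Module.finrank_fintype_fun_eq_card]
    simp
    omega
  · rcases a with a | a | a <;> rcases b with b | b | b <;>
      first | rfl | exact hG _ _
  · refine (hpos x hx).trans_eq ((hT _ _ _ _).trans (congrArg₂ _ ((he _ _).trans ?_) ?_)).symm <;>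
      simp
  · have h1 : matForm G (e.symm (0, Fin.tail x)) (e.symm (0, Fin.tail x))
        = -∑ i, Fin.tail x i * Fin.tail x i := (he _ _).trans (by simp)
    refine ((hT _ _ _ _).trans (congrArg (· + _) h1)).trans_lt ?_
    linarith [hpos x hx]

/-- The components of the ambient metric at `t = 1`, `ρ = 0`. -/
def initM (r : WeylPair d M p q) (x₀ : M) (y : ℰ d) : AMat d ℝ :=
  hypMat (Matrix.of fun i j => r.g (pt x₀ y)
      (chartVec (𝓡 d) x₀ y (single i 1))
      (chartVec (𝓡 d) x₀ y (single j 1)))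
    fun i => r.a (pt x₀ y) (chartVec (𝓡 d) x₀ y (single i 1))

lemma hasSignature_initM (r : WeylPair d M p q) {y : ℰ d} (hy : y ∈ chartO x₀) :
    HasSignature (fun u v => matForm (initM r x₀ y) u v) (p + 1) (q + 1) := by
  refine hasSignature_hypMat (fun i j => (r.signature _).symm _ _) _ ?_
  obtain ⟨e, he⟩ := exists_chartVec_equiv hy
  let φ : (Fin d → ℝ) ≃ₗ[ℝ] TangentSpace (𝓡 d) (pt x₀ y) :=
    (WithLp.linearEquiv 2 ℝ (Fin d → ℝ)).symm.trans e.toLinearEquiv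
  have hφ : ∀ c, φ c = ∑ i, c i • (chartVec (𝓡 d) x₀ y (single i 1) :
      TangentSpace (𝓡 d) (pt x₀ y)) := fun c => by
    refine (congrArg e (sum_smul_single c).symm).trans ((map_sum e _ _).trans ?_)
    exact sum_ext fun i => (map_smul e _ _).trans (congrArg _ (he _).symm)
  obtain ⟨b, hb⟩ := r.signature (pt x₀ y)
  refine ⟨φ.trans b, fun u v => Eq.trans ?_ (hb (φ u) (φ v))⟩
  rw [hφ u, hφ v]
  refine Eq.trans ?_ (bilin_sum_smul (r.g (pt x₀ y)) u v _).symm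
  simp only [matForm, LinearMap.mk₂_apply, Fintype.sum_prod_type, mul_assoc]

lemma HasHat.zero {F : (𝒮 x₀)⟦X⟧} {y : ℰ d} (h : HasHat l F y) (hy : y ∈ chartO x₀) :
    hat l F (y, 0) = ev y hy (constantCoeff F) := by
  have := h.2 0
  rwa [iteratedDeriv_zero, Nat.factorial_zero, Nat.cast_one, one_mul,
    coeff_zero, extz_eq_ev _ hy] at this

lemma hatM_zero {y : ℰ d} (hy : y ∈ chartO x₀) (hs : ∀ a b, HasHat l (s.G a b) y) (a b : Idx d) :
    hatM l s (y, 0) a b = (initM r x₀ y a b : 𝕜) := by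
  have g := s.sol.gauge
  have h := fun a b => (hs a b).zero hy
  have zz : ev y hy (constantCoeff (s.G (inl ()) (inl ()))) = 0 :=
    (congrArg _ g.zz).trans (map_zero _)
  have zs : ∀ i, ev y hy (constantCoeff (s.G (inl ()) (inr (inl i)))) = 0 :=
    fun i => (congrArg _ (g.zs i)).trans (map_zero _)
  have sz : ∀ i, ev y hy (constantCoeff (s.G (inr (inl i)) (inl ()))) = 0 :=
    fun i => by rw [g.symm, zs]
  have ss : ∀ i j, ev y hy (constantCoeff (s.G (inr (inl i)) (inr (inl j)))) = _ :=
    fun i j => (congrArg _ (g.ss i j)).trans (ev_locg 𝕜 r x₀ y hy i j)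
  rcases a with ⟨⟩ | a | ⟨⟩ <;> rcases b with ⟨⟩ | b | ⟨⟩ <;>
    simp only [hatM, h, initM, hypMat, of_apply, intA_zero, zz, zs, sz, ss, ofReal_zero, ofReal_one]

/-- The ambient metric with components `hatM` at `t = 1` and the warping function are admissible. -/
structure IsGood (l : ℕ → ℝ) (s : ChartSolution r A D x₀) (w : ℰ d × ℝ) :
    Prop where
  det : (hatM l s w).det ≠ 0
  warp : hat l s.f w ≠ 0
  signature : HasSignature (fun u v => matForm ((hatM l s w).map RCLike.re) u v) (p + 1) (q + 1)

lemma matForm_hatM_trans (hD : Regular D) (hl : Tendsto l atTop atTop)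
    {y : ℰ d} (hy : y ∈ transO x₀ x₁) {ρ : ℝ} (hw : (pt x₀ y, ρ) ∈ star A.dom) (u v : Idx d → ℝ) :
    matForm ((hatM l s (y, ρ)).map RCLike.re) u v
      = matForm ((hatM l s₁ (trans x₀ x₁ y, ρ)).map RCLike.re)
        ((jacR x₀ x₁ y).vecMulLinear u) ((jacR x₀ x₁ y).vecMulLinear v) := by
  simp only [matForm, LinearMap.mk₂_apply, map_apply, hatM_trans s s₁ hD hl hy hw, map_sum,
    RCLike.re_ofReal_mul, Matrix.vecMulLinear_apply, Matrix.vecMul, dotProduct, mul_sum,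
    sum_mul]
  rw [sum_comm]
  refine sum_ext fun c => ?_
  rw [Fintype.sum_prod_type, sum_comm]
  exact sum_ext₂ fun _ _ => by ring

lemma hat_warp_trans (hD : Regular D) (hl : Tendsto l atTop atTop)
    {y : ℰ d} (hy : y ∈ transO x₀ x₁) (ρ : ℝ) :
    hat l s.f (y, ρ) = hat l s₁.f (trans x₀ x₁ y, ρ) := by
  have h := hat_transfer hl (ι := Unit) (F₀ := s.f) (F₁ := fun _ => s₁.f) (c := fun _ => 1)
    (fun y hy n => by
      rw [Fintype.sum_unique, map_one, one_mul]
      exact s.ev_coeff_warp hD s₁ hy n) hy ρ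
  rwa [Fintype.sum_unique, extz_eq_ev _ hy, map_one, one_mul] at h

lemma IsGood.trans (hD : Regular D) (hl : Tendsto l atTop atTop)
    {y : ℰ d} (hy : y ∈ transO x₀ x₁) {ρ : ℝ}
    (hw : (pt x₀ y, ρ) ∈ star A.dom) (h : IsGood l s₁ (WeylAmbient.trans x₀ x₁ y, ρ)) :
    IsGood l s (y, ρ) where
  det := by
    have e : hatM l s (y, ρ) = (jacR x₀ x₁ y).map (algebraMap ℝ 𝕜)
        * hatM l s₁ (WeylAmbient.trans x₀ x₁ y, ρ)
        * ((jacR x₀ x₁ y).map (algebraMap ℝ 𝕜)).transpose := by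
      ext a b
      simp only [hatM_trans s s₁ hD hl hy hw, mul_apply, transpose_apply,
        map_apply, RCLike.algebraMap_eq_ofReal, ofReal_mul, sum_mul]
      rw [Fintype.sum_prod_type, sum_comm]
      exact sum_ext₂ fun _ _ => by ring
    have hj : ((jacR x₀ x₁ y).map (algebraMap ℝ 𝕜)).det ≠ 0 := by
      have := RingHom.map_det (algebraMap ℝ 𝕜) (jacR x₀ x₁ y)
      rw [RingHom.mapMatrix_apply] at this
      rw [← this]
      exact (map_ne_zero _).2 (det_jacR_ne_zero hy)
    rw [e, Matrix.det_mul, Matrix.det_mul, Matrix.det_transpose]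
    exact mul_ne_zero (mul_ne_zero hj h.det) hj
  warp := by rw [hat_warp_trans s s₁ hD hl hy]; exact h.warp
  signature := by
    simp only [matForm_hatM_trans s s₁ hD hl hy hw]
    exact h.signature.comp_injective _ (Matrix.vecMul_injective_iff_isUnit.2
      ((Matrix.isUnit_iff_isUnit_det _).2 (isUnit_iff_ne_zero.2 (det_jacR_ne_zero hy)))) rfl

lemma isGood_trans_iff (hD : Regular D) (hl : Tendsto l atTop atTop)
    {y : ℰ d} (hy : y ∈ transO x₀ x₁) {ρ : ℝ} (hw : (pt x₀ y, ρ) ∈ star A.dom) :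
    IsGood l s₁ (trans x₀ x₁ y, ρ) ↔ IsGood l s (y, ρ) := by
  refine ⟨IsGood.trans s s₁ hD hl hy hw, fun h => ?_⟩
  have hb : trans x₁ x₀ (trans x₀ x₁ y) = y := by
    rw [trans, pt_trans hy]; exact (extChartAt (𝓡 d) x₀).right_inv hy.1
  refine IsGood.trans s₁ s hD hl ⟨trans_mem hy, ?_⟩ ?_ (hb.symm ▸ h)
  · rw [pt_trans hy]; exact (extChartAt (𝓡 d) x₀).map_target hy.1
  · rwa [pt_trans hy]

lemma isOpen_isGood {l : ℕ → ℝ} (s : ChartSolution r A D x₀)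
    (hs : ∀ y ∈ chartO (d := d) x₀, (∀ a b, HasHat l (s.G a b) y) ∧ HasHat l s.f y) :
    IsOpen {w | w ∈ starO A x₀ ∧ IsGood l s w} := by
  rw [isOpen_iff_mem_nhds]
  rintro w ⟨hw, h⟩
  have hn := (starO A x₀).2.mem_nhds hw
  have hc : ContinuousAt (hatM l s) w := continuousAt_pi.2 fun a => continuousAt_pi.2 fun b =>
    ((contDiffOn_hatM s (fun y hy => (hs y hy).1) a b).contDiffAt hn).continuousAt
  have hr : ContinuousAt (fun w => (hatM l s w).map RCLike.re) w :=
    (continuous_id.matrix_map RCLike.continuous_re).continuousAt.comp hc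
  have hd : ContinuousAt (fun w => (hatM l s w).det) w :=
    (continuous_id.matrix_det).continuousAt.comp hc
  filter_upwards [hn, hd.eventually_ne h.det,
    ((hs w.1 hw.1).2.1 w.2).continuousAt.eventually_ne h.warp,
    hr.eventually (eventually_hasSignature h.signature)] with w h1 h2 h3 h4
  exact ⟨h1, h2, h3, h4 fun i j => congrArg _ (hatM_symm s w i j)⟩

lemma matForm_single {ι : Type*} [Fintype ι] [DecidableEq ι] (S : Matrix ι ι ℝ) (i j : ι) :
    matForm S (Pi.single i 1) (Pi.single j 1) = S i j := by
  simp [matForm, Fintype.sum_prod_type, Pi.single_apply]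

lemma isGood_zero {y : ℰ d} (hy : y ∈ chartO x₀)
    (hs : (∀ a b, HasHat l (s.G a b) y) ∧ HasHat l s.f y) : IsGood l s (y, 0) := by
  have e : hatM l s (y, 0) = (initM r x₀ y).map (algebraMap ℝ 𝕜) := by
    ext a b
    rw [hatM_zero s hy hs.1, map_apply, RCLike.algebraMap_eq_ofReal]
  have hsig := hasSignature_initM r hy
  have h0 : (initM r x₀ y).det ≠ 0 := by
    have := hsig.det_ne_zero (fun i => Pi.single i (1 : ℝ)) (fun w => ⟨w, by
      ext j; simp [Finset.sum_apply, Pi.single_apply]⟩) fun c hc => by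
        ext j; simpa [Finset.sum_apply, Pi.single_apply] using congrFun hc j
    simp only [matForm_single] at this
    exact this
  refine ⟨?_, ?_, ?_⟩
  · have := RingHom.map_det (algebraMap ℝ 𝕜) (initM r x₀ y)
    rw [RingHom.mapMatrix_apply, ← e] at this
    rw [← this]
    exact (map_ne_zero _).2 h0
  · rw [hs.2.zero hy, s.sol.f₀, map_one]
    exact one_ne_zero
  · have e' : (hatM l s (y, 0)).map RCLike.re = initM r x₀ y := by
      rw [e]
      ext a b
      simp
    rw [e']
    exact hsig

end

lemma mem_transO_self {y : ℰ d} (hy : y ∈ chartO x₀) :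
    y ∈ transO x₀ (pt x₀ y) := ⟨hy, mem_extChartAt_source _⟩

lemma chartVec_eq_fderiv {y : ℰ d} (hy : y ∈ chartO x₀) (u : ℰ d) : (chartVec (𝓡 d) x₀ y u : ℰ d)
      = fderiv ℝ (trans x₀ (pt x₀ y)) y u := by
  have h := (mdifferentiableAt_pt hy).mfderiv
  rw [modelWithCornersSelf_coe, Set.range_id, fderivWithin_univ] at h
  exact DFunLike.congr_fun h u

lemma pt_self (x : M) : pt x (extChartAt (𝓡 d) x x) = x := extChartAt_to_inv x

lemma chartVec_self (x : M) (u : ℰ d) : (chartVec (𝓡 d) x (extChartAt (𝓡 d) x x) u : ℰ d) = u := by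
  have hx : extChartAt (𝓡 d) x x ∈ chartO x := mem_extChartAt_target x
  refine (chartVec_eq_fderiv hx u).trans ?_
  rw [pt_self]
  have e : trans x x =ᶠ[𝓝 (extChartAt (𝓡 d) x x)] id := by
    filter_upwards [(chartO x).2.mem_nhds hx] with y hy
    exact (extChartAt (𝓡 d) x).right_inv hy
  rw [e.fderiv_eq, fderiv_id]
  rfl

lemma ofReal_weight_mul (t a b j j' : ℝ) (h : 𝕜) : ((t * a * j * (t * b * j') : ℝ) : 𝕜) * h
    = ((t ^ 2 * (a * b) : ℝ) : 𝕜) * (((j * j' : ℝ) : 𝕜) * h) := by push_cast; ring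

section Domain

variable (l : ℕ → ℝ) (S : ∀ x : M, ChartSolution r A D x)

/-- The set of points where the Borel sums define an admissible metric. -/
def ambO : Set (M × ℝ) :=
  {z | z ∈ star A.dom ∧ IsGood l (S z.1) (extChartAt (𝓡 d) z.1 z.1, z.2)}

/-- The domain of the ambient metric. -/
def ambU : Set (Total M) := {z | 0 < z.1 ∧ z.2 ∈ star (ambO l S)}

/-- The components of a tangent vector in the homogeneous frame. -/
def coords (d : ℕ) (t : ℝ) : Coord d →ₗ[ℝ] (Idx d → ℝ) where
  toFun u := Sum.elim (fun _ => u.1) (Sum.elim (fun i => t * u.2.1 i) fun _ => t * u.2.2)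
  map_add' u v := by ext (i | i | i) <;> simp [mul_add]
  map_smul' a u := by ext (i | i | i) <;> simp [mul_left_comm]

lemma matForm_hypMat_coords (G : Mat d ℝ) (α : Fin d → ℝ) {t : ℝ} (ht : 0 < t)
    (τ τ' : ℝ) (ξ ξ' : ℰ d) (σ σ' : ℝ) :
    matForm (hypMat G α) (coords d t (τ, ξ, σ)) (coords d t (τ', ξ', σ'))
      = t ^ 2 * ∑ a, ∑ b, ξ a * (ξ' b * G a b) + t ^ 2 * ((t⁻¹ * τ + ∑ a, ξ a * α a) * σ'
        + (t⁻¹ * τ' + ∑ a, ξ' a * α a) * σ) := by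
  rw [matForm_hypMat, matForm, LinearMap.mk₂_apply, Fintype.sum_prod_type]
  change ∑ a, ∑ b, t * ξ a * (t * ξ' b) * G a b + (τ + ∑ a, t * ξ a * α a) * (t * σ')
    + (τ' + ∑ a, t * ξ' a * α a) * (t * σ) = _
  have e : ∑ a, ∑ b, t * ξ a * (t * ξ' b) * G a b = t ^ 2 * ∑ a, ∑ b, ξ a * (ξ' b * G a b) := by
    simp only [mul_sum]
    exact sum_ext₂ fun _ _ => by ring
  have e' : ∀ ξ : ℰ d, ∑ a, t * ξ a * α a = t * ∑ a, ξ a * α a := fun ξ => by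
    simp only [mul_sum, mul_assoc]
  rw [e, e', e']
  field_simp
  ring

/-- The ambient metric. -/
def ambG : TwoTensor d M 𝕜 := fun z => show Coord d →ₗ[ℝ] Coord d →ₗ[ℝ] 𝕜 from
  LinearMap.mk₂ ℝ (fun u v => ∑ c : Idx d × Idx d,
      ((coords d z.1 u c.1 * coords d z.1 v c.2 : ℝ) : 𝕜)
        * hatM l (S z.2.1) (extChartAt (𝓡 d) z.2.1 z.2.1, z.2.2) c.1 c.2)
    (fun _ _ _ => by simp [add_mul, sum_add_distrib])
    (fun _ _ _ => by simp [smul_sum, real_smul_eq_coe_mul, mul_assoc])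
    (fun _ _ _ => by simp [mul_add, add_mul, sum_add_distrib])
    (fun _ _ _ => by simp [smul_sum, real_smul_eq_coe_mul, mul_assoc, mul_left_comm])

/-- The warping function. -/
def ambF (z : Total M) : 𝕜 := (z.1 : 𝕜) * hat l (S z.2.1).f (extChartAt (𝓡 d) z.2.1 z.2.1, z.2.2)

variable {l S}

lemma ambG_apply (z : Total M) (u v : Coord d) : ambG l S z u v = ∑ c : Idx d × Idx d,
    ((coords d z.1 u c.1 * coords d z.1 v c.2 : ℝ) : 𝕜)
      * hatM l (S z.2.1) (extChartAt (𝓡 d) z.2.1 z.2.1, z.2.2) c.1 c.2 := rfl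

lemma coords_frameVec {t : ℝ} (ht : 0 < t) {w : ℰ d × ℝ}
    (hw : w.1 ∈ chartO x₀) (a c : Idx d) : coords d t (frameVec x₀ (t, w) a) c
      = t * wt t a * jacR x₀ (pt x₀ w.1) w.1 a c := by
  have h0 : (chartVec (𝓡 d) x₀ w.1 0 : ℰ d) = 0 :=
    (chartVec_eq_fderiv hw 0).trans (map_zero _)
  rcases a with a | a | a <;> rcases c with c | c | c
  · exact (mul_inv_cancel₀ ht.ne').symm.trans (mul_one _).symm
  · exact (congrArg (fun u : ℰ d => t * u c) h0).trans
      ((mul_zero t).trans (by simp [jacR, idxJ]))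
  · simp [coords, frameVec, vec, coordBasis, jacR, idxJ]
  · simp [coords, frameVec, vec, coordBasis, jacR, idxJ]
  · exact (congrArg (fun u : ℰ d => t * u c) (chartVec_eq_fderiv hw _)).trans
      (congrArg (· * _) (mul_one t).symm)
  · simp [coords, frameVec, vec, coordBasis, jacR, idxJ]
  · simp [coords, frameVec, vec, coordBasis, jacR, idxJ]
  · exact (congrArg (fun u : ℰ d => t * u c) h0).trans
      ((mul_zero t).trans (by simp [jacR, idxJ]))
  · simp [coords, frameVec, vec, coordBasis, jacR, idxJ, wt]

variable (hD : Regular D) (hl : Tendsto l atTop atTop)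

include hD hl

lemma mem_ambO {w : ℰ d × ℝ} (hw : w.1 ∈ chartO x₀) :
    (pt x₀ w.1, w.2) ∈ ambO l S ↔ w ∈ starO A x₀ ∧ IsGood l (S x₀) w := by
  change _ ∧ _ ↔ (_ ∧ _) ∧ _
  simp only [hw, true_and]
  exact and_congr_right fun h => isGood_trans_iff (S x₀) (S (pt x₀ w.1)) hD hl (mem_transO_self hw) h

lemma comps_ambG (z₀ : Total M) (y : Coord d) (ht : 0 < y.1) (hy : y.2.1 ∈ chartO z₀.2.1)
    (hw : (pt z₀.2.1 y.2.1, y.2.2) ∈ star A.dom) (a b : Idx d) : comps (ambG l S) z₀ y a b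
      = ((y.1 ^ 2 * (wt y.1 a * wt y.1 b) : ℝ) : 𝕜) * hatM l (S z₀.2.1) y.2 a b := by
  rw [comps_apply _ hy, hatM_trans (S z₀.2.1) (S (pt z₀.2.1 y.2.1)) hD hl (mem_transO_self hy) hw,
    mul_sum]
  refine (ambG_apply _ _ _).trans (sum_ext fun c => ?_)
  refine (congrArg₂ (fun a b : ℝ => ((a * b : ℝ) : 𝕜) * _) (coords_frameVec ht hy a c.1)
    (coords_frameVec ht hy b c.2)).trans ?_
  exact ofReal_weight_mul _ _ _ _ _ _

lemma inChart_ambF (z₀ : Total M) (y : Coord d) (hy : y.2.1 ∈ chartO z₀.2.1) :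
    inChart (ambF l S) z₀ y = (y.1 : 𝕜) * hat l (S z₀.2.1).f y.2 :=
  congrArg _ (hat_warp_trans (S z₀.2.1) (S (pt z₀.2.1 y.2.1)) hD hl (mem_transO_self hy) y.2.2).symm

variable
  (hS : ∀ x₀ : M, ∀ y ∈ chartO (d := d) x₀, (∀ a b, HasHat l ((S x₀).G a b) y) ∧ HasHat l (S x₀).f y)

include hS

lemma isOpen_ambO : IsOpen (ambO l S) := by
  rw [isOpen_iff_mem_nhds]
  rintro ⟨x₀, ρ⟩ h
  have h1 : IsOpen (((extChartAt (𝓡 d) x₀).source ×ˢ (Set.univ : Set ℝ)) ∩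
      (fun z : M × ℝ => (extChartAt (𝓡 d) x₀ z.1, z.2)) ⁻¹'
        {w | w ∈ starO A x₀ ∧ IsGood l (S x₀) w}) :=
    (((continuousOn_extChartAt x₀).comp continuousOn_fst fun z hz => hz.1).prodMk
      continuousOn_snd).isOpen_inter_preimage ((isOpen_extChartAt_source x₀).prod isOpen_univ)
        (isOpen_isGood (S x₀) (hS x₀))
  have h2 : ∀ z : M × ℝ, z.1 ∈ (extChartAt (𝓡 d) x₀).source → (z ∈ ambO l S ↔
      (extChartAt (𝓡 d) x₀ z.1, z.2) ∈ {w | w ∈ starO A x₀ ∧ IsGood l (S x₀) w}) := fun z hz => by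
    have := mem_ambO (S := S) hD hl (w := (extChartAt (𝓡 d) x₀ z.1, z.2))
      ((extChartAt (𝓡 d) x₀).map_source hz)
    rwa [pt, (extChartAt (𝓡 d) x₀).left_inv hz] at this
  have h0 := mem_extChartAt_source (I := 𝓡 d) x₀
  filter_upwards [h1.mem_nhds ⟨⟨h0, trivial⟩, (h2 (x₀, ρ) h0).1 h⟩] with z hz
  exact (h2 z hz.1.1).2 hz.2

lemma zero_mem_ambO (x : M) : (x, (0 : ℝ)) ∈ ambO l S :=
  ⟨star_zero (A.zero_mem x), isGood_zero (S x) (mem_extChartAt_target x)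
    (hS x _ (mem_extChartAt_target x))⟩

omit hD hl in
lemma ambG_initial (z : Total M) (ht : 0 < z.1) (h0 : z.2.2 = 0) (τ τ' : ℝ)
    (ξ ξ' : TangentSpace (𝓡 d) z.2.1) (σ σ' : ℝ) : ambG l S z (vec z τ ξ σ) (vec z τ' ξ' σ')
      = ((z.1 ^ 2 * r.g z.2.1 ξ ξ' + z.1 ^ 2 * ((z.1⁻¹ * τ + r.a z.2.1 ξ) * σ' +
        (z.1⁻¹ * τ' + r.a z.2.1 ξ') * σ) : ℝ) : 𝕜) := by
  obtain ⟨t, x, ρ⟩ := z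
  obtain rfl : ρ = 0 := h0
  have hx : extChartAt (𝓡 d) x x ∈ chartO x := mem_extChartAt_target x
  have e : ambG l S (t, x, (0 : ℝ)) (vec (t, x, (0 : ℝ)) τ ξ σ) (vec (t, x, (0 : ℝ)) τ' ξ' σ')
      = ((matForm (initM r x (extChartAt (𝓡 d) x x)) (coords d t (τ, ξ, σ))
        (coords d t (τ', ξ', σ')) : ℝ) : 𝕜) := by
    refine (ambG_apply _ _ _).trans ?_
    simp only [hatM_zero (S x) hx (hS x _ hx).1, matForm, LinearMap.mk₂_apply, ofReal_sum,
      ofReal_mul]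
    rfl
  have hv := fun i => chartVec_self (d := d) x (single i 1)
  have hξ : ∀ ξ : ℰ d, ξ
      = ∑ i, ξ i • (chartVec (𝓡 d) x (extChartAt (𝓡 d) x x) (single i 1) : ℰ d) := fun ξ =>
    (sum_smul_basis ξ).symm.trans (sum_ext fun i => congrArg _ (hv i).symm)
  have ea : ∀ ξ : ℰ d, r.a x ξ = ∑ i, ξ i * r.a (pt x (extChartAt (𝓡 d) x x))
      (chartVec (𝓡 d) x (extChartAt (𝓡 d) x x) (single i 1)) := fun ξ =>
    (covector_congr (fun x u => r.a x u) (pt_self x).symm (hξ ξ)).trans (linear_sum_smul (r.a _) _ _)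
  have eg : ∀ ξ ξ' : ℰ d, r.g x ξ ξ' = _ := fun ξ ξ' =>
    (bilin_congr (fun x u v => r.g x u v) (pt_self x).symm (hξ ξ) (hξ ξ')).trans
      (bilin_sum_smul (r.g _) _ _ _)
  refine e.trans (congrArg _ ((matForm_hypMat_coords _ _ ht τ τ' ξ ξ' σ σ').trans ?_))
  refine Eq.trans ?_ (congrArg₂ (fun g a : ℝ => t ^ 2 * g + t ^ 2 * ((t⁻¹ * τ + a) * σ' +
        (t⁻¹ * τ' + r.a x ξ') * σ)) (eg ξ ξ') (ea ξ)).symm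
  exact (congrArg (fun a : ℝ => _ + t ^ 2 * (_ + (t⁻¹ * τ' + a) * σ)) (ea ξ')).symm

lemma isWeylPreAmbient_ambG : IsWeylPreAmbient r (ambU l S) (ambG l S) where
  isOpen := (isOpen_Ioi.preimage continuous_fst).inter
    ((isOpen_star (isOpen_ambO hD hl hS)).preimage continuous_snd)
  pos z hz := hz.1
  initial_mem := by
    rintro ⟨t, x, ρ⟩ ⟨ht, h0⟩
    obtain rfl : ρ = 0 := h0
    exact ⟨ht, star_zero (zero_mem_ambO hD hl hS x)⟩
  dil_mem s hs z hz := ⟨mul_pos hs hz.1, hz.2⟩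
  pullback z hz τ τ' ξ ξ' := by
    rw [ambG_initial hS z hz.1 hz.2]
    simp
  smooth z₀ a b := by
    have hw : ∀ a : Idx d, SmoothOn (fun t => wt t a) (Set.Ioi 0) := fun a => by
      rcases a with a | a
      · exact contDiffOn_inv_Ioi
      · exact contDiffOn_const
    have h1 : SmoothOn (fun y : Coord d => ((y.1 ^ 2 * (wt y.1 a * wt y.1 b) : ℝ) : 𝕜)
        * hatM l (S z₀.2.1) y.2 a b) (chartDomain (totalModel d) z₀ (ambU l S)) := by
      refine (contDiffOn_ofReal 𝕜 ((contDiffOn_fst.pow 2).mul (((hw a).comp contDiffOn_fst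
        fun y hy => ?_).mul ((hw b).comp contDiffOn_fst fun y hy => ?_)))).mul
        ((contDiffOn_hatM (S z₀.2.1) (fun y hy => (hS _ y hy).1) a b).comp contDiffOn_snd
          fun y hy => ?_)
      · exact ((mem_chartDomain _ _ _).1 hy).2.1
      · exact ((mem_chartDomain _ _ _).1 hy).2.1
      · have := (mem_chartDomain _ _ _).1 hy
        exact ((mem_ambO hD hl this.1).1 (star_subset _ this.2.2)).1
    refine h1.congr fun y hy => ?_
    have := (mem_chartDomain _ _ _).1 hy
    exact comps_ambG hD hl z₀ y this.2.1 this.1 (star_subset _ this.2.2).1 a b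
  symm z hz u v := by
    refine (ambG_apply z u v).trans (((Equiv.prodComm _ _).sum_comp _).symm.trans
      (sum_ext fun c => ?_))
    rw [Equiv.prodComm_apply, Prod.fst_swap, Prod.snd_swap, hatM_symm, mul_comm (coords d z.1 u c.2)]
  nondegenerate z₀ y hy := by
    obtain ⟨h1, h2, h3⟩ := (mem_chartDomain _ _ _).1 hy
    have h4 := (mem_ambO hD hl h1).1 (star_subset _ h3)
    have e : comps (ambG l S) z₀ y = diagonal (fun a => ((y.1 * wt y.1 a : ℝ) : 𝕜))
        * hatM l (S z₀.2.1) y.2 * diagonal (fun a => ((y.1 * wt y.1 a : ℝ) : 𝕜)) := by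
      ext a b
      rw [comps_ambG hD hl z₀ y h2 h1 h4.1.2, Matrix.mul_diagonal, Matrix.diagonal_mul]
      push_cast; ring
    have hw : (diagonal (fun a : Idx d => ((y.1 * wt y.1 a : ℝ) : 𝕜))).det ≠ 0 := by
      rw [Matrix.det_diagonal]
      refine Finset.prod_ne_zero_iff.2 fun a _ => RCLike.ofReal_ne_zero.2 (mul_ne_zero h2.ne' ?_)
      rcases a with a | a
      · exact inv_ne_zero h2.ne'
      · exact one_ne_zero
    rw [e, Matrix.det_mul, Matrix.det_mul]
    exact mul_ne_zero (mul_ne_zero hw h4.2.det) hw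
  signature z hz := by
    have h := (star_subset _ hz.2).2.signature
    have hc : Function.Injective (coords d z.1) := (injective_iff_map_eq_zero _).2 fun u hu => by
      have h1 := fun a => congrFun hu a
      simp only [coords, LinearMap.coe_mk, AddHom.coe_mk, Pi.zero_apply, Sum.forall, Sum.elim_inl,
        Sum.elim_inr, mul_eq_zero, hz.1.ne', false_or, forall_const] at h1
      exact Prod.ext h1.1 (Prod.ext (PiLp.ext h1.2.1) h1.2.2)
    have hd : Module.finrank ℝ (Coord d) = Module.finrank ℝ (Idx d → ℝ) := by
      simp
      try omega
    obtain ⟨e, he⟩ := h.comp_injective (coords d z.1) hc hd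
    refine ⟨e, fun u v => Eq.trans ?_ (he u v)⟩
    refine (congrArg RCLike.re (ambG_apply z u v)).trans ?_
    simp only [map_sum, RCLike.re_ofReal_mul]
    rfl
  homogeneous s hs z hz τ τ' ξ ξ' σ σ' := by
    have h : ∀ τ (ξ : ℰ d) σ, coords d (s * z.1) (s * τ, ξ, σ)
        = s • coords d z.1 (τ, ξ, σ) := fun τ ξ σ => by ext (i | i | i) <;> simp [coords, mul_assoc]
    refine (ambG_apply (dil s z) _ _).trans (Eq.trans ?_ (congrArg _ (ambG_apply z _ _)).symm)
    rw [mul_sum]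
    refine sum_ext fun c => ?_
    refine (congrArg₂ (fun u v : Idx d → ℝ => ((u c.1 * v c.2 : ℝ) : 𝕜) * _) (h τ ξ σ)
      (h τ' ξ' σ')).trans ?_
    have := ofReal_weight_mul (𝕜 := 𝕜) s 1 1
    simp only [mul_one] at this
    exact this _ _ _

end Domain

section

variable {l : ℕ → ℝ} {S : ∀ x : M, ChartSolution r A D x} (hD : Regular D)
  (hl : Tendsto l atTop atTop)
  (hS : ∀ x₀ : M, ∀ y ∈ chartO (d := d) x₀, (∀ a b, HasHat l ((S x₀).G a b) y) ∧ HasHat l (S x₀).f y)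

include hD hl

lemma ev_hatG_ambG (h : IsWeylPreAmbient r (ambU l S) (ambG l S)) (x₀ : M)
    (w : ℰ d × ℝ) (hw : w ∈ h.slab x₀) (a b : Idx d) :
    ev w hw (h.hatG x₀ a b) = hatM l (S x₀) w a b := by
  have h1 := star_subset _ hw.2.2
  refine (comps_ambG hD hl (1, x₀, 0) (1, w) one_pos hw.1 h1.1 a b).trans ?_
  rcases a with a | a <;> rcases b with b | b <;> simp [wt]

include hS

lemma isWeylNormal_ambG : IsWeylNormal r A (ambU l S) (ambG l S) where
  interval t x ht := by
    have : {ρ : ℝ | (t, x, ρ) ∈ ambU l S} = {ρ | (x, ρ) ∈ star (ambO l S)} := by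
      ext ρ; exact and_iff_right ht
    rw [this]
    exact ordConnected_star _ x
  subset_dom z hz := star_subset _ (star_subset _ hz.2).1
  initial z hz := ambG_initial hS z hz.1 hz.2
  acceleration z₀ y hy a := by
    have h := isWeylPreAmbient_ambG hD hl hS
    have hy' := (h.mem_cone_iff z₀ y).1 hy
    have hst := ((mem_ambO hD hl hy'.2.1).1 (star_subset _ hy'.2.2.2)).1
    have hev := fun w hw a b => ev_hatG_ambG hD hl h z₀.2.1 w hw a b
    rw [lineAcceleration, (h.isCone z₀).acceleration_eq y hy', IsWeylNormal.lowChr_inf_inf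
      (h.hatG_symm _), sm_ext (F := h.hatG z₀.2.1 nI nI) (G := 0)
        fun w hw => (hev w hw _ _).trans (map_zero _).symm, tw, map_zero, mul_zero, add_zero,
      mul_zero, sub_zero]
    have hc : A.covector _ (chartVec (totalModel d) z₀ y (coordBasis d a)) = y.1 ^ 2 *
        A.form (pt z₀.2.1 y.2.1) y.2.2 (chartVec (𝓡 d) z₀.2.1 y.2.1 (coordBasis d a).2.1) :=
      congrArg (A.covector _) (chartVec_total hy'.2.1 _)
    rw [hc]
    have e := ev_smD (0, (1 : ℝ)) (fun w hw => hev w hw a nI) y.2 hy'.2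
    have hdiff : DifferentiableAt ℝ (fun w => hatM l (S z₀.2.1) w a nI) y.2 :=
      ((contDiffOn_hatM (S z₀.2.1) (fun y hy => (hS _ y hy).1) a nI).contDiffAt
        ((starO A _).2.mem_nhds hst)).differentiableAt (by simp)
    refine (congrArg _ e).trans ?_
    have hline : HasDerivAt (fun ρ : ℝ => (y.2.1, ρ)) ((0, 1) : ℰ d × ℝ) y.2.2 :=
      (hasDerivAt_const _ _).prodMk (hasDerivAt_id _)
    have hd := hdiff.hasFDerivAt.comp_hasDerivAt y.2.2 hline
    have h0 : A.form (pt z₀.2.1 y.2.1) y.2.2 (chartVec (𝓡 d) z₀.2.1 y.2.1 0) = 0 :=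
      (congrArg (A.form _ y.2.2) (IsWeylNormal.chartVec_zero _ _)).trans (map_zero _)
    rcases a with a | a | a
    · rw [hd.unique (hasDerivAt_const _ (1 : 𝕜)), mul_zero]
      exact ((congrArg (fun s : ℝ => ((y.1 ^ 2 * s : ℝ) : 𝕜)) h0).trans (by simp)).symm
    · rw [hd.unique ((RCLike.ofRealCLM (K := 𝕜)).hasFDerivAt.comp_hasDerivAt y.2.2
        (hasDerivAt_intA r A a hst))]
      change ((y.1 ^ 2 * 1 : ℝ) : 𝕜) * ((A.form _ _ _ : ℝ) : 𝕜) = ((y.1 ^ 2 * A.form _ _ _ : ℝ) : 𝕜)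
      rw [mul_one, ← ofReal_mul]
      rfl
    · rw [hd.unique (hasDerivAt_const _ (0 : 𝕜)), mul_zero]
      exact ((congrArg (fun s : ℝ => ((y.1 ^ 2 * s : ℝ) : 𝕜)) h0).trans (by simp)).symm

lemma isWarp_ambF : IsWarp (d := d) (ambU l S) (ambF l S) where
  smooth z₀ := by
    have h1 : SmoothOn (fun y : Coord d => (y.1 : 𝕜) * hat l (S z₀.2.1).f y.2)
        (chartDomain (totalModel d) z₀ (ambU l S)) := by
      refine (contDiffOn_ofReal 𝕜 (f := fun y : Coord d => y.1) contDiffOn_fst).mul fun y hy => ?_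
      exact ((((hS _ _ ((mem_chartDomain _ _ _).1 hy).1).2.1 y.2.2).comp y
        contDiffAt_snd).contDiffWithinAt)
    exact h1.congr fun y hy => inChart_ambF hD hl z₀ y ((mem_chartDomain _ _ _).1 hy).1
  ne_zero z hz := mul_ne_zero (RCLike.ofReal_ne_zero.2 hz.1.ne') (star_subset _ hz.2).2.warp
  homogeneous s _ z _ := by
    rw [ambF, ambF, ← mul_assoc, ← ofReal_mul]
    rfl
  initial z hz := by
    have hx : extChartAt (𝓡 d) z.2.1 z.2.1 ∈ chartO z.2.1 := mem_extChartAt_target _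
    rw [ambF, hz.2, (hS _ _ hx).2.zero hx, (S z.2.1).sol.f₀, map_one, mul_one]

omit hD hl hS in
lemma jet_eq_of_hasHat {Ω : Opens (ℰ d × ℝ)}
    (hW : ∀ x ∈ chartO (d := d) x₀, (x, (0 : ℝ)) ∈ Ω) {P : Sm 𝕜 Ω}
    {F : (𝒮 x₀)⟦X⟧} (hF : ∀ y ∈ chartO x₀, HasHat l F y)
    (hP : ∀ w hw, ev w hw P = hat l F w) : jet hW P = F := by
  ext1 n
  refine sm_ext fun x hx => ?_
  have e : (fun ρ => extz P.1 (x, ρ)) =ᶠ[𝓝 0] fun ρ => hat l F (x, ρ) := by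
    filter_upwards [(Continuous.prodMk_right x).continuousAt.eventually_mem
      (Ω.2.mem_nhds (hW x hx))] with ρ hρ
    rw [extz_eq_ev _ hρ, hP]
  rw [ev_coeff_jet, e.iteratedDeriv_eq, (hF x hx).2, extz_eq_ev _ hx]
  have := n.factorial_ne_zero
  simp [real_smul_eq_coe_mul, this]

lemma jet_hatG_ambG (h : IsWeylPreAmbient r (ambU l S) (ambG l S)) (x₀ : M) :
    (h.hatG x₀).map (jet (h.slab_mem x₀)) = (S x₀).G := by
  have g := (isWeylNormal_ambG hD hl hS).gauge h x₀ (S x₀).sol.gauge.inv₀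
  have g' := (S x₀).sol.gauge
  have key : ∀ a b, (∀ w, hatM l (S x₀) w a b = hat l ((S x₀).G a b) w) →
      (h.hatG x₀).map (jet (h.slab_mem x₀)) a b = (S x₀).G a b := fun a b hab =>
    jet_eq_of_hasHat (h.slab_mem x₀) (fun y hy => (hS x₀ y hy).1 a b) fun w hw =>
      (ev_hatG_ambG hD hl h x₀ w hw a b).trans (hab w)
  ext1 a b
  rcases a with a | a | a <;> rcases b with b | b | b
  · exact key _ _ fun _ => rfl
  · exact key _ _ fun _ => rfl
  · exact g.zi.trans g'.zi.symm
  · exact key _ _ fun _ => rfl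
  · exact key _ _ fun _ => rfl
  · exact (g.si a).trans (g'.si a).symm
  · exact g.iz.trans g'.iz.symm
  · exact (g.symm _ _).trans ((g.si b).trans ((g'.si b).symm.trans (g'.symm _ _)))
  · exact g.ii.trans g'.ii.symm

lemma isFormalWeylAmbient_ambG : IsFormalWeylAmbient D r (ambU l S) (ambG l S) (ambF l S) := by
  have h := isWeylPreAmbient_ambG hD hl hS
  have hf := isWarp_ambF hD hl hS
  have hG := fun x₀ => jet_hatG_ambG hD hl hS h x₀
  have hK : ∀ x₀, (h.hatG x₀)⁻¹.map (jet (h.slab_mem x₀)) = (S x₀).K := fun x₀ => by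
    have g := ((isWeylNormal_ambG hD hl hS).gauge h x₀ (S x₀).sol.gauge.inv₀).inv
    rw [hG] at g
    exact left_inv_eq_right_inv (mul_eq_one_comm.1 g) (S x₀).sol.gauge.inv
  have hF : ∀ x₀, jet (h.slab_mem x₀) (hf.hatF h x₀) = (S x₀).f := fun x₀ =>
    jet_eq_of_hasHat (h.slab_mem x₀) (fun y hy => (hS x₀ y hy).2) fun w hw =>
      (inChart_ambF hD hl (1, x₀, 0) (1, w) hw.1).trans (by simp)
  refine { h with
    smooth_warp := hf.smooth, warp_ne_zero := hf.ne_zero, warp_homogeneous := hf.homogeneous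
    warp_initial := hf.initial, ricciFlat_base := fun z₀ y hy a b => ?_
    ricciFlat_fibre := fun z₀ y hy => ?_ }
  · obtain ⟨hx, ht, hρ⟩ := (mem_chartDomain _ _ _).1 hy
    obtain ⟨t, x, ρ⟩ := y
    obtain rfl : ρ = 0 := hρ
    obtain ⟨φ, hφ⟩ := hf.exists_hatF_inv h z₀.2.1
    have hφ' : jet (h.slab_mem z₀.2.1) φ = (S z₀.2.1).φ :=
      left_inv_eq_right_inv (by rw [mul_comm, ← hF, ← map_mul, hφ, map_one]) (S z₀.2.1).sol.inv
    have e := baseA_jet (h.slab_mem z₀.2.1) (h.hatG_symm z₀.2.1) (h.hatG_inv z₀.2.1) (D - d)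
      (hf.hatF h z₀.2.1) φ a b
    rw [hG, hK, hF, hφ', (S z₀.2.1).sol.base] at e
    refine vanishes_of_jet_eq_zero (c := fun t => wt t a * wt t b) (h.slab_mem z₀.2.1)
      (fun y hy => (h.isCone z₀).warpedRicciBase_eq (hf.inChart_eq h z₀) hφ _ y hy a b) e.symm ht ?_
      hx
    have hw : ∀ a : Idx d, ContinuousAt (fun t => wt t a) t := fun a => by
      rcases a with a | a
      · exact continuousAt_inv₀ (ne_of_gt ht)
      · exact continuousAt_const
    exact (hw a).mul (hw b)
  · obtain ⟨hx, ht, hρ⟩ := (mem_chartDomain _ _ _).1 hy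
    obtain ⟨t, x, ρ⟩ := y
    obtain rfl : ρ = 0 := hρ
    have e := fibreA_jet (h.slab_mem z₀.2.1) (h.hatG_symm z₀.2.1) (h.hatG_inv z₀.2.1) (D - d)
      (hf.hatF h z₀.2.1)
    rw [hG, hK, hF, (S z₀.2.1).fibre] at e
    refine vanishes_of_jet_eq_zero (c := fun _ => -1) (h.slab_mem z₀.2.1) (fun y hy => ?_) e.symm ht
      continuousAt_const hx
    rw [(h.isCone z₀).warpedRicciFibre_eq (hf.inChart_eq h z₀) _ y hy]
    simp

omit hl hS in
lemma exists_isFormalWeylAmbient [SecondCountableTopology M] (r : WeylPair d M p q)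
    (A : Acceleration d M) : ∃ (U : Set (Total M)) (g : TwoTensor d M 𝕜) (f : Total M → 𝕜),
      IsFormalWeylAmbient D r U g f ∧ IsWeylNormal r A U g := by
  let S := fun x => Classical.choice (nonempty_chartSolution r A hD x)
  obtain ⟨l, hl, hS⟩ := exists_hat hD S
  exact ⟨_, _, _, isFormalWeylAmbient_ambG hD hl hS, isWeylNormal_ambG hD hl hS⟩

end

end

end WeylAmbient
end

theorem mainTheorem1 {𝕜 : Type*} [RCLike 𝕜] (d p q : ℕ)
    {M : Type*} [TopologicalSpace M] [ChartedSpace (EuclideanSpace ℝ (Fin d)) M]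
    [IsManifold (𝓡 d) ∞ M] [T2Space M] [SecondCountableTopology M]
    (W : WeylAmbient.WeylClass d M p q) (r : WeylAmbient.WeylPair d M p q) (_hr : r.weylClass = W)
    (A : WeylAmbient.Acceleration d M) :
    -- honest Weyl-ambient spaces, for odd `d ≥ 3`
    (Odd d → 3 ≤ d →
      (∃ (U : Set (WeylAmbient.Total M)) (g : WeylAmbient.TwoTensor d M ℝ),
        WeylAmbient.IsWeylAmbient r U g ∧ WeylAmbient.IsWeylNormal r A U g) ∧
      ∀ (U₁ U₂ : Set (WeylAmbient.Total M)) (g₁ g₂ : WeylAmbient.TwoTensor d M ℝ),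
        WeylAmbient.IsWeylAmbient r U₁ g₁ → WeylAmbient.IsWeylNormal r A U₁ g₁ →
        WeylAmbient.IsWeylAmbient r U₂ g₂ → WeylAmbient.IsWeylNormal r A U₂ g₂ →
        WeylAmbient.AgreeToInfiniteOrder g₁ g₂) ∧
    -- every `d`, with the formal dimension parameter `D`
    (∀ D : 𝕜, WeylAmbient.Regular D →
      (∃ (U : Set (WeylAmbient.Total M)) (g : WeylAmbient.TwoTensor d M 𝕜)
        (f : WeylAmbient.Total M → 𝕜),
        WeylAmbient.IsFormalWeylAmbient D r U g f ∧ WeylAmbient.IsWeylNormal r A U g) ∧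
      ∀ (U₁ U₂ : Set (WeylAmbient.Total M)) (g₁ g₂ : WeylAmbient.TwoTensor d M 𝕜)
        (f₁ f₂ : WeylAmbient.Total M → 𝕜),
        WeylAmbient.IsFormalWeylAmbient D r U₁ g₁ f₁ → WeylAmbient.IsWeylNormal r A U₁ g₁ →
        WeylAmbient.IsFormalWeylAmbient D r U₂ g₂ f₂ → WeylAmbient.IsWeylNormal r A U₂ g₂ →
        WeylAmbient.AgreeToInfiniteOrder g₁ g₂ ∧
          WeylAmbient.AgreeToInfiniteOrderFun (d := d) f₁ f₂) ∧
    -- the expansion coefficients are rational functions of `D`, without poles at regular values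
    (∀ (m : ℕ) (z₀ : WeylAmbient.Total M) (I J : WeylAmbient.Idx d) (t : ℝ)
      (y : EuclideanSpace ℝ (Fin d)), 0 < t → y ∈ (extChartAt (𝓡 d) z₀.2.1).target →
      ∃ P Q : Polynomial ℝ, (∀ D : 𝕜, WeylAmbient.Regular D → Polynomial.aeval D Q ≠ 0) ∧
        ∀ (D : 𝕜) (U : Set (WeylAmbient.Total M)) (g : WeylAmbient.TwoTensor d M 𝕜)
          (f : WeylAmbient.Total M → 𝕜), WeylAmbient.Regular D →
          WeylAmbient.IsFormalWeylAmbient D r U g f → WeylAmbient.IsWeylNormal r A U g →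
          Polynomial.aeval D Q * WeylAmbient.rhoCoeff m g z₀ I J t y = Polynomial.aeval D P) := by
  refine ⟨fun hd h3 => ⟨?_, fun U₁ U₂ g₁ g₂ h₁ n₁ h₂ n₂ =>
      h₁.unique (WeylAmbient.regular_natCast hd h3) n₁ h₂ n₂⟩,
    fun D hD => ⟨WeylAmbient.exists_isFormalWeylAmbient hD r A, fun _ _ _ _ _ _ h₁ n₁ h₂ n₂ =>
      h₁.unique hD n₁ h₂ n₂⟩,
    fun m z₀ I J t y ht hy => WeylAmbient.exists_rational_rhoCoeff r A m z₀ I J ht hy⟩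
  obtain ⟨U, g, f, h, hn⟩ := WeylAmbient.exists_isFormalWeylAmbient
    (WeylAmbient.regular_natCast (𝕜 := ℝ) hd h3) r A
  refine ⟨U, g, ⟨h.toIsWeylPreAmbient, fun z₀ y hy I J => ?_⟩, hn⟩
  have := h.ricciFlat_base z₀ y hy I J
  rwa [sub_self, WeylAmbient.warpedRicciBase_zero] at this
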